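/- Setting. Let $K$ be a field, $t$ transcendental over $K$, $\Omega$ a separable closure of $K(t)$, and $f\in K(x)$ a nonconstant tamely ramified rational function of degree $d$ (every point of every geometric fibre of $f:\mathbb P^1\to\mathbb P^1$ has multiplicity prime to the characteristic). Let $T=f^{-\infty}(t)\subset\Omega$ be the rooted tree of iterated preimages of $t$, whose level $n$ is $f^{-n}(t)$, put $M=K(f^{-\infty}(t))$, and let $G=\mathrm{Gal}(M/K(t))$ be the arithmetic profinite iterated monodromy group (pfIMG) of $f$. Path data $\Lambda$ consist of a labelling $t_0,\dots,t_{d-1}$ of $f^{-1}(t)$ and, for each $i$, a $K$-automorphism $\lambda_i$ of $\Omega$ with $\lambda_i(t_i)=t$. Then $\lambda_i$ maps $K(f^{-\infty}(t_i))$ onto $M$ and the subtree over $t_i$ onto $T$. Composing these maps along words gives a path $\lambda_v$ from each vertex $v$ to $t$, and for $g\in G_v$ (the stabilizer of $v$) one puts $\pi_v(g)=\lambda_v\circ g|_{T_v}\circ\lambda_v^{-1}$. A subgroup $H\le G$ is self-similar (with respect to $\Lambda$) if $\pi_v(H_v)\subseteq H$ for all $v$, and fractal if moreover $\pi_v(H_v)=H$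 for all $v$. Fix path data $\Lambda$ for $f$. A curve over $K$ is a separated integral scheme of finite type that is smooth of relative dimension $1$ over $K$. A commutative square of curves is called a pullback if its upper left corner is the normalization of the fibre product. Let $X_{(n)}$ be the normalization of $\mathbb P^1_K$ in $K(f^{-n}(t))$. For an endomorphism $g$ of a curve $Y$ over $K$ and a geometric generic point $\bar y:\mathrm{Spec}\,\Omega\to Y$, the pfIMG of $g$ is the Galois group, over the residue field of $\bar y$ in $\Omega$, of the field generated by the residue fields of all geometric points $z$ with $g^n(z)=\bar y$ for some $n$. Given $\pi:Y\to\mathbb P^1_K$ with $\pi\circ g=f\circ\pi$ and $\pi(\bar y)=t$, we say that the pfIMG of $g$ is identified with a subgroup $H\le G$ if $z\mapsto\pi(z)$ is, on each level, a bijection from the tree of $g$ over $\bar y$ to $T$, the field just described is $M$, and restriction gives an isomorphism of topological groups from the pfIMG of $g$ to $H$. Path data for $f$ lift to $g$ if, with the same automorphisms $\lambda_i$ and with labels $y_i\in g^{-1}(\bar y)$ over $t_i$, they are path data for $g$ (that is, $\lambda_i$ takes $y_i$ to $\bar y$). Theorem. (1) Let $H$ be an open self-similar subgroup of $G$. Then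 $H$ is fractal. Let $L$ be the fixed field of $H$ in $M$. For all sufficiently large $n$, $L\subseteq K(f^{-n}(t))$. For every coordinate $i$, let $L_i$ be the fixed field of $H_i=H\cap G_{t_i}$. Then $L\subseteq L_i\subseteq K(f^{-\infty}(t_i))$; $\lambda_i$ takes $L_i$ onto $L$ and $K(t_i)$ onto $K(t)$; $L_i=L\cdot K(t_i)=L(t_i)$; and $L$ is linearly disjoint from $K(t_i)$ over $K(t)$. (2) Conversely, let $K(t)\subseteq L\subseteq K(f^{-n}(t))$ for some $n$, and suppose that for some $i$ the field $L$ is linearly disjoint from $K(t_i)$ over $K(t)$ and there is a $K$-isomorphism $\psi:L(t_i)\to L$ with $\psi(t_i)=t$. Let $H=\mathrm{Gal}(M/L)\le G$. Then there are path data $\Lambda'$ with the same labelling as $\Lambda$, whose path $\lambda'_i$ extends $\psi$, such that $H$ is self-similar with respect to $\Lambda'$. With respect to the given $\Lambda$, $H$ is self-similar whenever $\lambda_j(L(t_j))=L$ for all $j$, and also whenever $L/K(t)$ is Galois. Let $f$ also denote the endomorphism of $\mathbb P^1_K$ given by $f$ (which exists). (3) Let $H$ and $L$ be as in (1). There are a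 proper curve $Y_H$ over $K$, a $K$-morphism $\pi_H:Y_H\to\mathbb P^1_K$, and an identification of the function field of $Y_H$ with $L$ under which $\pi_H$ corresponds to $K(t)\subseteq L$. For all sufficiently large $n$ there are morphisms $\eta_{H,n}:X_{(n)}\to Y_H$ over $\mathbb P^1_K$, corresponding to $L\subseteq K(f^{-n}(t))$. For every coordinate $i$ there is a $K$-morphism $f_H:Y_H\to Y_H$, corresponding to $\lambda_i|_L:L\to L$, such that $$\begin{array}{ccc}Y_H&\xrightarrow{\;f_H\;}&Y_H\\ {\scriptstyle\pi_H}\downarrow&&\downarrow{\scriptstyle\pi_H}\\ \mathbb P^1_K&\xrightarrow{\;f\;}&\mathbb P^1_K\end{array}$$ commutes and is a pullback. The pfIMG of $f_H$ is identified with $H$, and there are path data $\Lambda'$ for $f$ with the same labelling as $\Lambda$ and with $\lambda'_i=\lambda_i$ that lift to $f_H$ and with respect to which $H$ is self-similar. (4) Conversely, let $Y$ be a curve over $K$ with $K$-morphisms $g:Y\to Y$ and $\pi:Y\to\mathbb P^1_K$ such that the square with $\pi\circ g=f\circ\pi$ is a pullback, and let $X_{(n)}\to Y$ be a morphism over $\mathbb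 P^1_K$ for some $n$. Let $\bar y$ be the induced geometric point of $Y$. Then the residue field of $\bar y$ in $\Omega$ is a field $L$ with $K(t)\subseteq L\subseteq M$, the pfIMG of $g$ is identified with $H=\mathrm{Gal}(M/L)$, and $H$ is open in $G$. There are path data for $f$, with the same labelling as $\Lambda$, that lift to $g$; and $H$ is self-similar with respect to any path data for $f$ that lift to $g$. -/

import Mathlib

open CategoryTheory CategoryTheory.Limits AlgebraicGeometry IntermediateField

universe u

noncomputable section

namespace SelfSimilarIMG

/-! ## Rational functions, trees of preimages, arithmetic iterated monodromy groups -/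

section Fields

variable {K : Type u} [Field K]

/-- The degree of a rational function `f = p / q` in lowest terms. -/
def degree (f : RatFunc K) : ℕ := max f.num.natDegree f.denom.natDegree

/-- The rational function `f = p / q` is nonconstant and tamely ramified: every point of every
geometric fibre of `f : ℙ¹ → ℙ¹` occurs with a multiplicity that is nonzero in `K`. The fibre over
the point `(-b : a)` is the zero scheme of the binary form of degree `deg f` that is the
homogenization of `a p + b q`; its multiplicity at `∞` is the drop of degree. -/
def IsTame (f : RatFunc K) : Prop :=
  0 < degree f ∧
  ∀ a b : AlgebraicClosure K, (a ≠ 0 ∨ b ≠ 0) →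
    let P : Polynomial (AlgebraicClosure K) :=
      Polynomial.C a * f.num.map (algebraMap K (AlgebraicClosure K)) +
        Polynomial.C b * f.denom.map (algebraMap K (AlgebraicClosure K))
    (∀ c : AlgebraicClosure K, P.IsRoot c → ((P.rootMultiplicity c : ℕ) : K) ≠ 0) ∧
    (P.natDegree < degree f → ((degree f - P.natDegree : ℕ) : K) ≠ 0)

/-- The map `x ↦ f(x)` on an extension `E` of `K`. It is only used to form preimages of elements
that are transcendental over `K`, and these never involve poles. -/
def evalMap (f : RatFunc K) (E : Type u) [Field E] [Algebra K E] : E → E :=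
  fun x => f.eval (algebraMap K E) x

/-- The transcendental `t`, as an element of an extension `E` of `K(t)`. -/
def tElt (K : Type u) [Field K] (E : Type u) [Field E] [Algebra (RatFunc K) E] : E :=
  algebraMap (RatFunc K) E RatFunc.X

/-- `f⁻ⁿ(t)` inside an extension `E` of `K(t)`: the vertices at level `n` of the tree. -/
def fiber (f : RatFunc K) (E : Type u) [Field E] [Algebra K E] [Algebra (RatFunc K) E] (n : ℕ) :
    Set E :=
  {x | (evalMap f E)^[n] x = tElt K E}

/-- The part of the tree of preimages that lies over `v`. -/
def treeOver (f : RatFunc K) {E : Type u} [Field E] [Algebra K E] (v : E) : Set E :=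
  {x | ∃ n : ℕ, (evalMap f E)^[n] x = v}

lemma evalMap_hom (f : RatFunc K) {E E' : Type u} [Field E] [Algebra K E] [Field E']
    [Algebra K E'] (φ : E →ₐ[K] E') (x : E) : φ (evalMap f E x) = evalMap f E' (φ x) := by
  simp only [evalMap, RatFunc.eval, map_div₀]
  congr 1
  all_goals
    rw [← AlgHom.coe_toRingHom, Polynomial.hom_eval₂]
    congr 1
    ext a
    simp

lemma evalMap_iterate_hom (f : RatFunc K) {E E' : Type u} [Field E] [Algebra K E] [Field E']
    [Algebra K E'] (φ : E →ₐ[K] E') (n : ℕ) (x : E) :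
    φ ((evalMap f E)^[n] x) = (evalMap f E')^[n] (φ x) := by
  induction n with
  | zero => rfl
  | succ n ih => rw [Function.iterate_succ_apply', Function.iterate_succ_apply', evalMap_hom, ih]

variable (f : RatFunc K) (Ω : Type u) [Field Ω] [Algebra K Ω] [Algebra (RatFunc K) Ω]
  [IsScalarTower K (RatFunc K) Ω]

/-- The field `K(f^{-∞}(t))` generated over `K(t)` by all iterated preimages of `t`. -/
def treeField : IntermediateField (RatFunc K) Ω := adjoin (RatFunc K) (⋃ n, fiber f Ω n)

/-- The arithmetic profinite iterated monodromy group `Gal(K(f^{-∞}(t))/K(t))`, with its Krull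
topology. It acts faithfully on the tree of preimages of `t`. -/
abbrev IMG : Type u := treeField f Ω ≃ₐ[RatFunc K] treeField f Ω

/-- `K(f⁻ⁿ(t))`, as a subfield of `K(f^{-∞}(t))`. -/
def levelField (n : ℕ) : IntermediateField (RatFunc K) (treeField f Ω) :=
  adjoin (RatFunc K) (fiber f (treeField f Ω) n)

/-- Path data: a labelling `t₀, …, t_{d-1}` of the vertices at level one, and for each of them an
étale path from `tᵢ` to `t`, given by a `K`-automorphism of the separable closure that takes
`tᵢ` to `t`. It restricts to an isomorphism from `K(f^{-∞}(tᵢ))` to `K(f^{-∞}(t))` and to an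
isomorphism from the tree over `tᵢ` to the tree over `t`. -/
structure PathData where
  label : Fin (degree f) ≃ fiber f Ω 1
  path : Fin (degree f) → (Ω ≃ₐ[K] Ω)
  path_label : ∀ i, path i (label i : Ω) = tElt K Ω

namespace PathData

variable {f Ω} (Λ : PathData f Ω)

/-- The composite path `λ_w = λ_{wₙ} ∘ ⋯ ∘ λ_{w₁}` attached to a word `w = [w₁, …, wₙ]`. -/
def wordPath : List (Fin (degree f)) → (Ω ≃ₐ[K] Ω)
  | [] => AlgEquiv.refl
  | i :: w => (Λ.path i).trans (wordPath w)

lemma wordPath_symm_mem (w : List (Fin (degree f))) :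
    (Λ.wordPath w).symm (tElt K Ω) ∈ fiber f Ω w.length := by
  induction w with
  | nil => rfl
  | cons i w ih =>
    change (evalMap f Ω)^[w.length + 1] ((Λ.path i).symm ((Λ.wordPath w).symm (tElt K Ω))) = _
    rw [Function.iterate_succ_apply']
    have h := evalMap_iterate_hom f (Λ.path i).symm.toAlgHom w.length
      ((Λ.wordPath w).symm (tElt K Ω))
    have h2 : (evalMap f Ω)^[w.length] ((Λ.wordPath w).symm (tElt K Ω)) = tElt K Ω := ih
    rw [h2] at h
    have h3 : (Λ.path i).symm (tElt K Ω) = (Λ.label i : Ω) := by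
      rw [AlgEquiv.symm_apply_eq, Λ.path_label]
    have h4 : evalMap f Ω (Λ.label i : Ω) = tElt K Ω := (Λ.label i).2
    exact (congrArg (evalMap f Ω) (h.symm.trans h3)).trans h4

/-- The vertex labelled by the word `w`; every vertex of the tree has exactly one label. -/
def vertex (w : List (Fin (degree f))) : treeField f Ω :=
  ⟨(Λ.wordPath w).symm (tElt K Ω),
    subset_adjoin _ _ (Set.mem_iUnion.2 ⟨w.length, Λ.wordPath_symm_mem w⟩)⟩

lemma vertex_singleton (i : Fin (degree f)) : (Λ.vertex [i] : Ω) = (Λ.label i : Ω) := by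
  change (Λ.path i).symm (tElt K Ω) = _
  rw [AlgEquiv.symm_apply_eq, Λ.path_label]

/-- `h = π_w(g)`: for `g` fixing the vertex `w`, the tree automorphism
`λ_w ∘ g|_{T_w} ∘ λ_w⁻¹` of `T` is the action of `h`. -/
def IsSection (w : List (Fin (degree f))) (g h : IMG f Ω) : Prop :=
  ∀ x y : treeField f Ω, x ∈ treeOver f (Λ.vertex w) → Λ.wordPath w (x : Ω) = (y : Ω) →
    Λ.wordPath w (g x : Ω) = (h y : Ω)

/-- `H` is self-similar: `π_w(H_w) ⊆ H` for every vertex `w`. -/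
def IsSelfSimilar (H : Subgroup (IMG f Ω)) : Prop :=
  ∀ w, ∀ g ∈ H, g (Λ.vertex w) = Λ.vertex w → ∃ h ∈ H, Λ.IsSection w g h

/-- `H` is fractal: it is self-similar and `π_w(H_w) = H` for every vertex `w`. -/
def IsFractal (H : Subgroup (IMG f Ω)) : Prop :=
  Λ.IsSelfSimilar H ∧
    ∀ w, ∀ h ∈ H, ∃ g ∈ H, g (Λ.vertex w) = Λ.vertex w ∧ Λ.IsSection w g h

/-- The vertex `tᵢ` at level one, as an element of `K(f^{-∞}(t))`. -/
def root (i : Fin (degree f)) : treeField f Ω := Λ.vertex [i]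

/-- `Hᵢ`, the stabilizer in `H` of the vertex `tᵢ`. -/
def stab (H : Subgroup (IMG f Ω)) (i : Fin (degree f)) : Subgroup (IMG f Ω) :=
  H ⊓ MulAction.stabilizer (IMG f Ω) (Λ.root i)

/-- The field `K(tᵢ) = K(t)(tᵢ)`. -/
def rootField (i : Fin (degree f)) : IntermediateField (RatFunc K) (treeField f Ω) :=
  adjoin (RatFunc K) {Λ.root i}

/-- The field `K(f^{-∞}(tᵢ))`. -/
def treeFieldOver (i : Fin (degree f)) : IntermediateField (RatFunc K) (treeField f Ω) :=
  adjoin (RatFunc K) (treeOver f (Λ.root i))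

end PathData

end Fields

/-! ## Curves -/

section Curves

variable (K : Type u) [Field K]

instance : GradedAlgebra (MvPolynomial.homogeneousSubmodule (Fin 2) K) :=
  MvPolynomial.gradedAlgebra

lemma X_one_mem : (MvPolynomial.X 1 : MvPolynomial (Fin 2) K) ∈
    MvPolynomial.homogeneousSubmodule (Fin 2) K 1 :=
  MvPolynomial.isHomogeneous_X K 1

/-- The projective line over `K`. -/
abbrev P1 : Scheme.{u} := Proj (MvPolynomial.homogeneousSubmodule (Fin 2) K)

/-- The structure morphism of the projective line. -/
def P1.struct : P1 K ⟶ Spec (.of K) :=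
  Proj.toSpecZero (MvPolynomial.homogeneousSubmodule (Fin 2) K) ≫
    Spec.map (CommRingCat.ofHom
      (algebraMap K (MvPolynomial.homogeneousSubmodule (Fin 2) K 0)))

/-- Evaluation of the degree zero part of `K[X₀, X₁, X₁⁻¹]` at `(x, 1)`. -/
def P1.awayEval (E : Type u) [Field E] [Algebra K E] (x : E) :
    HomogeneousLocalization.Away (MvPolynomial.homogeneousSubmodule (Fin 2) K)
      (MvPolynomial.X 1) →+* E :=
  (IsLocalization.Away.lift (S := Localization.Away (MvPolynomial.X 1 : MvPolynomial (Fin 2) K))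
    (MvPolynomial.X 1)
    (g := ((MvPolynomial.aeval ![x, 1] : MvPolynomial (Fin 2) K →ₐ[K] E) :
      MvPolynomial (Fin 2) K →+* E)) (by simp)).comp
  (algebraMap _ (Localization.Away (MvPolynomial.X 1 : MvPolynomial (Fin 2) K)))

/-- The `E`-valued point `(x : 1)` of the projective line. -/
def P1.pt (E : Type u) [Field E] [Algebra K E] (x : E) : Spec (.of E) ⟶ P1 K :=
  Spec.map (CommRingCat.ofHom (P1.awayEval K E x)) ≫
    Proj.awayι (MvPolynomial.homogeneousSubmodule (Fin 2) K) (MvPolynomial.X 1)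
      (X_one_mem K) one_pos

variable {K}

/-- `F` is the endomorphism of the projective line over `K` given by the rational function `f`:
it is a `K`-morphism and takes the generic point `(X : 1)` to `(f(X) : 1)`. -/
structure IsMorphismOf (f : RatFunc K) (F : P1 K ⟶ P1 K) : Prop where
  isOver : F ≫ P1.struct K = P1.struct K
  generic : P1.pt K (RatFunc K) RatFunc.X ≫ F = P1.pt K (RatFunc K) f

/-- `s : Y ⟶ Spec K` is a smooth integral curve over `K` (not necessarily geometrically
integral, not necessarily complete). -/
structure IsSmoothCurve {Y : Scheme.{u}} (s : Y ⟶ Spec (.of K)) : Prop where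
  integral : AlgebraicGeometry.IsIntegral Y
  smooth : SmoothOfRelativeDimension 1 s
  separated : AlgebraicGeometry.IsSeparated s
  quasiCompact : QuasiCompact s

/-- The integral scheme `P` with `p : P ⟶ X` and `q : P ⟶ Y` is a pullback of `a : X ⟶ Z` and
`b : Y ⟶ Z` in the sense of curves, that is, the normalization of the fibre product: the square
commutes, `P` is normal, and the canonical morphism from `P` to the fibre product is integral,
dominant, and an isomorphism on the residue fields at the generic points. In particular the fibre
product is irreducible. -/
structure IsNormalizedPullback {P X Y Z : Scheme.{u}} [AlgebraicGeometry.IsIntegral P]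
    (p : P ⟶ X) (q : P ⟶ Y) (a : X ⟶ Z) (b : Y ⟶ Z) : Prop where
  w : p ≫ a = q ≫ b
  normal : ∀ x : P, IsIntegrallyClosed (P.presheaf.stalk x)
  isIntegralHom : IsIntegralHom (pullback.lift p q w)
  isDominant : IsDominant (pullback.lift p q w)
  birational : Function.Surjective
    ((pullback.lift p q w).residueFieldMap (genericPoint P)).hom

/-- `y : Spec L ⟶ Y` is the generic point of the integral scheme `Y`, and it identifies the
function field of `Y` with `L`. -/
structure IsFunctionFieldPoint {Y : Scheme.{u}} {L : Type u} [Field L] (y : Spec (.of L) ⟶ Y) :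
    Prop where
  isDominant : IsDominant y
  surjectiveOnStalks : SurjectiveOnStalks y

/-- The morphism of spectra attached to an inclusion of fields. -/
abbrev specIncl (A B : Type u) [Field A] [Field B] [Algebra A B] :
    Spec (.of B) ⟶ Spec (.of A) :=
  Spec.map (CommRingCat.ofHom (algebraMap A B))

/-! ### Iterated monodromy of an endomorphism of a curve -/

section Endo

variable {Y : Scheme.{u}} (g : Y ⟶ Y) {Ω : Type u} [Field Ω] (y : Spec (.of Ω) ⟶ Y)

/-- The geometric points `z` with `gⁿ(z) = y`. -/
def endoFiber (n : ℕ) : Set (Spec (.of Ω) ⟶ Y) :=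
  {z | (fun x : Spec (.of Ω) ⟶ Y => x ≫ g)^[n] z = y}

/-- The image in `Ω` of the residue field at the image of a geometric point. -/
def ptField {Y : Scheme.{u}} {Ω : Type u} [Field Ω] (z : Spec (.of Ω) ⟶ Y) : Subfield Ω :=
  (Scheme.SpecToEquivOfField Ω Y z).2.hom.fieldRange

/-- The field generated over the residue field of `y` by all iterated preimages of `y`. -/
def endoTreeField : IntermediateField (ptField y) Ω :=
  adjoin (ptField y) (⋃ n, ⋃ z ∈ endoFiber g y n, (ptField z : Set Ω))

/-- The profinite iterated monodromy group of `g`, for a geometric generic point `y` of `Y`. -/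
abbrev EndoIMG : Type u := endoTreeField g y ≃ₐ[ptField y] endoTreeField g y

/-- Path data for `g`: a labelling `y₀, …, y_{d-1}` of the preimages of `y` and, for each of them,
an automorphism of `Ω` over `K` that takes `yᵢ` to `y`. -/
structure EndoPathData (K : Type u) [Field K] [Algebra K Ω] (d : ℕ) where
  label : Fin d ≃ endoFiber g y 1
  path : Fin d → (Ω ≃ₐ[K] Ω)
  path_label : ∀ i,
    Spec.map (CommRingCat.ofHom ((path i : Ω →ₐ[K] Ω) : Ω →+* Ω)) ≫
      (label i : Spec (.of Ω) ⟶ Y) = y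

end Endo

section Comparison

variable (f : RatFunc K) (Ω : Type u) [Field Ω] [Algebra K Ω] [Algebra (RatFunc K) Ω]
  [IsScalarTower K (RatFunc K) Ω]

/-- The geometric generic point of the projective line with coordinate `t`, defined over a field
`L` between `K(t)` and `K(f^{-∞}(t))`. -/
def basePt (L : IntermediateField (RatFunc K) (treeField f Ω)) : Spec (.of L) ⟶ P1 K :=
  P1.pt K L (tElt K L)

instance (L : IntermediateField (RatFunc K) (treeField f Ω)) : QuasiCompact (basePt f Ω L) := by
  have : (P1 K).IsSeparated :=
    inferInstanceAs ((Proj (MvPolynomial.homogeneousSubmodule (Fin 2) K)).IsSeparated)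
  infer_instance

instance (L : IntermediateField (RatFunc K) (treeField f Ω)) : QuasiSeparated (basePt f Ω L) :=
  inferInstance

/-- The curve `X₍ₙ₎` with function field `K(f⁻ⁿ(t))`: the normalization of the projective line
in this extension of its function field `K(t)`. -/
abbrev levelCurve (n : ℕ) : Scheme.{u} := (basePt f Ω (levelField f Ω n)).normalization

/-- The covering map `X₍ₙ₎ ⟶ ℙ¹`. -/
def levelCurveMap (n : ℕ) : levelCurve f Ω n ⟶ P1 K :=
  (basePt f Ω (levelField f Ω n)).fromNormalization

/-- The generic point `Spec K(f⁻ⁿ(t)) ⟶ X₍ₙ₎`. -/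
def levelCurvePt (n : ℕ) : Spec (.of (levelField f Ω n)) ⟶ levelCurve f Ω n :=
  (basePt f Ω (levelField f Ω n)).toNormalization

/-- The geometric point over a point with values in an intermediate field. -/
def geomPt {Y : Scheme.{u}} {L : IntermediateField (RatFunc K) (treeField f Ω)}
    (y : Spec (.of L) ⟶ Y) : Spec (.of Ω) ⟶ Y :=
  specIncl (treeField f Ω) Ω ≫ specIncl L (treeField f Ω) ≫ y

variable {f Ω}

/-- Path data for `f` lift to path data for `g : Y ⟶ Y` along `π : Y ⟶ ℙ¹`: with the same paths
and with labels that lie over the labels for `f`. -/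
def PathData.LiftsTo (Λ : PathData f Ω) {Y : Scheme.{u}} (π : Y ⟶ P1 K) (g : Y ⟶ Y)
    (y : Spec (.of Ω) ⟶ Y) : Prop :=
  ∃ Λg : EndoPathData g y K (degree f), ∀ i, Λg.path i = Λ.path i ∧
    (Λg.label i : Spec (.of Ω) ⟶ Y) ≫ π = P1.pt K Ω (Λ.label i : Ω)

/-- The profinite iterated monodromy group of `g : Y ⟶ Y` (with respect to `y`) is identified with
the subgroup `H` of that of `f`: composition with `π` identifies the tree of `g` with the tree of
`f`, the two trees generate the same field, and the elements of the group of `g` act on this field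
as the elements of `H`. -/
structure IsIdentifiedIMG {Y : Scheme.{u}} (π : Y ⟶ P1 K) (g : Y ⟶ Y) (y : Spec (.of Ω) ⟶ Y)
    (H : Subgroup (IMG f Ω)) : Prop where
  tree : ∀ n, Set.BijOn (fun z => z ≫ π) (endoFiber g y n) (P1.pt K Ω '' fiber f Ω n)
  field : (endoTreeField g y : Set Ω) = (treeField f Ω : Set Ω)
  group : ∃ Φ : EndoIMG g y ≃ₜ* H, ∀ (σ : EndoIMG g y) (a : endoTreeField g y)
    (b : treeField f Ω), (a : Ω) = (b : Ω) → (σ a : Ω) = ((Φ σ : IMG f Ω) b : Ω)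

end Comparison

end Curves

end SelfSimilarIMG

end

open SelfSimilarIMG

/-!
Everything rests on one reading of self-similarity in terms of fields. Write `M` for the field
generated by the tree, `L` for the fixed field of an open subgroup `H`, and `tᵢ` for a vertex of
level one. The stabilizer of `tᵢ` in `H` has the fixed field `L(tᵢ)`, and its sections at `tᵢ` lie in
`H` exactly when `λᵢ⁻¹(L) ⊆ L(tᵢ)`. As `λᵢ⁻¹` carries `K(t)` to `K(tᵢ)`, comparing degrees over these
two fields,

  `[L : K(t)] = [λᵢ⁻¹(L) : K(tᵢ)] ≤ [L(tᵢ) : K(tᵢ)] ≤ [L : K(t)]`,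

shows that all are equalities: `λᵢ⁻¹(L) = L(tᵢ)`, so that `H` is fractal, and `L` is linearly
disjoint from `K(tᵢ)` (`PathData.toK_sup_rootField_eq_and_linearDisjoint`,
`PathData.field_properties_of_isSelfSimilar`). Conversely linear disjointness makes `H` transitive
on level one, and this moves one path with `λᵢ(L(tᵢ)) = L` to every other vertex of that level
(`PathData.exists_pathData_of_algEquiv`, `PathData.isSelfSimilar_converse`).

For the geometric half let `Y` be the normalization of the line in `L`. The chart rings of `Y` are
the integral closures in `L` of `K[t]` and `K[1/t]`, and a `K`-embedding `ψ` of `L` induces an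
endomorphism of `Y` over that of the line (`exists_curve_endo`). If `L = ψ(L)(t)`, where `ψ(L)` and
`K(t)` are linearly disjoint over `K(f(t))`, then the square is generically cartesian, hence a
pullback of curves (`isNormalizedPullback_curve`). Smoothness of `Y` over the possibly imperfect
field `K` is where tameness enters. At a closed point of `Y` one takes a valuation ring above it and
distinguishes two cases. If the reduction of `t` is separable over `K` or infinite, then by tameness
the same holds for all vertices, and a wild inertia element, which moves every element only by
factors congruent to one, fixes the tree (`IsTame.fixed_of_wild`). So the order of the inertia group
is invertible in the residue field, which forces the residue field to be separable over `K`; and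
regular points with separable residue field are smooth. If the reduction of `t` is inseparable over
`K`, then `f` is unramified at everything above it, all of inertia fixes the tree
(`IsTame.fixed_of_not_isSeparable`), and `Y` is étale over the line there. The two cases are combined
in `IsTame.exists_isStandardSmooth_of_isMaximal`.

The iterated monodromy group of an endomorphism `g` of `Y` that is a pullback of `f` is found
through the points with values in `Ω`. Over transcendental points of the line such a square is a
pullback on points, so the preimages of `ȳ` under `gⁿ` correspond to those of `t` under `fⁿ`. All of
them lie over the generic point of `Y`, and any two differ by an automorphism of `Ω`; as the residue
field of `ȳ` lies in `M`, so do theirs (`IsPullbackEndo.isIdentifiedIMG`). The same automorphisms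
provide lifts of path data (`IsPullbackEndo.exists_pathData_liftsTo`),
and for lifted path data the field criterion above gives self-similarity
(`IsPullbackEndo.isSelfSimilar_of_liftsTo`).
-/

set_option linter.unusedSectionVars false

noncomputable section

namespace SelfSimilarIMG

/-! ### Automorphisms of the separable closure and self-similar groups -/

section TreeFields

variable {K : Type u} [Field K]

lemma ratFunc_ringHom_ext {E : Type*} [Field E] {φ ψ : RatFunc K →+* E}
    (hC : ∀ a, φ (algebraMap K _ a) = ψ (algebraMap K _ a)) (hX : φ RatFunc.X = ψ RatFunc.X) :
    φ = ψ := by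
  apply IsLocalization.ringHom_ext (nonZeroDivisors (Polynomial K))
  apply Polynomial.ringHom_ext
  · intro a
    simpa [RatFunc.algebraMap_eq_C] using hC a
  · simpa using hX

variable (f : RatFunc K) (Ω : Type u) [Field Ω] [Algebra K Ω] [Algebra (RatFunc K) Ω]
  [IsScalarTower K (RatFunc K) Ω]

variable {Ω} in
lemma exists_ratFunc_algEquiv (e : Ω ≃ₐ[K] Ω) (he : e (tElt K Ω) = tElt K Ω) :
    ∃ e' : Ω ≃ₐ[RatFunc K] Ω, ∀ x, e' x = e x := by
  have h : (e : Ω →+* Ω).comp (algebraMap (RatFunc K) Ω) = algebraMap (RatFunc K) Ω := by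
    apply ratFunc_ringHom_ext
    · intro a
      rw [RingHom.comp_apply, ← IsScalarTower.algebraMap_apply]
      exact e.commutes a
    · exact he
  exact ⟨AlgEquiv.ofRingEquiv (f := e.toRingEquiv) fun r => RingHom.congr_fun h r, fun x => rfl⟩

lemma mem_treeField_of_treeOver {x : Ω} (hx : x ∈ treeOver f (tElt K Ω)) : x ∈ treeField f Ω := by
  obtain ⟨n, hn⟩ := hx
  exact subset_adjoin _ _ (Set.mem_iUnion.2 ⟨n, hn⟩)

variable {Ω} in
lemma treeOver_trans {x y z : Ω} (hxy : x ∈ treeOver f y) (hyz : y ∈ treeOver f z) :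
    x ∈ treeOver f z := by
  obtain ⟨n, hn⟩ := hxy
  obtain ⟨m, hm⟩ := hyz
  exact ⟨m + n, by rw [Function.iterate_add_apply, hn, hm]⟩

lemma treeOver_hom {E E' : Type u} [Field E] [Algebra K E] [Field E'] [Algebra K E']
    (φ : E →ₐ[K] E') {x y : E} (h : x ∈ treeOver f y) : φ x ∈ treeOver f (φ y) := by
  obtain ⟨n, hn⟩ := h
  exact ⟨n, by rw [← evalMap_iterate_hom, hn]⟩

/-- An intermediate field `L` of `M / K(t)`, viewed as a subfield of `Ω` over `K`. -/
def toK {f : RatFunc K} {Ω : Type u} [Field Ω] [Algebra K Ω] [Algebra (RatFunc K) Ω]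
    [IsScalarTower K (RatFunc K) Ω] (L : IntermediateField (RatFunc K) (treeField f Ω)) :
    IntermediateField K Ω :=
  (IntermediateField.lift L).restrictScalars K

variable {f Ω}

lemma mem_toK {L : IntermediateField (RatFunc K) (treeField f Ω)} {x : Ω} :
    x ∈ toK L ↔ ∃ a ∈ L, (a : Ω) = x := by
  constructor
  · rintro ⟨a, ha, rfl⟩
    exact ⟨a, ha, rfl⟩
  · rintro ⟨a, ha, rfl⟩
    exact ⟨a, ha, rfl⟩

lemma coe_toK (L : IntermediateField (RatFunc K) (treeField f Ω)) :
    (toK L : Set Ω) = (fun a : treeField f Ω => (a : Ω)) '' L := by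
  ext x
  exact mem_toK

lemma coe_mem_toK {L : IntermediateField (RatFunc K) (treeField f Ω)} {a : treeField f Ω} :
    (a : Ω) ∈ toK L ↔ a ∈ L := by
  rw [mem_toK]
  exact ⟨fun ⟨b, hb, h⟩ => Subtype.ext h ▸ hb, fun h => ⟨a, h, rfl⟩⟩

lemma toK_le_iff {L L' : IntermediateField (RatFunc K) (treeField f Ω)} :
    toK L ≤ toK L' ↔ L ≤ L' := by
  constructor
  · intro h a ha
    exact coe_mem_toK.1 (h (coe_mem_toK.2 ha))
  · intro h x hx
    obtain ⟨a, ha, rfl⟩ := mem_toK.1 hx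
    exact coe_mem_toK.2 (h ha)

lemma restrictScalars_adjoin_eq (E : Type*) [Field E] [Algebra K E] [Algebra (RatFunc K) E]
    [IsScalarTower K (RatFunc K) E] (S : Set E) :
    (adjoin (RatFunc K) S).restrictScalars K =
      adjoin K (insert (algebraMap (RatFunc K) E RatFunc.X) S) := by
  apply le_antisymm
  · intro x hx
    replace hx : x ∈ adjoin (RatFunc K) S := hx
    induction hx using adjoin_induction with
    | mem x hx => exact subset_adjoin K _ (Set.mem_insert_of_mem _ hx)
    | algebraMap r =>
      have h2 : r ∈ adjoin K {(RatFunc.X : RatFunc K)} := by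
        rw [RatFunc.adjoin_X]
        exact mem_top
      have h3 : algebraMap (RatFunc K) E r ∈
          (adjoin K {(RatFunc.X : RatFunc K)}).map (IsScalarTower.toAlgHom K (RatFunc K) E) :=
        ⟨r, h2, rfl⟩
      rw [adjoin_map] at h3
      refine adjoin.mono K _ _ ?_ h3
      rintro _ ⟨_, rfl, rfl⟩
      exact Set.mem_insert _ _
    | add x y _ _ hx hy => exact add_mem hx hy
    | mul x y _ _ hx hy => exact mul_mem hx hy
    | inv x _ hx => exact inv_mem hx
  · rw [adjoin_le_iff]
    rintro x (rfl | hx)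
    · change _ ∈ adjoin (RatFunc K) S
      exact (adjoin (RatFunc K) S).algebraMap_mem _
    · change x ∈ adjoin (RatFunc K) S
      exact subset_adjoin _ _ hx

lemma treeField_restrictScalars :
    (treeField f Ω).restrictScalars K = adjoin K (treeOver f (tElt K Ω)) := by
  rw [treeField, restrictScalars_adjoin_eq]
  congr 1
  ext x
  simp only [Set.mem_insert_iff, Set.mem_iUnion]
  constructor
  · rintro (rfl | ⟨n, hn⟩)
    · exact ⟨0, rfl⟩
    · exact ⟨n, hn⟩
  · rintro ⟨n, hn⟩
    exact Or.inr ⟨n, hn⟩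

lemma mem_treeField_iff {x : Ω} : x ∈ treeField f Ω ↔ x ∈ adjoin K (treeOver f (tElt K Ω)) := by
  rw [← treeField_restrictScalars]
  rfl

lemma toK_adjoin (S : Set (treeField f Ω)) :
    toK (adjoin (RatFunc K) S) =
      adjoin K (insert (tElt K Ω) ((fun a : treeField f Ω => (a : Ω)) '' S)) := by
  rw [toK, IntermediateField.lift_adjoin, restrictScalars_adjoin_eq]
  rfl

end TreeFields

section Galois

variable {K : Type u} [Field K] {f : RatFunc K} {Ω : Type u} [Field Ω] [Algebra K Ω]
  [Algebra (RatFunc K) Ω] [IsScalarTower K (RatFunc K) Ω] [IsSepClosure (RatFunc K) Ω]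

instance : IsGalois (RatFunc K) Ω := IsSepClosure.isGalois

lemma treeField_normal : Normal (RatFunc K) (treeField f Ω) := by
  rw [IntermediateField.normal_iff_forall_map_le']
  intro σ
  rw [treeField, adjoin_map]
  apply adjoin.mono
  rintro _ ⟨x, hx, rfl⟩
  simp only [Set.mem_iUnion] at hx ⊢
  obtain ⟨n, hn⟩ := hx
  refine ⟨n, ?_⟩
  have := evalMap_iterate_hom f ((σ : Ω ≃ₐ[RatFunc K] Ω).restrictScalars K : Ω →ₐ[K] Ω) n x
  have hn' : (evalMap f Ω)^[n] x = tElt K Ω := hn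
  rw [hn'] at this
  exact this.symm.trans (σ.commutes _)

instance : Normal (RatFunc K) (treeField f Ω) := treeField_normal

instance : IsGalois (RatFunc K) (treeField f Ω) where

/-- Every automorphism of `Ω` over `K(t)` restricts to an element of the group `G`. -/
lemma exists_restrict (e : Ω ≃ₐ[RatFunc K] Ω) :
    ∃ h : IMG f Ω, ∀ a : treeField f Ω, (h a : Ω) = e a :=
  ⟨e.restrictNormal (treeField f Ω), fun a => e.restrictNormal_commutes (treeField f Ω) a⟩

lemma exists_lift (g : IMG f Ω) :
    ∃ e : Ω ≃ₐ[RatFunc K] Ω, ∀ a : treeField f Ω, e a = (g a : Ω) :=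
  ⟨g.liftNormal Ω, fun a => g.liftNormal_commutes Ω a⟩

/-- Restriction to `M` of an automorphism of `Ω` over `K` that fixes `t`. -/
lemma exists_restrict_of_fixes (e : Ω ≃ₐ[K] Ω) (he : e (tElt K Ω) = tElt K Ω) :
    ∃ h : IMG f Ω, ∀ a : treeField f Ω, (h a : Ω) = e a := by
  obtain ⟨e', he'⟩ := exists_ratFunc_algEquiv e he
  obtain ⟨h, hh⟩ := exists_restrict (f := f) e'
  exact ⟨h, fun a => (hh a).trans (he' a)⟩

/-- An element of `G` is determined by its action on the tree of preimages. -/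
lemma img_ext {g h : IMG f Ω}
    (H : ∀ x : treeField f Ω, x ∈ treeOver f (tElt K (treeField f Ω)) → g x = h x) : g = h := by
  ext a
  have ha : (a : Ω) ∈ treeField f Ω := a.2
  have : (g : treeField f Ω →ₐ[RatFunc K] treeField f Ω) = h := by
    refine IntermediateField.algHom_ext_of_eq_adjoin (RatFunc K) (S := treeField f Ω)
      (s := ⋃ n, fiber f Ω n) rfl fun x hx => ?_
    refine H ⟨x, subset_adjoin _ _ hx⟩ ?_
    obtain ⟨n, hn⟩ := Set.mem_iUnion.1 hx
    refine ⟨n, Subtype.ext ?_⟩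
    have := evalMap_iterate_hom f ((treeField f Ω).val.restrictScalars K) n ⟨x, subset_adjoin _ _ hx⟩
    exact this.trans hn
  exact congrArg Subtype.val (DFunLike.congr_fun this a)

namespace PathData

variable (Λ : PathData f Ω)

lemma coe_root (i : Fin (degree f)) : (Λ.root i : Ω) = (Λ.label i : Ω) := Λ.vertex_singleton i

lemma path_root (i : Fin (degree f)) : Λ.path i (Λ.root i : Ω) = tElt K Ω := by
  rw [coe_root, Λ.path_label]

lemma path_symm_t (i : Fin (degree f)) : (Λ.path i).symm (tElt K Ω) = (Λ.root i : Ω) := by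
  rw [AlgEquiv.symm_apply_eq, path_root]

lemma evalMap_root (i : Fin (degree f)) : evalMap f Ω (Λ.root i : Ω) = tElt K Ω := by
  rw [coe_root]
  exact (Λ.label i).2

lemma root_mem_treeOver (i : Fin (degree f)) : (Λ.root i : Ω) ∈ treeOver f (tElt K Ω) :=
  ⟨1, Λ.evalMap_root i⟩

/-- `λᵢ⁻¹` takes `M` into itself: its image is the field generated by the tree over `tᵢ`. -/
lemma path_symm_mem (i : Fin (degree f)) {x : Ω} (hx : x ∈ treeField f Ω) :
    (Λ.path i).symm x ∈ treeField f Ω := by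
  rw [mem_treeField_iff] at hx ⊢
  have h : (Λ.path i).symm x ∈ (adjoin K (treeOver f (tElt K Ω))).map
      ((Λ.path i).symm : Ω →ₐ[K] Ω) := ⟨x, hx, rfl⟩
  rw [adjoin_map] at h
  refine adjoin.mono K _ _ ?_ h
  rintro _ ⟨y, hy, rfl⟩
  have := treeOver_hom f ((Λ.path i).symm : Ω →ₐ[K] Ω) hy
  refine treeOver_trans f this ?_
  have h2 := Λ.root_mem_treeOver i
  rw [← path_symm_t] at h2
  exact h2

lemma coe_vertex (w : List (Fin (degree f))) :
    (Λ.vertex w : Ω) = (Λ.wordPath w).symm (tElt K Ω) := rfl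

lemma path_vertex_cons (i : Fin (degree f)) (w : List (Fin (degree f))) :
    Λ.path i (Λ.vertex (i :: w) : Ω) = (Λ.vertex w : Ω) := by
  change Λ.path i ((Λ.path i).symm ((Λ.wordPath w).symm (tElt K Ω))) = _
  rw [AlgEquiv.apply_symm_apply, coe_vertex]

lemma vertex_cons_iterate (i : Fin (degree f)) (w : List (Fin (degree f))) :
    (evalMap f (treeField f Ω))^[w.length] (Λ.vertex (i :: w)) = Λ.root i := by
  apply Subtype.ext
  have h := evalMap_iterate_hom f ((treeField f Ω).val.restrictScalars K) w.length
    (Λ.vertex (i :: w))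
  refine h.trans ?_
  have h3 : ((Λ.vertex (i :: w) : treeField f Ω) : Ω) =
      (Λ.path i).symm ((Λ.wordPath w).symm (tElt K Ω)) := rfl
  have h2 := evalMap_iterate_hom f ((Λ.path i).symm : Ω →ₐ[K] Ω) w.length
    ((Λ.wordPath w).symm (tElt K Ω))
  have h4 : (evalMap f Ω)^[w.length] ((Λ.wordPath w).symm (tElt K Ω)) = tElt K Ω :=
    Λ.wordPath_symm_mem w
  rw [h4] at h2
  exact h2.symm.trans (Λ.path_symm_t i)

/-- If `g` fixes the vertex `i w` then it fixes the vertex `i` below it. -/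
lemma fixes_root_of_fixes_vertex {i : Fin (degree f)} {w : List (Fin (degree f))} {g : IMG f Ω}
    (hg : g (Λ.vertex (i :: w)) = Λ.vertex (i :: w)) : g (Λ.root i) = Λ.root i := by
  rw [← Λ.vertex_cons_iterate i w]
  have h := evalMap_iterate_hom f
    ((g.restrictScalars K : treeField f Ω ≃ₐ[K] treeField f Ω) :
      treeField f Ω →ₐ[K] treeField f Ω) w.length (Λ.vertex (i :: w))
  refine h.trans ?_
  congr 1

/-- `h` is the section of `g` at the vertex `w`, as an identity on the whole field `M`. -/
def IsFieldSection (w : List (Fin (degree f))) (g h : IMG f Ω) : Prop :=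
  ∀ x y : treeField f Ω, Λ.wordPath w (x : Ω) = (y : Ω) → Λ.wordPath w (g x : Ω) = (h y : Ω)

variable {Λ} in
lemma IsFieldSection.isSection {w : List (Fin (degree f))} {g h : IMG f Ω}
    (H : Λ.IsFieldSection w g h) : Λ.IsSection w g h := fun x y _ hxy => H x y hxy

lemma exists_isFieldSection {w : List (Fin (degree f))} {g : IMG f Ω}
    (hg : g (Λ.vertex w) = Λ.vertex w) : ∃ h, Λ.IsFieldSection w g h := by
  obtain ⟨e, he⟩ := exists_lift g
  let p := Λ.wordPath w
  have hfix : (p.symm.trans ((e.restrictScalars K).trans p)) (tElt K Ω) = tElt K Ω := by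
    change p (e (p.symm (tElt K Ω))) = _
    have h1 : e (p.symm (tElt K Ω)) = p.symm (tElt K Ω) := by
      have := he (Λ.vertex w)
      rw [hg] at this
      exact this
    rw [h1, AlgEquiv.apply_symm_apply]
  obtain ⟨h, hh⟩ := exists_restrict_of_fixes (f := f) _ hfix
  refine ⟨h, fun x y hxy => ?_⟩
  rw [hh y, ← hxy]
  change _ = p (e (p.symm (p x)))
  rw [AlgEquiv.symm_apply_apply, he]

lemma treeOver_vertex {w : List (Fin (degree f))} {y : treeField f Ω}
    (hy : y ∈ treeOver f (tElt K (treeField f Ω))) :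
    ∃ x ∈ treeOver f (Λ.vertex w), Λ.wordPath w (x : Ω) = (y : Ω) := by
  have hyΩ := treeOver_hom f ((treeField f Ω).val.restrictScalars K) hy
  change (y : Ω) ∈ treeOver f (tElt K Ω) at hyΩ
  have h := treeOver_hom f ((Λ.wordPath w).symm : Ω →ₐ[K] Ω) hyΩ
  change (Λ.wordPath w).symm (y : Ω) ∈ treeOver f ((Λ.wordPath w).symm (tElt K Ω)) at h
  obtain ⟨n, hn⟩ := h
  have hmem : (Λ.wordPath w).symm (y : Ω) ∈ treeField f Ω :=
    mem_treeField_of_treeOver f Ω (treeOver_trans f ⟨n, hn⟩ ⟨_, Λ.wordPath_symm_mem w⟩)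
  refine ⟨⟨_, hmem⟩, ⟨n, Subtype.ext ?_⟩, AlgEquiv.apply_symm_apply _ _⟩
  have h3 := evalMap_iterate_hom f ((treeField f Ω).val.restrictScalars K) n ⟨_, hmem⟩
  exact h3.trans hn

lemma isSection_unique {w : List (Fin (degree f))} {g h h' : IMG f Ω}
    (H : Λ.IsSection w g h) (H' : Λ.IsSection w g h') : h = h' := by
  apply img_ext
  intro y hy
  obtain ⟨x, hx, hxy⟩ := Λ.treeOver_vertex (w := w) hy
  exact Subtype.ext ((H x y hx hxy).symm.trans (H' x y hx hxy))

variable {Λ} in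
lemma IsSection.isFieldSection {w : List (Fin (degree f))} {g h : IMG f Ω}
    (H : Λ.IsSection w g h) (hg : g (Λ.vertex w) = Λ.vertex w) : Λ.IsFieldSection w g h := by
  obtain ⟨h', hh'⟩ := Λ.exists_isFieldSection hg
  rwa [Λ.isSection_unique H hh'.isSection]

/-- Sections compose along words. -/
lemma IsSection.cons {Λ : PathData f Ω} {i : Fin (degree f)} {w : List (Fin (degree f))}
    {g h₁ h : IMG f Ω} (H₁ : Λ.IsFieldSection [i] g h₁) (H : Λ.IsSection w h₁ h) :
    Λ.IsSection (i :: w) g h := by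
  intro x y hx hxy
  have h2 := treeOver_hom f ((treeField f Ω).val.restrictScalars K) hx
  have h3 := treeOver_hom f ((Λ.path i) : Ω →ₐ[K] Ω) h2
  change Λ.path i (x : Ω) ∈ treeOver f (Λ.path i (Λ.vertex (i :: w) : Ω)) at h3
  rw [path_vertex_cons] at h3
  obtain ⟨n, hn⟩ := h3
  have hmem : Λ.path i (x : Ω) ∈ treeField f Ω :=
    mem_treeField_of_treeOver f Ω (treeOver_trans f ⟨n, hn⟩ ⟨_, Λ.wordPath_symm_mem w⟩)
  have h5 := H₁ x ⟨_, hmem⟩ rfl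
  have h6 := H ⟨_, hmem⟩ y ⟨n, Subtype.ext
    ((evalMap_iterate_hom f ((treeField f Ω).val.restrictScalars K) n ⟨_, hmem⟩).trans hn)⟩ hxy
  rw [← h6, ← h5]
  rfl

/-- The section at `i` of an element fixing the vertex `i w` fixes the vertex `w`. -/
lemma IsFieldSection.fixes_vertex {Λ : PathData f Ω} {i : Fin (degree f)}
    {w : List (Fin (degree f))} {g h : IMG f Ω} (H : Λ.IsFieldSection [i] g h)
    (hg : g (Λ.vertex (i :: w)) = Λ.vertex (i :: w)) : h (Λ.vertex w) = Λ.vertex w := by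
  have := H (Λ.vertex (i :: w)) (Λ.vertex w) (Λ.path_vertex_cons i w)
  rw [hg] at this
  exact Subtype.ext (this.symm.trans (Λ.path_vertex_cons i w))

/-- Self-similarity can be checked at the first level of the tree. -/
lemma isSelfSimilar_of_level_one {H : Subgroup (IMG f Ω)}
    (h1 : ∀ i, ∀ g ∈ H, g (Λ.root i) = Λ.root i → ∃ h ∈ H, Λ.IsFieldSection [i] g h) :
    Λ.IsSelfSimilar H := by
  intro w
  induction w with
  | nil => exact fun g hg _ => ⟨g, hg, fun x y _ hxy => by
      have : x = y := Subtype.ext hxy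
      rw [this]; rfl⟩
  | cons i w ih =>
    intro g hg hgv
    obtain ⟨h₁, hh₁, hs₁⟩ := h1 i g hg (Λ.fixes_root_of_fixes_vertex hgv)
    obtain ⟨h, hh, hs⟩ := ih h₁ hh₁ (hs₁.fixes_vertex hgv)
    exact ⟨h, hh, IsSection.cons hs₁ hs⟩

lemma root_mem_rootField (i : Fin (degree f)) : Λ.root i ∈ Λ.rootField i :=
  subset_adjoin _ _ rfl

/-- `Gal(M/L)` is self-similar if `λᵢ` takes `L(tᵢ)` onto `L` for all `i`. -/
lemma isSelfSimilar_fixingSubgroup (L : IntermediateField (RatFunc K) (treeField f Ω))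
    (hL : ∀ i, toK L ≤ (toK (L ⊔ Λ.rootField i)).map (Λ.path i : Ω →ₐ[K] Ω)) :
    Λ.IsSelfSimilar L.fixingSubgroup := by
  apply isSelfSimilar_of_level_one
  intro i g hg hgi
  obtain ⟨h, hh⟩ := Λ.exists_isFieldSection (w := [i]) hgi
  refine ⟨h, ?_, hh⟩
  have hgL : g ∈ (L ⊔ Λ.rootField i).fixingSubgroup := by
    rw [fixingSubgroup_sup]
    refine ⟨hg, ?_⟩
    change g ∈ (adjoin (RatFunc K) {Λ.root i}).fixingSubgroup
    rw [IntermediateField.mem_fixingSubgroup_iff]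
    have : adjoin (RatFunc K) {Λ.root i} ≤ fixedField (Subgroup.zpowers g) := by
      rw [adjoin_le_iff, Set.singleton_subset_iff]
      rintro ⟨_, n, rfl⟩
      have h : g ∈ MulAction.stabilizer (IMG f Ω) (Λ.root i) := hgi
      exact (MulAction.stabilizer (IMG f Ω) (Λ.root i)).zpow_mem h n
    intro x hx
    exact this hx ⟨g, Subgroup.mem_zpowers g⟩
  rw [IntermediateField.mem_fixingSubgroup_iff] at hgL ⊢
  intro a ha
  obtain ⟨c, hc, hba⟩ := hL i (coe_mem_toK.2 ha)
  obtain ⟨b, hb, rfl⟩ := mem_toK.1 hc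
  have := hh b a hba
  rw [hgL b hb] at this
  exact Subtype.ext (this.symm.trans hba)

end PathData
end Galois

/-! ### Open self-similar subgroups -/

section Extension

variable {K : Type u} [Field K] {Ω : Type u} [Field Ω] [Algebra K Ω]
  [Algebra (RatFunc K) Ω] [IsScalarTower K (RatFunc K) Ω]

lemma algebraMap_ratFunc_mem {A : IntermediateField K Ω} (hA : tElt K Ω ∈ A) (r : RatFunc K) :
    algebraMap (RatFunc K) Ω r ∈ A := by
  have h2 : r ∈ adjoin K {(RatFunc.X : RatFunc K)} := by
    rw [RatFunc.adjoin_X]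
    exact mem_top
  have h3 : algebraMap (RatFunc K) Ω r ∈
      (adjoin K {(RatFunc.X : RatFunc K)}).map (IsScalarTower.toAlgHom K (RatFunc K) Ω) :=
    ⟨r, h2, rfl⟩
  rw [adjoin_map] at h3
  refine (adjoin_le_iff (T := A)).2 ?_ h3
  rintro _ ⟨_, rfl, rfl⟩
  exact hA

variable [IsSepClosure (RatFunc K) Ω]

lemma isSepClosure_of_tElt_mem (A : IntermediateField K Ω) (hA : tElt K Ω ∈ A) :
    IsSepClosure A Ω := by
  let : Algebra (RatFunc K) A :=
    ((algebraMap (RatFunc K) Ω).codRestrict A.toSubfield (algebraMap_ratFunc_mem hA)).toAlgebra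
  have : IsScalarTower (RatFunc K) A Ω := .of_algebraMap_eq fun r => rfl
  have := Algebra.isSeparable_tower_top_of_isSeparable (RatFunc K) A Ω
  exact ⟨IsSepClosure.sep_closed (RatFunc K), this⟩

lemma exists_ringEquiv_extending {S S' Ω : Type*} [Field S] [Field S'] [Field Ω]
    [std : Algebra S Ω] [Algebra S' Ω] [hstd : IsSepClosure S Ω] [IsSepClosure S' Ω] (ψ : S ≃+* S') :
    ∃ e : Ω ≃+* Ω, ∀ a, e (algebraMap S Ω a) = algebraMap S' Ω (ψ a) := by
  let alg : Algebra S Ω := ((algebraMap S' Ω).comp ψ.toRingHom).toAlgebra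
  have hsep : @Algebra.IsSeparable S Ω _ _ alg := by
    refine @Algebra.IsSeparable.of_equiv_equiv S' Ω S Ω _ _ _ _ _ alg ψ.symm (RingEquiv.refl Ω)
      ?_ IsSepClosure.separable
    ext a
    change (algebraMap S' Ω) (ψ (ψ.symm a)) = algebraMap S' Ω a
    rw [RingEquiv.apply_symm_apply]
  have hcl : @IsSepClosure S _ Ω _ alg :=
    @IsSepClosure.mk S _ Ω _ alg (IsSepClosure.sep_closed S') hsep
  let e := @IsSepClosure.equiv S _ Ω Ω _ _ alg hcl std hstd
  exact ⟨@AlgEquiv.toRingEquiv S Ω Ω _ _ _ std alg e,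
    fun a => @AlgEquiv.commutes S Ω Ω _ _ _ std alg e a⟩

/-- Isomorphisms over `K` between subfields of `Ω` that contain `t` extend to automorphisms. -/
lemma exists_algEquiv_extending {A B : IntermediateField K Ω} (hA : tElt K Ω ∈ A)
    (hB : tElt K Ω ∈ B) (ψ : A ≃ₐ[K] B) : ∃ e : Ω ≃ₐ[K] Ω, ∀ a : A, e a = ψ a := by
  have := isSepClosure_of_tElt_mem A hA
  have := isSepClosure_of_tElt_mem B hB
  obtain ⟨e, he⟩ := exists_ringEquiv_extending (Ω := Ω) ψ.toRingEquiv
  refine ⟨AlgEquiv.ofRingEquiv (f := e) fun r => ?_, he⟩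
  have := he (algebraMap K A r)
  refine this.trans ?_
  exact congrArg Subtype.val (ψ.commutes r)

end Extension

section Open

variable {K : Type u} [Field K] {f : RatFunc K} {Ω : Type u} [Field Ω] [Algebra K Ω]
  [Algebra (RatFunc K) Ω] [IsScalarTower K (RatFunc K) Ω] [IsSepClosure (RatFunc K) Ω]

lemma toK_relfinrank (A B : IntermediateField (RatFunc K) (treeField f Ω)) :
    (toK A).relfinrank (toK B) = A.relfinrank B :=
  relfinrank_map_map A B (treeField f Ω).val

lemma tElt_mem_toK (A : IntermediateField (RatFunc K) (treeField f Ω)) : tElt K Ω ∈ toK A :=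
  coe_mem_toK (a := tElt K (treeField f Ω)).2 (A.algebraMap_mem _)

lemma toK_bot : (toK (⊥ : IntermediateField (RatFunc K) (treeField f Ω)) : Set Ω) =
    Set.range (algebraMap (RatFunc K) Ω) := by
  rw [coe_toK]
  ext x
  constructor
  · rintro ⟨a, ha, rfl⟩
    obtain ⟨r, rfl⟩ := mem_bot.1 ha
    exact ⟨r, rfl⟩
  · rintro ⟨r, rfl⟩
    exact ⟨algebraMap (RatFunc K) _ r, mem_bot.2 ⟨r, rfl⟩, rfl⟩

lemma toK_bot_eq_adjoin : toK (⊥ : IntermediateField (RatFunc K) (treeField f Ω)) =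
    adjoin K {tElt K Ω} := by
  rw [← adjoin_empty, toK_adjoin]
  simp

namespace PathData

variable (Λ : PathData f Ω)

lemma evalMap_mem {A : IntermediateField K Ω} {x : Ω} (hx : x ∈ A) : evalMap f Ω x ∈ A := by
  have := evalMap_hom f A.val ⟨x, hx⟩
  rw [show evalMap f Ω x = _ from this.symm]
  exact (evalMap f A ⟨x, hx⟩).2

lemma toK_rootField (i : Fin (degree f)) : toK (Λ.rootField i) = adjoin K {(Λ.root i : Ω)} := by
  rw [rootField, toK_adjoin]
  simp only [Set.image_singleton]
  apply le_antisymm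
  · rw [adjoin_le_iff]
    rintro x (rfl | rfl)
    · rw [← Λ.evalMap_root i]
      exact evalMap_mem (subset_adjoin K _ rfl)
    · exact subset_adjoin K _ rfl
  · exact adjoin.mono _ _ _ (by simp)

lemma map_toK_rootField (i : Fin (degree f)) :
    (toK (Λ.rootField i)).map (Λ.path i : Ω →ₐ[K] Ω) =
      toK (⊥ : IntermediateField (RatFunc K) (treeField f Ω)) := by
  rw [toK_rootField, adjoin_map, toK_bot_eq_adjoin, Set.image_singleton]
  congr 2
  exact Λ.path_root i

lemma map_map_symm (e : Ω ≃ₐ[K] Ω) (A : IntermediateField K Ω) :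
    (A.map (e : Ω →ₐ[K] Ω)).map (e.symm : Ω →ₐ[K] Ω) = A := by
  rw [IntermediateField.map_map]
  convert! IntermediateField.map_id A
  ext; simp

lemma map_symm_map (e : Ω ≃ₐ[K] Ω) (A : IntermediateField K Ω) :
    (A.map (e.symm : Ω →ₐ[K] Ω)).map (e : Ω →ₐ[K] Ω) = A := map_map_symm e.symm A

lemma isIntegral_treeField (x : treeField f Ω) : IsIntegral (RatFunc K) x :=
  Algebra.IsIntegral.isIntegral x

instance (i : Fin (degree f)) : FiniteDimensional (RatFunc K) (Λ.rootField i) :=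
  adjoin.finiteDimensional (isIntegral_treeField _)

lemma stabilizer_root (i : Fin (degree f)) :
    MulAction.stabilizer (IMG f Ω) (Λ.root i) = (Λ.rootField i).fixingSubgroup := by
  apply le_antisymm
  · rw [← IntermediateField.le_iff_le, rootField, adjoin_le_iff, Set.singleton_subset_iff]
    exact fun g => g.2
  · intro g hg
    rw [IntermediateField.mem_fixingSubgroup_iff] at hg
    exact hg _ (Λ.root_mem_rootField i)

lemma stab_eq (L : IntermediateField (RatFunc K) (treeField f Ω)) (i : Fin (degree f)) :
    Λ.stab L.fixingSubgroup i = (L ⊔ Λ.rootField i).fixingSubgroup := by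
  rw [stab, stabilizer_root, fixingSubgroup_sup]

section

variable {L : IntermediateField (RatFunc K) (treeField f Ω)}

/-- If `Gal(M/L)` is self-similar then `λᵢ⁻¹` takes `L` into `L(tᵢ)`. -/
lemma map_symm_le (hH : Λ.IsSelfSimilar L.fixingSubgroup) (i : Fin (degree f)) :
    (toK L).map ((Λ.path i).symm : Ω →ₐ[K] Ω) ≤ toK (L ⊔ Λ.rootField i) := by
  rintro _ ⟨x, hx, rfl⟩
  obtain ⟨a, ha, rfl⟩ := mem_toK.1 hx
  let b : treeField f Ω := ⟨_, Λ.path_symm_mem i a.2⟩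
  change (b : Ω) ∈ _
  rw [coe_mem_toK, ← InfiniteGalois.fixedField_fixingSubgroup (L ⊔ Λ.rootField i), ← stab_eq]
  rintro ⟨g, hg, hgi⟩
  obtain ⟨h, hh, hs⟩ := hH [i] g hg hgi
  have h1 := hs.isFieldSection hgi b a (AlgEquiv.apply_symm_apply _ _)
  have h2 : h a = a := (IntermediateField.mem_fixingSubgroup_iff _ _).1 hh a ha
  rw [h2] at h1
  apply Subtype.ext
  apply (Λ.path i).injective
  exact h1.trans (AlgEquiv.apply_symm_apply _ _).symm

/-- The degree count behind the field criterion: `λᵢ⁻¹(L)` has over `K(tᵢ)` the degree of `L` over `K(t)`, which is at least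
the degree of `L(tᵢ)` over `K(tᵢ)`. -/
lemma toK_sup_rootField_eq_and_linearDisjoint [FiniteDimensional (RatFunc K) L]
    (hH : Λ.IsSelfSimilar L.fixingSubgroup) (i : Fin (degree f)) :
    toK (L ⊔ Λ.rootField i) = (toK L).map ((Λ.path i).symm : Ω →ₐ[K] Ω) ∧
      L.LinearDisjoint (Λ.rootField i) := by
  set R := Λ.rootField i
  set S := (toK L).map ((Λ.path i).symm : Ω →ₐ[K] Ω)
  have hS : S ≤ toK (L ⊔ R) := Λ.map_symm_le hH i
  have hRS : toK R = (toK (⊥ : IntermediateField (RatFunc K) (treeField f Ω))).map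
      ((Λ.path i).symm : Ω →ₐ[K] Ω) := by
    rw [← Λ.map_toK_rootField i, map_map_symm]
  have h1 : (toK R).relfinrank S = Module.finrank (RatFunc K) L := by
    rw [hRS, relfinrank_map_map, toK_relfinrank, relfinrank_bot_left]
  have hRS' : toK R ≤ S := by
    rw [hRS]
    exact IntermediateField.map_mono _ (toK_le_iff.2 bot_le)
  have h2 := relfinrank_mul_relfinrank hRS' hS
  rw [h1, toK_relfinrank] at h2
  have h3 : Module.finrank (RatFunc K) R * R.relfinrank (L ⊔ R) =
    Module.finrank (RatFunc K) ↥(L ⊔ R) := finrank_bot_mul_relfinrank le_sup_right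
  have h4 := IntermediateField.finrank_sup_le L R
  have hR0 : 0 < Module.finrank (RatFunc K) R := Module.finrank_pos
  have hL0 : 0 < Module.finrank (RatFunc K) L := Module.finrank_pos
  have h0 : 0 < Module.finrank (RatFunc K) ↥(L ⊔ R) := Module.finrank_pos
  have h5 : R.relfinrank (L ⊔ R) ≤ Module.finrank (RatFunc K) L := by
    rw [← h3, mul_comm (Module.finrank (RatFunc K) L)] at h4
    exact Nat.le_of_mul_le_mul_left h4 hR0
  have h6 : S.relfinrank (toK (L ⊔ R)) = 1 := by
    rw [← h3, ← h2] at h0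
    have : 0 < S.relfinrank (toK (L ⊔ R)) := by
      by_contra hc
      simp [Nat.eq_zero_of_not_pos hc] at h0
    rw [← h2] at h5
    have := Nat.le_of_mul_le_mul_left (h5.trans (mul_one _).ge) hL0
    omega
  refine ⟨le_antisymm (relfinrank_eq_one_iff.1 h6) hS, LinearDisjoint.of_finrank_sup ?_⟩
  rw [← h3, ← h2, h6, mul_one, mul_comm]

/-- Extending an element of `Gal(M/L)` to `Ω` and conjugating it with `λᵢ` gives an automorphism
that fixes `λᵢ⁻¹(L) = L(tᵢ)`; so it fixes `L` and `tᵢ`, and its section at `tᵢ` is the given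
element. -/
lemma isFractal_of_isSelfSimilar [FiniteDimensional (RatFunc K) L]
    (hH : Λ.IsSelfSimilar L.fixingSubgroup) : Λ.IsFractal L.fixingSubgroup := by
  refine ⟨hH, fun w => ?_⟩
  induction w with
  | nil => exact fun h hh => ⟨h, hh, h.commutes _, fun x y _ hxy => by
      have : x = y := Subtype.ext hxy
      rw [this]; rfl⟩
  | cons i w ih =>
    intro h hh
    obtain ⟨g', hg', hg'w, hs⟩ := ih h hh
    obtain ⟨e, he⟩ := exists_lift g'
    let p := Λ.path i
    have hroot : (p.trans ((e.restrictScalars K).trans p.symm)) (Λ.root i : Ω) = Λ.root i := by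
      change p.symm (e (p (Λ.root i))) = _
      rw [Λ.path_root i, ← Λ.path_symm_t i]
      exact congrArg p.symm (e.commutes _)
    have hfix : (p.trans ((e.restrictScalars K).trans p.symm)) (tElt K Ω) = tElt K Ω := by
      conv_lhs => rw [← Λ.evalMap_root i]
      have := evalMap_hom f ((p.trans ((e.restrictScalars K).trans p.symm) : Ω ≃ₐ[K] Ω) : Ω →ₐ[K] Ω)
        (Λ.root i : Ω)
      refine this.trans ?_
      rw [← Λ.evalMap_root i]
      exact congrArg _ hroot
    obtain ⟨g, hg⟩ := exists_restrict_of_fixes (f := f) _ hfix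
    have hfs : Λ.IsFieldSection [i] g g' := by
      intro x y hxy
      change p (x : Ω) = y at hxy
      change p (g x : Ω) = _
      rw [hg x]
      change p (p.symm (e (p (x : Ω)))) = _
      rw [AlgEquiv.apply_symm_apply, hxy, he]
    refine ⟨g, ?_, ?_, IsSection.cons hfs hs⟩
    · rw [IntermediateField.mem_fixingSubgroup_iff]
      intro a ha
      have h1 : (a : Ω) ∈ toK (L ⊔ Λ.rootField i) :=
        coe_mem_toK.2 ((le_sup_left : L ≤ L ⊔ Λ.rootField i) ha)
      rw [(Λ.toK_sup_rootField_eq_and_linearDisjoint hH i).1] at h1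
      obtain ⟨c, hc, hca⟩ := h1
      obtain ⟨b, hb, rfl⟩ := mem_toK.1 hc
      have hb' : p (a : Ω) = b := by
        rw [← hca]
        exact AlgEquiv.apply_symm_apply _ _
      apply Subtype.ext
      apply p.injective
      refine (hfs a b hb').trans ?_
      rw [(IntermediateField.mem_fixingSubgroup_iff _ _).1 hg' b hb, hb']
    · apply Subtype.ext
      apply p.injective
      refine (hfs _ _ (Λ.path_vertex_cons i w)).trans ?_
      rw [hg'w]
      exact (Λ.path_vertex_cons i w).symm

end

/-- Every vertex of the tree is labelled by a word. -/
lemma exists_word {n : ℕ} {x : Ω} (hx : x ∈ fiber f Ω n) :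
    ∃ w : List (Fin (degree f)), w.length = n ∧ (Λ.vertex w : Ω) = x := by
  induction n generalizing x with
  | zero => exact ⟨[], rfl, hx.symm⟩
  | succ n ih =>
    have hx1 : (evalMap f Ω)^[n] x ∈ fiber f Ω 1 := by
      exact (Function.iterate_succ_apply' (evalMap f Ω) n x).symm.trans hx
    let i := Λ.label.symm ⟨_, hx1⟩
    have hi : (Λ.label i : Ω) = (evalMap f Ω)^[n] x := by simp [i]
    have h2 : Λ.path i x ∈ fiber f Ω n := by
      change (evalMap f Ω)^[n] (Λ.path i x) = _
      have := evalMap_iterate_hom f (Λ.path i : Ω →ₐ[K] Ω) n x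
      refine this.symm.trans ?_
      rw [← hi]
      exact Λ.path_label i
    obtain ⟨w, hw, hwx⟩ := ih h2
    refine ⟨i :: w, by simp [hw], (Λ.path i).injective ?_⟩
    rw [path_vertex_cons, hwx]

include Λ in
lemma finite_fiber (n : ℕ) : (fiber f Ω n).Finite := by
  refine ((List.finite_length_eq (Fin (degree f)) n).image fun w => (Λ.vertex w : Ω)).subset ?_
  intro x hx
  obtain ⟨w, hw, rfl⟩ := Λ.exists_word hx
  exact ⟨w, hw, rfl⟩

lemma coe_mem_fiber {n : ℕ} {x : treeField f Ω} :
    (x : Ω) ∈ fiber f Ω n ↔ x ∈ fiber f (treeField f Ω) n := by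
  have h := evalMap_iterate_hom f ((treeField f Ω).val.restrictScalars K) n x
  constructor
  · intro hx
    exact Subtype.ext (h.trans hx)
  · intro hx
    exact h.symm.trans (congrArg Subtype.val hx)

include Λ in
lemma finiteDimensional_levelField (n : ℕ) :
    FiniteDimensional (RatFunc K) (levelField f Ω n) := by
  have : Finite (fiber f (treeField f Ω) n) := by
    refine Set.Finite.to_subtype (Set.Finite.of_finite_image (f := Subtype.val)
      ((Λ.finite_fiber n).subset ?_) Subtype.val_injective.injOn)
    rintro _ ⟨x, hx, rfl⟩
    exact coe_mem_fiber.2 hx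
  exact IntermediateField.finiteDimensional_adjoin fun x _ => isIntegral_treeField x

lemma evalMap_mem' {A : IntermediateField (RatFunc K) (treeField f Ω)} {x : treeField f Ω}
    (hx : x ∈ A) : evalMap f (treeField f Ω) x ∈ A := by
  have := evalMap_hom f (A.val.restrictScalars K) ⟨x, hx⟩
  rw [show evalMap f (treeField f Ω) x = _ from this.symm]
  exact (evalMap f A ⟨x, hx⟩).2

include Λ in
lemma levelField_mono (hd : 0 < degree f) : Monotone (levelField f Ω) := by
  refine monotone_nat_of_le_succ fun n => ?_
  rw [levelField, adjoin_le_iff]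
  intro x hx
  obtain ⟨w, hw, hwx⟩ := Λ.exists_word (coe_mem_fiber.2 hx)
  -- a preimage of the vertex `x` is found by extending its word by one letter
  let z : Ω := (Λ.wordPath w).symm (Λ.root ⟨0, hd⟩ : Ω)
  have hz : evalMap f Ω z = x := by
    have := evalMap_hom f ((Λ.wordPath w).symm : Ω →ₐ[K] Ω) (Λ.root ⟨0, hd⟩ : Ω)
    refine this.symm.trans ?_
    rw [Λ.evalMap_root]
    exact hwx
  have hzn : z ∈ fiber f Ω (n + 1) := by
    change (evalMap f Ω)^[n + 1] z = _
    rw [Function.iterate_succ_apply, hz]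
    exact coe_mem_fiber.2 hx
  have hzM : z ∈ treeField f Ω := mem_treeField_of_treeOver f Ω ⟨_, hzn⟩
  have : (⟨z, hzM⟩ : treeField f Ω) ∈ levelField f Ω (n + 1) :=
    subset_adjoin _ _ (coe_mem_fiber.1 hzn)
  have h2 := evalMap_mem' (f := f) this
  rwa [show evalMap f (treeField f Ω) ⟨z, hzM⟩ = x from Subtype.ext
    ((evalMap_hom f ((treeField f Ω).val.restrictScalars K) ⟨z, hzM⟩).trans hz)] at h2

include Λ in
lemma exists_mem_levelField (hd : 0 < degree f) (x : treeField f Ω) :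
    ∃ n, x ∈ levelField f Ω n := by
  have h : (⨆ n, levelField f Ω n) = ⊤ := by
    apply IntermediateField.lift_injective
    have h1 : (treeField f Ω : IntermediateField (RatFunc K) Ω) ≤
        IntermediateField.lift (⨆ n, levelField f Ω n) := by
      conv_lhs => rw [treeField]
      rw [adjoin_le_iff]
      intro y hy
      obtain ⟨n, hn⟩ := Set.mem_iUnion.1 hy
      have hyM : y ∈ treeField f Ω := subset_adjoin _ _ hy
      exact ⟨⟨y, hyM⟩, le_iSup (levelField f Ω) n (subset_adjoin _ _ (coe_mem_fiber.1 hn)), rfl⟩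
    refine le_antisymm ?_ ?_
    · rintro _ ⟨a, _, rfl⟩
      exact ⟨a, mem_top, rfl⟩
    · rintro _ ⟨a, _, rfl⟩
      exact h1 a.2
  have hx : x ∈ ((⨆ n, levelField f Ω n : IntermediateField (RatFunc K) (treeField f Ω)) :
      Set (treeField f Ω)) := by
    rw [h]; trivial
  rw [IntermediateField.coe_iSup_of_directed (Λ.levelField_mono hd).directed_le] at hx
  exact Set.mem_iUnion.1 hx

include Λ in
lemma exists_le_levelField (hd : 0 < degree f)
    (L : IntermediateField (RatFunc K) (treeField f Ω)) [FiniteDimensional (RatFunc K) L] :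
    ∃ N, ∀ n ≥ N, L ≤ levelField f Ω n := by
  obtain ⟨⟨a, ha⟩, h⟩ := Field.exists_primitive_element (RatFunc K) L
  obtain ⟨N, hN⟩ := Λ.exists_mem_levelField hd a
  refine ⟨N, fun n hn => ?_⟩
  have : L = adjoin (RatFunc K) {a} := by
    have h3 := congrArg (IntermediateField.lift) h
    rw [IntermediateField.lift_adjoin, IntermediateField.lift_top] at h3
    simpa using h3.symm
  rw [this, adjoin_le_iff, Set.singleton_subset_iff]
  exact Λ.levelField_mono hd hn hN

end PathData

lemma fixingSubgroup_fixedField_of_isOpen {H : Subgroup (IMG f Ω)}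
    (hH : IsOpen (H : Set (IMG f Ω))) : (fixedField H).fixingSubgroup = H :=
  InfiniteGalois.fixingSubgroup_fixedField ⟨H, Subgroup.isClosed_of_isOpen H hH⟩

lemma finiteDimensional_fixedField_of_isOpen {H : Subgroup (IMG f Ω)}
    (hH : IsOpen (H : Set (IMG f Ω))) : FiniteDimensional (RatFunc K) (fixedField H) := by
  rw [← InfiniteGalois.isOpen_iff_finite]
  change IsOpen ((fixedField H).fixingSubgroup : Set (IMG f Ω))
  rwa [fixingSubgroup_fixedField_of_isOpen hH]

/-- The fixed field of an open self-similar subgroup is linearly disjoint from each `K(tᵢ)`, and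
`λᵢ` takes the compositum back to the field. -/
theorem PathData.field_properties_of_isSelfSimilar (Λ : PathData f Ω) (hd : 0 < degree f)
    {H : Subgroup (IMG f Ω)} (hH : IsOpen (H : Set (IMG f Ω))) (hs : Λ.IsSelfSimilar H) :
    Λ.IsFractal H ∧
      (∃ N : ℕ, ∀ n ≥ N, fixedField H ≤ levelField f Ω n) ∧
      ∀ i : Fin (degree f),
        fixedField H ≤ fixedField (Λ.stab H i) ∧
        fixedField (Λ.stab H i) ≤ Λ.treeFieldOver i ∧
        (fun a : treeField f Ω => Λ.path i (a : Ω)) '' (fixedField (Λ.stab H i)) =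
          (fun a : treeField f Ω => (a : Ω)) '' (fixedField H) ∧
        (fun a : treeField f Ω => Λ.path i (a : Ω)) '' (Λ.rootField i) =
          Set.range (algebraMap (RatFunc K) Ω) ∧
        fixedField (Λ.stab H i) = fixedField H ⊔ Λ.rootField i ∧
        fixedField (Λ.stab H i) =
          (adjoin (fixedField H) {Λ.root i}).restrictScalars (RatFunc K) ∧
        (fixedField H).LinearDisjoint (Λ.rootField i) := by
  have hfd := finiteDimensional_fixedField_of_isOpen hH
  have hHL := fixingSubgroup_fixedField_of_isOpen hH
  set L := fixedField H with hL
  clear_value L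
  subst hHL
  refine ⟨Λ.isFractal_of_isSelfSimilar hs, Λ.exists_le_levelField hd L, fun i => ?_⟩
  have hst : fixedField (Λ.stab L.fixingSubgroup i) = L ⊔ Λ.rootField i := by
    rw [Λ.stab_eq, InfiniteGalois.fixedField_fixingSubgroup]
  rw [hst]
  obtain ⟨h1, h2⟩ := Λ.toK_sup_rootField_eq_and_linearDisjoint hs i
  have him : ∀ A : IntermediateField (RatFunc K) (treeField f Ω),
      (fun a : treeField f Ω => Λ.path i (a : Ω)) '' A =
        ((toK A).map (Λ.path i : Ω →ₐ[K] Ω) : Set Ω) := by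
    intro A
    rw [IntermediateField.coe_map, coe_toK, Set.image_image]
    rfl
  refine ⟨le_sup_left, ?_, ?_, ?_, rfl, ?_, h2⟩
  · rw [← toK_le_iff, h1, PathData.treeFieldOver, toK_adjoin]
    rintro _ ⟨x, hx, rfl⟩
    obtain ⟨a, ha, rfl⟩ := mem_toK.1 hx
    have h3 : (Λ.path i).symm (a : Ω) ∈ (adjoin K (treeOver f (tElt K Ω))).map
      ((Λ.path i).symm : Ω →ₐ[K] Ω) := ⟨a, mem_treeField_iff.1 a.2, rfl⟩
    rw [adjoin_map] at h3
    refine adjoin.mono K _ _ ?_ h3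
    rintro _ ⟨y, hy, rfl⟩
    right
    have h4 := treeOver_hom f ((Λ.path i).symm : Ω →ₐ[K] Ω) hy
    change _ ∈ treeOver f ((Λ.path i).symm (tElt K Ω)) at h4
    rw [Λ.path_symm_t] at h4
    have hM : (Λ.path i).symm y ∈ treeField f Ω :=
      mem_treeField_of_treeOver f Ω (treeOver_trans f h4 (Λ.root_mem_treeOver i))
    obtain ⟨n, hn⟩ := h4
    exact ⟨⟨_, hM⟩, ⟨n, Subtype.ext
      ((evalMap_iterate_hom f ((treeField f Ω).val.restrictScalars K) n ⟨_, hM⟩).trans hn)⟩, rfl⟩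
  · rw [him, h1, PathData.map_symm_map, coe_toK]
  · rw [him, Λ.map_toK_rootField, toK_bot]
  · rw [restrictScalars_adjoin, PathData.rootField, IntermediateField.adjoin_union,
      IntermediateField.adjoin_self]

end Open

/-! ### Path data extending a given isomorphism -/

section Converse

variable {K : Type u} [Field K] {f : RatFunc K} {Ω : Type u} [Field Ω] [Algebra K Ω]
  [Algebra (RatFunc K) Ω] [IsScalarTower K (RatFunc K) Ω] [IsSepClosure (RatFunc K) Ω]

/-- An intermediate field of `M / K(t)` is isomorphic over `K` to its image in `Ω`. -/
def toKEquiv (L : IntermediateField (RatFunc K) (treeField f Ω)) : L ≃ₐ[K] toK L :=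
  (IntermediateField.liftAlgEquiv L).restrictScalars K

lemma coe_toKEquiv (L : IntermediateField (RatFunc K) (treeField f Ω)) (a : L) :
    (toKEquiv L a : Ω) = ((a : treeField f Ω) : Ω) := rfl

namespace PathData

variable (Λ : PathData f Ω)

lemma toK_sup_rootField (L : IntermediateField (RatFunc K) (treeField f Ω))
    (j : Fin (degree f)) :
    toK (L ⊔ Λ.rootField j) = adjoin K ((toK L : Set Ω) ∪ {(Λ.root j : Ω)}) := by
  have h : L ⊔ Λ.rootField j = adjoin (RatFunc K) ((L : Set (treeField f Ω)) ∪ {Λ.root j}) := by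
    rw [adjoin_union, adjoin_self]; rfl
  rw [h, toK_adjoin, Set.image_union, ← coe_toK, Set.image_singleton]
  congr 1
  exact Set.insert_eq_of_mem (Or.inl (tElt_mem_toK L))

/-- Any two vertices `tⱼ` and `tᵢ` are conjugate over `K(t)`. -/
lemma exists_img_root (i j : Fin (degree f)) : ∃ h : IMG f Ω, h (Λ.root j) = Λ.root i := by
  have : ((Λ.path j).trans (Λ.path i).symm) (Λ.root j : Ω) = (Λ.root i : Ω) := by
    change (Λ.path i).symm (Λ.path j (Λ.root j : Ω)) = _
    rw [path_root, path_symm_t]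
  obtain ⟨h, hh⟩ := exists_restrict_of_fixes (f := f) ((Λ.path j).trans (Λ.path i).symm) (by
    conv_lhs => rw [← Λ.evalMap_root j]
    refine (evalMap_hom f (((Λ.path j).trans (Λ.path i).symm : Ω ≃ₐ[K] Ω) : Ω →ₐ[K] Ω)
      (Λ.root j : Ω)).trans ?_
    rw [← Λ.evalMap_root i]
    exact congrArg _ this)
  exact ⟨h, Subtype.ext ((hh _).trans this)⟩

/-- If `A` and `F(x)` are linearly disjoint then `x` has the same minimal polynomial over `A` as
over `F`. -/
lemma _root_.IntermediateField.LinearDisjoint.map_minpoly {F E : Type*} [Field F] [Field E]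
    [Algebra F E] {A : IntermediateField F E} [FiniteDimensional F A] {x : E}
    (hint : _root_.IsIntegral F x) (h : A.LinearDisjoint F⟮x⟯) :
    (minpoly F x).map (algebraMap F A) = minpoly A x := by
  have hintA : _root_.IsIntegral A x := hint.tower_top
  have h1 : (minpoly A x).natDegree = (minpoly F x).natDegree := by
    have h2 := h.finrank_sup
    have h3 : A ⊔ F⟮x⟯ = (adjoin A {x}).restrictScalars F :=
      (restrictScalars_adjoin_eq_sup _ _ _).symm
    have hfree : Module.Free A (adjoin A {x}) := Module.Free.of_divisionRing _ _
    have h4 := Module.finrank_mul_finrank F A (adjoin A {x})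
    rw [← adjoin.finrank hintA, ← adjoin.finrank hint]
    have h5 : Module.finrank F (A ⊔ F⟮x⟯ : IntermediateField _ _) =
        Module.finrank F (adjoin A {x}) := by
      rw [h3]; rfl
    rw [h5, ← h4] at h2
    exact Nat.eq_of_mul_eq_mul_left Module.finrank_pos h2
  exact Polynomial.eq_of_monic_of_dvd_of_natDegree_le (minpoly.monic hintA)
    ((minpoly.monic hint).map _) (minpoly.dvd_map_of_isScalarTower _ _ _)
    (by rw [(minpoly.monic hint).natDegree_map, h1])

/-- If `L` is linearly disjoint from `K(tᵢ)` then all `tⱼ` are conjugate over `L`. -/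
lemma exists_conj_of_linearDisjoint {L : IntermediateField (RatFunc K) (treeField f Ω)}
    [FiniteDimensional (RatFunc K) L] {i : Fin (degree f)}
    (hL : L.LinearDisjoint (Λ.rootField i)) (j : Fin (degree f)) :
    ∃ h ∈ L.fixingSubgroup, h (Λ.root j) = Λ.root i := by
  have hint : ∀ j, IsIntegral (RatFunc K) (Λ.root j) := fun j => isIntegral_treeField _
  have hintL : ∀ j, IsIntegral L (Λ.root j) := fun j => (hint j).tower_top
  have h2 := IntermediateField.LinearDisjoint.map_minpoly (hint i) hL
  obtain ⟨g, hg⟩ := Λ.exists_img_root i j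
  have h3 : minpoly L (Λ.root i) = minpoly L (Λ.root j) := by
    refine minpoly.eq_of_irreducible_of_monic (minpoly.irreducible (hintL i)) ?_
      (minpoly.monic (hintL i))
    rw [← h2, Polynomial.aeval_map_algebraMap, ← hg, minpoly.algEquiv_eq g]
    exact minpoly.aeval _ _
  have := Normal.tower_top_of_normal (RatFunc K) L (treeField f Ω)
  rw [Normal.minpoly_eq_iff_mem_orbit] at h3
  obtain ⟨τ, hτ⟩ := h3
  refine ⟨τ.restrictScalars (RatFunc K), ?_, hτ⟩
  rw [IntermediateField.mem_fixingSubgroup_iff]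
  exact fun a ha => τ.commutes ⟨a, ha⟩

/-- Path data adapted to an isomorphism `e` from `L(tᵢ)` to `L`: the paths `λ'ⱼ` are obtained from
`e` by composition with automorphisms over `L` that take `tⱼ` to `tᵢ`. -/
lemma exists_pathData_of_algEquiv {L : IntermediateField (RatFunc K) (treeField f Ω)}
    [FiniteDimensional (RatFunc K) L] {i : Fin (degree f)}
    (hL : L.LinearDisjoint (Λ.rootField i)) (e : Ω ≃ₐ[K] Ω)
    (het : e (Λ.root i) = tElt K Ω)
    (heL : (toK (L ⊔ Λ.rootField i)).map (e : Ω →ₐ[K] Ω) = toK L) :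
    ∃ Λ' : PathData f Ω, Λ'.label = Λ.label ∧ Λ'.path i = e ∧
      (∀ j, (toK (L ⊔ Λ'.rootField j)).map (Λ'.path j : Ω →ₐ[K] Ω) = toK L) ∧
      ∀ j, ∀ a ∈ L, Λ'.path j (a : Ω) = e a := by
  have hσ : ∀ j, ∃ σ : Ω ≃ₐ[K] Ω, (j = i → σ = AlgEquiv.refl) ∧ (∀ a ∈ L, σ (a : Ω) = a) ∧
      σ (Λ.root j) = Λ.root i := by
    intro j
    by_cases hj : j = i
    · exact ⟨AlgEquiv.refl, fun _ => rfl, fun _ _ => rfl, by rw [hj]; rfl⟩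
    · obtain ⟨h, hh, hj'⟩ := Λ.exists_conj_of_linearDisjoint hL j
      obtain ⟨σ, hσ⟩ := exists_lift h
      refine ⟨σ.restrictScalars K, fun h => absurd h hj, fun a ha => ?_, ?_⟩
      · refine (hσ a).trans ?_
        rw [(IntermediateField.mem_fixingSubgroup_iff _ _).1 hh a ha]
      · refine (hσ _).trans ?_
        rw [hj']
  choose σ hσi hσL hσr using hσ
  have hmap : ∀ j, (toK (L ⊔ Λ.rootField j)).map (((σ j).trans e : Ω ≃ₐ[K] Ω) : Ω →ₐ[K] Ω) =
      toK L := by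
    intro j
    have h1 : (((σ j).trans e : Ω ≃ₐ[K] Ω) : Ω →ₐ[K] Ω) =
      (e : Ω →ₐ[K] Ω).comp (σ j : Ω →ₐ[K] Ω) := rfl
    have h2 : (toK (L ⊔ Λ.rootField j)).map (σ j : Ω →ₐ[K] Ω) = toK (L ⊔ Λ.rootField i) := by
      rw [toK_sup_rootField, toK_sup_rootField, adjoin_map, Set.image_union, Set.image_singleton]
      congr 1
      congr 1
      · rw [coe_toK, Set.image_image]
        exact Set.image_congr fun a ha => hσL j a ha
      · exact congrArg _ (hσr j)
    rw [h1, ← IntermediateField.map_map, h2, heL]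
  let Λ' : PathData f Ω := ⟨Λ.label, fun j => (σ j).trans e, fun j => by
    rw [← Λ.coe_root j]
    change e (σ j (Λ.root j)) = _
    rw [hσr, het]⟩
  have hr : ∀ j, (Λ'.root j : Ω) = Λ.root j := fun j => by
    rw [coe_root, coe_root]
  refine ⟨Λ', rfl, ?_, fun j => ?_, fun j a ha => congrArg e (hσL j a ha)⟩
  · change (σ i).trans e = e
    rw [hσi i rfl]; rfl
  · have h3 : toK (L ⊔ Λ'.rootField j) = toK (L ⊔ Λ.rootField j) := by
      rw [toK_sup_rootField, toK_sup_rootField, hr]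
    rw [h3]
    exact hmap j

lemma toK_le_map_of_normal {L : IntermediateField (RatFunc K) (treeField f Ω)}
    [Normal (RatFunc K) L] (e : Ω ≃ₐ[K] Ω) (he : e (tElt K Ω) = tElt K Ω) :
    toK L ≤ (toK L).map (e : Ω →ₐ[K] Ω) := by
  obtain ⟨h, hh⟩ := exists_restrict_of_fixes (f := f) e.symm (by
    rw [AlgEquiv.symm_apply_eq, he])
  intro x hx
  obtain ⟨a, ha, rfl⟩ := mem_toK.1 hx
  have h1 : h a ∈ L := (normal_iff_forall_map_le'.1 ‹_› h) ⟨a, ha, rfl⟩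
  refine ⟨(h a : Ω), coe_mem_toK.2 h1, ?_⟩
  rw [hh a]
  exact AlgEquiv.apply_symm_apply _ _

end PathData

/-- Fields `L` that are linearly disjoint from some `K(tᵢ)` and isomorphic to `L(tᵢ)` give
self-similar groups, for suitable path data. -/
theorem PathData.isSelfSimilar_converse (Λ : PathData f Ω)
    (L : IntermediateField (RatFunc K) (treeField f Ω)) (n : ℕ) (i : Fin (degree f))
    (hLn : L ≤ levelField f Ω n) (hL : L.LinearDisjoint (Λ.rootField i))
    (ψ : (L ⊔ Λ.rootField i : IntermediateField (RatFunc K) (treeField f Ω)) ≃ₐ[K] L)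
    (hψ : ∀ a : (L ⊔ Λ.rootField i : IntermediateField (RatFunc K) (treeField f Ω)),
          (a : treeField f Ω) = Λ.root i → ψ a = tElt K L) :
    (∃ Λ' : PathData f Ω, Λ'.label = Λ.label ∧
      (∀ a : (L ⊔ Λ.rootField i : IntermediateField (RatFunc K) (treeField f Ω)),
        Λ'.path i ((a : treeField f Ω) : Ω) = ((ψ a : treeField f Ω) : Ω)) ∧
      Λ'.IsSelfSimilar L.fixingSubgroup) ∧
    ((∀ j, (fun a : treeField f Ω => Λ.path j (a : Ω)) ''
        (L ⊔ Λ.rootField j : IntermediateField (RatFunc K) (treeField f Ω)) =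
          (fun a : treeField f Ω => (a : Ω)) '' L) →
      Λ.IsSelfSimilar L.fixingSubgroup) ∧
    (IsGalois (RatFunc K) L → Λ.IsSelfSimilar L.fixingSubgroup) := by
  have := Λ.finiteDimensional_levelField n
  have hfd : FiniteDimensional (RatFunc K) L :=
    .of_injective (inclusion hLn).toLinearMap (inclusion hLn).injective
  obtain ⟨e, he⟩ := exists_algEquiv_extending (tElt_mem_toK _) (tElt_mem_toK _)
    ((toKEquiv (L ⊔ Λ.rootField i)).symm.trans (ψ.trans (toKEquiv L)))
  have he' : ∀ a : (L ⊔ Λ.rootField i : IntermediateField (RatFunc K) (treeField f Ω)),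
      e ((a : treeField f Ω) : Ω) = ((ψ a : treeField f Ω) : Ω) := by
    intro a
    have := he (toKEquiv _ a)
    rw [coe_toKEquiv] at this
    rw [this]
    change ((ψ ((toKEquiv _).symm (toKEquiv _ a)) : treeField f Ω) : Ω) = _
    rw [AlgEquiv.symm_apply_apply]
  have hroot : Λ.root i ∈ L ⊔ Λ.rootField i :=
    (le_sup_right : Λ.rootField i ≤ _) (Λ.root_mem_rootField i)
  have het : e (Λ.root i) = tElt K Ω := by
    refine (he' ⟨_, hroot⟩).trans ?_
    rw [hψ _ rfl]
    rfl
  have heL : (toK (L ⊔ Λ.rootField i)).map (e : Ω →ₐ[K] Ω) = toK L := by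
    apply le_antisymm
    · rintro _ ⟨x, hx, rfl⟩
      obtain ⟨a, ha, rfl⟩ := mem_toK.1 hx
      exact mem_toK.2 ⟨_, (ψ ⟨a, ha⟩).2, (he' ⟨a, ha⟩).symm⟩
    · intro x hx
      obtain ⟨a, ha, rfl⟩ := mem_toK.1 hx
      refine ⟨((ψ.symm ⟨a, ha⟩ : (L ⊔ Λ.rootField i : IntermediateField (RatFunc K) _)) :
        treeField f Ω), coe_mem_toK.2 (ψ.symm ⟨a, ha⟩).2, ?_⟩
      refine (he' _).trans ?_
      rw [AlgEquiv.apply_symm_apply]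
  obtain ⟨Λ', hlab, hpath, hΛ', -⟩ := Λ.exists_pathData_of_algEquiv hL e het heL
  refine ⟨⟨Λ', hlab, fun a => ?_, Λ'.isSelfSimilar_fixingSubgroup L fun j => (hΛ' j).ge⟩,
    fun hj => Λ.isSelfSimilar_fixingSubgroup L fun j => ?_,
    fun hG => Λ.isSelfSimilar_fixingSubgroup L fun j => ?_⟩
  · rw [hpath]
    exact he' a
  · intro x hx
    obtain ⟨a, ha, rfl⟩ := mem_toK.1 hx
    have h1 : (a : Ω) ∈ (fun a : treeField f Ω => (a : Ω)) '' L := ⟨a, ha, rfl⟩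
    rw [← hj j] at h1
    obtain ⟨b, hb, hba⟩ := h1
    exact ⟨b, coe_mem_toK.2 hb, hba⟩
  · have hn : Normal (RatFunc K) L := hG.to_normal
    have hr : ∀ j, (Λ'.root j : Ω) = Λ.root j := fun j => by
      rw [PathData.coe_root, PathData.coe_root, hlab]
    have hrf : toK (L ⊔ Λ'.rootField j) = toK (L ⊔ Λ.rootField j) := by
      rw [PathData.toK_sup_rootField, PathData.toK_sup_rootField, hr]
    let τ : Ω ≃ₐ[K] Ω := (Λ'.path j).symm.trans (Λ.path j)
    have hτ : τ (tElt K Ω) = tElt K Ω := by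
      change Λ.path j ((Λ'.path j).symm (tElt K Ω)) = _
      rw [PathData.path_symm_t, hr, PathData.path_root]
    refine (PathData.toK_le_map_of_normal τ hτ).trans ?_
    conv_lhs => rw [← hΛ' j]
    rw [IntermediateField.map_map, hrf]
    rintro _ ⟨x, hx, rfl⟩
    refine ⟨x, hx, ?_⟩
    change _ = Λ.path j ((Λ'.path j).symm (Λ'.path j x))
    rw [AlgEquiv.symm_apply_apply]
    rfl

end Converse

/-! ### Inertia and residue fields -/

section Inertia

open scoped Pointwise

variable {R S G : Type*} [CommRing R] [CommRing S] [Algebra R S] [Group G]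
  [MulSemiringAction G S] [IsGaloisGroup G R S] [Finite G]

/-- An element that avoids `P` but lies in all the conjugates of `P` other than `P`. -/
lemma exists_notMem_forall_smul_mem (P : Ideal S) [P.IsMaximal] :
    ∃ u ∉ P, ∀ g : G, g ∉ MulAction.stabilizer G P → g • u ∈ P := by
  classical
  have := Fintype.ofFinite G
  have h : ∀ g : G, ∃ u ∉ P, g ∉ MulAction.stabilizer G P → g • u ∈ P := by
    intro g
    by_cases hg : g ∈ MulAction.stabilizer G P
    · exact ⟨1, (Ideal.ne_top_iff_one P).1 Ideal.IsPrime.ne_top', fun h => absurd hg h⟩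
    · have : ¬ (g⁻¹ • P ≤ P) := by
        intro hle
        apply hg
        have h1 := Ideal.pointwise_smul_le_pointwise_smul_iff (a := g) |>.2 hle
        rw [smul_inv_smul] at h1
        rw [MulAction.mem_stabilizer_iff]
        refine ((‹P.IsMaximal›).eq_of_le ?_ h1).symm
        intro htop
        have h2 : (1 : S) ∈ g • P := htop ▸ Submodule.mem_top
        rw [Ideal.mem_pointwise_smul_iff_inv_smul_mem, smul_one] at h2
        exact (Ideal.ne_top_iff_one P).1 Ideal.IsPrime.ne_top' h2
      obtain ⟨u, hu, huP⟩ := SetLike.not_le_iff_exists.1 this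
      refine ⟨u, huP, fun _ => ?_⟩
      rwa [Ideal.mem_inv_pointwise_smul_iff] at hu
  choose u hu hg using h
  refine ⟨∏ g, u g, fun hmem => ?_, fun g hgs => ?_⟩
  · obtain ⟨g, -, hh⟩ := (Ideal.IsPrime.prod_mem_iff).1 hmem
    exact hu g hh
  · rw [Finset.smul_prod']
    exact (Ideal.IsPrime.prod_mem_iff).2 ⟨g, Finset.mem_univ _, hg g hgs⟩

attribute [local instance] Ideal.Quotient.field in
/-- If the order of the inertia group at `P` is nonzero in the residue field then the extension of
residue fields is Galois: an element of the residue field at `P` that is fixed by all automorphisms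
is a trace of some `θ`, and the trace over `G` of a suitable lift of `θ` reduces to the product of
the element and the order of the inertia group. -/
theorem isGalois_quotient_of_inertia (p : Ideal R) (P : Ideal S) [p.IsMaximal] [P.IsMaximal]
    [P.LiesOver p] [Module.Finite R S] (hI : (Nat.card (P.inertia G) : S ⧸ P) ≠ 0) :
    IsGalois (R ⧸ p) (S ⧸ P) := by
  classical
  have := Fintype.ofFinite G
  have hfin : Module.Finite (R ⧸ p) (S ⧸ P) := inferInstance
  apply IsGalois.of_fixedField_eq_bot
  rw [eq_bot_iff]
  intro a ha
  have ha' : ∀ τ : (S ⧸ P) ≃ₐ[R ⧸ p] (S ⧸ P), τ a = a := fun τ => ha ⟨τ, trivial⟩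
  obtain ⟨θ, hθ⟩ : ∃ θ : S ⧸ P, ∑ τ : (S ⧸ P) ≃ₐ[R ⧸ p] (S ⧸ P), τ θ ≠ 0 := by
    by_contra! h
    have hli := linearIndependent_monoidHom (S ⧸ P) (S ⧸ P)
    let c : ((S ⧸ P) ≃ₐ[R ⧸ p] (S ⧸ P)) → ((S ⧸ P) →* (S ⧸ P)) := fun τ => (τ : (S ⧸ P) →* (S ⧸ P))
    have hc : Function.Injective c := fun σ τ h => AlgEquiv.ext fun x => DFunLike.congr_fun h x
    have := Fintype.linearIndependent_iff.1 (hli.comp c hc) (fun _ => 1) (by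
      funext x
      simpa [c] using h x) 1
    exact one_ne_zero this
  set t0 := ∑ τ : (S ⧸ P) ≃ₐ[R ⧸ p] (S ⧸ P), τ θ with ht0
  have ht0' : ∀ τ : (S ⧸ P) ≃ₐ[R ⧸ p] (S ⧸ P), τ t0 = t0 := by
    intro τ
    rw [ht0, map_sum]
    exact Fintype.sum_equiv (Equiv.mulLeft τ) _ _ fun _ => rfl
  obtain ⟨u, huP, hu⟩ := exists_notMem_forall_smul_mem (G := G) P
  have hu0 : Ideal.Quotient.mk P u ≠ 0 := by rwa [Ne, Ideal.Quotient.eq_zero_iff_mem]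
  set θ' : S ⧸ P := a * θ / t0 with hθ'
  obtain ⟨w', hw'⟩ := Ideal.Quotient.mk_surjective (θ' / Ideal.Quotient.mk P u)
  have hw : Ideal.Quotient.mk P (u * w') = θ' := by
    rw [map_mul, hw', mul_div_cancel₀ _ hu0]
  have hsum : ∑ τ : (S ⧸ P) ≃ₐ[R ⧸ p] (S ⧸ P), τ θ' = a := by
    simp only [hθ', map_div₀, map_mul, ha', ht0']
    rw [← Finset.sum_div, ← Finset.mul_sum, mul_div_assoc, div_self hθ, mul_one]
  have hinv : ∃ r : R, algebraMap R S r = ∑ g : G, g • (u * w') := by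
    apply Algebra.IsInvariant.isInvariant (G := G)
    intro g
    rw [Finset.smul_sum]
    exact Fintype.sum_equiv (Equiv.mulLeft g) _ _ fun h => (mul_smul g h _).symm
  obtain ⟨r, hr⟩ := hinv
  let φ := Ideal.Quotient.stabilizerHom P p G
  have hφs : Function.Surjective φ := Ideal.Quotient.stabilizerHom_surjective G p P
  have hcard : ∀ τ, (Finset.univ.filter fun g => φ g = τ).card = Nat.card (P.inertia G) := by
    intro τ
    rw [MonoidHom.card_fiber_eq_of_mem_range φ (hφs τ) (hφs 1)]
    rw [← Ideal.Quotient.map_ker_stabilizer_subtype P p G,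
      Nat.card_congr (Subgroup.equivMapOfInjective _ _ (Subgroup.subtype_injective _)).symm.toEquiv,
      ← Fintype.card_subtype, Nat.card_eq_fintype_card.symm]
    rfl
  have hred : Ideal.Quotient.mk P (∑ g : G, g • (u * w')) =
      (Nat.card (P.inertia G) : S ⧸ P) * a := by
    rw [map_sum]
    have h1 : ∑ g : G, Ideal.Quotient.mk P (g • (u * w')) =
        ∑ g : MulAction.stabilizer G P, Ideal.Quotient.mk P ((g : G) • (u * w')) := by
      rw [← Finset.sum_subtype (Finset.univ.filter fun g => g ∈ MulAction.stabilizer G P)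
        (fun g => by simp) fun g : G => Ideal.Quotient.mk P (g • (u * w'))]
      refine (Finset.sum_filter_of_ne fun g _ hg => ?_).symm
      by_contra hgs
      apply hg
      rw [Ideal.Quotient.eq_zero_iff_mem, smul_mul']
      exact P.mul_mem_right _ (hu g hgs)
    have h2 : ∀ g : MulAction.stabilizer G P, Ideal.Quotient.mk P ((g : G) • (u * w')) =
        φ g θ' := by
      intro g
      rw [← hw]; rfl
    rw [h1, Finset.sum_congr rfl fun g _ => h2 g, ← Finset.sum_fiberwise Finset.univ φ]
    have h3 : ∀ τ, ∑ g with φ g = τ, φ g θ' = (Nat.card (P.inertia G) : S ⧸ P) * τ θ' := by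
      intro τ
      rw [Finset.sum_congr rfl fun g hg => by rw [(Finset.mem_filter.1 hg).2],
        Finset.sum_const, hcard, nsmul_eq_mul]
    rw [Finset.sum_congr rfl fun τ _ => h3 τ, ← Finset.mul_sum, hsum]
  rw [IntermediateField.mem_bot]
  refine ⟨Ideal.Quotient.mk p r / (Nat.card (P.inertia G) : R ⧸ p), ?_⟩
  rw [map_div₀, map_natCast, div_eq_iff hI, mul_comm a, ← hred, ← hr]
  rfl

end Inertia

section Inertia

open scoped Pointwise

variable {R S G : Type*} [CommRing R] [CommRing S] [Algebra R S] [Group G]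
  [MulSemiringAction G S] [IsGaloisGroup G R S] [Finite G]

attribute [local instance] Ideal.Quotient.field in
lemma isSeparable_residueField_of_quotient {R S : Type*} [CommRing R] [CommRing S] [Algebra R S]
    (p : Ideal R) (P : Ideal S) [p.IsMaximal] [P.IsMaximal]
    [P.LiesOver p] [Algebra (Localization.AtPrime p) (Localization.AtPrime P)]
    [Localization.AtPrime.IsLiesOverAlgebra p P]
    [Algebra.IsSeparable (R ⧸ p) (S ⧸ P)] :
    Algebra.IsSeparable p.ResidueField P.ResidueField := by
  let e₁ : (R ⧸ p) ≃+* p.ResidueField :=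
    RingEquiv.ofBijective _ (Ideal.bijective_algebraMap_quotient_residueField p)
  let e₂ : (S ⧸ P) ≃+* P.ResidueField :=
    RingEquiv.ofBijective _ (Ideal.bijective_algebraMap_quotient_residueField P)
  refine Algebra.IsSeparable.of_equiv_equiv e₁ e₂ ?_
  ext x
  simp [e₁, e₂, ← IsScalarTower.algebraMap_apply]

attribute [local instance] Ideal.Quotient.field in
/-- Trivial inertia implies unramified. -/
theorem isUnramifiedAt_of_inertia_eq_bot [IsDomain R] [IsDomain S] [Module.Finite R S]
    [Module.Flat R S] (p : Ideal R) (P : Ideal S) [p.IsMaximal] [P.IsMaximal]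
    [P.LiesOver p] (hI : P.inertia G = ⊥) : Algebra.IsUnramifiedAt R P := by
  have hI1 : Nat.card (P.inertia G) = 1 := by rw [hI]; exact Subgroup.card_bot
  have hgal : IsGalois (R ⧸ p) (S ⧸ P) := isGalois_quotient_of_inertia (G := G) p P (by
    rw [hI1, Nat.cast_one]; exact one_ne_zero)
  have hfin : Module.Finite (R ⧸ p) (S ⧸ P) := inferInstance
  have h1 : Nat.card (MulAction.stabilizer G P) = P.inertiaDeg R := by
    have h2 : Nat.card (MulAction.stabilizer G P ⧸ P.inertia (MulAction.stabilizer G P)) = _ :=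
      Nat.card_congr (Ideal.Quotient.stabilizerQuotientInertiaEquiv G p P).toEquiv
    have h3 := Subgroup.card_mul_index (P.inertia (MulAction.stabilizer G P))
    have h4 : P.inertia (MulAction.stabilizer G P) = ⊥ := by
      rw [eq_bot_iff]
      intro g hg
      have : (g : G) ∈ P.inertia G := Ideal.coe_mem_inertia.2 hg
      rw [hI, Subgroup.mem_bot] at this
      exact Subtype.ext this
    rw [Ideal.inertiaDeg_eq_of_isMaximal p P, ← IsGalois.card_aut_eq_finrank (R ⧸ p) (S ⧸ P),
      ← h2, ← h3, h4, Subgroup.card_bot, one_mul]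
    rfl
  have h2 : (p.primesOver S).ncard * P.inertiaDeg R = Nat.card G := by
    rw [← h1, ← Algebra.IsInvariant.orbit_eq_primesOver R S G p P]
    simpa using Nat.card_congr (MulAction.orbitProdStabilizerEquivGroup G P)
  have h3 : P.ramificationIdx R = 1 := by
    have h4 := Ideal.ncard_primesOver_mul_ramificationIdxIn_mul_inertiaDegIn p S G
    rw [Ideal.ramificationIdxIn_eq_ramificationIdx p P G,
      Ideal.inertiaDegIn_eq_inertiaDeg p P G, ← h2] at h4
    have h5 : 0 < (p.primesOver S).ncard * P.inertiaDeg R := h2 ▸ Nat.card_pos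
    have h6 := Nat.pos_of_mul_pos_left h5
    rw [mul_left_comm] at h4
    exact Nat.eq_of_mul_eq_mul_right h5 (h4.trans (one_mul _).symm)
  rw [Ideal.ramificationIdx_def, ENat.toNat_eq_iff_eq_natCast, Nat.cast_one,
    Module.length_eq_one_iff, isSimpleModule_iff_isCoatom, ← Ideal.isMaximal_def,
    IsLocalRing.isMaximal_iff, ← Ideal.over_def P p] at h3
  let := Localization.AtPrime.algebraOfLiesOver p P
  rw [Algebra.isUnramifiedAt_iff_map_eq R p P]
  exact ⟨isSeparable_residueField_of_quotient p P, h3⟩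

end Inertia

/-! ### Tame rational functions -/

section Tame

open Polynomial

/-- A root `c` of a polynomial over `F` whose multiplicity is nonzero in `F` is separable over
`F`. -/
theorem isSeparable_of_rootMultiplicity_ne_zero {F E : Type*} [Field F] [Field E] [Algebra F E]
    (P : F[X]) (hP : P ≠ 0) (c : E) (hc : aeval c P = 0)
    (hm : (((P.map (algebraMap F E)).rootMultiplicity c : ℕ) : F) ≠ 0) : IsSeparable F c := by
  classical
  have hint : IsIntegral F c := isAlgebraic_iff_isIntegral.1 ⟨P, hP, hc⟩
  have hirr := minpoly.irreducible hint
  obtain ⟨p, hp⟩ := ExpChar.exists F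
  rcases hp with _ | hprime
  · exact hirr.separable
  have : Fact p.Prime := ⟨hprime⟩
  rcases separable_or p hirr with h | ⟨-, g, -, hg⟩
  · exact h
  exfalso
  apply hm
  have : ExpChar E p := expChar_of_injective_algebraMap (algebraMap F E).injective p
  obtain ⟨Q, hQ, hdvd⟩ : ∃ Q : F[X], P = minpoly F c ^ (multiplicity (minpoly F c) P) * Q ∧
      ¬ minpoly F c ∣ Q := by
    have hfin : FiniteMultiplicity (minpoly F c) P :=
      Polynomial.finiteMultiplicity_of_degree_pos_of_monic
        (minpoly.degree_pos hint) (minpoly.monic hint) hP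
    exact hfin.exists_eq_pow_mul_and_not_dvd
  have hinj := (algebraMap F E).injective
  have hQc : ¬ (Q.map (algebraMap F E)).IsRoot c := by
    rw [IsRoot, eval_map_algebraMap]
    exact fun h => hdvd (minpoly.dvd F c h)
  have hPm : P.map (algebraMap F E) ≠ 0 := (Polynomial.map_ne_zero_iff hinj).2 hP
  have h1 : (P.map (algebraMap F E)).rootMultiplicity c =
      multiplicity (minpoly F c) P *
        (p * (g.map (algebraMap F E)).rootMultiplicity (c ^ p)) := by
    conv_lhs => rw [hQ]
    rw [Polynomial.map_mul, Polynomial.map_pow, rootMultiplicity_mul,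
      rootMultiplicity_eq_zero hQc, add_zero, ← count_roots, roots_pow, Multiset.count_nsmul,
      count_roots, ← hg, map_expand, rootMultiplicity_expand]
    rw [← Polynomial.map_pow, ← Polynomial.map_mul, ← hQ]
    exact hPm
  rw [h1]
  push_cast
  rw [CharP.cast_eq_zero F p]
  ring

/-- The condition on a fraction `A / B` at a point `c` under which it is tamely ramified at `c`. -/
structure IsTamePair {κ : Type*} [Field κ] (A B : κ[X]) (c : κ) : Prop where
  notBoth : A.eval c ≠ 0 ∨ B.eval c ≠ 0
  ne_zero : ∀ b : κ, A - C b * B ≠ 0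
  mult : ∀ b : κ, (A - C b * B).IsRoot c → (((A - C b * B).rootMultiplicity c : ℕ) : κ) ≠ 0

lemma rootMultiplicity_zero_reflect {κ : Type*} [Field κ] {P : κ[X]} (hP : P ≠ 0) {d : ℕ}
    (hd : P.natDegree ≤ d) : (reflect d P).rootMultiplicity 0 = d - P.natDegree := by
  have h1 : reflect d P = P.reverse * X ^ (d - P.natDegree) := by
    have := reflect_mul P 1 (le_refl P.natDegree) (G := d - P.natDegree) (by simp)
    rw [mul_one, Nat.add_sub_cancel' hd, reflect_one] at this
    exact this
  have h2 : P.reverse ≠ 0 := by simpa using hP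
  have h3 : ¬ (P.reverse).IsRoot 0 := by
    rw [IsRoot, ← coeff_zero_eq_eval_zero, coeff_zero_reverse]
    simpa using hP
  rw [h1, rootMultiplicity_mul (mul_ne_zero h2 (pow_ne_zero _ X_ne_zero)),
    rootMultiplicity_eq_zero h3, zero_add]
  have := rootMultiplicity_X_sub_C_pow (0 : κ) (d - P.natDegree)
  rwa [C_0, sub_zero] at this

lemma eval_zero_reflect {κ : Type*} [Field κ] (P : κ[X]) (d : ℕ) :
    (reflect d P).eval 0 = P.coeff d := by
  rw [← coeff_zero_eq_eval_zero, coeff_reflect]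
  simp

variable {K : Type u} [Field K] {f : RatFunc K} {κ : Type u} [Field κ] [Algebra K κ]

lemma IsTame.mult (hf : IsTame f) [Algebra.IsAlgebraic K κ] {a b : κ} (hab : a ≠ 0 ∨ b ≠ 0) :
    let P := C a * f.num.map (algebraMap K κ) + C b * f.denom.map (algebraMap K κ)
    (∀ c, P.IsRoot c → ((P.rootMultiplicity c : ℕ) : κ) ≠ 0) ∧
    (P.natDegree < degree f → ((degree f - P.natDegree : ℕ) : κ) ≠ 0) := by
  intro P
  let i : κ →ₐ[K] AlgebraicClosure K := IsAlgClosed.lift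
  have hi : Function.Injective (i : κ →+* AlgebraicClosure K) := i.injective
  have hP : P.map (i : κ →+* AlgebraicClosure K) =
      C (i a) * f.num.map (algebraMap K (AlgebraicClosure K)) +
        C (i b) * f.denom.map (algebraMap K (AlgebraicClosure K)) := by
    simp only [P, Polynomial.map_add, Polynomial.map_mul, Polynomial.map_map, map_C]
    have : (i : κ →+* AlgebraicClosure K).comp (algebraMap K κ) =
      algebraMap K (AlgebraicClosure K) := i.comp_algebraMap
    rw [this]; rfl
  have hab' : i a ≠ 0 ∨ i b ≠ 0 := by simpa using hab
  obtain ⟨h1, h2⟩ := hf.2 (i a) (i b) hab'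
  simp only [← hP] at h1 h2
  have hcast : ∀ n : ℕ, (n : K) ≠ 0 → (n : κ) ≠ 0 := fun n hn h => hn (by
    apply (algebraMap K κ).injective
    rw [map_natCast, h, map_zero])
  refine ⟨fun c hc => hcast _ ?_, fun hd => hcast _ ?_⟩
  · rw [eq_rootMultiplicity_map hi c]
    exact h1 _ (hc.map)
  · rw [natDegree_map] at h2
    exact h2 hd

lemma natDegree_num_le_degree : f.num.natDegree ≤ degree f := le_max_left _ _
lemma natDegree_denom_le_degree : f.denom.natDegree ≤ degree f := le_max_right _ _

lemma IsTame.combination_ne_zero (hf : IsTame f) {a b : κ} (hab : a ≠ 0 ∨ b ≠ 0) :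
    C a * f.num.map (algebraMap K κ) + C b * f.denom.map (algebraMap K κ) ≠ 0 := by
  intro h
  have hcop : IsCoprime (f.num.map (algebraMap K κ)) (f.denom.map (algebraMap K κ)) :=
    (RatFunc.isCoprime_num_denom f).map (mapRingHom (algebraMap K κ))
  have hd : f.denom.map (algebraMap K κ) ≠ 0 :=
    (Polynomial.map_ne_zero_iff (algebraMap K κ).injective).2 (RatFunc.denom_ne_zero f)
  have hpos := hf.1
  by_cases ha : a = 0
  · rw [ha, C_0, zero_mul, zero_add] at h
    have hb : b ≠ 0 := by tauto
    exact (mul_ne_zero (C_ne_zero.2 hb) hd) h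
  by_cases hb : b = 0
  · rw [hb, C_0, zero_mul, add_zero] at h
    have hnum := (mul_eq_zero.1 h).resolve_left (C_ne_zero.2 ha)
    rw [hnum, isCoprime_zero_left] at hcop
    have h1 := natDegree_eq_zero_of_isUnit hcop
    rw [Polynomial.map_eq_zero] at hnum
    rw [natDegree_map] at h1
    unfold degree at hpos
    rw [h1, hnum] at hpos
    simp at hpos
  · have hdvd : f.denom.map (algebraMap K κ) ∣ f.num.map (algebraMap K κ) := by
      refine ⟨C (-b / a), ?_⟩
      have h2 : C a * f.num.map (algebraMap K κ) = - C b * f.denom.map (algebraMap K κ) := by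
        linear_combination h
      have h3 : C a * (f.num.map (algebraMap K κ)) =
          C a * (f.denom.map (algebraMap K κ) * C (-b / a)) := by
        rw [h2]
        have : (C (-b / a) : κ[X]) = C (-b) * C a⁻¹ := by rw [← C_mul, div_eq_mul_inv]
        rw [this, C_neg]
        have : (C a : κ[X]) * C a⁻¹ = 1 := by rw [← C_mul, mul_inv_cancel₀ ha, C_1]
        linear_combination (C b * f.denom.map (algebraMap K κ)) * this
      exact mul_left_cancel₀ (C_ne_zero.2 ha) h3
    have hdvd' : f.num.map (algebraMap K κ) ∣ f.denom.map (algebraMap K κ) := by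
      have : C b * f.denom.map (algebraMap K κ) = - C a * f.num.map (algebraMap K κ) := by
        linear_combination h
      have h2 : f.num.map (algebraMap K κ) ∣ C b * f.denom.map (algebraMap K κ) :=
        this ▸ Dvd.intro_left _ rfl
      exact (IsUnit.dvd_mul_left ((isUnit_C).2 (isUnit_iff_ne_zero.2 hb))).1 h2
    have hu := hcop.isUnit_of_dvd' hdvd dvd_rfl
    have hu' := hcop.isUnit_of_dvd' dvd_rfl hdvd'
    have h1 := natDegree_eq_zero_of_isUnit hu
    have h2 := natDegree_eq_zero_of_isUnit hu'
    rw [natDegree_map] at h1 h2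
    unfold degree at hpos
    rw [h1, h2] at hpos
    simp at hpos

variable (κ) in
lemma IsTame.isTamePair (hf : IsTame f) [Algebra.IsAlgebraic K κ] (c : κ) :
    IsTamePair (f.num.map (algebraMap K κ)) (f.denom.map (algebraMap K κ)) c := by
  have hcop : IsCoprime (f.num.map (algebraMap K κ)) (f.denom.map (algebraMap K κ)) :=
    (RatFunc.isCoprime_num_denom f).map (mapRingHom (algebraMap K κ))
  have hform : ∀ b : κ, f.num.map (algebraMap K κ) - C b * f.denom.map (algebraMap K κ) =
      C 1 * f.num.map (algebraMap K κ) + C (-b) * f.denom.map (algebraMap K κ) := by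
    intro b; rw [C_1, C_neg]; ring
  refine ⟨?_, fun b => ?_, fun b => ?_⟩
  · by_contra! h
    obtain ⟨u, v, huv⟩ := hcop
    have := congrArg (eval c) huv
    simp [h.1, h.2] at this
  · rw [hform]
    exact hf.combination_ne_zero (Or.inl one_ne_zero)
  · rw [hform]
    exact (hf.mult (Or.inl one_ne_zero)).1 c

variable (κ) in
lemma IsTame.isTamePair_swap (hf : IsTame f) [Algebra.IsAlgebraic K κ] (c : κ) :
    IsTamePair (f.denom.map (algebraMap K κ)) (f.num.map (algebraMap K κ)) c := by
  have hform : ∀ b : κ, f.denom.map (algebraMap K κ) - C b * f.num.map (algebraMap K κ) =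
      C (-b) * f.num.map (algebraMap K κ) + C 1 * f.denom.map (algebraMap K κ) := by
    intro b; rw [C_1, C_neg]; ring
  refine ⟨(hf.isTamePair κ c).notBoth.symm, fun b => ?_, fun b => ?_⟩
  · rw [hform]
    exact hf.combination_ne_zero (Or.inr one_ne_zero)
  · rw [hform]
    exact (hf.mult (Or.inr one_ne_zero)).1 c

lemma isTamePair_reflect {A B : κ[X]} {d : ℕ} (hA : A.natDegree ≤ d) (hB : B.natDegree ≤ d)
    (hd : max A.natDegree B.natDegree = d) (hpos : 0 < d) (h0 : ∀ b : κ, A - C b * B ≠ 0)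
    (hm : ∀ b : κ, (A - C b * B).natDegree < d →
      ((d - (A - C b * B).natDegree : ℕ) : κ) ≠ 0) :
    IsTamePair (reflect d A) (reflect d B) 0 := by
  have hform : ∀ b : κ, reflect d A - C b * reflect d B = reflect d (A - C b * B) := by
    intro b; rw [reflect_sub, reflect_C_mul]
  have hdeg : ∀ b : κ, (A - C b * B).natDegree ≤ d := fun b =>
    (natDegree_sub_le _ _).trans (max_le hA ((natDegree_C_mul_le _ _).trans hB))
  refine ⟨?_, fun b => ?_, fun b hb => ?_⟩
  · rw [eval_zero_reflect, eval_zero_reflect]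
    rcases le_total A.natDegree B.natDegree with h | h
    · right
      rw [max_eq_right h] at hd
      rw [← hd, coeff_natDegree, Ne, leadingCoeff_eq_zero]
      rintro rfl
      simp at hd; omega
    · left
      rw [max_eq_left h] at hd
      rw [← hd, coeff_natDegree, Ne, leadingCoeff_eq_zero]
      rintro rfl
      simp at hd; omega
  · rw [hform, Ne, reflect_eq_zero_iff]
    exact h0 b
  · rw [hform] at hb ⊢
    rw [rootMultiplicity_zero_reflect (h0 b) (hdeg b)]
    refine hm b (lt_of_le_of_ne (hdeg b) fun h => ?_)
    rw [IsRoot, eval_zero_reflect, ← h, coeff_natDegree, leadingCoeff_eq_zero] at hb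
    exact h0 b hb

variable (κ) in
lemma IsTame.isTamePair_reflect (hf : IsTame f) [Algebra.IsAlgebraic K κ] :
    IsTamePair (reflect (degree f) (f.num.map (algebraMap K κ)))
      (reflect (degree f) (f.denom.map (algebraMap K κ))) 0 := by
  have hform : ∀ b : κ, f.num.map (algebraMap K κ) - C b * f.denom.map (algebraMap K κ) =
      C 1 * f.num.map (algebraMap K κ) + C (-b) * f.denom.map (algebraMap K κ) := by
    intro b; rw [C_1, C_neg]; ring
  refine SelfSimilarIMG.isTamePair_reflect (by rw [natDegree_map]; exact natDegree_num_le_degree)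
    (by rw [natDegree_map]; exact natDegree_denom_le_degree) (by
      rw [natDegree_map, natDegree_map]; rfl) hf.1 (hf.isTamePair κ 0).ne_zero fun b => ?_
  rw [hform]
  exact (hf.mult (Or.inl one_ne_zero)).2

variable (κ) in
lemma IsTame.isTamePair_swap_reflect (hf : IsTame f) [Algebra.IsAlgebraic K κ] :
    IsTamePair (reflect (degree f) (f.denom.map (algebraMap K κ)))
      (reflect (degree f) (f.num.map (algebraMap K κ))) 0 := by
  have hform : ∀ b : κ, f.denom.map (algebraMap K κ) - C b * f.num.map (algebraMap K κ) =
      C (-b) * f.num.map (algebraMap K κ) + C 1 * f.denom.map (algebraMap K κ) := by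
    intro b; rw [C_1, C_neg]; ring
  refine SelfSimilarIMG.isTamePair_reflect (by
    rw [natDegree_map]; exact natDegree_denom_le_degree)
    (by rw [natDegree_map]; exact natDegree_num_le_degree) (by
      rw [natDegree_map, natDegree_map, max_comm]; rfl) hf.1 (hf.isTamePair_swap κ 0).ne_zero
      fun b => ?_
  rw [hform]
  exact (hf.mult (Or.inr one_ne_zero)).2

end Tame

section Tame

open Polynomial IsLocalRing

/-- The computation behind tame ramification: `xᵉ H / B` takes different values at `x` and at
`x (1 + ε)` if `H` and `B` do not vanish at the centre and `e` is a unit. -/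
lemma eq_zero_of_tame {O : Type*} [CommRing O] [IsDomain O] [IsLocalRing O] (H B : O[X])
    (β x ε : O) (e : ℕ) (hx : x ∈ maximalIdeal O) (hε : ε ∈ maximalIdeal O)
    (hH : IsUnit (H.eval β)) (hB : IsUnit (B.eval β)) (he : IsUnit (e : O))
    (h : H.eval β * B.eval (β + x * ε) = H.eval (β + x * ε) * B.eval β * (1 + ε) ^ e) :
    ε = 0 := by
  by_contra hne
  obtain ⟨r, hr⟩ := H.sub_dvd_eval_sub (β + x * ε) β
  obtain ⟨s, hs⟩ := B.sub_dvd_eval_sub (β + x * ε) β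
  obtain ⟨w, hw⟩ := Polynomial.powAddExpansion 1 ε e
  rw [add_sub_cancel_left, sub_eq_iff_eq_add] at hr hs
  rw [hr, hs, hw] at h
  simp only [one_pow, mul_one] at h
  have h2 : ε * (H.eval β * B.eval β * e) =
      ε * (x * (H.eval β * s - r * B.eval β * (1 + e * ε + w * ε ^ 2)) -
        ε * (H.eval β * B.eval β * w)) := by
    linear_combination -h
  have h3 := mul_left_cancel₀ hne h2
  have h4 : H.eval β * B.eval β * e ∈ maximalIdeal O := by
    rw [h3]
    exact sub_mem (Ideal.mul_mem_right _ _ hx) (Ideal.mul_mem_right _ _ hε)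
  exact (mem_maximalIdeal _).1 h4 ((hH.mul hB).mul he)

lemma eq_zero_of_simple_root {O : Type*} [CommRing O] [IsLocalRing O] (P : O[X])
    (β δ : O) (hδ : δ ∈ maximalIdeal O) (hP : P.eval β = 0) (hP' : P.eval (β + δ) = 0)
    (h : IsUnit (P.derivative.eval β)) : δ = 0 := by
  obtain ⟨w, hw⟩ := P.binomExpansion β δ
  rw [hP', hP] at hw
  have h2 : (P.derivative.eval β + w * δ) * δ = 0 := by linear_combination -hw
  have h3 : IsUnit (P.derivative.eval β + w * δ) := by
    by_contra h4
    have h5 : P.derivative.eval β + w * δ ∈ maximalIdeal O := (mem_maximalIdeal _).2 h4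
    have h6 := sub_mem h5 (Ideal.mul_mem_left _ w hδ)
    rw [add_sub_cancel_right] at h6
    exact (mem_maximalIdeal _).1 h6 h
  exact (h3.mul_right_eq_zero).1 h2

/-- A wild automorphism (one with `σ x / x ≡ 1` for all `x`) that fixes `α` fixes all solutions `β`
of `A(β) = α B(β)` that reduce to a rational point `c` at which `A / B` is tamely ramified. -/
theorem fixed_of_isTamePair {k E : Type*} [Field k] [Field E] [Algebra k E]
    (O : ValuationSubring E) [Algebra k O] [IsScalarTower k O E] (σ : E ≃ₐ[k] E)
    (hσ : ∀ x ≠ 0, σ x / x - 1 ∈ O.nonunits) {A B : k[X]} {c b : k} (hAB : IsTamePair A B c)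
    {α β : E} (hα : σ α = α) (hαb : α ≠ algebraMap k E b)
    (hb : α - algebraMap k E b ∈ O.nonunits) (hc : β - algebraMap k E c ∈ O.nonunits)
    (h : aeval β A = α * aeval β B) : σ β = β := by
  have hinj : Function.Injective (algebraMap O E) := Subtype.val_injective
  obtain ⟨hxO, hx⟩ := ValuationSubring.mem_nonunits_iff_exists_mem_maximalIdeal.1 hc
  obtain ⟨hbO, hb'⟩ := ValuationSubring.mem_nonunits_iff_exists_mem_maximalIdeal.1 hb
  set x : O := ⟨_, hxO⟩ with hxdef
  set a : O := ⟨_, hbO⟩ with hadef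
  set y : O := algebraMap k O c + x with hy
  have hyE : algebraMap O E y = β := by
    rw [hy, map_add, ← IsScalarTower.algebraMap_apply]
    change algebraMap k E c + (β - algebraMap k E c) = β
    ring
  have haE : algebraMap O E a = α - algebraMap k E b := rfl
  have ha0 : a ≠ 0 := fun h0 => sub_ne_zero.2 hαb (by rw [← haE, h0, map_zero])
  have hae : ∀ (Q : k[X]) (z : O), algebraMap O E (aeval z Q) = aeval (algebraMap O E z) Q :=
    fun Q z => (aeval_algebraMap_apply E z Q).symm
  have hP : aeval y (A - C b * B) = a * aeval y B := by
    apply hinj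
    rw [map_mul, hae, hae, hyE, haE, map_sub, map_mul, aeval_C, h]
    ring
  -- the residue map is the identity on constants
  have hconst : ∀ q : k, algebraMap k O q ∈ maximalIdeal O → q = 0 := by
    intro q hq
    by_contra hne
    exact (mem_maximalIdeal _).1 hq ((IsUnit.mk0 q hne).map (algebraMap k O))
  have hred : ∀ Q : k[X], aeval y Q - algebraMap k O (Q.eval c) ∈ maximalIdeal O := by
    intro Q
    obtain ⟨r, hr⟩ := (Q.map (algebraMap k O)).sub_dvd_eval_sub y (algebraMap k O c)
    rw [eval_map_algebraMap, eval_map_algebraMap, aeval_algebraMap_apply, coe_aeval_eq_eval] at hr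
    rw [hr, hy, add_sub_cancel_left]
    exact Ideal.mul_mem_right _ _ hx
  have hunit : ∀ Q : k[X], Q.eval c ≠ 0 → IsUnit (aeval y Q) := by
    intro Q hQ
    by_contra hn
    have h1 := sub_mem ((mem_maximalIdeal _).2 hn) (hred Q)
    rw [sub_sub_cancel] at h1
    exact hQ (hconst _ h1)
  have hroot : (A - C b * B).IsRoot c := by
    apply hconst
    have h1 := hred (A - C b * B)
    rw [hP] at h1
    have h2 := sub_mem (Ideal.mul_mem_right (aeval y B) _ hb') h1
    rwa [sub_sub_cancel] at h2
  have hBc : B.eval c ≠ 0 := by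
    intro h0
    have : A.eval c = 0 := by
      have := hroot
      simpa [IsRoot, h0] using this
    exact hAB.notBoth.elim (fun h => h this) fun h => h h0
  obtain ⟨H, hH, hndvd⟩ :=
    (A - C b * B).exists_eq_pow_rootMultiplicity_mul_and_not_dvd (hAB.ne_zero b) c
  set e := (A - C b * B).rootMultiplicity c with he
  have hHc : H.eval c ≠ 0 := fun h0 => hndvd (dvd_iff_isRoot.2 h0)
  have heunit : IsUnit (e : O) := by
    rw [← map_natCast (algebraMap k O)]
    exact (IsUnit.mk0 _ (hAB.mult b hroot)).map _
  have he0 : e ≠ 0 := by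
    intro h0
    exact hAB.mult b hroot (by rw [← he, h0, Nat.cast_zero])
  have hE : x ^ e * aeval y H = a * aeval y B := by
    rw [← hP]
    conv_rhs => rw [hH]
    rw [map_mul, map_pow, map_sub, aeval_X, aeval_C, hy, add_sub_cancel_left]
  have hx0 : x ≠ 0 := by
    intro h0
    rw [h0, zero_pow he0, zero_mul] at hE
    exact mul_ne_zero ha0 (hunit B hBc).ne_zero hE.symm
  have hxE0 : algebraMap O E x ≠ 0 := fun h0 => hx0 (hinj (h0.trans (map_zero _).symm))
  obtain ⟨hεO, hε⟩ := ValuationSubring.mem_nonunits_iff_exists_mem_maximalIdeal.1 (hσ _ hxE0)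
  set ε : O := ⟨_, hεO⟩ with hεdef
  have hσx : σ (algebraMap O E x) = algebraMap O E (x * (1 + ε)) := by
    rw [map_mul, map_add, map_one]
    change _ = algebraMap O E x * (1 + (σ (algebraMap O E x) / algebraMap O E x - 1))
    field_simp
    ring
  have hσβ : σ β = algebraMap O E (y + x * ε) := by
    rw [← hyE, hy, map_add, map_add, ← IsScalarTower.algebraMap_apply, AlgEquiv.commutes, hσx]
    simp only [map_add, map_mul, map_one, ← IsScalarTower.algebraMap_apply]
    ring
  have hE' : (x * (1 + ε)) ^ e * aeval (y + x * ε) H = a * aeval (y + x * ε) B := by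
    apply hinj
    have h1 := congrArg (fun z : O => σ (algebraMap O E z)) hE
    simp only [map_mul, map_pow] at h1
    rw [hae, hae, ← aeval_algHom_apply, ← aeval_algHom_apply, hyE, hσβ, hσx, haE, map_sub, hα,
      AlgEquiv.commutes] at h1
    rw [map_mul, map_mul, map_pow, hae, hae, haE]
    exact h1
  have hε0 : ε = 0 := by
    refine eq_zero_of_tame (H.map (algebraMap k O)) (B.map (algebraMap k O)) y x ε e hx hε
      ?_ ?_ heunit ?_
    · rw [eval_map_algebraMap]; exact hunit H hHc
    · rw [eval_map_algebraMap]; exact hunit B hBc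
    · simp only [eval_map_algebraMap]
      apply mul_left_cancel₀ (mul_ne_zero (pow_ne_zero e hx0) ha0)
      rw [mul_pow] at hE'
      linear_combination (a * aeval (y + x * ε) B) * hE - (a * aeval y B) * hE'
  rw [hσβ, hε0, mul_zero, add_zero, hyE]

end Tame

/-! ### Separability of fibres -/

section Tame

open Polynomial IsLocalRing

variable {K : Type u} [Field K]

/-- `A / B` is tamely ramified everywhere over the affine line, geometrically. -/
def IsTameFraction (A B : K[X]) : Prop :=
  ∀ (κ : Type u) [Field κ] [Algebra K κ] [Algebra.IsAlgebraic K κ] (c : κ),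
    IsTamePair (A.map (algebraMap K κ)) (B.map (algebraMap K κ)) c

lemma IsTame.isTameFraction {f : RatFunc K} (hf : IsTame f) : IsTameFraction f.num f.denom :=
  fun κ _ _ _ c => hf.isTamePair κ c

lemma IsTame.isTameFraction_swap {f : RatFunc K} (hf : IsTame f) :
    IsTameFraction f.denom f.num :=
  fun κ _ _ _ c => hf.isTamePair_swap κ c

variable {κ : Type u} [Field κ] [Algebra K κ]

lemma IsTameFraction.isSeparable_adjoin {A B : K[X]} (h : IsTameFraction A B) {b c : κ}
    (hb : _root_.IsIntegral K b) (hbc : aeval c A = b * aeval c B) :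
    _root_.IsIntegral K c ∧ IsSeparable K⟮b⟯ c := by
  have hFalg : Algebra.IsAlgebraic K K⟮b⟯ := isAlgebraic_adjoin_simple hb
  set F := K⟮b⟯
  let b' : F := AdjoinSimple.gen K b
  set P : F[X] := A.map (algebraMap K F) - C b' * B.map (algebraMap K F) with hPdef
  have hP0 : P ≠ 0 := (h F 0).ne_zero b'
  have hPc : aeval c P = 0 := by
    rw [hPdef, map_sub, map_mul, aeval_C, aeval_map_algebraMap, aeval_map_algebraMap, hbc]
    exact sub_self _
  have hcF : _root_.IsIntegral F c := isAlgebraic_iff_isIntegral.1 ⟨P, hP0, hPc⟩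
  have hcK : _root_.IsIntegral K c := isIntegral_trans (R := K) (A := F) c hcF
  refine ⟨hcK, ?_⟩
  let E : IntermediateField F κ := F⟮c⟯
  have hEF : Algebra.IsAlgebraic F E := isAlgebraic_adjoin_simple hcF
  have hEK : Algebra.IsAlgebraic K E := Algebra.IsAlgebraic.trans K F E
  let c' : E := AdjoinSimple.gen F c
  have hPE : P.map (algebraMap F E) =
      A.map (algebraMap K E) - C (algebraMap F E b') * B.map (algebraMap K E) := by
    rw [hPdef, Polynomial.map_sub, Polynomial.map_mul, map_C, Polynomial.map_map,
      Polynomial.map_map, ← IsScalarTower.algebraMap_eq]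
  have hPc' : aeval c' P = 0 := by
    apply (algebraMap E κ).injective
    rw [← aeval_algebraMap_apply, map_zero]
    exact hPc
  have hs : IsSeparable F c' := by
    refine isSeparable_of_rootMultiplicity_ne_zero P hP0 c' hPc' fun h0 => ?_
    have h1 := (h E c').mult (algebraMap F E b')
    rw [← hPE] at h1
    refine h1 ?_ ?_
    · rw [IsRoot, eval_map_algebraMap, hPc']
    · rw [← map_natCast (algebraMap F E), h0, map_zero]
  have := (isSeparable_map_iff E.val E.val.injective (x := c')).2 hs
  exact this

lemma isSeparable_of_mem_adjoin {b c : κ} (hb : IsSeparable K b) (hc : IsSeparable K⟮b⟯ c) :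
    IsSeparable K c := by
  have := (isSeparable_adjoin_simple_iff_isSeparable K κ).2 hb
  exact IsSeparable.of_algebra_isSeparable_of_isSeparable K hc

lemma IsTameFraction.isSeparable {A B : K[X]} (h : IsTameFraction A B) {b c : κ}
    (hb : IsSeparable K b) (hbc : aeval c A = b * aeval c B) : IsSeparable K c :=
  isSeparable_of_mem_adjoin hb (h.isSeparable_adjoin hb.isIntegral hbc).2

lemma derivation_aeval_of_algebraMap_eq_zero {F L M : Type*} [Field L] [Algebra K L] [Field F]
    [Algebra F L] [AddCommGroup M] [Module K M] [Module L M] [IsScalarTower K L M]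
    (D : Derivation K L M) (hD : ∀ a : F, D (algebraMap F L a) = 0) (c : L) (Q : F[X]) :
    D (aeval c Q) = aeval c (derivative Q) • D c := by
  induction Q using Polynomial.induction_on' with
  | add p q hp hq => simp only [map_add, hp, hq, add_smul]
  | monomial n a =>
    rw [aeval_monomial, D.leibniz, hD, smul_zero, add_zero, D.leibniz_pow, derivative_monomial,
      aeval_monomial, ← Nat.cast_smul_eq_nsmul L, smul_smul, smul_smul, map_mul, map_natCast,
      mul_assoc]

lemma derivation_eq_zero_of_mem_adjoin {L M : Type*} [Field L] [Algebra K L]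
    [AddCommGroup M] [Module K M] [Module L M] [IsScalarTower K L M]
    (D : Derivation K L M) {b : L} (hb : _root_.IsIntegral K b) (hD : D b = 0) {z : L}
    (hz : z ∈ K⟮b⟯) : D z = 0 := by
  have hz2 : z ∈ Algebra.adjoin K {b} := by
    rw [← adjoin_simple_toSubalgebra_of_isAlgebraic hb.isAlgebraic]
    exact hz
  exact Derivation.eqOn_adjoin (D1 := D) (D2 := 0) (s := {b}) (by
    intro x hx
    rw [Set.mem_singleton_iff.1 hx, hD]; rfl) hz2

lemma mem_adjoin_of_coe_mem_adjoin {κ : Type*} [Field κ] [Algebra K κ] {L : IntermediateField K κ}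
    (b z : L) (h : (z : κ) ∈ K⟮(b : κ)⟯) : z ∈ K⟮b⟯ := by
  have h1 : K⟮b⟯.map L.val = K⟮(b : κ)⟯ := by rw [adjoin_map, Set.image_singleton]; rfl
  rw [← h1] at h
  obtain ⟨w, hw, hwz⟩ := h
  exact (Subtype.ext hwz : w = z) ▸ hw

lemma isSeparable_of_kaehlerDifferential_eq_zero {κ : Type u} [Field κ] [Algebra K κ] {c : κ}
    (hc : _root_.IsIntegral K c)
    (h : KaehlerDifferential.D K K⟮c⟯ (AdjoinSimple.gen K c) = 0) : IsSeparable K c := by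
  have hfd : FiniteDimensional K K⟮c⟯ := adjoin.finiteDimensional hc
  have hsub : Subsingleton (Ω[K⟮c⟯⁄K]) := by
    rw [← Submodule.subsingleton_iff K⟮c⟯, ← subsingleton_iff_bot_eq_top,
      ← KaehlerDifferential.span_range_derivation, eq_comm, Submodule.span_eq_bot]
    rintro _ ⟨z, rfl⟩
    exact derivation_eq_zero_of_mem_adjoin _ (Algebra.IsIntegral.isIntegral _) h
      (mem_adjoin_of_coe_mem_adjoin _ z z.2)
  have hfu : Algebra.FormallyUnramified K K⟮c⟯ := ⟨hsub⟩
  have hsep := (Algebra.FormallyUnramified.iff_isSeparable K K⟮c⟯).1 hfu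
  exact (isSeparable_adjoin_simple_iff_isSeparable K κ).1 hsep

/-- If `b = f(c)` is inseparable over `K` then so is `c`, and `f` is unramified at `c`: otherwise
`db = f'(c) dc` would vanish although `K(c) / K(b)` is separable, and `dc` would vanish too. -/
theorem IsTameFraction.simple_root_of_not_isSeparable {A B : K[X]} (h : IsTameFraction A B)
    {b c : κ} (hb : _root_.IsIntegral K b) (hb' : ¬ IsSeparable K b)
    (hbc : aeval c A = b * aeval c B) :
    aeval c B ≠ 0 ∧ _root_.IsIntegral K c ∧ ¬ IsSeparable K c ∧
      aeval c (derivative A) - b * aeval c (derivative B) ≠ 0 := by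
  obtain ⟨hcK, hcsep⟩ := h.isSeparable_adjoin hb hbc
  set L : IntermediateField K κ := K⟮c⟯ with hL
  have hLalg : Algebra.IsAlgebraic K L := isAlgebraic_adjoin_simple hcK
  let c' : L := AdjoinSimple.gen K c
  have hae : ∀ Q : K[X], ((aeval c' Q : L) : κ) = aeval c Q := fun Q =>
    (aeval_algebraMap_apply κ c' Q).symm
  have hB0 : aeval c B ≠ 0 := by
    intro h0
    have hA0 : aeval c A = 0 := by rw [hbc, h0, mul_zero]
    have h1 := (h L c').notBoth
    rw [eval_map_algebraMap, eval_map_algebraMap] at h1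
    rcases h1 with h1 | h1
    · exact h1 (Subtype.ext ((hae A).trans hA0))
    · exact h1 (Subtype.ext ((hae B).trans h0))
  have hb_eq : b = aeval c A / aeval c B := by rw [hbc, mul_div_cancel_right₀ _ hB0]
  have hbL : b ∈ L := by
    rw [hb_eq, ← hae, ← hae]
    exact div_mem (SetLike.coe_mem _) (SetLike.coe_mem _)
  have hcns : ¬ IsSeparable K c := by
    intro hc
    apply hb'
    have : Algebra.IsSeparable K L := (isSeparable_adjoin_simple_iff_isSeparable K κ).2 hc
    exact (isSeparable_map_iff L.val L.val.injective (x := (⟨b, hbL⟩ : L))).2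
      (Algebra.IsSeparable.isSeparable K _)
  refine ⟨hB0, hcK, hcns, fun hder => hcns ?_⟩
  let b' : L := ⟨b, hbL⟩
  have hB' : aeval c' B ≠ 0 := fun h0 => hB0 (by rw [← hae, h0]; rfl)
  have hbc' : aeval c' A = b' * aeval c' B := Subtype.ext (by
    rw [hae, hbc, ← hae]; rfl)
  have hder' : aeval c' (derivative A) - b' * aeval c' (derivative B) = 0 := Subtype.ext (by
    rw [← hae, ← hae] at hder
    exact hder)
  let D := KaehlerDifferential.D K L
  have hDb : D b' = 0 := by
    have h1 := congrArg D hbc'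
    rw [D.leibniz, Derivation.map_aeval, Derivation.map_aeval, smul_smul] at h1
    have h2 : (aeval c' B) • D b' =
        (aeval c' (derivative A) - b' * aeval c' (derivative B)) • D c' := by
      rw [sub_smul, h1, add_sub_cancel_left]
    rw [hder', zero_smul] at h2
    exact (smul_eq_zero.1 h2).resolve_left hB'
  refine isSeparable_of_kaehlerDifferential_eq_zero hcK ?_
  have hKL : K⟮b⟯ ≤ L := adjoin_simple_le_iff.2 hbL
  let _ : Algebra K⟮b⟯ L := (inclusion hKL).toAlgebra
  have hDF : ∀ a : K⟮b⟯, D (algebraMap K⟮b⟯ L a) = 0 := fun a =>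
    derivation_eq_zero_of_mem_adjoin D (Algebra.IsIntegral.isIntegral b') hDb
      (mem_adjoin_of_coe_mem_adjoin b' _ a.2)
  have : IsScalarTower K⟮b⟯ L κ := IsScalarTower.of_algebraMap_eq fun _ => rfl
  have haem : ∀ Q : (K⟮b⟯)[X], ((aeval c' Q : L) : κ) = aeval c Q :=
    fun Q => (aeval_algebraMap_apply κ c' Q).symm
  have h1 : aeval c' (minpoly K⟮b⟯ c) = 0 :=
    Subtype.ext ((haem _).trans (minpoly.aeval _ _))
  have h2 : aeval c' (derivative (minpoly K⟮b⟯ c)) ≠ 0 := by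
    intro h0
    have h4 : aeval c (minpoly K⟮b⟯ c) = 0 := minpoly.aeval _ _
    refine Separable.aeval_derivative_ne_zero hcsep h4 ?_
    rw [← haem, h0]; rfl
  have h3 := derivation_aeval_of_algebraMap_eq_zero D hDF c' (minpoly K⟮b⟯ c)
  rw [h1, map_zero] at h3
  exact (smul_eq_zero.1 h3.symm).resolve_left h2

end Tame

/-! ### Reduction of preimages in valuation rings -/

section Reduction

open Polynomial IsLocalRing

variable {K : Type u} [Field K]

lemma mem_nonunits_iff_residue {E : Type u} [Field E] {O : ValuationSubring E} (x : O) :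
    (x : E) ∈ O.nonunits ↔ residue O x = 0 := by
  rw [residue_eq_zero_iff, ValuationSubring.mem_nonunits_iff_exists_mem_maximalIdeal]
  exact ⟨fun ⟨_, h⟩ => h, fun h => ⟨x.2, h⟩⟩

lemma mem_or_inv_mem_nonunits {E : Type u} [Field E] (O : ValuationSubring E) (x : E) :
    x ∈ O ∨ x⁻¹ ∈ O.nonunits := by
  by_cases h : x ∈ O
  · exact Or.inl h
  · right
    rw [ValuationSubring.inv_mem_nonunits_iff]
    exact Or.inr h

section

variable {E : Type u} [Field E] [Algebra K E] (O : ValuationSubring E) [Algebra K O]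
  [IsScalarTower K O E]

lemma residue_aeval (x : O) (Q : K[X]) : residue O (aeval x Q) = aeval (residue O x) Q :=
  (aeval_algebraMap_apply (ResidueField O) x Q).symm

lemma coe_aeval_valuationSubring (x : O) (Q : K[X]) :
    ((aeval x Q : O) : E) = aeval (x : E) Q :=
  (aeval_algebraMap_apply E x Q).symm

lemma mem_valuationSubring_of_isIntegral {x : E} (hx : _root_.IsIntegral K x) : x ∈ O := by
  have h1 : _root_.IsIntegral O x := hx.tower_top
  obtain ⟨y, hy⟩ := IsIntegrallyClosed.isIntegral_iff.1 h1
  rw [← hy]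
  exact y.2

lemma exists_isSeparable_sub_mem_nonunits_of_aeval [IsSepClosed E] {x : E} {μ : K[X]}
    (hmon : μ.Monic) (h : μ.Separable) (h1 : aeval x μ ∈ O.nonunits) :
    ∃ c : E, IsSeparable K c ∧ x - c ∈ O.nonunits := by
  have hsplit : (μ.map (algebraMap K E)).Splits := IsSepClosed.splits_codomain _ h
  rw [hsplit.aeval_eq_prod_aroots_of_monic hmon, ValuationSubring.mem_nonunits_iff,
    map_multiset_prod, Multiset.map_map] at h1
  obtain ⟨c, hc, hcx⟩ : ∃ c ∈ μ.aroots E, O.valuation (x - c) < 1 := by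
    by_contra! hcon
    refine not_le.2 h1 (Multiset.one_le_prod fun y hy => ?_)
    obtain ⟨c, hc, rfl⟩ := Multiset.mem_map.1 hy
    exact hcon c hc
  refine ⟨c, ?_, (ValuationSubring.mem_nonunits_iff O).2 hcx⟩
  rw [mem_aroots] at hc
  exact Separable.of_dvd h (minpoly.dvd K c hc.2)

/-- An element whose reduction is separable over `K` is congruent to a constant. -/
lemma exists_isSeparable_sub_mem_nonunits [IsSepClosed E] {x : E} (hx : x ∈ O)
    (h : IsSeparable K (residue O ⟨x, hx⟩)) :
    ∃ c : E, IsSeparable K c ∧ x - c ∈ O.nonunits := by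
  refine exists_isSeparable_sub_mem_nonunits_of_aeval O (minpoly.monic h.isIntegral) h ?_
  have h2 := coe_aeval_valuationSubring O ⟨x, hx⟩ (minpoly K (residue O ⟨x, hx⟩))
  change _ = aeval x _ at h2
  rw [← h2, mem_nonunits_iff_residue, residue_aeval]
  exact minpoly.aeval _ _

/-- The reduction of `y` is a point of the projective line that is separable over `K`. -/
def HasSeparableReduction (K : Type u) [Field K] {E : Type u} [Field E] [Algebra K E]
    (O : ValuationSubring E) (y : E) : Prop :=
  (∃ b : E, IsSeparable K b ∧ y - b ∈ O.nonunits) ∨ y⁻¹ ∈ O.nonunits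

lemma residue_relation {A B : K[X]} {x y : E} (hx : x ∈ O) (hy : y ∈ O)
    (h : aeval x A = y * aeval x B) :
    aeval (residue O ⟨x, hx⟩) A = residue O ⟨y, hy⟩ * aeval (residue O ⟨x, hx⟩) B := by
  rw [← residue_aeval, ← residue_aeval, ← map_mul]
  congr 1
  apply Subtype.ext
  refine (coe_aeval_valuationSubring O _ A).trans (h.trans ?_)
  exact congrArg (y * ·) (coe_aeval_valuationSubring O ⟨x, hx⟩ B).symm

lemma IsTameFraction.exists_isSeparable_sub_mem_nonunits [IsSepClosed E] {A B : K[X]}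
    (hAB : IsTameFraction A B) {x y b : E} (hx : x ∈ O) (hb : IsSeparable K b)
    (hy : y - b ∈ O.nonunits) (h : aeval x A = y * aeval x B) :
    ∃ c : E, IsSeparable K c ∧ x - c ∈ O.nonunits := by
  refine SelfSimilarIMG.exists_isSeparable_sub_mem_nonunits O hx ?_
  have hbO : b ∈ O := mem_valuationSubring_of_isIntegral O hb.isIntegral
  have hyO : y ∈ O := by
    have := O.add_mem _ _ (ValuationSubring.nonunits_le hy) hbO
    rwa [sub_add_cancel] at this
  refine hAB.isSeparable ?_ (residue_relation O hx hyO h)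
  have h1 : residue O ⟨y, hyO⟩ = residue O ⟨b, hbO⟩ := by
    rw [← sub_eq_zero, ← map_sub]
    exact (mem_nonunits_iff_residue _).1 hy
  rw [h1]
  have h2 : IsSeparable K (⟨b, hbO⟩ : O) :=
    (isSeparable_map_iff (IsScalarTower.toAlgHom K O E) Subtype.val_injective).1 hb
  exact Separable.of_dvd h2 (minpoly.dvd K _ (by
    rw [← residue_aeval, minpoly.aeval, map_zero]))

lemma IsTame.hasSeparableReduction [IsSepClosed E] {f : RatFunc K} (hf : IsTame f) {x y : E}
    (hy0 : y ≠ 0) (h : aeval x f.num = y * aeval x f.denom) (hy : HasSeparableReduction K O y) :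
    HasSeparableReduction K O x := by
  rcases mem_or_inv_mem_nonunits O x with hx | hx
  · left
    rcases hy with ⟨b, hb, hyb⟩ | hy
    · exact hf.isTameFraction.exists_isSeparable_sub_mem_nonunits O hx hb hyb h
    · refine hf.isTameFraction_swap.exists_isSeparable_sub_mem_nonunits O (y := y⁻¹) (b := 0) hx
        ?_ (by rwa [sub_zero]) ?_
      · rw [← map_zero (algebraMap K E)]
        exact isSeparable_algebraMap 0
      · rw [h, inv_mul_cancel_left₀ hy0]
  · exact Or.inr hx

lemma aeval_inv_reflect {x : E} (hx : x ≠ 0) {d : ℕ} {Q : K[X]} (hQ : Q.natDegree ≤ d) :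
    aeval x⁻¹ (reflect d Q) * x ^ d = aeval x Q := by
  have := invertibleOfNonzero hx
  have h := eval₂_reflect_mul_pow (algebraMap K E) x d Q hQ
  rwa [invOf_eq_inv] at h

lemma aeval_inv_reflect_relation {x y : E} (hx : x ≠ 0) {d : ℕ} {A B : K[X]}
    (hA : A.natDegree ≤ d) (hB : B.natDegree ≤ d) (h : aeval x A = y * aeval x B) :
    aeval x⁻¹ (reflect d A) = y * aeval x⁻¹ (reflect d B) := by
  rw [← aeval_inv_reflect hx hA, ← aeval_inv_reflect hx hB, ← mul_assoc] at h
  exact mul_right_cancel₀ (pow_ne_zero d hx) h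

lemma IsTame.mem_of_not_isSeparable {f : RatFunc K} (hf : IsTame f) {x y : E} (hy : y ∈ O)
    (hys : ¬ IsSeparable K (residue O ⟨y, hy⟩)) (h : aeval x f.num = y * aeval x f.denom) :
    x ∈ O := by
  by_contra hx
  have hx0 : x ≠ 0 := fun h0 => hx (h0 ▸ O.zero_mem)
  have hxn : x⁻¹ ∈ O.nonunits := (mem_or_inv_mem_nonunits O x).resolve_left hx
  have hxO : x⁻¹ ∈ O := ValuationSubring.nonunits_le hxn
  have h1 := residue_relation O hxO hy (aeval_inv_reflect_relation hx0 natDegree_num_le_degree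
    natDegree_denom_le_degree h)
  have h2 : residue O ⟨x⁻¹, hxO⟩ = 0 := (mem_nonunits_iff_residue _).1 hxn
  rw [h2, ← map_zero (algebraMap K (ResidueField O)), aeval_algebraMap_apply,
    aeval_algebraMap_apply, coe_aeval_eq_eval] at h1
  have h3 := (hf.isTamePair_reflect K).notBoth
  simp only [Algebra.algebraMap_self, Polynomial.map_id] at h3
  set a := (reflect (degree f) f.num).eval 0
  set b := (reflect (degree f) f.denom).eval 0
  by_cases hb : b = 0
  · rw [hb, map_zero, mul_zero, map_eq_zero] at h1
    exact h3.elim (fun h => h h1) fun h => h hb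
  · apply hys
    have : residue O ⟨y, hy⟩ = algebraMap K _ (a / b) := by
      rw [map_div₀, h1, mul_div_cancel_right₀]
      simpa using hb
    rw [this]
    exact isSeparable_algebraMap _

/-- Above a point that is inseparable over `K` the covering `f` is unramified, and the preimages
are inseparable again. -/
lemma IsTame.isUnit_derivative {f : RatFunc K} (hf : IsTame f) {x y : E} (hy : y ∈ O)
    (hyi : _root_.IsIntegral K (residue O ⟨y, hy⟩))
    (hys : ¬ IsSeparable K (residue O ⟨y, hy⟩)) (h : aeval x f.num = y * aeval x f.denom) :
    ∃ hx : x ∈ O, _root_.IsIntegral K (residue O ⟨x, hx⟩) ∧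
      ¬ IsSeparable K (residue O ⟨x, hx⟩) ∧
      IsUnit (aeval (⟨x, hx⟩ : O) (derivative f.num) -
        ⟨y, hy⟩ * aeval (⟨x, hx⟩ : O) (derivative f.denom)) := by
  have hx := hf.mem_of_not_isSeparable O hy hys h
  obtain ⟨-, h1, h2, h3⟩ := hf.isTameFraction.simple_root_of_not_isSeparable hyi hys
    (residue_relation O hx hy h)
  refine ⟨hx, h1, h2, ?_⟩
  rw [← residue_aeval, ← residue_aeval, ← map_mul, ← map_sub, Ne, residue_eq_zero_iff,
    mem_maximalIdeal, mem_nonunits_iff, not_not] at h3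
  exact h3

end

end Reduction

/-! ### Wild inertia acts trivially on the tree -/

section Reduction

open Polynomial IsLocalRing

section Wild

variable {F E : Type*} [Field F] [Field E] [Algebra F E] (O : ValuationSubring E)

lemma sub_iterate_mem_nonunits {σ : E ≃ₐ[F] E} (hσ : ∀ x ∈ O, σ x - x ∈ O.nonunits) {x : E}
    (hx : x ∈ O) (i : ℕ) : (σ ^ i) x ∈ O ∧ (σ ^ i) x - x ∈ O.nonunits := by
  induction i with
  | zero =>
    refine ⟨hx, ?_⟩
    have : (σ ^ 0) x - x = 0 := sub_self _
    rw [this]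
    exact (ValuationSubring.mem_nonunits_iff_exists_mem_maximalIdeal).2 ⟨O.zero_mem, zero_mem _⟩
  | succ i ih =>
    have h1 : (σ ^ (i + 1)) x = σ ((σ ^ i) x) := by rw [pow_succ']; rfl
    have h2 := hσ _ ih.1
    obtain ⟨h3, h4⟩ := ValuationSubring.mem_nonunits_iff_exists_mem_maximalIdeal.1 h2
    obtain ⟨h5, h6⟩ := ValuationSubring.mem_nonunits_iff_exists_mem_maximalIdeal.1 ih.2
    rw [h1]
    constructor
    · have := O.add_mem _ _ h3 ih.1
      rwa [sub_add_cancel] at this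
    · refine ValuationSubring.mem_nonunits_iff_exists_mem_maximalIdeal.2 ?_
      have h7 : σ ((σ ^ i) x) - x = (σ ((σ ^ i) x) - (σ ^ i) x) + ((σ ^ i) x - x) := by ring
      rw [h7]
      exact ⟨O.add_mem _ _ h3 h5, add_mem h4 h6⟩

lemma prod_range_pow_div {σ : E ≃ₐ[F] E} {p : ℕ} (hp : σ ^ p = 1) {x : E} (hx : x ≠ 0) :
    ∏ i ∈ Finset.range p, (σ ^ i) (σ x / x) = 1 := by
  have h0 : ∀ i, (σ ^ i) x ≠ 0 := fun i => (map_ne_zero (σ ^ i)).2 hx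
  have h1 : ∀ i, (σ ^ i) (σ x / x) = (σ ^ (i + 1)) x / (σ ^ i) x := by
    intro i
    rw [map_div₀, pow_succ]
    rfl
  simp only [h1]
  have h2 : ∀ n, ∏ i ∈ Finset.range n, (σ ^ (i + 1)) x / (σ ^ i) x = (σ ^ n) x / x := by
    intro n
    induction n with
    | zero => simp [div_self hx]
    | succ n ih =>
      rw [Finset.prod_range_succ, ih]
      have := h0 n
      field_simp
  rw [h2, hp]
  exact div_self hx

lemma residue_pow_eq_one {σ : E ≃ₐ[F] E} (hσ : ∀ x ∈ O, σ x - x ∈ O.nonunits) {p : ℕ} {y : E}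
    (hy : y ∈ O) (h : ∏ i ∈ Finset.range p, (σ ^ i) y = 1) : (residue O ⟨y, hy⟩) ^ p = 1 := by
  have h2 : ∀ i, residue O ⟨(σ ^ i) y, (sub_iterate_mem_nonunits O hσ hy i).1⟩ =
      residue O ⟨y, hy⟩ := by
    intro i
    rw [← sub_eq_zero, ← map_sub]
    exact (mem_nonunits_iff_residue _).1 (sub_iterate_mem_nonunits O hσ hy i).2
  have h3 : ∏ i ∈ Finset.range p,
      (⟨(σ ^ i) y, (sub_iterate_mem_nonunits O hσ hy i).1⟩ : O) = 1 := by
    apply Subtype.ext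
    refine Eq.trans ?_ h
    exact map_prod O.subtype _ _
  have h4 := congrArg (residue O) h3
  rwa [map_prod, map_one, Finset.prod_congr rfl fun i _ => h2 i, Finset.prod_const,
    Finset.card_range] at h4

/-- An inertia element of order `p`, the residue characteristic, is wild: `x ↦ σ x / x` induces a
homomorphism from the inertia group to the units of the residue field, which have no `p`-torsion. -/
theorem div_sub_one_mem_nonunits_of_pow_eq_one {σ : E ≃ₐ[F] E}
    (hσ : ∀ x ∈ O, σ x - x ∈ O.nonunits) {p : ℕ} [Fact p.Prime] [CharP (ResidueField O) p]
    (hp : σ ^ p = 1) {x : E} (hx : x ≠ 0) : σ x / x - 1 ∈ O.nonunits := by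
  have hprod := prod_range_pow_div hp hx
  have hpp : p.Prime := Fact.out
  have hu : σ x / x ∈ O := by
    by_contra hn
    have h1 := (mem_or_inv_mem_nonunits O (σ x / x)).resolve_left hn
    have h2 := residue_pow_eq_one O hσ (p := p) (ValuationSubring.nonunits_le h1) (by
      simp only [map_inv₀ (σ ^ _), Finset.prod_inv_distrib, hprod, inv_one])
    rw [(mem_nonunits_iff_residue ⟨_, ValuationSubring.nonunits_le h1⟩).1 h1,
      zero_pow hpp.ne_zero] at h2
    exact zero_ne_one h2
  have h1 := residue_pow_eq_one O hσ hu hprod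
  have h2 : residue O ⟨σ x / x, hu⟩ - 1 = 0 := by
    have : (residue O ⟨σ x / x, hu⟩ - 1) ^ p = 0 := by
      rw [sub_pow_char, h1, one_pow, sub_self]
    exact pow_eq_zero_iff hpp.ne_zero |>.1 this
  rw [← map_one (residue O), ← map_sub] at h2
  exact (mem_nonunits_iff_residue _).2 h2

end Wild

variable {K : Type u} [Field K] {f : RatFunc K}
variable {E : Type u} [Field E] [Algebra K E] [Algebra (RatFunc K) E]
  [IsScalarTower K (RatFunc K) E]

lemma transcendental_tElt : Transcendental K (tElt K E) := by
  have h1 : Transcendental K (RatFunc.X : RatFunc K) := RatFunc.transcendental_X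
  exact (transcendental_algebraMap_iff (algebraMap (RatFunc K) E).injective).2 h1

lemma transcendental_of_transcendental_iterate {M : Type u} [Field M] [Algebra K M] {x : M} {m : ℕ}
    (h : Transcendental K ((evalMap f M)^[m] x)) : Transcendental K x := by
  intro hx
  have h1 : ∀ z ∈ algebraicClosure K M, evalMap f M z ∈ algebraicClosure K M := by
    intro z hz
    have := evalMap_hom f (algebraicClosure K M).val ⟨z, hz⟩
    rw [show evalMap f M z = _ from this.symm]
    exact (evalMap f (algebraicClosure K M) ⟨z, hz⟩).2
  have h2 : (evalMap f M)^[m] x ∈ algebraicClosure K M := by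
    clear h
    induction m with
    | zero => exact mem_algebraicClosure_iff.2 hx
    | succ m ih => rw [Function.iterate_succ_apply']; exact h1 _ ih
  exact h (mem_algebraicClosure_iff.1 h2)

lemma transcendental_of_iterate {x : E} {m : ℕ} (h : (evalMap f E)^[m] x = tElt K E) :
    Transcendental K x :=
  transcendental_of_transcendental_iterate (m := m) (h.symm ▸ transcendental_tElt)

lemma aeval_num_of_transcendental {x : E} (h : Transcendental K x) :
    aeval x f.num = evalMap f E x * aeval x f.denom := by
  have h0 : aeval x f.denom ≠ 0 := fun h0 =>
    h ⟨f.denom, RatFunc.denom_ne_zero f, h0⟩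
  rw [evalMap, RatFunc.eval]
  exact (div_mul_cancel₀ _ h0).symm

end Reduction

section Reduction

open Polynomial IsLocalRing

variable {K : Type u} [Field K] {f : RatFunc K}
variable {E : Type u} [Field E] [Algebra K E] [Algebra (RatFunc K) E]
  [IsScalarTower K (RatFunc K) E] (O : ValuationSubring E) [Algebra K O] [IsScalarTower K O E]

/-- Inertia elements fix the constants. -/
lemma apply_eq_of_isIntegral {σ : E ≃ₐ[RatFunc K] E} (hσ : ∀ x ∈ O, σ x - x ∈ O.nonunits)
    {a : E} (ha : _root_.IsIntegral K a) : σ a = a := by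
  by_contra hne
  have h1 := hσ a (mem_valuationSubring_of_isIntegral O ha)
  have h2 : _root_.IsIntegral K (σ a - a) :=
    (ha.map (σ.toAlgHom.restrictScalars K)).sub ha
  have h3 := mem_valuationSubring_of_isIntegral O h2.inv
  rw [← inv_inv (σ a - a), ValuationSubring.inv_mem_nonunits_iff] at h1
  rcases h1 with h1 | h1
  · exact sub_ne_zero.2 hne (inv_eq_zero.1 h1)
  · exact h1 h3

/-- Wild inertia acts trivially on the tree. -/
theorem IsTame.fixed_of_wild (hf : IsTame f) {σ : E ≃ₐ[RatFunc K] E}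
    (hσ : ∀ x ∈ O, σ x - x ∈ O.nonunits) (hw : ∀ x ≠ 0, σ x / x - 1 ∈ O.nonunits) {n : ℕ}
    (hred : ∀ m ≤ n, ∀ x : E, (evalMap f E)^[m] x = tElt K E → HasSeparableReduction K O x) :
    ∀ m ≤ n, ∀ x : E, (evalMap f E)^[m] x = tElt K E → σ x = x := by
  let k := separableClosure K E
  have hkint : ∀ a : k, _root_.IsIntegral K (a : E) := fun a =>
    (mem_separableClosure_iff.1 a.2).isIntegral
  let τ : E ≃ₐ[k] E := AlgEquiv.ofRingEquiv (f := (σ : E ≃+* E)) fun a =>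
    apply_eq_of_isIntegral O hσ (hkint a)
  let _ : Algebra k O := ((algebraMap k E).codRestrict O.toSubring fun a =>
    mem_valuationSubring_of_isIntegral O (hkint a)).toAlgebra
  have : IsScalarTower k O E := IsScalarTower.of_algebraMap_eq fun _ => rfl
  have hkalg : Algebra.IsAlgebraic K k := inferInstance
  have hae : ∀ (Q : K[X]) (x : E), aeval x (Q.map (algebraMap K k)) = aeval x Q := fun Q x =>
    aeval_map_algebraMap k x Q
  have hrefl : ∀ Q : K[X], reflect (degree f) (Q.map (algebraMap K k)) =
      (reflect (degree f) Q).map (algebraMap K k) := fun Q => reflect_map _ _ _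
  intro m
  induction m with
  | zero =>
    rintro - x rfl
    exact σ.commutes _
  | succ m ih =>
    intro hm x hx
    have hxt := transcendental_of_iterate hx
    have hfx : (evalMap f E)^[m] (evalMap f E x) = tElt K E := hx
    have hyt := transcendental_of_iterate hfx
    have hrel := aeval_num_of_transcendental (f := f) hxt
    have hσy := ih (Nat.le_of_succ_le hm) _ hfx
    set y := evalMap f E x
    have hx0 : x ≠ 0 := fun h => hxt (h ▸ isAlgebraic_zero)
    have hy0 : y ≠ 0 := fun h => hyt (h ▸ isAlgebraic_zero)
    have hrel' : aeval x f.denom = y⁻¹ * aeval x f.num := by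
      rw [hrel, inv_mul_cancel_left₀ hy0]
    have hσy' : σ y⁻¹ = y⁻¹ := by rw [map_inv₀, hσy]
    have hy0' : y⁻¹ ≠ algebraMap k E 0 := by rw [map_zero]; exact inv_ne_zero hy0
    rcases hred (m + 1) hm x hx with ⟨c, hc, hxc⟩ | hx'
    · let c' : k := ⟨c, mem_separableClosure_iff.2 hc⟩
      rcases hred m (Nat.le_of_succ_le hm) y hfx with ⟨b, hb, hyb⟩ | hy'
      · let b' : k := ⟨b, mem_separableClosure_iff.2 hb⟩
        refine fixed_of_isTamePair O τ hw (hf.isTamePair k c') (b := b') hσy ?_ hyb hxc ?_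
        · intro h
          exact hyt (h ▸ (hkint b').isAlgebraic)
        · rw [hae, hae, hrel]
      · refine fixed_of_isTamePair O τ hw (hf.isTamePair_swap k c') (b := 0) hσy' hy0' ?_ hxc ?_
        · rwa [map_zero, sub_zero]
        · rw [hae, hae, hrel']
    · have hx'' : x⁻¹ - algebraMap k E 0 ∈ O.nonunits := by rwa [map_zero, sub_zero]
      suffices h : σ x⁻¹ = x⁻¹ by rwa [map_inv₀, inv_inj] at h
      rcases hred m (Nat.le_of_succ_le hm) y hfx with ⟨b, hb, hyb⟩ | hy'
      · let b' : k := ⟨b, mem_separableClosure_iff.2 hb⟩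
        refine fixed_of_isTamePair O τ hw (hf.isTamePair_reflect k) (b := b') hσy ?_ hyb hx'' ?_
        · intro h
          exact hyt (h ▸ (hkint b').isAlgebraic)
        · rw [hrefl, hrefl, hae, hae]
          exact aeval_inv_reflect_relation hx0 natDegree_num_le_degree
            natDegree_denom_le_degree hrel
      · refine fixed_of_isTamePair O τ hw (hf.isTamePair_swap_reflect k) (b := 0) hσy' hy0'
          ?_ hx'' ?_
        · rwa [map_zero, sub_zero]
        · rw [hrefl, hrefl, hae, hae]
          exact aeval_inv_reflect_relation hx0 natDegree_denom_le_degree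
            natDegree_num_le_degree hrel'

/-- Inertia acts trivially on the tree above a point that is inseparable over `K`. -/
theorem IsTame.fixed_of_not_isSeparable (hf : IsTame f) {σ : E ≃ₐ[RatFunc K] E}
    (hσ : ∀ x ∈ O, σ x - x ∈ O.nonunits) (ht : tElt K E ∈ O)
    (hti : _root_.IsIntegral K (residue O ⟨_, ht⟩)) (hts : ¬ IsSeparable K (residue O ⟨_, ht⟩))
    (m : ℕ) (x : E) (hx : (evalMap f E)^[m] x = tElt K E) :
    σ x = x ∧ ∃ hxO : x ∈ O, _root_.IsIntegral K (residue O ⟨x, hxO⟩) ∧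
      ¬ IsSeparable K (residue O ⟨x, hxO⟩) := by
  induction m generalizing x with
  | zero =>
    obtain rfl : x = tElt K E := hx
    exact ⟨σ.commutes _, ht, hti, hts⟩
  | succ m ih =>
    have hrel := aeval_num_of_transcendental (f := f) (transcendental_of_iterate hx)
    obtain ⟨hσy, hyO, hyi, hys⟩ := ih (evalMap f E x) hx
    set y := evalMap f E x
    obtain ⟨hxO, hxi, hxs, hu⟩ := hf.isUnit_derivative O hyO hyi hys hrel
    refine ⟨?_, hxO, hxi, hxs⟩
    obtain ⟨hδO, hδ⟩ := ValuationSubring.mem_nonunits_iff_exists_mem_maximalIdeal.1 (hσ x hxO)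
    set P : O[X] := f.num.map (algebraMap K O) - C ⟨y, hyO⟩ * f.denom.map (algebraMap K O)
    have hP : ∀ z : O, ((P.eval z : O) : E) = aeval (z : E) f.num - y * aeval (z : E) f.denom := by
      intro z
      simp only [P, eval_sub, eval_mul, eval_C, eval_map_algebraMap]
      rw [← coe_aeval_valuationSubring, ← coe_aeval_valuationSubring]
      rfl
    have h0 := eq_zero_of_simple_root P ⟨x, hxO⟩ ⟨_, hδO⟩ hδ ?_ ?_ ?_
    · exact sub_eq_zero.1 (congrArg Subtype.val h0)
    · apply Subtype.ext
      rw [hP]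
      exact sub_eq_zero.2 hrel
    · apply Subtype.ext
      rw [hP]
      have h1 : (((⟨x, hxO⟩ + ⟨σ x - x, hδO⟩ : O)) : E) = σ x := add_sub_cancel _ _
      rw [h1]
      have h2 := congrArg (σ.toAlgHom.restrictScalars K) hrel
      rw [map_mul, ← aeval_algHom_apply, ← aeval_algHom_apply] at h2
      refine sub_eq_zero.2 (h2.trans ?_)
      exact congrArg (· * _) hσy
    · simpa [P, eval_map_algebraMap, derivative_map] using hu

end Reduction

/-! ### Centres of valuations on integral closures -/

section Centre

open Polynomial IsLocalRing

open scoped Pointwise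

variable {E : Type u} [Field E] (R : Type u) [CommRing R] [Algebra R E]
  (O : ValuationSubring E) (hRO : ∀ r : R, algebraMap R E r ∈ O)

include hRO in
lemma coe_mem_of_mem_integralClosure (c : integralClosure R E) : (c : E) ∈ O := by
  let _ : Algebra R O := ((algebraMap R E).codRestrict O.toSubring hRO).toAlgebra
  have : IsScalarTower R O E := IsScalarTower.of_algebraMap_eq fun _ => rfl
  have h1 : _root_.IsIntegral O (c : E) := (show _root_.IsIntegral R (c : E) from c.2).tower_top
  obtain ⟨y, hy⟩ := IsIntegrallyClosed.isIntegral_iff.1 h1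
  rw [← hy]
  exact y.2

/-- The inclusion of the integral closure of `R` in a valuation ring that contains `R`. -/
def integralClosureToValuationSubring : integralClosure R E →+* O :=
  ((integralClosure R E).val : integralClosure R E →+* E).codRestrict O.toSubring
    fun c => coe_mem_of_mem_integralClosure R O hRO c

/-- The centre of a valuation ring on the integral closure of a subring `R`. -/
def centre : Ideal (integralClosure R E) :=
  (maximalIdeal O).comap (integralClosureToValuationSubring R O hRO)

instance : (centre R O hRO).IsPrime := Ideal.comap_isPrime _ _

lemma mem_centre {c : integralClosure R E} : c ∈ centre R O hRO ↔ (c : E) ∈ O.nonunits := by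
  rw [ValuationSubring.mem_nonunits_iff_exists_mem_maximalIdeal]
  exact ⟨fun h => ⟨_, h⟩, fun ⟨_, h⟩ => h⟩

/-- A valuation ring of the fraction field of a Dedekind domain is the localization at its
centre. -/
lemma exists_eq_div_of_mem [IsDedekindDomain (integralClosure R E)]
    [IsFractionRing (integralClosure R E) E] (h0 : centre R O hRO ≠ ⊥) {x : E} (hx : x ∈ O) :
    ∃ a b : integralClosure R E, b ∉ centre R O hRO ∧ x = (a : E) / b := by
  set P := centre R O hRO
  let S := Localization.subalgebra.ofField E P.primeCompl P.primeCompl_le_nonZeroDivisors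
  have hS : IsLocalization.AtPrime S P :=
    Localization.subalgebra.isLocalization_ofField E P.primeCompl P.primeCompl_le_nonZeroDivisors
  have : IsFractionRing S E :=
    Localization.subalgebra.isFractionRing_ofField E P.primeCompl P.primeCompl_le_nonZeroDivisors
  have : IsDiscreteValuationRing S :=
    IsLocalization.AtPrime.isDiscreteValuationRing_of_dedekind_domain (integralClosure R E) h0 S
  have hdiv : ∀ y ∈ S, ∃ a b : integralClosure R E, b ∉ P ∧ y = (a : E) / b := by
    rintro y ⟨a, b, hb, rfl⟩
    exact ⟨a, b, hb, (div_eq_mul_inv _ _).symm⟩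
  by_cases hx0 : x = 0
  · exact ⟨0, 1, (Ideal.ne_top_iff_one P).1 Ideal.IsPrime.ne_top', by simp [hx0]⟩
  rcases ValuationRing.isInteger_or_isInteger S x with ⟨y, hy⟩ | ⟨y, hy⟩
  · exact hdiv x (hy ▸ y.2)
  · obtain ⟨a, b, hb, hab⟩ := hdiv x⁻¹ (hy ▸ y.2)
    refine ⟨b, a, fun ha => hb ?_, by rw [← inv_inv x, hab, inv_div]⟩
    have hb0 : (b : E) ≠ 0 := fun h => hb ((Subtype.ext h : b = 0) ▸ P.zero_mem)
    have h1 : (b : E) = x * a := by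
      field_simp at hab
      exact hab
    have h2 := Ideal.mul_mem_left (maximalIdeal O) ⟨x, hx⟩ ha
    refine (mem_centre R O hRO).2 ?_
    rw [h1]
    exact ValuationSubring.mem_nonunits_iff_exists_mem_maximalIdeal.2 ⟨_, h2⟩

variable {F : Type u} [Field F] [Algebra R F] [Algebra F E] [IsScalarTower R F E]

/-- The inertia group at the centre acts trivially on the residue field. -/
lemma sub_mem_nonunits_of_mem_inertia [IsDedekindDomain (integralClosure R E)]
    [IsFractionRing (integralClosure R E) E] (h0 : centre R O hRO ≠ ⊥) {σ : E ≃ₐ[F] E}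
    (hσ : σ ∈ (centre R O hRO).inertia (E ≃ₐ[F] E)) (x : E) (hx : x ∈ O) :
    σ x - x ∈ O.nonunits := by
  obtain ⟨a, b, hb, rfl⟩ := exists_eq_div_of_mem R O hRO h0 hx
  set P := centre R O hRO with hP
  have hσ' : ∀ c : integralClosure R E, σ • c - c ∈ P := hσ
  have hσb : σ • b ∉ P := fun h => hb (by
    have := sub_mem h (hσ' b)
    rwa [sub_sub_cancel] at this)
  have hunit : ∀ c : integralClosure R E, c ∉ P → (c : E)⁻¹ ∈ O := by
    intro c hc
    by_contra hn
    apply hc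
    rw [hP, mem_centre, ← inv_inv (c : E), ValuationSubring.inv_mem_nonunits_iff]
    exact Or.inr hn
  have hne : ∀ c : integralClosure R E, c ∉ P → (c : E) ≠ 0 := fun c hc h =>
    hc ((Subtype.ext h : c = 0) ▸ P.zero_mem)
  have h1 : σ • a * b - a * σ • b ∈ P := by
    have : σ • a * b - a * σ • b = (σ • a - a) * b - a * (σ • b - b) := by ring
    rw [this]
    exact sub_mem (Ideal.mul_mem_right _ _ (hσ' a)) (Ideal.mul_mem_left _ _ (hσ' b))
  have h2 : σ ((a : E) / b) - a / b =
      ((σ • a * b - a * σ • b : integralClosure R E) : E) *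
        ((((σ • b : integralClosure R E) : E))⁻¹ * (b : E)⁻¹) := by
    have h3 := hne b hb
    have h4 := hne _ hσb
    have h5 : ∀ c : integralClosure R E, ((σ • c : integralClosure R E) : E) = σ c := fun _ => rfl
    rw [map_div₀]
    push_cast [h5] at h4 ⊢
    field_simp
  rw [h2]
  obtain ⟨h3, h4⟩ := ValuationSubring.mem_nonunits_iff_exists_mem_maximalIdeal.1
    ((mem_centre R O hRO).1 h1)
  exact ValuationSubring.mem_nonunits_iff_exists_mem_maximalIdeal.2 ⟨_,
    Ideal.mul_mem_right (⟨_, O.mul_mem _ _ (hunit _ hσb) (hunit _ hb)⟩ : O) _ h4⟩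

attribute [local instance] Ideal.Quotient.field in
/-- If wild inertia is trivial, then the order of the inertia group is nonzero in the residue
field. -/
theorem card_inertia_ne_zero [FiniteDimensional F E] [IsDedekindDomain (integralClosure R E)]
    [IsFractionRing (integralClosure R E) E] (h0 : centre R O hRO ≠ ⊥)
    [(centre R O hRO).IsMaximal]
    (hw : ∀ σ : E ≃ₐ[F] E, (∀ x ∈ O, σ x - x ∈ O.nonunits) →
      (∀ x ≠ 0, σ x / x - 1 ∈ O.nonunits) → σ = 1) :
    (Nat.card ((centre R O hRO).inertia (E ≃ₐ[F] E)) : integralClosure R E ⧸ centre R O hRO) ≠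
      0 := by
  set P := centre R O hRO with hP
  intro hcard
  obtain ⟨p, hp⟩ := CharP.exists (integralClosure R E ⧸ P)
  rw [CharP.cast_eq_zero_iff _ p] at hcard
  have hp0 : p ≠ 0 := by
    rintro rfl
    exact Nat.card_pos.ne' (zero_dvd_iff.1 hcard)
  have hpp : p.Prime := (CharP.char_is_prime_or_zero (integralClosure R E ⧸ P) p).resolve_right hp0
  have : Fact p.Prime := ⟨hpp⟩
  obtain ⟨σ, hσ⟩ := exists_prime_orderOf_dvd_card' p hcard
  have hchar : CharP (ResidueField O) p := by
    refine charP_of_injective_ringHom (f := Ideal.Quotient.lift P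
      ((residue O).comp (integralClosureToValuationSubring R O hRO)) fun c hc => ?_)
      (RingHom.injective _) p
    exact (residue_eq_zero_iff _).2 hc
  have h1 : ∀ x ∈ O, (σ : E ≃ₐ[F] E) x - x ∈ O.nonunits :=
    sub_mem_nonunits_of_mem_inertia R O hRO h0 σ.2
  have h2 : (σ : E ≃ₐ[F] E) ^ p = 1 := by
    have := pow_orderOf_eq_one σ
    rw [hσ] at this
    exact congrArg Subtype.val this
  have h3 := hw σ h1 fun x hx => div_sub_one_mem_nonunits_of_pow_eq_one O h1 h2 hx
  have h4 : σ = 1 := Subtype.ext h3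
  rw [h4, orderOf_one] at hσ
  exact hpp.ne_one hσ.symm

end Centre

section Centre

open Polynomial IsLocalRing

open scoped Pointwise

variable {K : Type u} [Field K] {f : RatFunc K}

section

variable {E : Type u} [Field E] [Algebra K E] [Algebra (RatFunc K) E]
  [IsScalarTower K (RatFunc K) E] [FiniteDimensional (RatFunc K) E] [IsGalois (RatFunc K) E]
  (O : ValuationSubring E) [Algebra K O] [IsScalarTower K O E]
  (R : Type u) [CommRing R] [IsDedekindDomain R] [Algebra R (RatFunc K)]
  [IsFractionRing R (RatFunc K)] [Algebra R E] [IsScalarTower R (RatFunc K) E]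
  (hRO : ∀ r : R, algebraMap R E r ∈ O)

attribute [local instance] Ideal.Quotient.field in
/-- In a field generated by the tree and by constants, the residue field extension at a centre
above a point whose preimages are separable over `K` is separable. -/
theorem IsTame.isSeparable_quotient_centre (hf : IsTame f) (h0 : centre R O hRO ≠ ⊥)
    [(centre R O hRO).IsMaximal] [((centre R O hRO).under R).IsMaximal] {n : ℕ}
    (hred : ∀ m ≤ n, ∀ x : E, (evalMap f E)^[m] x = tElt K E → HasSeparableReduction K O x)
    (hgen : ∀ σ : E ≃ₐ[RatFunc K] E, (∀ m ≤ n, ∀ x : E, (evalMap f E)^[m] x = tElt K E → σ x = x) →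
      (∀ a : E, _root_.IsIntegral K a → σ a = a) → σ = 1) :
    Algebra.IsSeparable (R ⧸ (centre R O hRO).under R)
      (integralClosure R E ⧸ centre R O hRO) := by
  have : IsDedekindDomain (integralClosure R E) := integralClosure.isDedekindDomain R (RatFunc K) E
  have : IsFractionRing (integralClosure R E) E :=
    integralClosure.isFractionRing_of_finite_extension (RatFunc K) E
  have : IsGaloisGroup (E ≃ₐ[RatFunc K] E) R (integralClosure R E) :=
    IsGaloisGroup.of_isFractionRing _ R (integralClosure R E) (RatFunc K) E
  have : Module.Finite R (integralClosure R E) :=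
    IsIntegralClosure.finite R (RatFunc K) E (integralClosure R E)
  have h1 := card_inertia_ne_zero (F := RatFunc K) R O hRO h0 fun σ hσ hw =>
    hgen σ (hf.fixed_of_wild O hσ hw hred) fun a ha => apply_eq_of_isIntegral O hσ ha
  exact (isGalois_quotient_of_inertia ((centre R O hRO).under R) (centre R O hRO) h1).to_isSeparable

/-- A field generated by the tree is unramified above a point that is inseparable over `K`. -/
theorem IsTame.isUnramifiedAt_centre (hf : IsTame f) (h0 : centre R O hRO ≠ ⊥)
    [(centre R O hRO).IsMaximal] [((centre R O hRO).under R).IsMaximal]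
    (ht : tElt K E ∈ O) (hti : _root_.IsIntegral K (residue O ⟨_, ht⟩))
    (hts : ¬ IsSeparable K (residue O ⟨_, ht⟩))
    (hgen : ∀ σ : E ≃ₐ[RatFunc K] E, (∀ m, ∀ x : E, (evalMap f E)^[m] x = tElt K E → σ x = x) →
      σ = 1) :
    Algebra.IsUnramifiedAt R (centre R O hRO) := by
  have : IsDedekindDomain (integralClosure R E) := integralClosure.isDedekindDomain R (RatFunc K) E
  have : IsFractionRing (integralClosure R E) E :=
    integralClosure.isFractionRing_of_finite_extension (RatFunc K) E
  have : IsGaloisGroup (E ≃ₐ[RatFunc K] E) R (integralClosure R E) :=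
    IsGaloisGroup.of_isFractionRing _ R (integralClosure R E) (RatFunc K) E
  have : Module.Finite R (integralClosure R E) :=
    IsIntegralClosure.finite R (RatFunc K) E (integralClosure R E)
  have : Module.IsTorsionFree R E := .trans_faithfulSMul R (RatFunc K) E
  have : Module.IsTorsionFree R (integralClosure R E) := IsIntegralClosure.isTorsionFree R E
  refine isUnramifiedAt_of_inertia_eq_bot (G := E ≃ₐ[RatFunc K] E)
    ((centre R O hRO).under R) (centre R O hRO) ?_
  rw [eq_bot_iff]
  intro σ hσ
  refine hgen σ fun m x hx => (hf.fixed_of_not_isSeparable O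
    (sub_mem_nonunits_of_mem_inertia R O hRO h0 hσ) ht hti hts m x hx).1

end

variable {Ω : Type u} [Field Ω] [Algebra K Ω] [Algebra (RatFunc K) Ω]
  [IsScalarTower K (RatFunc K) Ω] [IsSepClosure (RatFunc K) Ω]

lemma isGalois_adjoin_of_stable {S : Set Ω}
    (hS : ∀ σ : Ω ≃ₐ[RatFunc K] Ω, ∀ x ∈ S, σ x ∈ S) :
    IsGalois (RatFunc K) (adjoin (RatFunc K) S) := by
  have : Normal (RatFunc K) (adjoin (RatFunc K) S) := by
    rw [IntermediateField.normal_iff_forall_map_le']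
    intro σ
    rw [adjoin_map]
    apply adjoin.mono
    rintro _ ⟨x, hx, rfl⟩
    exact hS σ x hx
  exact { }

lemma finiteDimensional_adjoin_of_finite {S : Set Ω} (hS : S.Finite) :
    FiniteDimensional (RatFunc K) (adjoin (RatFunc K) S) := by
  have := hS.to_subtype
  exact IntermediateField.finiteDimensional_adjoin fun x _ =>
    Algebra.IsIntegral.isIntegral x

lemma algEquiv_eq_one_of_adjoin {S : Set Ω} (σ : adjoin (RatFunc K) S ≃ₐ[RatFunc K]
    adjoin (RatFunc K) S) (h : ∀ x : adjoin (RatFunc K) S, (x : Ω) ∈ S → σ x = x) : σ = 1 := by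
  apply AlgEquiv.ext
  have h2 : (σ : adjoin (RatFunc K) S →ₐ[RatFunc K] adjoin (RatFunc K) S) = AlgHom.id _ _ :=
    IntermediateField.algHom_ext_of_eq_adjoin _ rfl fun x hx => h ⟨x, subset_adjoin _ _ hx⟩ hx
  exact fun x => DFunLike.congr_fun h2 x

/-- The vertices of the tree up to level `n`. -/
def verticesUpTo (f : RatFunc K) (Ω : Type u) [Field Ω] [Algebra K Ω] [Algebra (RatFunc K) Ω]
    (n : ℕ) : Set Ω := {x | ∃ m ≤ n, x ∈ fiber f Ω m}

lemma apply_mem_verticesUpTo {n : ℕ} (σ : Ω ≃ₐ[RatFunc K] Ω) {x : Ω}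
    (hx : x ∈ verticesUpTo f Ω n) : σ x ∈ verticesUpTo f Ω n := by
  obtain ⟨m, hm, hx⟩ := hx
  refine ⟨m, hm, ?_⟩
  have := evalMap_iterate_hom f ((σ : Ω ≃ₐ[RatFunc K] Ω).restrictScalars K : Ω →ₐ[K] Ω) m x
  have hn' : (evalMap f Ω)^[m] x = tElt K Ω := hx
  rw [hn'] at this
  exact this.symm.trans (σ.commutes _)

lemma finite_verticesUpTo (hfin : ∀ m, (fiber f Ω m).Finite) (n : ℕ) :
    (verticesUpTo f Ω n).Finite := by
  refine ((Set.finite_le_nat n).biUnion fun m _ => hfin m).subset ?_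
  rintro x ⟨m, hm, hx⟩
  exact Set.mem_iUnion₂.2 ⟨m, hm, hx⟩

lemma coe_iterate_evalMap {A : IntermediateField (RatFunc K) Ω} (m : ℕ) (x : A) :
    (((evalMap f A)^[m] x : A) : Ω) = (evalMap f Ω)^[m] x :=
  evalMap_iterate_hom f (A.val.restrictScalars K) m x

lemma coe_mem_fiber_of_iterate {A : IntermediateField (RatFunc K) Ω} {m : ℕ} {x : A}
    (hx : (evalMap f A)^[m] x = tElt K A) : (x : Ω) ∈ fiber f Ω m :=
  (coe_iterate_evalMap m x).symm.trans (congrArg Subtype.val hx)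

lemma iterate_of_coe_mem_fiber {A : IntermediateField (RatFunc K) Ω} {m : ℕ} {x : A}
    (hx : (x : Ω) ∈ fiber f Ω m) : (evalMap f A)^[m] x = tElt K A :=
  Subtype.ext ((coe_iterate_evalMap m x).trans hx)

end Centre

/-! ### Smoothness of the normalization of the affine line -/

section StandardSmooth

open Polynomial

variable {K : Type u} [Field K]

lemma isStandardSmoothOfRelativeDimension_polynomial (R : Type u) [CommRing R] :
    Algebra.IsStandardSmoothOfRelativeDimension 1 R R[X] := by
  let e := MvPolynomial.uniqueAlgEquiv R PUnit.{1}
  have he : (MvPolynomial.aeval fun _ : PUnit.{1} => (X : R[X])) = (e : _ →ₐ[R] R[X]) := by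
    ext
    simp [e]
  let P : Algebra.PreSubmersivePresentation R R[X] PUnit.{1} PEmpty.{1} :=
    { toGenerators := .ofSurjective (fun _ => X) (by rw [he]; exact e.surjective)
      relation := PEmpty.elim
      span_range_relation_eq_ker := by
        rw [Set.range_eq_empty, Ideal.span_empty]
        refine ((RingHom.injective_iff_ker_eq_bot _).1 ?_).symm
        change Function.Injective (MvPolynomial.aeval fun _ : PUnit.{1} => (X : R[X]))
        rw [he]
        exact e.injective
      map := PEmpty.elim
      map_inj := fun x => x.elim }
  let P' : Algebra.SubmersivePresentation R R[X] PUnit.{1} PEmpty.{1} :=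
    { __ := P
      jacobian_isUnit := by
        rw [Algebra.PreSubmersivePresentation.jacobian_eq_jacobiMatrix_det,
          Matrix.det_isEmpty, map_one]
        exact isUnit_one }
  exact ⟨_, _, _, inferInstance, P', by simp [Algebra.Presentation.dimension]⟩

/-- A domain over `K` that is faithful and unramified over a polynomial ring at `q` is smooth of
relative dimension one near `q`. -/
lemma exists_isStandardSmooth_of_isUnramifiedAt {B : Type u} [CommRing B] [IsDomain B]
    [Algebra K B] [Algebra K[X] B] [IsScalarTower K K[X] B] [FaithfulSMul K[X] B]
    [Algebra.FiniteType K B]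
    (q : Ideal B) [q.IsPrime] [Algebra.IsUnramifiedAt K[X] q] :
    ∃ b ∉ q, Algebra.IsStandardSmoothOfRelativeDimension 1 K (Localization.Away b) := by
  have : Module.Flat K[X] B := inferInstance
  have : Algebra.FiniteType K[X] B := .of_restrictScalars_finiteType K _ _
  have : Algebra.FinitePresentation K[X] B := .of_finiteType.1 ‹_›
  have : Algebra.IsEtaleAt K[X] q := .of_isUnramifiedAt_of_flat q
  obtain ⟨b, hb, hbe⟩ := Algebra.exists_etale_of_isEtaleAt (R := K[X]) q
  refine ⟨b, hb, ?_⟩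
  rw [Algebra.Etale.iff_isStandardSmoothOfRelativeDimension_zero] at hbe
  have := isStandardSmoothOfRelativeDimension_polynomial K
  have : IsScalarTower K K[X] (Localization.Away b) := IsScalarTower.of_algebraMap_eq fun x => by
    rw [IsScalarTower.algebraMap_apply K[X] B, ← IsScalarTower.algebraMap_apply K K[X] B,
      ← IsScalarTower.algebraMap_apply]
  exact Algebra.IsStandardSmoothOfRelativeDimension.trans 1 0 K K[X] _

/-- A curve over `K` is smooth near a regular point whose residue field is separable over `K`. -/
lemma exists_isStandardSmooth_of_isSeparable {B : Type u} [CommRing B] [IsDedekindDomain B]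
    [Algebra K B] [Algebra.FiniteType K B] [FaithfulSMul K B] (q : Ideal B) [q.IsMaximal] (hq : q ≠ ⊥)
    [Algebra.IsSeparable K (B ⧸ q)] :
    ∃ b ∉ q, Algebra.IsStandardSmoothOfRelativeDimension 1 K (Localization.Away b) := by
  have : IsDiscreteValuationRing (Localization.AtPrime q) :=
    IsLocalization.AtPrime.isDiscreteValuationRing_of_dedekind_domain B hq _
  obtain ⟨ϖ, hϖ⟩ := IsDiscreteValuationRing.exists_irreducible (Localization.AtPrime q)
  obtain ⟨a, b, hab⟩ := IsLocalization.exists_mk'_eq q.primeCompl ϖ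
  -- a uniformizer at `q` that lies in `B`
  have hϖa : ϖ * algebraMap B (Localization.AtPrime q) b = algebraMap B _ a := by
    rw [← hab, IsLocalization.mk'_spec]
  have ha : Ideal.span {algebraMap B (Localization.AtPrime q) a} =
      IsLocalRing.maximalIdeal (Localization.AtPrime q) := by
    rw [hϖ.maximalIdeal_eq, ← hϖa, Ideal.span_singleton_mul_right_unit]
    exact IsLocalization.map_units _ b
  have haq : a ∈ q := by
    rw [← IsLocalization.AtPrime.under_maximalIdeal (Localization.AtPrime q) q, Ideal.mem_comap,
      ← ha]
    exact Ideal.mem_span_singleton_self _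
  have ha0 : a ≠ 0 := by
    rintro rfl
    rw [map_zero, mul_eq_zero, or_iff_right hϖ.ne_zero] at hϖa
    exact (IsLocalization.map_units (Localization.AtPrime q) b).ne_zero hϖa
  let _ : Algebra K[X] B := (aeval a : K[X] →ₐ[K] B).toRingHom.toAlgebra
  have hX : ∀ x : K[X], algebraMap K[X] B x = aeval a x := fun _ => rfl
  have : IsScalarTower K K[X] B := IsScalarTower.of_algebraMap_eq' (aeval a).comp_algebraMap.symm
  have hinj : Function.Injective (algebraMap K[X] B) :=
    transcendental_iff_injective.1 fun h =>
      Ideal.IsPrime.ne_top' (q.eq_top_of_isUnit_mem haq (h.isIntegral.isUnit ha0))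
  have : FaithfulSMul K[X] B := (faithfulSMul_iff_algebraMap_injective _ _).2 hinj
  have : Algebra.FiniteType K[X] B := .of_restrictScalars_finiteType K _ _
  have hXm : (Ideal.span {(X : K[X])}).IsMaximal :=
    PrincipalIdealRing.isMaximal_of_irreducible irreducible_X
  have hp : Ideal.span {(X : K[X])} = q.under K[X] := by
    refine hXm.eq_of_le Ideal.IsPrime.ne_top' ?_
    rw [Ideal.span_singleton_le_iff_mem, Ideal.mem_comap, hX, aeval_X]
    exact haq
  have : (q.under K[X]).IsMaximal := hp ▸ hXm
  let _ := Ideal.Quotient.field (q.under K[X])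
  let _ := Ideal.Quotient.field q
  have : IsScalarTower K (K[X] ⧸ q.under K[X]) (B ⧸ q) := inferInstance
  have : Algebra.IsSeparable (K[X] ⧸ q.under K[X]) (B ⧸ q) :=
    Algebra.isSeparable_tower_top_of_isSeparable K _ _
  let := Localization.AtPrime.algebraOfLiesOver (q.under K[X]) q
  have : Algebra.IsUnramifiedAt K[X] q := by
    rw [Algebra.isUnramifiedAt_iff_map_eq K[X] (q.under K[X]) q]
    refine ⟨isSeparable_residueField_of_quotient (q.under K[X]) q, ?_⟩
    rw [← hp, Ideal.map_span, Set.image_singleton, ← ha, IsScalarTower.algebraMap_apply K[X] B, hX,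
      aeval_X]
  exact exists_isStandardSmooth_of_isUnramifiedAt q

end StandardSmooth

section Chart

open Polynomial IsLocalRing

variable {K : Type u} [Field K] {f : RatFunc K}

section

variable {E : Type u} [Field E] [Algebra K E] [Algebra (RatFunc K) E]
  [IsScalarTower K (RatFunc K) E]
  (O : ValuationSubring E) [Algebra K O] [IsScalarTower K O E]
  (R : Type u) [CommRing R] [Algebra K R] [Algebra R (RatFunc K)]
  [IsScalarTower K R (RatFunc K)] [IsFractionRing R (RatFunc K)] [Algebra R E]
  [IsScalarTower R (RatFunc K) E]
  (hRO : ∀ r : R, algebraMap R E r ∈ O) (e : K[X] ≃ₐ[K] R)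
  (he : algebraMap R (RatFunc K) (e X) = RatFunc.X ∨
    algebraMap R (RatFunc K) (e X) = RatFunc.X⁻¹)

lemma tElt_ne_zero : tElt K E ≠ 0 := by
  simp [tElt, RatFunc.X_ne_zero]

include he in
lemma algebraMap_chart_X : algebraMap R E (e X) = tElt K E ∨
    algebraMap R E (e X) = (tElt K E)⁻¹ := by
  rw [IsScalarTower.algebraMap_apply R (RatFunc K) E]
  rcases he with h | h
  · exact Or.inl (by rw [h]; rfl)
  · exact Or.inr (by rw [h, map_inv₀]; rfl)

/-- The residue map of a valuation ring, restricted to a chart. -/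
def chartResidue [IsScalarTower K R E] : R →ₐ[K] ResidueField O :=
  { (residue O).comp ((algebraMap R E).codRestrict O.toSubring hRO) with
    commutes' := fun c => by
      change residue O _ = algebraMap O (ResidueField O) (algebraMap K O c)
      refine congrArg (residue O) (Subtype.ext ?_)
      exact (IsScalarTower.algebraMap_apply K R E c).symm.trans
        (IsScalarTower.algebraMap_apply K O E c) }

lemma chartResidue_apply [IsScalarTower K R E] (r : R) :
    chartResidue (K := K) O R hRO r = residue O ⟨algebraMap R E r, hRO r⟩ := rfl

lemma chartResidue_eq_aeval [IsScalarTower K R E] (Q : K[X]) :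
    chartResidue (K := K) O R hRO (e Q) =
      aeval (chartResidue (K := K) O R hRO (e X)) Q := by
  have := Polynomial.aeval_algHom_apply
    ((chartResidue (K := K) O R hRO).comp (e : K[X] →ₐ[K] R)) X Q
  rw [aeval_X_left_apply] at this
  exact this.symm

lemma ker_chartResidue [IsScalarTower K R E] :
    RingHom.ker (chartResidue (K := K) O R hRO) = (centre R O hRO).under R := by
  ext r
  rw [RingHom.mem_ker, chartResidue_apply, ← mem_nonunits_iff_residue, Ideal.mem_comap,
    mem_centre]
  rfl

include e he in
lemma isSeparable_quotient_under_centre [IsScalarTower K R E]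
    (ht : HasSeparableReduction K O (tElt K E)) :
    Algebra.IsSeparable K (R ⧸ (centre R O hRO).under R) := by
  have hX : chartResidue (K := K) O R hRO (e X) ∈ separableClosure K (ResidueField O) := by
    have hsep : ∀ y : E, ∀ hy : y ∈ O, ∀ b : E, IsSeparable K b → y - b ∈ O.nonunits →
        residue O ⟨y, hy⟩ ∈ separableClosure K (ResidueField O) := by
      intro y hy b hb hyb
      have hbO : b ∈ O := mem_valuationSubring_of_isIntegral O hb.isIntegral
      have h1 : residue O ⟨y, hy⟩ = residue O ⟨b, hbO⟩ := by
        rw [← sub_eq_zero, ← map_sub]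
        exact (mem_nonunits_iff_residue _).1 hyb
      rw [h1, mem_separableClosure_iff]
      have h2 : IsSeparable K (⟨b, hbO⟩ : O) :=
        (isSeparable_map_iff (IsScalarTower.toAlgHom K O E) Subtype.val_injective).1 hb
      exact Separable.of_dvd h2 (minpoly.dvd K _ (by
        rw [← residue_aeval, minpoly.aeval, map_zero]))
    rw [chartResidue_apply]
    have hXO := hRO (e X)
    rcases algebraMap_chart_X R (E := E) e he with h | h
    · rcases ht with ⟨b, hb, htb⟩ | ht
      · exact hsep _ hXO b hb (by rwa [h])
      · exfalso
        rw [← h, ValuationSubring.inv_mem_nonunits_iff] at ht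
        rcases ht with h0 | h1
        · rw [h] at h0
          exact tElt_ne_zero h0
        · exact h1 hXO
    · rcases ht with ⟨b, hb, htb⟩ | ht
      · have hbO : b ∈ O := mem_valuationSubring_of_isIntegral O hb.isIntegral
        have htO : tElt K E ∈ O := by
          have := O.add_mem _ _ (ValuationSubring.nonunits_le htb) hbO
          rwa [sub_add_cancel] at this
        have h1 : residue O ⟨algebraMap R E (e X), hXO⟩ = (residue O ⟨_, htO⟩)⁻¹ := by
          refine eq_inv_of_mul_eq_one_left ?_
          rw [← map_mul, ← map_one (residue O)]
          congr 1
          apply Subtype.ext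
          change algebraMap R E (e X) * tElt K E = 1
          rw [h, inv_mul_cancel₀ tElt_ne_zero]
        rw [h1]
        exact inv_mem (hsep _ htO b hb htb)
      · rw [← h] at ht
        rw [(mem_nonunits_iff_residue ⟨_, hXO⟩).1 ht]
        exact zero_mem _
  have hall : ∀ r : R, IsSeparable K (chartResidue (K := K) O R hRO r) := by
    intro r
    obtain ⟨Q, rfl⟩ := e.surjective r
    rw [← mem_separableClosure_iff]
    rw [chartResidue_eq_aeval]
    exact Algebra.adjoin_singleton_le
      (S := (separableClosure K (ResidueField O)).toSubalgebra) hX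
      (aeval_mem_adjoin_singleton K _)
  rw [← ker_chartResidue (K := K) O R hRO]
  constructor
  intro x
  obtain ⟨r, rfl⟩ := Ideal.Quotient.mk_surjective x
  rw [← isSeparable_map_iff (Ideal.kerLiftAlg (chartResidue (K := K) O R hRO))
    (Ideal.kerLiftAlg_injective _)]
  exact hall r

include e he in
lemma isIntegral_residue_tElt [IsScalarTower K R E] (h0 : (centre R O hRO).under R ≠ ⊥)
    (ht : tElt K E ∈ O) : _root_.IsIntegral K (residue O ⟨_, ht⟩) := by
  obtain ⟨r, hr, hr0⟩ := Submodule.exists_mem_ne_zero_of_ne_bot h0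
  obtain ⟨Q, rfl⟩ := e.surjective r
  rw [← ker_chartResidue (K := K) O R hRO, RingHom.mem_ker] at hr
  have h2 : _root_.IsIntegral K (chartResidue (K := K) O R hRO (e X)) :=
    IsAlgebraic.isIntegral ⟨Q, fun h => hr0 (by rw [h, map_zero]), (chartResidue_eq_aeval O R hRO e Q).symm.trans hr⟩
  rcases algebraMap_chart_X R (E := E) e he with h | h
  · rw [chartResidue_apply] at h2
    simp only [h] at h2
    exact h2
  · have h3 : residue O ⟨_, ht⟩ = (chartResidue (K := K) O R hRO (e X))⁻¹ := by
      refine eq_inv_of_mul_eq_one_left ?_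
      rw [chartResidue_apply, ← map_mul, ← map_one (residue O)]
      congr 1
      apply Subtype.ext
      change tElt K E * algebraMap R E (e X) = 1
      rw [h, mul_inv_cancel₀ tElt_ne_zero]
    rw [h3]
    exact h2.inv

end

end Chart

section Chart

open Polynomial IsLocalRing

variable {K : Type u} [Field K] {f : RatFunc K}
  {E : Type u} [Field E] [Algebra K E] [Algebra (RatFunc K) E]
  [IsScalarTower K (RatFunc K) E] [FiniteDimensional (RatFunc K) E] [IsGalois (RatFunc K) E]
  (O : ValuationSubring E) [Algebra K O] [IsScalarTower K O E]
  (R : Type u) [CommRing R] [IsPrincipalIdealRing R] [IsDomain R]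
  [Algebra K R] [Algebra R (RatFunc K)]
  [IsScalarTower K R (RatFunc K)] [IsFractionRing R (RatFunc K)] [Algebra R E]
  [IsScalarTower R (RatFunc K) E] [IsScalarTower K R E]
  (hRO : ∀ r : R, algebraMap R E r ∈ O) (e : K[X] ≃ₐ[K] R)
  (he : algebraMap R (RatFunc K) (e X) = RatFunc.X ∨
    algebraMap R (RatFunc K) (e X) = RatFunc.X⁻¹)
  (L : Type u) [Field L] [Algebra K L] [Algebra (RatFunc K) L] [IsScalarTower K (RatFunc K) L]
  [Algebra R L] [IsScalarTower R (RatFunc K) L] [IsScalarTower K R L]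
  [FiniteDimensional (RatFunc K) L]
  [Algebra L E] [IsScalarTower (RatFunc K) L E] [IsScalarTower R L E]

include K in
variable (K) in
lemma faithfulSMul_integralClosure : FaithfulSMul R (integralClosure R L) := by
  rw [faithfulSMul_iff_algebraMap_injective]
  have h := (algebraMap (RatFunc K) L).injective.comp (IsFractionRing.injective R (RatFunc K))
  intro a b hab
  refine h ?_
  have h1 := congrArg Subtype.val hab
  change algebraMap (RatFunc K) L (algebraMap R _ a) = algebraMap (RatFunc K) L (algebraMap R _ b)
  rw [← IsScalarTower.algebraMap_apply, ← IsScalarTower.algebraMap_apply]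
  exact h1

/-- The map between integral closures induced by an extension of fields. -/
def integralClosureMap : integralClosure R L →ₐ[R] integralClosure R E :=
  (IsScalarTower.toAlgHom R L E).mapIntegralClosure

/-- A centre on an integral closure in a subextension is nonzero and maximal together with
the centres below and above. -/
lemma centre_ne_bot_of_comap (q : Ideal (integralClosure R L)) (hq : q ≠ ⊥)
    (hqO : q = (centre R O hRO).comap (integralClosureMap R L)) :
    (centre R O hRO).under R ≠ ⊥ := by
  have h1 : q.under R = (centre R O hRO).under R := by
    rw [hqO]
    ext r
    simp only [Ideal.under, Ideal.mem_comap, AlgHom.commutes]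
  rw [← h1]
  have : q.IsPrime := hqO ▸ inferInstance
  exact Ideal.IsIntegral.comap_ne_bot (R := R) hq

include e in
lemma finiteType_integralClosure [Algebra.IsSeparable (RatFunc K) L] :
    Algebra.FiniteType K (integralClosure R L) := by
  have : Module.Finite R (integralClosure R L) :=
    IsIntegralClosure.finite R (RatFunc K) L (integralClosure R L)
  have : Algebra.FiniteType K R := .of_surjective (e : K[X] →ₐ[K] R) e.surjective
  exact Algebra.FiniteType.trans (S := R) ‹_› inferInstance

include e he in
lemma IsTame.exists_isStandardSmooth_of_hasSeparableReduction (hf : IsTame f)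
    (q : Ideal (integralClosure R L)) [q.IsMaximal] (hq : q ≠ ⊥)
    (hqO : q = (centre R O hRO).comap (integralClosureMap R L)) {n : ℕ}
    (hred : ∀ m ≤ n, ∀ x : E, (evalMap f E)^[m] x = tElt K E → HasSeparableReduction K O x)
    (hgen : ∀ σ : E ≃ₐ[RatFunc K] E, (∀ m ≤ n, ∀ x : E, (evalMap f E)^[m] x = tElt K E → σ x = x) →
      (∀ a : E, _root_.IsIntegral K a → σ a = a) → σ = 1) :
    ∃ b ∉ q, Algebra.IsStandardSmoothOfRelativeDimension 1 K (Localization.Away b) := by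
  have hp := centre_ne_bot_of_comap O R hRO L q hq hqO
  have hRE : FaithfulSMul R (integralClosure R E) := faithfulSMul_integralClosure K R E
  have h0 : centre R O hRO ≠ ⊥ := by
    intro h
    rw [h] at hp
    exact hp (Ideal.comap_bot_of_injective _
      (FaithfulSMul.algebraMap_injective R (integralClosure R E)))
  have : Algebra.IsSeparable (RatFunc K) L := Algebra.isSeparable_tower_bot_of_isSeparable _ L E
  have : IsDedekindDomain (integralClosure R E) := integralClosure.isDedekindDomain R (RatFunc K) E
  have : IsDedekindDomain (integralClosure R L) := integralClosure.isDedekindDomain R (RatFunc K) L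
  have : ((centre R O hRO).under R).IsMaximal := Ideal.IsPrime.isMaximal inferInstance hp
  have : (centre R O hRO).IsMaximal := Ideal.IsPrime.isMaximal inferInstance h0
  have h1 := hf.isSeparable_quotient_centre O R hRO h0 hred hgen
  have h2 : HasSeparableReduction K O (tElt K E) := hred 0 n.zero_le _ rfl
  have h3 := isSeparable_quotient_under_centre O R hRO e he h2
  let _ := Ideal.Quotient.field ((centre R O hRO).under R)
  let _ := Ideal.Quotient.field (centre R O hRO)
  let _ := Ideal.Quotient.field q
  have h4 : Algebra.IsSeparable K (integralClosure R E ⧸ centre R O hRO) :=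
    Algebra.IsSeparable.trans K (R ⧸ (centre R O hRO).under R) _
  let φ : (integralClosure R L ⧸ q) →ₐ[K] (integralClosure R E ⧸ centre R O hRO) :=
    Ideal.quotientMapₐ _ ((integralClosureMap R L).restrictScalars K) hqO.le
  have : Algebra.IsSeparable K (integralClosure R L ⧸ q) := Algebra.IsSeparable.of_algHom K _ φ
  have := finiteType_integralClosure R e L
  have : FaithfulSMul K (integralClosure R L) := inferInstance
  exact SelfSimilarIMG.exists_isStandardSmooth_of_isSeparable q hq

include e he in
lemma IsTame.exists_isStandardSmooth_of_not_isSeparable (hf : IsTame f)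
    (q : Ideal (integralClosure R L)) [q.IsMaximal] (hq : q ≠ ⊥)
    (hqO : q = (centre R O hRO).comap (integralClosureMap R L))
    (ht : tElt K E ∈ O)
    (hts : ¬ IsSeparable K (residue O ⟨_, ht⟩))
    (hgen : ∀ σ : E ≃ₐ[RatFunc K] E, (∀ m, ∀ x : E, (evalMap f E)^[m] x = tElt K E → σ x = x) →
      σ = 1) :
    ∃ b ∉ q, Algebra.IsStandardSmoothOfRelativeDimension 1 K (Localization.Away b) := by
  have hp := centre_ne_bot_of_comap O R hRO L q hq hqO
  have hRE : FaithfulSMul R (integralClosure R E) := faithfulSMul_integralClosure K R E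
  have h0 : centre R O hRO ≠ ⊥ := by
    intro h
    rw [h] at hp
    exact hp (Ideal.comap_bot_of_injective _
      (FaithfulSMul.algebraMap_injective R (integralClosure R E)))
  have : Algebra.IsSeparable (RatFunc K) L := Algebra.isSeparable_tower_bot_of_isSeparable _ L E
  have : IsDedekindDomain (integralClosure R E) := integralClosure.isDedekindDomain R (RatFunc K) E
  have : IsDedekindDomain (integralClosure R L) := integralClosure.isDedekindDomain R (RatFunc K) L
  have : ((centre R O hRO).under R).IsMaximal := Ideal.IsPrime.isMaximal inferInstance hp
  have : (centre R O hRO).IsMaximal := Ideal.IsPrime.isMaximal inferInstance h0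
  have hti := isIntegral_residue_tElt O R hRO e he hp ht
  have h1 := hf.isUnramifiedAt_centre O R hRO h0 ht hti hts hgen
  let _ : Algebra (integralClosure R L) (integralClosure R E) :=
    (integralClosureMap R L).toRingHom.toAlgebra
  have : IsScalarTower R (integralClosure R L) (integralClosure R E) :=
    IsScalarTower.of_algebraMap_eq' (integralClosureMap R L).comp_algebraMap.symm
  have : (centre R O hRO).LiesOver q := ⟨hqO⟩
  have : Module.Finite R (integralClosure R L) :=
    IsIntegralClosure.finite R (RatFunc K) L (integralClosure R L)
  have : Module.Finite R (integralClosure R E) :=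
    IsIntegralClosure.finite R (RatFunc K) E (integralClosure R E)
  have : FaithfulSMul (integralClosure R L) (integralClosure R E) := by
    rw [faithfulSMul_iff_algebraMap_injective]
    intro a b hab
    exact Subtype.ext ((algebraMap L E).injective (congrArg Subtype.val hab))
  have h2 : Algebra.IsUnramifiedAt R q := .of_liesOver R q (centre R O hRO)
  let _ : Algebra K[X] R := (e : K[X] →ₐ[K] R).toRingHom.toAlgebra
  let _ : Algebra K[X] (integralClosure R L) :=
    ((algebraMap R (integralClosure R L)).comp (algebraMap K[X] R)).toAlgebra
  have : IsScalarTower K[X] R (integralClosure R L) := IsScalarTower.of_algebraMap_eq' rfl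
  have : IsScalarTower K K[X] R :=
    IsScalarTower.of_algebraMap_eq' (e : K[X] →ₐ[K] R).comp_algebraMap.symm
  have : IsScalarTower K K[X] (integralClosure R L) := .to₁₂₄ _ _ R _
  have : Algebra.FormallyUnramified K[X] R := .of_surjective (Algebra.ofId K[X] R) e.surjective
  have : Algebra.IsUnramifiedAt K[X] q := Algebra.FormallyUnramified.comp K[X] R _
  have : FaithfulSMul K[X] (integralClosure R L) := by
    have := faithfulSMul_integralClosure K R L
    rw [faithfulSMul_iff_algebraMap_injective]
    exact (FaithfulSMul.algebraMap_injective R (integralClosure R L)).comp e.injective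
  have := finiteType_integralClosure R e L
  exact exists_isStandardSmooth_of_isUnramifiedAt q

end Chart

section Chart

open Polynomial IsLocalRing

/-- A proper ideal of a subring is dominated by a valuation ring. -/
lemma exists_valuationSubring_of_ideal {B M : Type u} [CommRing B] [Field M] [Algebra B M]
    [FaithfulSMul B M] (q : Ideal B) (hq : q ≠ ⊤) :
    ∃ O : ValuationSubring M, (∀ b : B, algebraMap B M b ∈ O) ∧
      ∀ b ∈ q, algebraMap B M b ∈ O.nonunits := by
  let e : B ≃+* (algebraMap B M).range := RingEquiv.ofBijective (algebraMap B M).rangeRestrict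
    ⟨fun a b h => FaithfulSMul.algebraMap_injective B M (congrArg Subtype.val h),
      (algebraMap B M).rangeRestrict_surjective⟩
  obtain ⟨O, h1, h2⟩ := Ideal.image_subset_nonunits_valuationSubring
    (q.comap (e.symm : (algebraMap B M).range →+* B)) (Ideal.comap_ne_top _ hq)
  refine ⟨O, fun b => h1 ⟨b, rfl⟩, fun b hb => h2 ⟨e b, ?_, rfl⟩⟩
  change e.symm (e b) ∈ q
  rwa [e.symm_apply_apply]

lemma mem_nonunits_comap {M N : Type u} [Field M] [Field N] (O : ValuationSubring N) (φ : M →+* N)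
    (x : M) : x ∈ (O.comap φ).nonunits ↔ φ x ∈ O.nonunits := by
  rw [← inv_inv x, map_inv₀ φ, ValuationSubring.inv_mem_nonunits_iff,
    ValuationSubring.inv_mem_nonunits_iff, ValuationSubring.mem_comap, map_eq_zero]

variable {K : Type u} [Field K] {f : RatFunc K}
  {Ω : Type u} [Field Ω] [Algebra K Ω] [Algebra (RatFunc K) Ω]
  [IsScalarTower K (RatFunc K) Ω] [IsSepClosure (RatFunc K) Ω]

/-- Separability of the reduction passes from `t` up the tree. -/
lemma IsTame.hasSeparableReduction_of_mem_fiber [IsSepClosed Ω] (hf : IsTame f)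
    (O : ValuationSubring Ω) [Algebra K O] [IsScalarTower K O Ω]
    (ht : HasSeparableReduction K O (tElt K Ω)) (m : ℕ) :
    ∀ x : Ω, x ∈ fiber f Ω m → HasSeparableReduction K O x := by
  induction m with
  | zero => rintro x (rfl : x = _); exact ht
  | succ m ih =>
    intro x hx
    have hx' : (evalMap f Ω)^[m + 1] x = tElt K Ω := hx
    have h1 : evalMap f Ω x ∈ fiber f Ω m := by
      rw [Function.iterate_succ_apply] at hx'
      exact hx'
    have h2 : Transcendental K (evalMap f Ω x) := transcendental_of_iterate h1
    exact hf.hasSeparableReduction O (fun h0 => h2 (by rw [h0]; exact isAlgebraic_zero))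
      (aeval_num_of_transcendental (transcendental_of_iterate hx')) (ih _ h1)

variable
  (R : Type u) [CommRing R] [IsPrincipalIdealRing R] [IsDomain R]
  [Algebra K R] [Algebra R (RatFunc K)]
  [IsScalarTower K R (RatFunc K)] [IsFractionRing R (RatFunc K)] (e : K[X] ≃ₐ[K] R)
  (he : algebraMap R (RatFunc K) (e X) = RatFunc.X ∨
    algebraMap R (RatFunc K) (e X) = RatFunc.X⁻¹)
  (L : Type u) [Field L] [Algebra K L] [Algebra (RatFunc K) L] [IsScalarTower K (RatFunc K) L]
  [Algebra R L] [IsScalarTower R (RatFunc K) L] [IsScalarTower K R L]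
  [FiniteDimensional (RatFunc K) L]
  [Algebra L Ω] [IsScalarTower (RatFunc K) L Ω] [IsScalarTower K L Ω]

include e he in
/-- Smoothness at a closed point `q`, given a finite Galois extension `E` of `K(t)` that contains
`L` and is generated by vertices, together with constants if `t` has separable reduction at a
valuation ring `O` above `q`. -/
lemma IsTame.exists_isStandardSmooth_of_subfield [IsSepClosed Ω] [Algebra R Ω]
    [IsScalarTower R (RatFunc K) Ω] [IsScalarTower R L Ω] [IsScalarTower K R Ω] (hf : IsTame f)
    (E : IntermediateField (RatFunc K) Ω) [FiniteDimensional (RatFunc K) E]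
    [IsGalois (RatFunc K) E] (hLE : ∀ a : L, algebraMap L Ω a ∈ E)
    (O : ValuationSubring Ω) (hO : ∀ b : integralClosure R L, algebraMap L Ω b ∈ O)
    (hKO : ∀ a : K, algebraMap K Ω a ∈ O)
    (q : Ideal (integralClosure R L)) [q.IsMaximal] (hq : q ≠ ⊥)
    (hqO : ∀ b ∈ q, algebraMap L Ω b ∈ O.nonunits)
    (hE : (∃ n : ℕ,
        (∀ m ≤ n, ∀ x : E, (evalMap f E)^[m] x = tElt K E →
          HasSeparableReduction K (O.comap (algebraMap E Ω)) x) ∧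
        ∀ σ : E ≃ₐ[RatFunc K] E,
          (∀ m ≤ n, ∀ x : E, (evalMap f E)^[m] x = tElt K E → σ x = x) →
          (∀ a : E, _root_.IsIntegral K a → σ a = a) → σ = 1) ∨
      (¬ HasSeparableReduction K O (tElt K Ω) ∧
        ∀ σ : E ≃ₐ[RatFunc K] E,
          (∀ m, ∀ x : E, (evalMap f E)^[m] x = tElt K E → σ x = x) → σ = 1)) :
    ∃ b ∉ q, Algebra.IsStandardSmoothOfRelativeDimension 1 K (Localization.Away b) := by
  let O' := O.comap (algebraMap E Ω)
  let _ : Algebra K O' := ((algebraMap K E).codRestrict O'.toSubring hKO).toAlgebra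
  have : IsScalarTower K O' E := IsScalarTower.of_algebraMap_eq' rfl
  let _ : Algebra L E := ((algebraMap L Ω).codRestrict E.toSubring hLE).toAlgebra
  have : IsScalarTower (RatFunc K) L E := IsScalarTower.of_algebraMap_eq fun x =>
    Subtype.ext (IsScalarTower.algebraMap_apply (RatFunc K) L Ω x)
  have : IsScalarTower R (RatFunc K) E := IsScalarTower.of_algebraMap_eq fun x =>
    Subtype.ext (IsScalarTower.algebraMap_apply R (RatFunc K) Ω x)
  have : IsScalarTower R L E := .to₁₃₄ R (RatFunc K) L E
  have : IsScalarTower K R E := .to₁₂₄ K R (RatFunc K) E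
  have hRO : ∀ r : R, algebraMap R E r ∈ O' := fun r => by
    have h1 := hO (algebraMap R _ r)
    have h2 : algebraMap L Ω (algebraMap R (integralClosure R L) r : L) =
        algebraMap E Ω (algebraMap R E r) :=
      (IsScalarTower.algebraMap_apply R L Ω r).symm.trans rfl
    rw [h2] at h1
    exact h1
  have hqO' : q = (centre R O' hRO).comap (integralClosureMap R L) := by
    refine (‹q.IsMaximal›).eq_of_le Ideal.IsPrime.ne_top' fun b hb => ?_
    rw [Ideal.mem_comap, mem_centre, mem_nonunits_comap]
    exact hqO b hb
  rcases hE with ⟨n, hred, hgen⟩ | ⟨ht, hgen⟩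
  · exact hf.exists_isStandardSmooth_of_hasSeparableReduction O' R hRO e he L q hq hqO' hred hgen
  · have htΩ : tElt K Ω ∈ O :=
      (mem_or_inv_mem_nonunits O _).resolve_right fun h => ht (Or.inr h)
    have htE : tElt K E ∈ O' := htΩ
    refine hf.exists_isStandardSmooth_of_not_isSeparable O' R hRO e he L q hq hqO' htE ?_ hgen
    intro hs
    let _ : Algebra K O := ((algebraMap K Ω).codRestrict O.toSubring hKO).toAlgebra
    have : IsScalarTower K O Ω := IsScalarTower.of_algebraMap_eq' rfl
    refine ht (Or.inl (exists_isSeparable_sub_mem_nonunits_of_aeval O (minpoly.monic hs.isIntegral)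
      hs ?_))
    have h1 : aeval (tElt K E) (minpoly K (residue O' ⟨_, htE⟩)) ∈ O'.nonunits := by
      have h2 := coe_aeval_valuationSubring O' ⟨_, htE⟩ (minpoly K (residue O' ⟨_, htE⟩))
      change _ = aeval (tElt K E) _ at h2
      rw [← h2, mem_nonunits_iff_residue, residue_aeval]
      exact minpoly.aeval _ _
    rw [mem_nonunits_comap] at h1
    have h3 := Polynomial.aeval_algHom_apply (E.val.restrictScalars K) (tElt K E)
      (minpoly K (residue O' ⟨_, htE⟩))
    exact h3 ▸ h1

include e he in
/-- The normalization of the projective line in a field generated by vertices of the tree is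
smooth at its closed points. -/
theorem IsTame.exists_isStandardSmooth_of_isMaximal (hf : IsTame f)
    (hfin : ∀ m, (fiber f Ω m).Finite) {n : ℕ}
    (hL : ∀ a : L, algebraMap L Ω a ∈ adjoin (RatFunc K) (verticesUpTo f Ω n))
    (q : Ideal (integralClosure R L)) [q.IsMaximal] (hq : q ≠ ⊥) :
    ∃ b ∉ q, Algebra.IsStandardSmoothOfRelativeDimension 1 K (Localization.Away b) := by
  have : IsSepClosed Ω := IsSepClosure.sep_closed (RatFunc K)
  classical
  let _ : Algebra R Ω := ((algebraMap (RatFunc K) Ω).comp (algebraMap R (RatFunc K))).toAlgebra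
  have : IsScalarTower R (RatFunc K) Ω := IsScalarTower.of_algebraMap_eq' rfl
  have : IsScalarTower R L Ω := .to₁₃₄ R (RatFunc K) L Ω
  have : IsScalarTower K R Ω := .to₁₂₄ K R (RatFunc K) Ω
  obtain ⟨O, hO, hqO⟩ := exists_valuationSubring_of_ideal (M := Ω) q Ideal.IsPrime.ne_top'
  have hKO : ∀ a : K, algebraMap K Ω a ∈ O := fun a => by
    have := hO (algebraMap K _ a)
    rwa [← IsScalarTower.algebraMap_apply] at this
  let _ : Algebra K O := ((algebraMap K Ω).codRestrict O.toSubring hKO).toAlgebra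
  have : IsScalarTower K O Ω := IsScalarTower.of_algebraMap_eq' rfl
  by_cases ht : HasSeparableReduction K O (tElt K Ω)
  · -- the constants to which the vertices are congruent
    let c : Ω → Ω := fun x =>
      if h : ∃ b : Ω, IsSeparable K b ∧ x - b ∈ O.nonunits then h.choose else 0
    let S : Set Ω := verticesUpTo f Ω n ∪ ⋃ x ∈ verticesUpTo f Ω n, (minpoly K (c x)).rootSet Ω
    have hSf : S.Finite := (finite_verticesUpTo hfin n).union
      ((finite_verticesUpTo hfin n).biUnion fun x _ => rootSet_finite _ _)
    have hSs : ∀ σ : Ω ≃ₐ[RatFunc K] Ω, ∀ x ∈ S, σ x ∈ S := by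
      rintro σ x (hx | hx)
      · exact Or.inl (apply_mem_verticesUpTo σ hx)
      · obtain ⟨v, hv, hx⟩ := Set.mem_iUnion₂.1 hx
        refine Or.inr (Set.mem_iUnion₂.2 ⟨v, hv, ?_⟩)
        have h1 := Polynomial.mem_rootSet.1 hx
        refine Polynomial.mem_rootSet.2 ⟨h1.1, ?_⟩
        have := Polynomial.aeval_algHom_apply ((σ.restrictScalars K : Ω ≃ₐ[K] Ω) : Ω →ₐ[K] Ω) x
          (minpoly K (c v))
        rw [h1.2, map_zero] at this
        exact this
    have := isGalois_adjoin_of_stable (K := K) hSs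
    have := finiteDimensional_adjoin_of_finite (K := K) hSf
    refine hf.exists_isStandardSmooth_of_subfield R e he L (adjoin (RatFunc K) S)
      (fun a => adjoin.mono _ _ _ Set.subset_union_left (hL a)) O hO hKO q hq hqO
        (Or.inl ⟨n, ?_, ?_⟩)
    · intro m hm x hx
      have hxf := coe_mem_fiber_of_iterate hx
      have hxS : (x : Ω) ∈ verticesUpTo f Ω n := ⟨m, hm, hxf⟩
      rcases hf.hasSeparableReduction_of_mem_fiber O ht m x hxf with h | h
      · have hc : c x = h.choose := dif_pos h
        have hcs : IsSeparable K (c x) := hc ▸ h.choose_spec.1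
        refine Or.inl ⟨⟨c x, subset_adjoin _ _ (Or.inr (Set.mem_iUnion₂.2 ⟨x, hxS, ?_⟩))⟩, ?_, ?_⟩
        · exact Polynomial.mem_rootSet.2 ⟨minpoly.ne_zero hcs.isIntegral, minpoly.aeval _ _⟩
        · exact (isSeparable_map_iff ((adjoin (RatFunc K) S).val.restrictScalars K)
            Subtype.val_injective).1 hcs
        · rw [mem_nonunits_comap]
          have h5 := h.choose_spec.2
          rw [← hc] at h5
          exact h5
      · right
        rw [mem_nonunits_comap, map_inv₀]
        exact h
    · intro σ h1 h2
      refine algEquiv_eq_one_of_adjoin σ fun x hx => ?_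
      rcases hx with ⟨m, hm, hx⟩ | hx
      · exact h1 m hm x (iterate_of_coe_mem_fiber hx)
      · obtain ⟨v, -, hx⟩ := Set.mem_iUnion₂.1 hx
        refine h2 x ?_
        have h3 := Polynomial.mem_rootSet.1 hx
        have h4 : _root_.IsIntegral K (x : Ω) := IsAlgebraic.isIntegral ⟨_, h3.1, h3.2⟩
        exact (isIntegral_algHom_iff ((adjoin (RatFunc K) S).val.restrictScalars K)
          Subtype.val_injective).1 h4
  · have := isGalois_adjoin_of_stable (K := K) fun σ x (hx : x ∈ verticesUpTo f Ω n) =>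
      apply_mem_verticesUpTo σ hx
    have := finiteDimensional_adjoin_of_finite (K := K) (finite_verticesUpTo hfin n)
    refine hf.exists_isStandardSmooth_of_subfield R e he L
      (adjoin (RatFunc K) (verticesUpTo f Ω n)) hL O hO hKO q hq hqO (Or.inr ⟨ht, fun σ h1 => ?_⟩)
    exact algEquiv_eq_one_of_adjoin σ fun x ⟨m, _, hx⟩ => h1 m x (iterate_of_coe_mem_fiber hx)

include e he in
/-- The normalization of the projective line in a field generated by vertices of the tree is
smooth. -/
theorem IsTame.exists_isStandardSmooth_of_isPrime (hf : IsTame f)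
    (hfin : ∀ m, (fiber f Ω m).Finite) {n : ℕ}
    (hL : ∀ a : L, algebraMap L Ω a ∈ adjoin (RatFunc K) (verticesUpTo f Ω n))
    (q : Ideal (integralClosure R L)) [q.IsPrime] :
    ∃ b ∉ q, Algebra.IsStandardSmoothOfRelativeDimension 1 K (Localization.Away b) := by
  obtain ⟨m, hm, hqm⟩ := Ideal.exists_le_maximal q Ideal.IsPrime.ne_top'
  have hB : ¬ IsField (integralClosure R L) := fun h => by
    have := faithfulSMul_integralClosure K R L
    have h1 : IsField R := isField_of_isIntegral_of_isField
      (FaithfulSMul.algebraMap_injective R (integralClosure R L)) h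
    exact Polynomial.not_isField K (e.toMulEquiv.isField h1)
  obtain ⟨b, hb, h⟩ := hf.exists_isStandardSmooth_of_isMaximal R e he L hfin hL m
    (Ring.ne_bot_of_isMaximal_of_not_isField hm hB)
  exact ⟨b, fun hbq => hb (hqm hbq), h⟩

end Chart

/-! ### Charts of the projective line -/

section ProjectiveLine

open Polynomial HomogeneousLocalization

variable (K : Type u) [Field K]

/-- The grading of the homogeneous coordinate ring of the projective line. -/
abbrev grading : ℕ → Submodule K (MvPolynomial (Fin 2) K) :=
  MvPolynomial.homogeneousSubmodule (Fin 2) K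

lemma X_mem_grading (j : Fin 2) : (MvPolynomial.X j : MvPolynomial (Fin 2) K) ∈ grading K 1 :=
  MvPolynomial.isHomogeneous_X K j

variable {K}

lemma aeval_mul_of_isHomogeneous {S : Type*} [CommRing S] [Algebra K S]
    {a : MvPolynomial (Fin 2) K} {n : ℕ} (ha : a.IsHomogeneous n) (c : S) (v : Fin 2 → S) :
    MvPolynomial.aeval (fun i => c * v i) a = c ^ n * MvPolynomial.aeval v a := by
  rw [MvPolynomial.aeval_def, MvPolynomial.aeval_def, MvPolynomial.eval₂_eq',
    MvPolynomial.eval₂_eq', Finset.mul_sum]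
  refine Finset.sum_congr rfl fun d hd => ?_
  have h1 := ha (MvPolynomial.mem_support_iff.1 hd)
  simp only [mul_pow, Finset.prod_mul_distrib, Finset.prod_pow_eq_pow_sum]
  have h2 : ∑ i, d i = n := by
    rw [← h1, Finsupp.weight_apply, Finsupp.sum_fintype]
    · simp
    · simp
  rw [h2]
  ring

/-- Evaluation of the degree zero part of a localization of `K[X₀, X₁]` at a vector. -/
def evalAway {S : Type u} [CommRing S] [Algebra K S] (v : Fin 2 → S)
    (g : MvPolynomial (Fin 2) K) (hg : IsUnit (MvPolynomial.aeval v g)) :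
    Away (grading K) g →+* S :=
  (IsLocalization.Away.lift (S := Localization.Away g) g
    (g := ((MvPolynomial.aeval v : MvPolynomial (Fin 2) K →ₐ[K] S) :
      MvPolynomial (Fin 2) K →+* S)) hg).comp
  (algebraMap _ (Localization.Away g))

section

variable {S : Type u} [CommRing S] [Algebra K S] (v : Fin 2 → S)

lemma evalAway_mk {g : MvPolynomial (Fin 2) K} (hg : IsUnit (MvPolynomial.aeval v g)) {d : ℕ}
    (hgd : g ∈ grading K d) (n : ℕ) (a : MvPolynomial (Fin 2) K) (ha : a ∈ grading K (n • d)) :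
    evalAway v g hg (Away.mk (grading K) hgd n a ha) * MvPolynomial.aeval v g ^ n =
      MvPolynomial.aeval v a := by
  have h := IsLocalization.Away.lift_eq (S := Localization.Away g) g
    (g := ((MvPolynomial.aeval v : MvPolynomial (Fin 2) K →ₐ[K] S) :
      MvPolynomial (Fin 2) K →+* S)) hg
  have h1 := h g
  have h2 := h a
  simp only [RingHom.coe_coe] at h1 h2
  rw [← h1, ← h2, evalAway, RingHom.comp_apply, ← map_pow, ← map_mul]
  congr 1
  rw [HomogeneousLocalization.algebraMap_apply, Away.val_mk, Localization.mk_eq_mk', ← map_pow]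
  exact IsLocalization.mk'_spec (Localization.Away g) a
    (⟨g ^ n, n, rfl⟩ : Submonoid.powers g)

lemma evalAway_awayMap {g h : MvPolynomial (Fin 2) K} {d e : ℕ} (hgd : g ∈ grading K d)
    (hhd : h ∈ grading K e)
    (hg : IsUnit (MvPolynomial.aeval v g)) {x : MvPolynomial (Fin 2) K} (hx : x = g * h)
    (hxu : IsUnit (MvPolynomial.aeval v x)) :
    (evalAway v x hxu).comp (awayMap (grading K) hhd hx) = evalAway v g hg := by
  ext z
  obtain ⟨n, a, ha, rfl⟩ := Away.mk_surjective (grading K) hgd z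
  refine (hg.pow n).mul_right_cancel ?_
  rw [evalAway_mk, RingHom.comp_apply]
  subst hx
  refine (hxu.pow n).mul_right_cancel ?_
  rw [awayMap_mk]
  have := evalAway_mk v hxu (SetLike.mul_mem_graded hgd hhd) n (a * h ^ n)
    (by rw [smul_add]; exact SetLike.mul_mem_graded ha (SetLike.pow_mem_graded n hhd))
  rw [mul_right_comm, this, map_mul, map_mul, map_pow, mul_pow]
  ring

lemma evalAway_smul {c : S} {g : MvPolynomial (Fin 2) K} {d : ℕ}
    (hgd : g ∈ grading K d) (hg : IsUnit (MvPolynomial.aeval v g))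
    (hg' : IsUnit (MvPolynomial.aeval (fun i => c * v i) g)) :
    evalAway (fun i => c * v i) g hg' = evalAway v g hg := by
  ext z
  obtain ⟨n, a, ha, rfl⟩ := Away.mk_surjective (grading K) hgd z
  refine (hg'.pow n).mul_right_cancel ?_
  have h1 : g.IsHomogeneous d := hgd
  have h2 : a.IsHomogeneous (n • d) := ha
  rw [evalAway_mk, aeval_mul_of_isHomogeneous h1, aeval_mul_of_isHomogeneous h2, mul_pow,
    mul_left_comm, evalAway_mk, ← pow_mul, smul_eq_mul, mul_comm d n]

lemma evalAway_algebraMap (g : MvPolynomial (Fin 2) K) (hg : IsUnit (MvPolynomial.aeval v g))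
    (a : K) : evalAway v g hg (fromZeroRingHom (grading K) _ (algebraMap K (grading K 0) a)) =
      algebraMap K S a := by
  have h := IsLocalization.Away.lift_eq (S := Localization.Away g) g
    (g := ((MvPolynomial.aeval v : MvPolynomial (Fin 2) K →ₐ[K] S) :
      MvPolynomial (Fin 2) K →+* S)) hg (MvPolynomial.C a)
  rw [RingHom.coe_coe, MvPolynomial.aeval_C] at h
  rw [← h]
  rfl

lemma map_evalAway {S' : Type u} [CommRing S'] [Algebra K S'] (φ : S →ₐ[K] S')
    {g : MvPolynomial (Fin 2) K} (hg : IsUnit (MvPolynomial.aeval v g))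
    (hg' : IsUnit (MvPolynomial.aeval (φ ∘ v) g)) :
    (φ : S →+* S').comp (evalAway v g hg) = evalAway (φ ∘ v) g hg' := by
  rw [evalAway, evalAway, ← RingHom.comp_assoc]
  congr 1
  apply IsLocalization.ringHom_ext (Submonoid.powers g)
  ext x
  · simp [IsLocalization.Away.lift]
  · simp [IsLocalization.Away.lift]

end

/-- The vector with coordinates `1` and `s`, where `1` is in place `j`. -/
def chartVec {S : Type u} [One S] (j : Fin 2) (s : S) : Fin 2 → S := fun i => if i = j then 1 else s

lemma isUnit_aeval_chartVec {S : Type u} [CommRing S] [Algebra K S] (j : Fin 2) (s : S) :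
    IsUnit (MvPolynomial.aeval (chartVec j s) (MvPolynomial.X j : MvPolynomial (Fin 2) K)) := by
  simp [chartVec]

variable (K)

/-- The ring of functions on a standard chart of the projective line is a polynomial ring. -/
def chartHom (j : Fin 2) : Away (grading K) (MvPolynomial.X j) →+* K[X] :=
  evalAway (chartVec j (X : K[X])) (MvPolynomial.X j) (isUnit_aeval_chartVec j X)

lemma chartHom_bijective (j : Fin 2) : Function.Bijective (chartHom K j) := by
  constructor
  · rw [injective_iff_map_eq_zero]
    intro z hz
    obtain ⟨n, a, ha, rfl⟩ := Away.mk_surjective (grading K) (X_mem_grading K j) z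
    have h1 := evalAway_mk (chartVec j (X : K[X])) (isUnit_aeval_chartVec j X)
      (X_mem_grading K j) n a ha
    change chartHom K j _ * _ = _ at h1
    rw [hz, zero_mul] at h1
    have ha' : a.IsHomogeneous n := by simpa using ha
    have h2 : a = 0 := by
      let M := FractionRing (MvPolynomial (Fin 2) K)
      have hinj : Function.Injective (algebraMap (MvPolynomial (Fin 2) K) M) :=
        IsFractionRing.injective _ _
      apply hinj
      set x : Fin 2 → M := fun i =>
        algebraMap (MvPolynomial (Fin 2) K) M (MvPolynomial.X i)
      have hxj : x j ≠ 0 := by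
        rw [Ne, ← map_zero (algebraMap (MvPolynomial (Fin 2) K) M)]
        exact fun h => MvPolynomial.X_ne_zero j (hinj h)
      have h3 : algebraMap _ M a = MvPolynomial.aeval x a := by
        have := MvPolynomial.aeval_algebraMap_apply (R := K) M
          (MvPolynomial.X : Fin 2 → MvPolynomial (Fin 2) K) a
        rw [MvPolynomial.aeval_X_left_apply] at this
        exact this.symm
      have h4 : x = fun i => x j * (chartVec j (x (1 - j) / x j)) i := by
        funext i
        fin_cases i <;> fin_cases j <;> simp [chartVec] <;>
        · rw [mul_div_cancel₀]
          exact hxj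
      have h5 : chartVec j (x (1 - j) / x j) =
          (aeval (x (1 - j) / x j) : K[X] →ₐ[K] M) ∘ chartVec j X := by
        funext i
        by_cases hi : i = j <;> simp [chartVec, hi]
      have h6 := MvPolynomial.comp_aeval_apply (chartVec j (X : K[X]))
        (aeval (x (1 - j) / x j) : K[X] →ₐ[K] M) a
      rw [← h1, map_zero] at h6
      rw [h3, h4, aeval_mul_of_isHomogeneous ha', h5, map_zero]
      exact mul_eq_zero_of_right _ h6.symm
    subst h2
    apply HomogeneousLocalization.val_injective
    rw [Away.val_mk, Localization.mk_zero, HomogeneousLocalization.val_zero]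
  · intro Q
    induction Q using Polynomial.induction_on' with
    | add p q hp hq =>
      obtain ⟨a, rfl⟩ := hp
      obtain ⟨b, rfl⟩ := hq
      exact ⟨a + b, map_add _ _ _⟩
    | monomial n c =>
      refine ⟨Away.mk (grading K) (X_mem_grading K j) n
        (MvPolynomial.C c * MvPolynomial.X (1 - j) ^ n) ?_, ?_⟩
      · rw [smul_eq_mul, mul_one]
        exact MvPolynomial.isHomogeneous_C_mul_X_pow c _ n
      · have h1 := evalAway_mk (chartVec j (X : K[X])) (isUnit_aeval_chartVec j X)
          (X_mem_grading K j) n (MvPolynomial.C c * MvPolynomial.X (1 - j) ^ n)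
        have h2 : (1 - j) ≠ j := by fin_cases j <;> decide
        simp [chartVec, h2, C_mul_X_pow_eq_monomial] at h1
        exact h1 (MvPolynomial.isHomogeneous_C_mul_X_pow c _ n)

end ProjectiveLine

section ProjectiveLine

open Polynomial HomogeneousLocalization

variable (K : Type u) [Field K]

/-- The coordinate ring of a standard chart is a polynomial ring. -/
def chartEquiv (j : Fin 2) : Away (grading K) (MvPolynomial.X j) ≃+* K[X] :=
  RingEquiv.ofBijective (chartHom K j) (chartHom_bijective K j)

/-- The standard charts of the projective line: the coordinate of the first one is `X₁ / X₀`, that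
of the second one is `X₀ / X₁`. -/
def chart (j : Fin 2) : Spec (.of K[X]) ⟶ P1 K :=
  Spec.map (CommRingCat.ofHom (chartEquiv K j : _ →+* K[X])) ≫
    Proj.awayι (grading K) (MvPolynomial.X j) (X_mem_grading K j) one_pos

instance (j : Fin 2) : IsIso (Spec.map (CommRingCat.ofHom
    (chartEquiv K j : Away (grading K) (MvPolynomial.X j) →+* K[X]))) :=
  inferInstanceAs (IsIso (Spec.map (chartEquiv K j).toCommRingCatIso.hom))

instance (j : Fin 2) : IsOpenImmersion (chart K j) :=
  inferInstanceAs (IsOpenImmersion (_ ≫ _))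

/-- The point with values in a ring `S` that has the coordinate `s` on a chart. -/
def chartPt {S : Type u} [CommRing S] [Algebra K S] (j : Fin 2) (s : S) : Spec (.of S) ⟶ P1 K :=
  Spec.map (CommRingCat.ofHom ((aeval s : K[X] →ₐ[K] S) : K[X] →+* S)) ≫ chart K j

variable {K}

lemma chartPt_eq {S : Type u} [CommRing S] [Algebra K S] (j : Fin 2) (s : S) :
    chartPt K j s = Spec.map (CommRingCat.ofHom (evalAway (chartVec j s) (MvPolynomial.X j)
      (isUnit_aeval_chartVec (K := K) j s))) ≫
      Proj.awayι (grading K) (MvPolynomial.X j) (X_mem_grading K j) one_pos := by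
  rw [chartPt, chart, ← Spec.map_comp_assoc, ← CommRingCat.ofHom_comp]
  congr 3
  have h : (aeval s : K[X] →ₐ[K] S) ∘ chartVec j X = chartVec j s := by
    funext i
    by_cases hi : i = j <;> simp [chartVec, hi]
  have h1 := map_evalAway (chartVec j (X : K[X])) (aeval s : K[X] →ₐ[K] S)
    (isUnit_aeval_chartVec (K := K) j X) (by rw [h]; exact isUnit_aeval_chartVec j s)
  simp only [h] at h1
  exact h1

lemma pt_eq_chartPt {E : Type u} [Field E] [Algebra K E] (x : E) :
    P1.pt K E x = chartPt K 1 x := by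
  have h : chartVec 1 x = ![x, 1] := by
    funext i
    fin_cases i <;> simp [chartVec]
  have h1 : P1.awayEval K E x = evalAway ![x, 1] (MvPolynomial.X 1) (by simp) := rfl
  rw [chartPt_eq, P1.pt, h1]
  simp only [h]

lemma chartPt_zero_eq {S : Type u} [CommRing S] [Algebra K S] (s s' : S) (h : s * s' = 1) :
    chartPt K 0 s = chartPt K 1 s' := by
  rw [chartPt_eq, chartPt_eq]
  have hs' : IsUnit s' := .of_mul_eq_one_right _ h
  have h1 : chartVec 1 s' = fun i => s' * chartVec 0 s i := by
    funext i
    fin_cases i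
    · simp [chartVec]
    · simpa [chartVec, mul_comm] using h.symm
  have hu0 : IsUnit (MvPolynomial.aeval (chartVec 0 s)
      (MvPolynomial.X 0 * MvPolynomial.X 1 : MvPolynomial (Fin 2) K)) := by
    simpa [chartVec] using IsUnit.of_mul_eq_one _ h
  have hu1 : IsUnit (MvPolynomial.aeval (chartVec 1 s')
      (MvPolynomial.X 0 * MvPolynomial.X 1 : MvPolynomial (Fin 2) K)) := by
    simpa [chartVec] using hs'
  rw [← evalAway_awayMap _ (X_mem_grading K 0) (X_mem_grading K 1)
      (isUnit_aeval_chartVec (K := K) 0 s) rfl hu0,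
    ← evalAway_awayMap _ (X_mem_grading K 1) (X_mem_grading K 0)
      (isUnit_aeval_chartVec (K := K) 1 s') (mul_comm _ _) hu1,
    CommRingCat.ofHom_comp, CommRingCat.ofHom_comp, Spec.map_comp_assoc, Spec.map_comp_assoc,
    Proj.SpecMap_awayMap_awayι, Proj.SpecMap_awayMap_awayι]
  congr 3
  simp only [h1]
  exact (evalAway_smul _ (SetLike.mul_mem_graded (X_mem_grading K 0) (X_mem_grading K 1)) _ _).symm

lemma chartPt_isOver {S : Type u} [CommRing S] [Algebra K S] (j : Fin 2) (s : S) :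
    chartPt K j s ≫ P1.struct K = Spec.map (CommRingCat.ofHom (algebraMap K S)) := by
  rw [chartPt_eq, P1.struct, Category.assoc, Proj.awayι_toSpecZero_assoc, ← Spec.map_comp,
    ← Spec.map_comp]
  congr 1
  ext a
  exact evalAway_algebraMap _ _ (isUnit_aeval_chartVec j s) a

lemma opensRange_chart (j : Fin 2) :
    (chart K j).opensRange = Proj.basicOpen (grading K) (MvPolynomial.X j) :=
  (Scheme.Hom.opensRange_comp_of_isIso _ _).trans
    (Proj.opensRange_awayι (grading K) _ (X_mem_grading K j) one_pos)

lemma exists_mem_range_chart (x : P1 K) : ∃ j, x ∈ (chart K j).opensRange := by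
  have h : ⨆ j : Fin 2, Proj.basicOpen (grading K) (MvPolynomial.X j) = ⊤ := by
    refine Proj.iSup_basicOpen_eq_top' (grading K) _ (fun j => ⟨1, X_mem_grading K j⟩) ?_
    rw [eq_top_iff]
    rintro p -
    induction p using MvPolynomial.induction_on with
    | C a => exact Subalgebra.algebraMap_mem _ (algebraMap K (grading K 0) a)
    | add p q hp hq => exact add_mem hp hq
    | mul_X p i hp => exact mul_mem hp (Algebra.subset_adjoin ⟨i, rfl⟩)
  have h1 : x ∈ ⨆ j : Fin 2, Proj.basicOpen (grading K) (MvPolynomial.X j) := h ▸ trivial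
  obtain ⟨j, hj⟩ := TopologicalSpace.Opens.mem_iSup.1 h1
  refine ⟨j, ?_⟩
  rwa [opensRange_chart]

end ProjectiveLine

/-! ### Residue fields of points with values in a field -/

section FieldPoints

open IsLocalRing

variable {Y P : Scheme.{u}} {M : Type u} [Field M]

lemma exists_fac_residueField (z : Spec (.of M) ⟶ Y) :
    ∃ ψ : Y.residueField (z (closedPoint M)) ⟶ .of M,
      Spec.map ψ ≫ Y.fromSpecResidueField _ = z :=
  ⟨_, Scheme.descResidueField_stalkClosedPointTo_fromSpecResidueField M Y z⟩

lemma SpecMap_fromSpecResidueField_apply {p : Y} (ψ : Y.residueField p ⟶ .of M) :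
    (Spec.map ψ ≫ Y.fromSpecResidueField p) (closedPoint M) = p :=
  Y.fromSpecResidueField_apply p _

lemma SpecMap_fromSpecResidueField_injective {p : Y} {ψ ψ' : Y.residueField p ⟶ .of M}
    (h : Spec.map ψ ≫ Y.fromSpecResidueField p = Spec.map ψ' ≫ Y.fromSpecResidueField p) :
    ψ = ψ' := by
  have := (Scheme.SpecToEquivOfField M Y).symm.injective (a₁ := ⟨p, ψ⟩) (a₂ := ⟨p, ψ'⟩) h
  simpa using this

lemma ptField_eq_fieldRange {p : Y} (ψ : Y.residueField p ⟶ .of M) :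
    ptField (Spec.map ψ ≫ Y.fromSpecResidueField p) = ψ.hom.fieldRange := by
  have h := (Scheme.SpecToEquivOfField M Y).apply_symm_apply ⟨p, ψ⟩
  unfold ptField
  change Scheme.SpecToEquivOfField M Y (Spec.map ψ ≫ Y.fromSpecResidueField p) = ⟨p, ψ⟩ at h
  rw [h]

lemma comp_fromSpecResidueField (h : Y ⟶ P) {p : Y} (ψ : Y.residueField p ⟶ .of M) :
    (Spec.map ψ ≫ Y.fromSpecResidueField p) ≫ h =
      Spec.map (h.residueFieldMap p ≫ ψ) ≫ P.fromSpecResidueField (h p) := by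
  rw [Spec.map_comp, Category.assoc, Category.assoc,
    Scheme.Hom.SpecMap_residueFieldMap_fromSpecResidueField]

lemma ptField_comp_le (z : Spec (.of M) ⟶ Y) (h : Y ⟶ P) : ptField (z ≫ h) ≤ ptField z := by
  obtain ⟨ψ, hψ⟩ := exists_fac_residueField z
  generalize z (closedPoint M) = p at ψ hψ
  subst hψ
  rw [comp_fromSpecResidueField, ptField_eq_fieldRange, ptField_eq_fieldRange]
  rintro _ ⟨a, rfl⟩
  exact ⟨_, rfl⟩

lemma ptField_comp_of_surjective (z : Spec (.of M) ⟶ Y) (h : Y ⟶ P)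
    (hs : Function.Surjective (h.residueFieldMap (z (closedPoint M))).hom) :
    ptField (z ≫ h) = ptField z := by
  obtain ⟨ψ, hψ⟩ := exists_fac_residueField z
  generalize z (closedPoint M) = p at ψ hψ hs
  subst hψ
  refine le_antisymm (ptField_comp_le _ _) ?_
  rw [comp_fromSpecResidueField, ptField_eq_fieldRange, ptField_eq_fieldRange]
  rintro _ ⟨a, rfl⟩
  obtain ⟨b, rfl⟩ := hs a
  exact ⟨b, rfl⟩

lemma ptField_map {M' : Type u} [Field M'] (σ : M →+* M') (z : Spec (.of M) ⟶ Y) :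
    ptField (Spec.map (CommRingCat.ofHom σ) ≫ z) = (ptField z).map σ := by
  obtain ⟨ψ, hψ⟩ := exists_fac_residueField z
  generalize z (closedPoint M) = p at ψ hψ
  subst hψ
  rw [← Spec.map_comp_assoc, ptField_eq_fieldRange, ptField_eq_fieldRange]
  exact (RingHom.map_fieldRange σ ψ.hom).symm

lemma range_le_ptField {R : CommRingCat.{u}} (φ : R ⟶ .of M) (a : R) :
    φ.hom a ∈ ptField (Spec.map φ) := by
  obtain ⟨ψ, hψ⟩ := exists_fac_residueField (Spec.map φ)
  generalize (Spec.map φ) (closedPoint M) = p at ψ hψ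
  obtain ⟨ρ, hρ⟩ := Spec.map_surjective ((Spec R).fromSpecResidueField p)
  rw [← hρ, ← Spec.map_comp, Spec.map_inj] at hψ
  subst hψ
  have := ptField_eq_fieldRange (Y := Spec R) ψ
  rw [← hρ, ← Spec.map_comp] at this
  rw [this]
  exact ⟨_, rfl⟩

lemma ptField_eq_top {y : Spec (.of M) ⟶ Y} [SurjectiveOnStalks y] : ptField y = ⊤ := by
  rw [eq_top_iff]
  rintro a -
  have h1 := y.stalkMap_surjective (closedPoint M)
  have h2 : Function.Surjective (Scheme.stalkClosedPointTo y).hom := by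
    unfold Scheme.stalkClosedPointTo
    exact (ConcreteCategory.bijective_of_isIso (stalkClosedPointIso (.of M)).hom).2.comp h1
  obtain ⟨b, rfl⟩ := h2 a
  refine ⟨(Y.residue _).hom b, ?_⟩
  exact congrArg (fun φ => φ.hom b) (Y.residue_descResidueField (Scheme.stalkClosedPointTo y))

lemma exists_fac_residueField_of_eq (z : Spec (.of M) ⟶ Y) {p : Y} (hz : z (closedPoint M) = p) :
    ∃ ψ : Y.residueField p ⟶ .of M, Spec.map ψ ≫ Y.fromSpecResidueField p = z := by
  subst hz
  exact exists_fac_residueField z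

/-- A point with values in a field is determined by its image under a morphism that is an
isomorphism on residue fields, if the underlying point is known. -/
lemma eq_of_comp_eq {h : Y ⟶ P} {p : Y} (hs : Function.Surjective (h.residueFieldMap p).hom)
    {z z' : Spec (.of M) ⟶ Y} (hz : z (closedPoint M) = p) (hz' : z' (closedPoint M) = p)
    (hzz : z ≫ h = z' ≫ h) : z = z' := by
  obtain ⟨ψ, rfl⟩ := exists_fac_residueField_of_eq z hz
  obtain ⟨ψ', rfl⟩ := exists_fac_residueField_of_eq z' hz'
  rw [comp_fromSpecResidueField, comp_fromSpecResidueField] at hzz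
  have h1 := SpecMap_fromSpecResidueField_injective hzz
  congr 2
  ext a
  obtain ⟨b, rfl⟩ := hs a
  exact congrArg (fun φ => φ.hom b) h1

lemma exists_comp_eq {h : Y ⟶ P} {p : Y} (hs : Function.Surjective (h.residueFieldMap p).hom)
    {w : Spec (.of M) ⟶ P} (hw : w (closedPoint M) = h p) :
    ∃ z : Spec (.of M) ⟶ Y, z ≫ h = w ∧ z (closedPoint M) = p := by
  obtain ⟨χ, hχ⟩ := exists_fac_residueField w
  generalize w (closedPoint M) = q at χ hχ hw
  subst hw
  subst hχ
  have : IsIso (h.residueFieldMap p) := by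
    rw [ConcreteCategory.isIso_iff_bijective]
    exact ⟨(h.residueFieldMap p).hom.injective, hs⟩
  refine ⟨Spec.map (inv (h.residueFieldMap p) ≫ χ) ≫ Y.fromSpecResidueField p, ?_,
    SpecMap_fromSpecResidueField_apply _⟩
  rw [comp_fromSpecResidueField, IsIso.hom_inv_id_assoc]

end FieldPoints

/-! ### Points of the projective line -/

section ProjectiveLine

open Polynomial HomogeneousLocalization IsLocalRing

lemma isDominant_specMap {R S : Type u} [CommRing R] [CommRing S] {φ : R →+* S}
    (hφ : Function.Injective φ) : IsDominant (Spec.map (CommRingCat.ofHom φ)) := by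
  refine ⟨?_⟩
  refine (PrimeSpectrum.denseRange_comap_iff_ker_le_nilRadical (f := φ)).2 ?_
  rw [(RingHom.injective_iff_ker_eq_bot φ).1 hφ]
  exact bot_le

lemma isDominant_of_forall_exists {X Y : Scheme.{u}} (h : X ⟶ Y)
    (H : ∀ y : Y, ∃ (U : Scheme.{u}) (j : U ⟶ Y) (k : X ⟶ U) (_ : IsOpenImmersion j), IsDominant k ∧
      k ≫ j = h ∧ y ∈ j.opensRange) : IsDominant h := by
  refine ⟨fun y => ?_⟩
  obtain ⟨U, j, k, hj, hk, rfl, x, rfl⟩ := H y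
  have h1 : x ∈ closure (Set.range k) := k.denseRange x
  have h2 := image_closure_subset_closure_image j.continuous ⟨x, h1, rfl⟩
  convert h2 using 2
  rw [← Set.range_comp]
  rfl

variable (K : Type u) [Field K]

instance : (P1 K).IsSeparated :=
  inferInstanceAs ((Proj (MvPolynomial.homogeneousSubmodule (Fin 2) K)).IsSeparated)

instance : IsProper (P1.struct K) := by
  have h1 : Function.Bijective (algebraMap K (grading K 0)) := by
    refine ⟨fun a b h => MvPolynomial.C_injective _ _ (congrArg Subtype.val h),
      fun ⟨a, ha⟩ => ?_⟩
    rw [grading, MvPolynomial.homogeneousSubmodule_zero, Submodule.mem_one] at ha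
    obtain ⟨b, rfl⟩ := ha
    exact ⟨b, rfl⟩
  have h2 : Algebra.FiniteType (grading K 0) (MvPolynomial (Fin 2) K) :=
    have : IsScalarTower K (grading K 0) (MvPolynomial (Fin 2) K) :=
      ⟨fun a b c => smul_mul_assoc a (b : MvPolynomial (Fin 2) K) c⟩
    .of_restrictScalars_finiteType K _ _
  have h3 : IsIso (Spec.map (CommRingCat.ofHom (algebraMap K (grading K 0)))) :=
    inferInstanceAs (IsIso (Spec.map (RingEquiv.ofBijective _ h1).toCommRingCatIso.hom))
  unfold P1.struct
  infer_instance

variable {K}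

lemma specMap_chartPt {S S' : Type u} [CommRing S] [CommRing S'] [Algebra K S] [Algebra K S']
    (φ : S →ₐ[K] S') (j : Fin 2) (s : S) :
    Spec.map (CommRingCat.ofHom (φ : S →+* S')) ≫ chartPt K j s = chartPt K j (φ s) := by
  rw [chartPt, chartPt, ← Spec.map_comp_assoc, ← CommRingCat.ofHom_comp]
  congr 3
  ext <;> simp

lemma chart_eq (j : Fin 2) : chart K j = chartPt K j (X : K[X]) := by
  have : ((aeval (X : K[X]) : K[X] →ₐ[K] K[X]) : K[X] →+* K[X]) = RingHom.id _ := by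
    ext <;> simp
  rw [chartPt, this, CommRingCat.ofHom_id, Spec.map_id, Category.id_comp]

lemma chartPt_injective {S : Type u} [CommRing S] [Algebra K S] (j : Fin 2) {s s' : S}
    (h : chartPt K j s = chartPt K j s') : s = s' := by
  rw [chartPt, chartPt, cancel_mono, Spec.map_inj] at h
  simpa using congrArg (fun φ => φ.hom X) h

section Points

variable {M : Type u} [Field M] [Algebra K M]

lemma transcendental_inv {s : M} (hs : Transcendental K s) : Transcendental K s⁻¹ :=
  fun h => hs (by simpa using h.inv)

lemma chartPt_swap {s : M} (hs : s ≠ 0) (i j : Fin 2) :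
    ∃ s' : M, (s' = s ∨ s' = s⁻¹) ∧ chartPt K i s = chartPt K j s' := by
  fin_cases i <;> fin_cases j
  · exact ⟨s, .inl rfl, rfl⟩
  · exact ⟨s⁻¹, .inr rfl, chartPt_zero_eq _ _ (mul_inv_cancel₀ hs)⟩
  · exact ⟨s⁻¹, .inr rfl, (chartPt_zero_eq _ _ (inv_mul_cancel₀ hs)).symm⟩
  · exact ⟨s, .inl rfl, rfl⟩

lemma isDominant_chartPt {s : M} (hs : Transcendental K s) (i : Fin 2) :
    IsDominant (chartPt K i s) := by
  refine isDominant_of_forall_exists _ fun p => ?_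
  obtain ⟨j, hj⟩ := exists_mem_range_chart p
  have hs0 : s ≠ 0 := fun h => hs (by rw [h]; exact isAlgebraic_zero)
  obtain ⟨s', hs', h⟩ := chartPt_swap (K := K) hs0 i j
  have hs2 : Transcendental K s' := by
    obtain rfl | rfl := hs'
    exacts [hs, transcendental_inv hs]
  exact ⟨_, chart K j, _, inferInstance,
    isDominant_specMap (transcendental_iff_injective.1 hs2), h.symm, hj⟩

/-- The standard affine cover of the projective line. -/
def chartCover (K : Type u) [Field K] : (P1 K).OpenCover :=
  Scheme.Cover.mkOfCovers (Fin 2) _ (chart K)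
    (fun x => by
      obtain ⟨j, y, hy⟩ := exists_mem_range_chart x
      exact ⟨j, y, hy⟩)
    (fun j => inferInstanceAs (IsOpenImmersion (chart K j)))

instance : IsReduced (P1 K) :=
  have (i : (chartCover K).I₀) : IsReduced ((chartCover K).X i) :=
    inferInstanceAs (IsReduced (Spec (.of K[X])))
  .of_openCover _ (chartCover K)

instance : AlgebraicGeometry.IsIntegral (P1 K) := by
  have h := isDominant_chartPt (K := K) (M := RatFunc K) (s := RatFunc.X)
    RatFunc.transcendental_X 1
  have : IrreducibleSpace (P1 K) := by
    rw [irreducibleSpace_def]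
    change IsIrreducible Set.univ
    rw [← (chartPt K 1 (RatFunc.X : RatFunc K)).denseRange.closure_range,
      ← Set.image_univ]
    exact ((IrreducibleSpace.isIrreducible_univ _).image _
      (chartPt K 1 (RatFunc.X : RatFunc K)).continuous.continuousOn).closure
  exact isIntegral_of_irreducibleSpace_of_isReduced _

lemma exists_eq_chartPt {w : Spec (.of M) ⟶ P1 K}
    (hw : w ≫ P1.struct K = Spec.map (CommRingCat.ofHom (algebraMap K M))) :
    ∃ j s, w = chartPt K j s := by
  obtain ⟨j, hj⟩ := exists_mem_range_chart (w (closedPoint M))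
  have h1 : Set.range w ⊆ Set.range (chart K j) := by
    rintro _ ⟨p, rfl⟩
    rwa [Subsingleton.elim p (closedPoint M)]
  obtain ⟨φ, hφ⟩ := Spec.map_surjective (IsOpenImmersion.lift (chart K j) w h1)
  have h2 := IsOpenImmersion.lift_fac (chart K j) w h1
  rw [← hφ] at h2
  rw [← h2, Category.assoc, chart_eq, chartPt_isOver, ← Spec.map_comp, Spec.map_inj] at hw
  refine ⟨j, φ.hom X, ?_⟩
  rw [← h2, chartPt]
  congr 2
  ext a
  · simpa using congrArg (fun ψ => ψ.hom a) hw
  · simp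

lemma mem_ptField_chartPt (j : Fin 2) (s : M) : s ∈ ptField (chartPt K j s) := by
  rw [chartPt, ptField_comp_of_surjective]
  · simpa using range_le_ptField (CommRingCat.ofHom
      ((aeval s : K[X] →ₐ[K] M) : K[X] →+* M)) X
  · exact (ConcreteCategory.bijective_of_isIso _).2

lemma ptField_chartPt_le (F : IntermediateField K M) (j : Fin 2) {s : M} (hs : s ∈ F) :
    ptField (chartPt K j s) ≤ F.toSubfield := by
  have h := specMap_chartPt (K := K) F.val j ⟨s, hs⟩
  have h1 : F.val ⟨s, hs⟩ = s := rfl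
  rw [h1] at h
  rw [← h, ptField_map]
  rintro _ ⟨a, -, rfl⟩
  exact a.2

lemma exists_eq_pt {w : Spec (.of M) ⟶ P1 K}
    (hw : w ≫ P1.struct K = Spec.map (CommRingCat.ofHom (algebraMap K M)))
    {b : M} (hb : b ∈ ptField w) (hb' : Transcendental K b) :
    ∃ x : M, Transcendental K x ∧ w = P1.pt K M x := by
  obtain ⟨j, s, rfl⟩ := exists_eq_chartPt hw
  have hs : Transcendental K s := fun h =>
    hb' (mem_algebraicClosure_iff.1 (ptField_chartPt_le (algebraicClosure K M) j
      (mem_algebraicClosure_iff.2 h) hb))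
  obtain ⟨s', hs', h⟩ := chartPt_swap (K := K) (s := s)
    (fun h => hs (by rw [h]; exact isAlgebraic_zero)) j 1
  refine ⟨s', ?_, h.trans (pt_eq_chartPt _).symm⟩
  obtain rfl | rfl := hs'
  exacts [hs, transcendental_inv hs]

lemma pt_injective {x x' : M} (h : P1.pt K M x = P1.pt K M x') : x = x' := by
  rw [pt_eq_chartPt, pt_eq_chartPt] at h
  exact chartPt_injective 1 h

lemma specMap_pt {M' : Type u} [Field M'] [Algebra K M'] (φ : M →ₐ[K] M') (x : M) :
    Spec.map (CommRingCat.ofHom (φ : M →+* M')) ≫ P1.pt K M x = P1.pt K M' (φ x) := by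
  rw [pt_eq_chartPt, pt_eq_chartPt, specMap_chartPt]

lemma mem_ptField_pt (x : M) : x ∈ ptField (P1.pt K M x) :=
  pt_eq_chartPt (K := K) x ▸ mem_ptField_chartPt 1 x

end Points
end ProjectiveLine

/-! ### The endomorphism of the projective line given by a rational function -/

section Gluing

/-- Morphisms on the members of an open cover of `X` glue if they all restrict to the same
morphism on a dominant `W ⟶ X` that factors through every member of the cover. -/
lemma exists_glue_of_isDominant {W X Z : Scheme.{u}} [IsReduced X] [Z.IsSeparated]
    (𝒰 : X.OpenCover) (i : 𝒰.I₀) (ξ : W ⟶ X) [IsDominant ξ] (ψ : W ⟶ Z) (ξ' : ∀ k, W ⟶ 𝒰.X k)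
    (hξ' : ∀ k, ξ' k ≫ 𝒰.f k = ξ) (φ : ∀ k, 𝒰.X k ⟶ Z) (hφ : ∀ k, ξ' k ≫ φ k = ψ) :
    ∃ F : X ⟶ Z, ξ ≫ F = ψ := by
  suffices h : ∀ j k, pullback.fst (𝒰.f j) (𝒰.f k) ≫ φ j = pullback.snd _ _ ≫ φ k from
    ⟨𝒰.glueMorphisms φ h, by rw [← hξ' i, Category.assoc, 𝒰.ι_glueMorphisms, hφ]⟩
  intro j k
  let ι : W ⟶ pullback (𝒰.f j) (𝒰.f k) := pullback.lift (ξ' j) (ξ' k) ((hξ' j).trans (hξ' k).symm)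
  have h1 : ι ≫ pullback.fst _ _ ≫ 𝒰.f j = ξ := by rw [pullback.lift_fst_assoc, hξ']
  have : IsDominant (ι ≫ pullback.fst _ _ ≫ 𝒰.f j) := h1 ▸ inferInstance
  have : IsDominant ι := IsDominant.of_comp_of_isOpenImmersion ι (pullback.fst _ _ ≫ 𝒰.f j)
  have : IsReduced (pullback (𝒰.f j) (𝒰.f k)) :=
    isReduced_of_isOpenImmersion (pullback.fst (𝒰.f j) (𝒰.f k) ≫ 𝒰.f j)
  refine ext_of_isDominant ι ?_
  rw [pullback.lift_fst_assoc, pullback.lift_snd_assoc, hφ, hφ]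

end Gluing

section Gluing

lemma exists_glue_of_family {W X Z : Scheme.{u}} [IsReduced X] [Z.IsSeparated] {J : Type}
    (i : J) {U : J → Scheme.{u}} (u : ∀ k, U k ⟶ X) (hu : ∀ k, IsOpenImmersion (u k))
    (hcov : ∀ x, ∃ k y, u k y = x) (ξ : W ⟶ X) [IsDominant ξ] (ψ : W ⟶ Z) (ξ' : ∀ k, W ⟶ U k)
    (hξ' : ∀ k, ξ' k ≫ u k = ξ) (φ : ∀ k, U k ⟶ Z) (hφ : ∀ k, ξ' k ≫ φ k = ψ) :
    ∃ F : X ⟶ Z, ξ ≫ F = ψ :=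
  exists_glue_of_isDominant (Scheme.Cover.mkOfCovers J U u hcov hu) i ξ ψ ξ' hξ' φ hφ

end Gluing

section RatCharts

open Polynomial IsLocalRing

/-- The coordinate of a standard chart of the projective line, as a rational function. -/
def ratCoord (K : Type u) [Field K] (j : Fin 2) : RatFunc K := if j = 1 then RatFunc.X else
  RatFunc.X⁻¹

/-- The coordinate ring of a standard chart of the projective line, as a subring of the function
field: the polynomial ring in `X` or in `X⁻¹`. -/
def ChartRing (K : Type u) [Field K] (_ : Fin 2) : Type u := K[X]

variable {K : Type u} [Field K] (j : Fin 2)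

instance : CommRing (ChartRing K j) := inferInstanceAs (CommRing K[X])
instance : IsDomain (ChartRing K j) := inferInstanceAs (IsDomain K[X])
instance : IsPrincipalIdealRing (ChartRing K j) := inferInstanceAs (IsPrincipalIdealRing K[X])
instance : Algebra K (ChartRing K j) := inferInstanceAs (Algebra K K[X])

/-- The coordinate ring of a chart as a polynomial ring. -/
def chartRingEquiv (K : Type u) [Field K] (j : Fin 2) : K[X] ≃ₐ[K] ChartRing K j := AlgEquiv.refl

instance : Algebra (ChartRing K j) (RatFunc K) :=
  (((aeval (ratCoord K j)).comp (chartRingEquiv K j).symm.toAlgHom : ChartRing K j →ₐ[K] RatFunc K)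
    : ChartRing K j →+* RatFunc K).toAlgebra

instance : IsScalarTower K (ChartRing K j) (RatFunc K) :=
  .of_algebraMap_eq fun a => (((aeval (ratCoord K j)).comp
    (chartRingEquiv K j).symm.toAlgHom).commutes a).symm

lemma algebraMap_chartRing (p : K[X]) :
    algebraMap (ChartRing K j) (RatFunc K) (chartRingEquiv K j p) = aeval (ratCoord K j) p := rfl

lemma transcendental_ratCoord : Transcendental K (ratCoord K j) := by
  unfold ratCoord
  split_ifs
  · exact RatFunc.transcendental_X
  · exact transcendental_inv RatFunc.transcendental_X

instance : FaithfulSMul (ChartRing K j) (RatFunc K) :=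
  (faithfulSMul_iff_algebraMap_injective _ _).2
    (transcendental_iff_injective.1 (transcendental_ratCoord j))

instance : IsFractionRing (ChartRing K j) (RatFunc K) := by
  refine IsFractionRing.of_field _ _ fun z => ?_
  have h : K⟮ratCoord K j⟯ = ⊤ := by
    rw [eq_top_iff, ← RatFunc.adjoin_X, adjoin_simple_le_iff]
    unfold ratCoord
    split_ifs
    · exact mem_adjoin_simple_self K _
    · simpa using inv_mem (mem_adjoin_simple_self K (RatFunc.X : RatFunc K)⁻¹)
  obtain ⟨r, s, h⟩ := (mem_adjoin_simple_iff K z).1 (h ▸ mem_top : z ∈ K⟮ratCoord K j⟯)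
  exact ⟨chartRingEquiv K j r, chartRingEquiv K j s, h⟩

lemma chartPt_ratCoord : chartPt K j (ratCoord K j) = P1.pt K (RatFunc K) RatFunc.X := by
  rw [pt_eq_chartPt]
  fin_cases j
  · exact chartPt_zero_eq _ _ (inv_mul_cancel₀ RatFunc.X_ne_zero)
  · rfl

lemma exists_coprime_chart (f : RatFunc K) :
    ∃ A B : K[X], IsCoprime A B ∧ B ≠ 0 ∧
      aeval (ratCoord K j) A = f * aeval (ratCoord K j) B := by
  obtain ⟨a, b, hab, h⟩ := IsFractionRing.exists_reduced_fraction (A := ChartRing K j) f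
  rw [isRelPrime_iff_isCoprime] at hab
  obtain ⟨A, rfl⟩ := (chartRingEquiv K j).surjective a
  obtain ⟨B, hB⟩ := (chartRingEquiv K j).surjective (b : ChartRing K j)
  have h1 := IsLocalization.mk'_spec (RatFunc K) (chartRingEquiv K j A) b
  rw [h, ← hB, algebraMap_chartRing, algebraMap_chartRing] at h1
  refine ⟨A, B, ?_, fun h0 => nonZeroDivisors.coe_ne_zero b (by rw [← hB, h0, map_zero]), h1.symm⟩
  rw [← hB] at hab
  simpa using hab.map ((chartRingEquiv K j).symm : ChartRing K j →+* K[X])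

end RatCharts

section Morphism

open Polynomial IsLocalRing

variable {K : Type u} [Field K] {f : RatFunc K}

/-- The intersection of a standard chart of the projective line with the locus where a polynomial in
its coordinate does not vanish. -/
def basicChart (K : Type u) [Field K] (j : Fin 2) (P : K[X]) :
    Spec (.of (Localization.Away P)) ⟶ P1 K :=
  Spec.map (CommRingCat.ofHom (algebraMap K[X] (Localization.Away P))) ≫ chart K j

instance (j : Fin 2) (P : K[X]) : IsOpenImmersion (basicChart K j P) :=
  inferInstanceAs (IsOpenImmersion (_ ≫ _))

lemma exists_basicChart_eq (D : Fin 2 → Fin 2 → K[X]) (hD : ∀ j, IsCoprime (D j 0) (D j 1))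
    (x : P1 K) : ∃ (k : Fin 2 × Fin 2) (y : Spec (.of (Localization.Away (D k.1 k.2)))),
      basicChart K k.1 (D k.1 k.2) y = x := by
  obtain ⟨j, p, rfl⟩ := exists_mem_range_chart x
  obtain ⟨i, hi⟩ : ∃ i, D j i ∉ p.asIdeal := by
    by_contra! hp
    obtain ⟨a, b, hab⟩ := hD j
    exact p.2.ne_top ((Ideal.eq_top_iff_one _).2 (hab ▸ add_mem
      (Ideal.mul_mem_left _ _ (hp 0)) (Ideal.mul_mem_left _ _ (hp 1))))
  obtain ⟨q, hq⟩ : p ∈ Set.range (PrimeSpectrum.comap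
      (algebraMap K[X] (Localization.Away (D j i)))) := by
    rw [PrimeSpectrum.localization_away_comap_range _ (D j i)]
    exact hi
  exact ⟨(j, i), q, congrArg (chart K j) hq⟩

lemma exists_chart_quotient (D : Fin 2 → Fin 2 → K[X]) (hD : ∀ j i, D j i ≠ 0) (f : RatFunc K)
    (hD' : ∀ j i, aeval (ratCoord K j) (D j (i + 1)) =
      (if i = 1 then f else f⁻¹) * aeval (ratCoord K j) (D j i)) (j i : Fin 2) :
    ∃ (ρ : Localization.Away (D j i) →ₐ[K] RatFunc K) (N : Localization.Away (D j i)),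
      Spec.map (CommRingCat.ofHom (ρ : _ →+* RatFunc K)) ≫
        basicChart K j (D j i) = P1.pt K (RatFunc K) RatFunc.X ∧ ρ N = if i = 1 then f else f⁻¹ := by
  have hu : IsUnit (aeval (ratCoord K j) (D j i)) :=
    isUnit_iff_ne_zero.2 (mt (transcendental_iff.1 (transcendental_ratCoord j) (D j i)) (hD j i))
  let ρ : Localization.Away (D j i) →ₐ[K] RatFunc K :=
    IsLocalization.liftAlgHom (M := Submonoid.powers (D j i))
      (f := aeval (ratCoord K j)) (by
        rintro ⟨_, n, rfl⟩
        rw [map_pow]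
        exact hu.pow n)
  have hρ : ∀ p, ρ (algebraMap K[X] _ p) = aeval (ratCoord K j) p := fun p =>
    IsLocalization.lift_eq _ _
  clear_value ρ
  refine ⟨ρ, IsLocalization.mk' _ (D j (i + 1)) ⟨D j i, Submonoid.mem_powers _⟩, ?_, ?_⟩
  · rw [basicChart, ← Spec.map_comp_assoc, ← CommRingCat.ofHom_comp, ← chartPt_ratCoord j, chartPt]
    exact congrArg (fun φ => Spec.map (CommRingCat.ofHom φ) ≫ chart K j) (RingHom.ext hρ)
  · have h1 := congrArg ρ (IsLocalization.mk'_spec (Localization.Away (D j i))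
      (D j (i + 1)) ⟨D j i, Submonoid.mem_powers _⟩)
    rw [map_mul, hρ, hρ, hD'] at h1
    exact mul_right_cancel₀ hu.ne_zero h1

/-- The endomorphism of the projective line given by a rational function exists: it is glued from
its restrictions to the four affine open sets that are the intersections of a standard chart with
the preimage of a standard chart. -/
theorem exists_isMorphismOf (hf0 : f ≠ 0) : ∃ F : P1 K ⟶ P1 K, IsMorphismOf f F := by
  choose A B hAB hB h using fun j => exists_coprime_chart (K := K) j f
  have hA : ∀ j, A j ≠ 0 := fun j h0 => by
    have h1 := h j
    rw [h0, map_zero] at h1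
    exact mul_ne_zero hf0 (mt (transcendental_iff.1 (transcendental_ratCoord j) (B j)) (hB j))
      h1.symm
  let D : Fin 2 → Fin 2 → K[X] := fun j => ![A j, B j]
  have hD : ∀ j i, D j i ≠ 0 := fun j i => by
    fin_cases i
    exacts [hA j, hB j]
  have hD' : ∀ j i, aeval (ratCoord K j) (D j (i + 1)) =
      (if i = 1 then f else f⁻¹) * aeval (ratCoord K j) (D j i) := fun j i => by
    fin_cases i
    · simp only [D]
      simp [h j, hf0]
    · exact h j
  have hD0 : ∀ j, IsCoprime (D j 0) (D j 1) := hAB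
  clear_value D
  choose ρ N hρ hN using fun k : Fin 2 × Fin 2 => exists_chart_quotient D hD f hD' k.1 k.2
  have hdom : IsDominant (P1.pt K (RatFunc K) RatFunc.X) :=
    pt_eq_chartPt (K := K) (RatFunc.X : RatFunc K) ▸ isDominant_chartPt RatFunc.transcendental_X 1
  have hN' : ∀ k, Spec.map (CommRingCat.ofHom (ρ k : _ →+* RatFunc K)) ≫ chartPt K k.2 (N k) =
      P1.pt K (RatFunc K) f := fun k => by
    rw [specMap_chartPt, hN, pt_eq_chartPt]
    obtain ⟨j, i⟩ := k
    fin_cases i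
    · exact chartPt_zero_eq _ _ (inv_mul_cancel₀ hf0)
    · rfl
  obtain ⟨F, hgen⟩ := exists_glue_of_family (J := Fin 2 × Fin 2) (1, 1)
    _ (fun k => inferInstanceAs (IsOpenImmersion (basicChart K k.1 (D k.1 k.2))))
    (exists_basicChart_eq D hD0) (P1.pt K (RatFunc K) RatFunc.X) (P1.pt K (RatFunc K) f) _ hρ _ hN'
  refine ⟨F, ext_of_isDominant (P1.pt K (RatFunc K) RatFunc.X) ?_, hgen⟩
  rw [reassoc_of% hgen, pt_eq_chartPt, pt_eq_chartPt, chartPt_isOver, chartPt_isOver]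

lemma evalMap_X (f : RatFunc K) : evalMap f (RatFunc K) RatFunc.X = f := by
  have h (p : K[X]) : p.eval₂ (algebraMap K (RatFunc K)) RatFunc.X = algebraMap _ _ p := by
    rw [← aeval_def, ← RatFunc.algebraMap_X, aeval_algebraMap_apply, aeval_X_left_apply]
  rw [evalMap, RatFunc.eval, h, h, RatFunc.num_div_denom]

variable {M : Type u} [Field M] [Algebra K M] {F : P1 K ⟶ P1 K}

lemma exists_algHom_ratFunc {x : M} (hx : Transcendental K x) :
    ∃ φ : RatFunc K →ₐ[K] M, φ RatFunc.X = x := by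
  refine ⟨RatFunc.liftAlgHom (aeval x) (nonZeroDivisors_le_comap_nonZeroDivisors_of_injective _
    (transcendental_iff_injective.1 hx)), ?_⟩
  rw [← RatFunc.algebraMap_X]
  exact (RatFunc.liftRingHom_algebraMap ((aeval x : K[X] →ₐ[K] M) : K[X] →+* M) _ X).trans (aeval_X x)

/-- The endomorphism attached to `f` acts on points with transcendental coordinate by `f`. -/
lemma IsMorphismOf.pt_comp (hF : IsMorphismOf f F) {x : M} (hx : Transcendental K x) :
    P1.pt K M x ≫ F = P1.pt K M (evalMap f M x) := by
  obtain ⟨φ, rfl⟩ := exists_algHom_ratFunc hx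
  rw [← specMap_pt, Category.assoc, hF.generic, specMap_pt, ← evalMap_hom, evalMap_X]

lemma isOver_pt (x : M) :
    P1.pt K M x ≫ P1.struct K = Spec.map (CommRingCat.ofHom (algebraMap K M)) := by
  rw [pt_eq_chartPt, chartPt_isOver]

lemma IsMorphismOf.exists_eq_pt (hF : IsMorphismOf f F) {x : M} (hx : Transcendental K x)
    {w : Spec (.of M) ⟶ P1 K} (hw : w ≫ F = P1.pt K M x) :
    ∃ x' : M, Transcendental K x' ∧ w = P1.pt K M x' ∧ evalMap f M x' = x := by
  obtain ⟨x', hx', rfl⟩ := SelfSimilarIMG.exists_eq_pt (w := w)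
    (by rw [← hF.isOver, reassoc_of% hw, isOver_pt])
    (ptField_comp_le w F (hw ▸ mem_ptField_pt x)) hx
  refine ⟨x', hx', rfl, ?_⟩
  rw [hF.pt_comp hx'] at hw
  exact pt_injective hw

end Morphism

/-! ### Generic points of smooth curves -/

section Genericity

open IsLocalRing TensorProduct

variable {K : Type u} [Field K]

/-- A point of a smooth affine curve that is not generic has an algebraic residue field: the curve
is quasi-finite over an affine line. -/
lemma isAlgebraic_of_not_injective {B M : Type u} [CommRing B] [IsDomain B] [Algebra K B]
    [Algebra.IsStandardSmoothOfRelativeDimension 1 K B] [Field M] [Algebra K M] (χ : B →ₐ[K] M)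
    (hχ : ¬ Function.Injective χ) (b : B) : IsAlgebraic K (χ b) := by
  obtain ⟨g, hg⟩ := Algebra.IsStandardSmoothOfRelativeDimension.exists_etale_mvPolynomial 1 K B
  let A := MvPolynomial (Fin 1) K
  let : Algebra A B := g.toRingHom.toAlgebra
  have : Algebra.Etale A B := hg
  let E := algebraicClosure K M
  have hinj : Function.Injective (algebraMap A B) := FaithfulSMul.algebraMap_injective A B
  have hX : χ (g (MvPolynomial.X 0)) ∈ E := by
    rw [mem_algebraicClosure_iff]
    by_contra hX
    have h1 : AlgebraicIndependent K fun _ : Fin 1 => χ (g (MvPolynomial.X 0)) :=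
      algebraicIndependent_unique_type_iff.2 hX
    have h2 : (χ.comp g : A →ₐ[K] M) = MvPolynomial.aeval fun _ => χ (g (MvPolynomial.X 0)) := by
      ext i
      rw [Subsingleton.elim i 0]
      simp
    have h3 : Function.Injective (χ.comp g) := h2 ▸ h1
    refine hχ ((RingHom.injective_iff_ker_eq_bot (χ : B →+* M)).2 ?_)
    have : (RingHom.ker (χ : B →+* M)).IsPrime := RingHom.ker_isPrime _
    refine (Algebra.QuasiFinite.eq_of_le_of_under_eq (R := A) ⊥ (RingHom.ker (χ : B →+* M))
      bot_le ?_).symm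
    exact ((RingHom.injective_iff_ker_eq_bot (algebraMap A B)).1 hinj).trans
      ((RingHom.injective_iff_ker_eq_bot ((χ.comp g : A →ₐ[K] M) : A →+* M)).1 h3).symm
  have hE : ∀ a : A, χ (algebraMap A B a) ∈ E := by
    intro a
    change χ (g a) ∈ E
    induction a using MvPolynomial.induction_on with
    | C a =>
      rw [← MvPolynomial.algebraMap_eq, AlgHom.commutes, AlgHom.commutes]
      exact E.algebraMap_mem a
    | add p q hp hq =>
      rw [map_add, map_add]
      exact add_mem hp hq
    | mul_X p i hp =>
      rw [map_mul, map_mul, Subsingleton.elim i 0]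
      exact mul_mem hp hX
  let φ : A →+* E := (χ.toRingHom.comp (algebraMap A B)).codRestrict E.toSubalgebra.toSubring hE
  let : Algebra A E := φ.toAlgebra
  let : Algebra A M := (χ.toRingHom.comp (algebraMap A B)).toAlgebra
  have : IsScalarTower A E M := .of_algebraMap_eq fun _ => rfl
  let χA : B →ₐ[A] M := { χ.toRingHom with commutes' := fun _ => rfl }
  have : Module.Finite E (E ⊗[A] B) := Module.Finite.of_quasiFinite
  have h1 := (Algebra.IsIntegral.isIntegral (R := E) (1 ⊗ₜ[A] b : E ⊗[A] B)).map
    (Algebra.TensorProduct.lift (Algebra.ofId E M) χA (fun _ _ => .all _ _))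
  have h2 : _root_.IsIntegral E (χ b) := by
    rw [Algebra.TensorProduct.lift_tmul, map_one, one_mul] at h1
    exact h1
  exact (isIntegral_trans (R := K) _ h2).isAlgebraic

lemma exists_specMap_comp_eq {Y : Scheme.{u}} {R : CommRingCat.{u}} (c : Spec R ⟶ Y)
    [IsOpenImmersion c] {M : Type u} [Field M] (z : Spec (.of M) ⟶ Y)
    (h : z (closedPoint M) ∈ c.opensRange) : ∃ φ : R ⟶ .of M, Spec.map φ ≫ c = z := by
  have h1 : Set.range z ⊆ Set.range c := by
    rintro _ ⟨p, rfl⟩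
    rwa [Subsingleton.elim p (closedPoint M)]
  obtain ⟨φ, hφ⟩ := Spec.map_surjective (IsOpenImmersion.lift c z h1)
  exact ⟨φ, hφ ▸ IsOpenImmersion.lift_fac c z h1⟩

lemma ptField_specMap_comp_le {Y : Scheme.{u}} {R : CommRingCat.{u}} (c : Spec R ⟶ Y)
    [IsOpenImmersion c] {M : Type u} [Field M] (φ : R ⟶ .of M) (F : Subfield M)
    (h : ∀ a, φ.hom a ∈ F) : ptField (Spec.map φ ≫ c) ≤ F := by
  have h1 : φ = CommRingCat.ofHom (φ.hom.codRestrict F.toSubring h : R →+* F) ≫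
      CommRingCat.ofHom F.subtype := rfl
  rw [h1, Spec.map_comp_assoc]
  refine (ptField_map (M := F) F.subtype _).le.trans ?_
  rintro _ ⟨a, -, rfl⟩
  exact a.2

lemma exists_affine_isStandardSmooth {Y : Scheme.{u}} (s : Y ⟶ Spec (.of K))
    [SmoothOfRelativeDimension 1 s] (y : Y) : ∃ (V : Y.Opens) (_ : IsAffineOpen V), y ∈ V ∧
      ((Scheme.ΓSpecIso (.of K)).inv ≫ s.appLE ⊤ V le_top).hom.IsStandardSmoothOfRelativeDimension
        1 := by
  obtain ⟨U, hU, V, hV, hy, e, h⟩ :=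
    SmoothOfRelativeDimension.exists_isStandardSmoothOfRelativeDimension (n := 1) (f := s) y
  obtain rfl : U = ⊤ := by
    rw [eq_top_iff]
    rintro p -
    rw [Subsingleton.elim p (s y)]
    exact e hy
  refine ⟨V, hV, hy, ?_⟩
  exact (RingHom.isStandardSmoothOfRelativeDimension_respectsIso).2 _
    (Scheme.ΓSpecIso (.of K)).symm.commRingCatIsoToRingEquiv h

lemma specMap_closedPoint {R : CommRingCat.{u}} [IsDomain R] {M : Type u} [Field M]
    (φ : R ⟶ .of M) (hφ : Function.Injective φ.hom) :
    Spec.map φ (closedPoint M) = genericPoint (Spec R) := by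
  rw [genericPoint_eq_bot_of_affine]
  refine PrimeSpectrum.ext ?_
  change (maximalIdeal M).comap φ.hom = ⊥
  rw [maximalIdeal_eq_bot]
  exact (RingHom.injective_iff_ker_eq_bot _).1 hφ

/-- A point with values in a field is the generic point of a smooth curve if its residue field
contains a transcendental element. -/
lemma eq_genericPoint_of_transcendental {Y : Scheme.{u}} [AlgebraicGeometry.IsIntegral Y]
    (s : Y ⟶ Spec (.of K)) [SmoothOfRelativeDimension 1 s] {M : Type u} [Field M] [Algebra K M]
    {z : Spec (.of M) ⟶ Y} (hz : z ≫ s = Spec.map (CommRingCat.ofHom (algebraMap K M)))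
    {b : M} (hb : b ∈ ptField z) (hb' : Transcendental K b) :
    z (closedPoint M) = genericPoint Y := by
  obtain ⟨V, hV, hy, h⟩ := exists_affine_isStandardSmooth s (z (closedPoint M))
  have : Nonempty V := ⟨⟨_, hy⟩⟩
  obtain ⟨χ, rfl⟩ := exists_specMap_comp_eq hV.fromSpec z (by rwa [hV.opensRange_fromSpec])
  let : Algebra K Γ(Y, V) :=
    ((Scheme.ΓSpecIso (.of K)).inv ≫ s.appLE ⊤ V le_top).hom.toAlgebra
  have : Algebra.IsStandardSmoothOfRelativeDimension 1 K Γ(Y, V) := h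
  have hs : hV.fromSpec ≫ s = Spec.map ((Scheme.ΓSpecIso (.of K)).inv ≫ s.appLE ⊤ V le_top) := by
    have := IsAffineOpen.SpecMap_appLE_fromSpec s (isAffineOpen_top (Spec (.of K))) hV le_top
    rw [← this, IsAffineOpen.fromSpec_top, Spec.map_comp]
    rw [Scheme.isoSpec_Spec_inv]
  rw [Category.assoc, hs, ← Spec.map_comp, Spec.map_inj] at hz
  let χK : Γ(Y, V) →ₐ[K] M := { χ.hom with commutes' := fun a => congrArg (fun φ => φ.hom a) hz }
  have hinj : Function.Injective χK := by
    by_contra hχ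
    refine hb' (mem_algebraicClosure_iff.1 (ptField_specMap_comp_le hV.fromSpec χ
      (algebraicClosure K M).toSubfield (fun a => mem_algebraicClosure_iff.2 ?_) hb))
    exact isAlgebraic_of_not_injective χK hχ a
  refine (congrArg hV.fromSpec (specMap_closedPoint χ hinj)).trans ?_
  exact genericPoint_eq_of_isOpenImmersion hV.fromSpec

end Genericity

/-! ### Pullback endomorphisms of curves -/

section PullbackEndo

open IsLocalRing Polynomial

variable {K : Type u} [Field K] {f : RatFunc K} {F : P1 K ⟶ P1 K}

lemma transcendental_of_closedPoint {M : Type u} [Field M] [Algebra K M] {j : Fin 2} {x : M}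
    (h : chartPt K j x (closedPoint M) = genericPoint (P1 K)) : Transcendental K x := by
  have h1 : chart K j (Spec.map (CommRingCat.ofHom ((aeval x : K[X] →ₐ[K] M) : K[X] →+* M))
      (closedPoint M)) = chart K j (genericPoint (Spec (.of K[X]))) :=
    h.trans (genericPoint_eq_of_isOpenImmersion (chart K j)).symm
  have h2 := (chart K j).isOpenEmbedding.injective h1
  rw [genericPoint_eq_bot_of_affine] at h2
  have h3 : (maximalIdeal M).comap ((aeval x : K[X] →ₐ[K] M) : K[X] →+* M) = ⊥ :=
    congrArg PrimeSpectrum.asIdeal h2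
  rw [maximalIdeal_eq_bot] at h3
  exact transcendental_iff_injective.2 ((RingHom.injective_iff_ker_eq_bot _).2 h3)

lemma pt_closedPoint {M : Type u} [Field M] [Algebra K M] {x : M} (hx : Transcendental K x) :
    P1.pt K M x (closedPoint M) = genericPoint (P1 K) := by
  rw [pt_eq_chartPt]
  refine (congrArg (chart K 1) (specMap_closedPoint _ (transcendental_iff_injective.1 hx))).trans ?_
  exact genericPoint_eq_of_isOpenImmersion (chart K 1)

/-- The square formed by an endomorphism `g` of a smooth curve over `K` and the endomorphism of
the projective line given by `f` is a pullback in the sense of curves. -/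
structure IsPullbackEndo (f : RatFunc K) (F : P1 K ⟶ P1 K) {Y : Scheme.{u}}
    [AlgebraicGeometry.IsIntegral Y] (π : Y ⟶ P1 K) (g : Y ⟶ Y) : Prop where
  isMorphismOf : IsMorphismOf f F
  smooth : SmoothOfRelativeDimension 1 (π ≫ P1.struct K)
  isNormalizedPullback : IsNormalizedPullback g π π F

namespace IsPullbackEndo

variable {Y : Scheme.{u}} [AlgebraicGeometry.IsIntegral Y] {π : Y ⟶ P1 K} {g : Y ⟶ Y}
  (h : IsPullbackEndo f F π g)

include h

lemma closedPoint_eq {M : Type u} [Field M] [Algebra K M] {z : Spec (.of M) ⟶ Y} {x : M}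
    (hx : Transcendental K x) (hz : z ≫ π = P1.pt K M x) :
    z (closedPoint M) = genericPoint Y := by
  have := h.smooth
  refine eq_genericPoint_of_transcendental (π ≫ P1.struct K) ?_
    (ptField_comp_le z π (hz ▸ mem_ptField_pt x)) hx
  rw [reassoc_of% hz, isOver_pt]

lemma eq_genericPoint {p : Y} (hp : π p = genericPoint (P1 K)) : p = genericPoint Y := by
  have := h.smooth
  let M := Y.residueField p
  let z : Spec (.of M) ⟶ Y := Y.fromSpecResidueField p
  have hz : z (closedPoint M) = p := Y.fromSpecResidueField_apply p _
  obtain ⟨φ, hφ⟩ := Spec.map_surjective (z ≫ π ≫ P1.struct K)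
  let : Algebra K M := φ.hom.toAlgebra
  obtain ⟨j, x, hx⟩ := exists_eq_chartPt (w := z ≫ π)
    (by rw [Category.assoc, ← hφ]; rfl)
  have hx' : Transcendental K x := transcendental_of_closedPoint (j := j) (by
    rw [← hx]
    exact (congrArg π hz).trans hp)
  rw [← hz]
  refine eq_genericPoint_of_transcendental (π ≫ P1.struct K) (by rw [← hφ]; rfl)
    (ptField_comp_le z π (hx ▸ mem_ptField_chartPt j x)) hx'

lemma w : g ≫ π = π ≫ F := h.isNormalizedPullback.w

lemma surjective_lift : Function.Surjective (pullback.lift g π h.w) := by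
  have := h.isNormalizedPullback.isIntegralHom
  have := h.isNormalizedPullback.isDominant
  exact (surjective_of_isDominant_of_isClosed_range _
    (pullback.lift g π h.w).isClosedMap.isClosed_range).surj

variable {M : Type u} [Field M] [Algebra K M]

/-- A point of the curve with transcendental coordinate is determined by its images under the
endomorphism and under the covering of the line. -/
lemma ext {z z' : Spec (.of M) ⟶ Y} {x : M} (hx : Transcendental K x)
    (hz : z ≫ π = P1.pt K M x) (h1 : z ≫ g = z' ≫ g) (h2 : z ≫ π = z' ≫ π) : z = z' := by
  refine eq_of_comp_eq h.isNormalizedPullback.birational (h.closedPoint_eq hx hz)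
    (h.closedPoint_eq hx (h2 ▸ hz)) (pullback.hom_ext ?_ ?_)
  · rw [Category.assoc, Category.assoc, pullback.lift_fst, h1]
  · rw [Category.assoc, Category.assoc, pullback.lift_snd, h2]

/-- Preimages of points under the endomorphism of the line lift uniquely to the curve. -/
lemma exists_lift {x : M} (hx : Transcendental K x)
    {y : Spec (.of M) ⟶ Y} (hy : y ≫ π = P1.pt K M (evalMap f M x)) :
    ∃ z : Spec (.of M) ⟶ Y, z ≫ g = y ∧ z ≫ π = P1.pt K M x := by
  let u : Spec (.of M) ⟶ pullback π F := pullback.lift y (P1.pt K M x)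
    (hy.trans (h.isMorphismOf.pt_comp hx).symm)
  obtain ⟨p, hp⟩ := h.surjective_lift (u (closedPoint M))
  have hp' : p = genericPoint Y := by
    refine h.eq_genericPoint ?_
    have h1 : pullback.snd π F (pullback.lift g π h.w p) = π p := by
      rw [← Scheme.Hom.comp_apply, pullback.lift_snd]
    rw [← h1, hp, ← pt_closedPoint hx]
    have h2 : u ≫ pullback.snd π F = P1.pt K M x := pullback.lift_snd _ _ _
    exact congrArg (fun φ : Spec (.of M) ⟶ P1 K => φ (closedPoint M)) h2
  subst hp'
  obtain ⟨z, hz, -⟩ := exists_comp_eq h.isNormalizedPullback.birational hp.symm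
  have h1 := congrArg (· ≫ pullback.fst π F) hz
  have h2 := congrArg (· ≫ pullback.snd π F) hz
  simp only [Category.assoc, pullback.lift_fst, pullback.lift_snd, u] at h1 h2
  exact ⟨z, h1, h2⟩

end IsPullbackEndo
end PullbackEndo

/-! ### Galois action on geometric points -/

section GeometricPoints

open IsLocalRing

variable {K : Type u} [Field K] {f : RatFunc K} {Ω : Type u} [Field Ω] [Algebra K Ω]
  [Algebra (RatFunc K) Ω] [IsScalarTower K (RatFunc K) Ω]

/-- The geometric point `σ(z)`. -/
abbrev galPt {Y : Scheme.{u}} (σ : Ω ≃ₐ[K] Ω) (z : Spec (.of Ω) ⟶ Y) : Spec (.of Ω) ⟶ Y :=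
  Spec.map (CommRingCat.ofHom ((σ : Ω →ₐ[K] Ω) : Ω →+* Ω)) ≫ z

lemma galPt_galPt {Y : Scheme.{u}} (σ τ : Ω ≃ₐ[K] Ω) (z : Spec (.of Ω) ⟶ Y) :
    galPt σ (galPt τ z) = galPt (τ.trans σ) z := by
  rw [galPt, galPt, ← Spec.map_comp_assoc, ← CommRingCat.ofHom_comp]
  rfl

lemma galPt_pt (σ : Ω ≃ₐ[K] Ω) (x : Ω) : galPt σ (P1.pt K Ω x) = P1.pt K Ω (σ x) :=
  specMap_pt (σ : Ω →ₐ[K] Ω) x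

lemma mem_ptField_galPt {Y : Scheme.{u}} {σ : Ω ≃ₐ[K] Ω} {z : Spec (.of Ω) ⟶ Y} {a : Ω} :
    a ∈ ptField (galPt σ z) ↔ ∃ b ∈ ptField z, σ b = a := by
  rw [galPt, ptField_map]
  rfl

/-- The Galois action moves a geometric point exactly if it moves its residue field. -/
lemma galPt_eq_self_iff {Y : Scheme.{u}} {σ : Ω ≃ₐ[K] Ω} {z : Spec (.of Ω) ⟶ Y} :
    galPt σ z = z ↔ ∀ a ∈ ptField z, σ a = a := by
  obtain ⟨ψ, hψ⟩ := exists_fac_residueField z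
  generalize z (closedPoint Ω) = p at ψ hψ
  subst hψ
  rw [ptField_eq_fieldRange, galPt, ← Spec.map_comp_assoc]
  constructor
  · rintro h _ ⟨a, rfl⟩
    exact congrArg (fun φ => φ.hom a) (SpecMap_fromSpecResidueField_injective h)
  · intro h
    congr 2
    ext a
    exact h _ ⟨a, rfl⟩

lemma algebraMap_mem_ptField {Y : Scheme.{u}} {s : Y ⟶ Spec (.of K)} {z : Spec (.of Ω) ⟶ Y}
    (hz : z ≫ s = Spec.map (CommRingCat.ofHom (algebraMap K Ω))) (a : K) :
    algebraMap K Ω a ∈ ptField z :=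
  ptField_comp_le z s (hz ▸ range_le_ptField (CommRingCat.ofHom (algebraMap K Ω)) a)

/-- Geometric generic points of a curve are conjugate under the automorphisms of `Ω` over `K`. -/
lemma exists_galPt_eq [IsSepClosure (RatFunc K) Ω] {Y : Scheme.{u}} {s : Y ⟶ Spec (.of K)}
    {y z : Spec (.of Ω) ⟶ Y}
    (hy : y ≫ s = Spec.map (CommRingCat.ofHom (algebraMap K Ω)))
    (hz : z ≫ s = Spec.map (CommRingCat.ofHom (algebraMap K Ω)))
    (hyz : y (closedPoint Ω) = z (closedPoint Ω)) (hyt : tElt K Ω ∈ ptField y)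
    (hzt : tElt K Ω ∈ ptField z) : ∃ σ : Ω ≃ₐ[K] Ω, galPt σ y = z := by
  have hyK := algebraMap_mem_ptField hy
  have hzK := algebraMap_mem_ptField hz
  obtain ⟨ψ, hψ⟩ := exists_fac_residueField_of_eq y hyz
  obtain ⟨χ, hχ⟩ := exists_fac_residueField z
  generalize z (closedPoint Ω) = p at ψ hψ χ hχ
  subst hψ hχ
  rw [ptField_eq_fieldRange] at hyt hzt hyK hzK
  let A : IntermediateField K Ω := ψ.hom.fieldRange.toIntermediateField hyK
  let B : IntermediateField K Ω := χ.hom.fieldRange.toIntermediateField hzK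
  let eA : Y.residueField p ≃+* A := RingEquiv.ofBijective (ψ.hom.rangeRestrict)
    ⟨fun a b hab => ψ.hom.injective (congrArg Subtype.val hab), ψ.hom.rangeRestrict_surjective⟩
  let eB : Y.residueField p ≃+* B := RingEquiv.ofBijective (χ.hom.rangeRestrict)
    ⟨fun a b hab => χ.hom.injective (congrArg Subtype.val hab), χ.hom.rangeRestrict_surjective⟩
  obtain ⟨ι, hι⟩ := Spec.map_surjective (Y.fromSpecResidueField p ≫ s)
  rw [Category.assoc, ← hι, ← Spec.map_comp, Spec.map_inj] at hy hz
  let e : A ≃ₐ[K] B := AlgEquiv.ofRingEquiv (f := eA.symm.trans eB) fun a => by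
    have h1 : algebraMap K A a = eA (ι.hom a) :=
      Subtype.ext (congrArg (fun φ => φ.hom a) hy).symm
    have h2 : algebraMap K B a = eB (ι.hom a) :=
      Subtype.ext (congrArg (fun φ => φ.hom a) hz).symm
    rw [h1, h2, RingEquiv.trans_apply, RingEquiv.symm_apply_apply]
  obtain ⟨σ, hσ⟩ := exists_algEquiv_extending (A := A) (B := B) hyt hzt e
  refine ⟨σ, ?_⟩
  rw [galPt, ← Spec.map_comp_assoc]
  congr 2
  ext a
  have := hσ (eA a)
  refine this.trans ?_
  change ((eB (eA.symm (eA a)) : B) : Ω) = _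
  rw [RingEquiv.symm_apply_apply]
  rfl

end GeometricPoints

namespace IsPullbackEndo

open IsLocalRing

variable {K : Type u} [Field K] {f : RatFunc K} {F : P1 K ⟶ P1 K} {Ω : Type u} [Field Ω]
  [Algebra K Ω] [Algebra (RatFunc K) Ω] [IsScalarTower K (RatFunc K) Ω]
  {Y : Scheme.{u}} [AlgebraicGeometry.IsIntegral Y] {π : Y ⟶ P1 K} {g : Y ⟶ Y}
  (h : IsPullbackEndo f F π g)

include h

/-- Induction on `n`: over points with transcendental coordinate the square is a pullback on points
with values in `Ω`. -/
lemma bijOn_endoFiber_of_transcendental (n : ℕ) : ∀ {y : Spec (.of Ω) ⟶ Y} {x : Ω}, Transcendental K x →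
    y ≫ π = P1.pt K Ω x → Set.BijOn (fun z => z ≫ π) (endoFiber g y n)
      (P1.pt K Ω '' {x' | Transcendental K x' ∧ (evalMap f Ω)^[n] x' = x}) := by
  induction n with
  | zero =>
    intro y x hx hy
    have h1 : endoFiber g y 0 = {y} := rfl
    have h2 : {x' | Transcendental K x' ∧ (evalMap f Ω)^[0] x' = x} = {x} := by
      ext x'
      exact ⟨fun h => h.2, fun h => by rw [Set.mem_singleton_iff.1 h]; exact ⟨hx, rfl⟩⟩
    rw [h1, h2, Set.image_singleton, ← hy]
    exact Set.bijOn_singleton.2 rfl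
  | succ n ih =>
    intro y x hx hy
    obtain ⟨h1, h2, h3⟩ := ih hx hy
    have key : ∀ z ∈ endoFiber g y (n + 1), ∃ x', Transcendental K x' ∧ z ≫ π = P1.pt K Ω x' ∧
        (evalMap f Ω)^[n + 1] x' = x := by
      intro z hz
      obtain ⟨x₁, ⟨hx₁, hx₁'⟩, hz₁⟩ := h1 (show z ≫ g ∈ endoFiber g y n from hz)
      obtain ⟨x', hx', hzx, hxx⟩ := h.isMorphismOf.exists_eq_pt (w := z ≫ π) hx₁ (by
        rw [Category.assoc, ← h.w, ← Category.assoc]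
        exact hz₁.symm)
      exact ⟨x', hx', hzx, by rw [Function.iterate_succ_apply, hxx, hx₁']⟩
    refine ⟨?_, ?_, ?_⟩
    · intro z hz
      obtain ⟨x', hx', hzx, hxx⟩ := key z hz
      exact ⟨x', ⟨hx', hxx⟩, hzx.symm⟩
    · intro z hz z' hz' hzz
      obtain ⟨x', hx', hzx, -⟩ := key z hz
      refine h.ext hx' hzx (h2 (show z ≫ g ∈ endoFiber g y n from hz)
        (show z' ≫ g ∈ endoFiber g y n from hz') ?_) hzz
      change (z ≫ g) ≫ π = (z' ≫ g) ≫ π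
      rw [Category.assoc, Category.assoc, h.w, ← Category.assoc, ← Category.assoc]
      exact congrArg (· ≫ F) hzz
    · rintro _ ⟨x', ⟨hx', hxx⟩, rfl⟩
      have hx₁ : Transcendental K (evalMap f Ω x') := by
        refine transcendental_of_transcendental_iterate (f := f) (m := n) ?_
        rwa [← Function.iterate_succ_apply, hxx]
      obtain ⟨z₁, hz₁, hz₁'⟩ := h3 ⟨evalMap f Ω x', ⟨hx₁, hxx⟩, rfl⟩
      obtain ⟨z, hz, hz'⟩ := h.exists_lift hx' hz₁'
      exact ⟨z, show z ≫ g ∈ endoFiber g y n from hz ▸ hz₁, hz'⟩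

end IsPullbackEndo

/-! ### The tree of a pullback endomorphism -/

namespace IsPullbackEndo

open IsLocalRing

variable {K : Type u} [Field K] {f : RatFunc K} {F : P1 K ⟶ P1 K} {Ω : Type u} [Field Ω]
  [Algebra K Ω] [Algebra (RatFunc K) Ω] [IsScalarTower K (RatFunc K) Ω]
  {Y : Scheme.{u}} [AlgebraicGeometry.IsIntegral Y] {π : Y ⟶ P1 K} {g : Y ⟶ Y}

lemma ptField_le_of_mem_endoFiber {y z : Spec (.of Ω) ⟶ Y} {n : ℕ} (hz : z ∈ endoFiber g y n) :
    ptField y ≤ ptField z := by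
  induction n generalizing z with
  | zero =>
    rw [show z = y from hz]
  | succ n ih =>
    exact (ih (show z ≫ g ∈ endoFiber g y n from hz)).trans (ptField_comp_le z g)

lemma isOver_of_comp_eq {z : Spec (.of Ω) ⟶ Y} {x : Ω} (hz : z ≫ π = P1.pt K Ω x) :
    z ≫ π ≫ P1.struct K = Spec.map (CommRingCat.ofHom (algebraMap K Ω)) := by
  rw [reassoc_of% hz, isOver_pt]

variable {y : Spec (.of Ω) ⟶ Y} (hy : y ≫ π = P1.pt K Ω (tElt K Ω))

include hy

lemma tElt_mem_ptField : tElt K Ω ∈ ptField y :=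
  ptField_comp_le y π (hy ▸ mem_ptField_pt _)

lemma ratFunc_mem_ptField (r : RatFunc K) : algebraMap (RatFunc K) Ω r ∈ ptField y := by
  have hK : ∀ a : K, algebraMap K Ω a ∈ ptField y := fun a =>
    algebraMap_mem_ptField (s := π ≫ P1.struct K) (isOver_of_comp_eq hy) a
  have ht := tElt_mem_ptField hy
  generalize ptField y = S at hK ht ⊢
  let P : IntermediateField K Ω := S.toIntermediateField hK
  have h1 : K⟮(RatFunc.X : RatFunc K)⟯ ≤ P.comap (IsScalarTower.toAlgHom K (RatFunc K) Ω) :=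
    adjoin_simple_le_iff.2 ht
  rw [RatFunc.adjoin_X] at h1
  exact h1 (mem_top (x := r))

variable (h : IsPullbackEndo f F π g)

include h

lemma bijOn_endoFiber (n : ℕ) :
    Set.BijOn (fun z => z ≫ π) (endoFiber g y n) (P1.pt K Ω '' fiber f Ω n) := by
  have h1 : {x | Transcendental K x ∧ (evalMap f Ω)^[n] x = tElt K Ω} = fiber f Ω n :=
    Set.ext fun x => ⟨fun hx => hx.2, fun hx => ⟨transcendental_of_iterate hx, hx⟩⟩
  exact h1 ▸ h.bijOn_endoFiber_of_transcendental n transcendental_tElt hy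

variable [IsSepClosure (RatFunc K) Ω]

/-- The vertices of the tree of `g` are conjugates of the base point, since they are supported at
the generic point of the curve. -/
lemma exists_galPt {z : Spec (.of Ω) ⟶ Y} {n : ℕ} (hz : z ∈ endoFiber g y n) :
    ∃ σ : Ω ≃ₐ[K] Ω, galPt σ y = z ∧ σ (tElt K Ω) ∈ fiber f Ω n := by
  obtain ⟨x, hx, hxz⟩ := (h.bijOn_endoFiber hy n).mapsTo hz
  have h1 : y (closedPoint Ω) = z (closedPoint Ω) :=
    (h.closedPoint_eq transcendental_tElt hy).trans
      (h.closedPoint_eq (transcendental_of_iterate hx) hxz.symm).symm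
  obtain ⟨σ, hσ⟩ := exists_galPt_eq (isOver_of_comp_eq hy) (isOver_of_comp_eq hxz.symm) h1
    (tElt_mem_ptField hy) (ptField_le_of_mem_endoFiber hz (tElt_mem_ptField hy))
  refine ⟨σ, hσ, ?_⟩
  have h2 : galPt σ y ≫ π = P1.pt K Ω (σ (tElt K Ω)) := by
    rw [galPt, Category.assoc, hy]
    exact galPt_pt σ _
  rw [hσ] at h2
  rwa [← pt_injective (hxz.trans h2)]

lemma liftsTo_of_forall (Λ : PathData f Ω) (hΛ : ∀ i, ∃ z : Spec (.of Ω) ⟶ Y, z ≫ g = y ∧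
    z ≫ π = P1.pt K Ω (Λ.label i : Ω) ∧ galPt (Λ.path i) z = y) : Λ.LiftsTo π g y := by
  choose z hz1 hz2 hz3 using hΛ
  have hB := h.bijOn_endoFiber hy 1
  let lab : Fin (degree f) → endoFiber g y 1 := fun i => ⟨z i, hz1 i⟩
  have hlab : Function.Bijective lab := by
    refine ⟨fun i j hij => ?_, fun w => ?_⟩
    · have h1 : z i = z j := congrArg Subtype.val hij
      have h2 := (hz2 i).symm.trans (h1 ▸ hz2 j)
      exact Λ.label.injective (Subtype.ext (pt_injective h2))
    · obtain ⟨x, hx, hxw⟩ := hB.mapsTo w.2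
      obtain ⟨i, hi⟩ := Λ.label.surjective ⟨x, hx⟩
      refine ⟨i, Subtype.ext (hB.injOn (hz1 i) w.2 ?_)⟩
      refine (hz2 i).trans ?_
      rw [hi]
      exact hxw
  exact ⟨⟨Equiv.ofBijective lab hlab, Λ.path, hz3⟩, fun i => ⟨rfl, hz2 i⟩⟩

lemma exists_pathData_liftsTo (Λ : PathData f Ω) :
    ∃ Λ' : PathData f Ω, Λ'.label = Λ.label ∧ Λ'.LiftsTo π g y := by
  have h1 : ∀ i, ∃ (z : Spec (.of Ω) ⟶ Y) (σ : Ω ≃ₐ[K] Ω), z ≫ g = y ∧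
      z ≫ π = P1.pt K Ω (Λ.label i : Ω) ∧ galPt σ z = y ∧ σ (Λ.label i : Ω) = tElt K Ω := by
    intro i
    obtain ⟨z, hz, hzi⟩ := (h.bijOn_endoFiber hy 1).surjOn ⟨_, (Λ.label i).2, rfl⟩
    have hzi' : z ≫ π = P1.pt K Ω (Λ.label i : Ω) := hzi
    obtain ⟨σ, hσ, -⟩ := exists_galPt hy h hz
    have h2 : galPt σ.symm z = y := by
      rw [← hσ, galPt_galPt, AlgEquiv.self_trans_symm (R := K)]
      exact galPt_eq_self_iff.2 fun _ _ => rfl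
    refine ⟨z, σ.symm, hz, hzi', h2, pt_injective (K := K) ?_⟩
    rw [← hy, ← h2, galPt, Category.assoc, hzi']
    exact (galPt_pt _ _).symm
  choose z σ h1 h2 h3 h4 using h1
  exact ⟨⟨Λ.label, σ, h4⟩, rfl, liftsTo_of_forall hy h _ fun i => ⟨z i, h1 i, h2 i, h3 i⟩⟩

variable {L : IntermediateField (RatFunc K) (treeField f Ω)}
  (hL : (toK L : Set Ω) = ptField y)

include hL

/-- An automorphism that takes the base point to a vertex takes `M` to the field of the subtree
over this vertex, so the residue field of the vertex remains in `M`. -/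
lemma ptField_subset_treeField {z : Spec (.of Ω) ⟶ Y} {n : ℕ} (hz : z ∈ endoFiber g y n) :
    (ptField z : Set Ω) ⊆ treeField f Ω := by
  obtain ⟨σ, rfl, hσ⟩ := exists_galPt hy h hz
  intro a ha
  obtain ⟨b, hb, rfl⟩ := mem_ptField_galPt.1 ha
  have hb1 : b ∈ toK L := (Set.ext_iff.1 hL b).2 hb
  obtain ⟨c, -, rfl⟩ := mem_toK.1 hb1
  have h1 : (c : Ω) ∈ adjoin K (treeOver f (tElt K Ω)) := mem_treeField_iff.1 c.2
  refine mem_treeField_iff.2 ?_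
  have h2 : adjoin K (treeOver f (tElt K Ω)) ≤
      (adjoin K (treeOver f (tElt K Ω))).comap (σ : Ω →ₐ[K] Ω) := by
    rw [adjoin_le_iff]
    intro x hx
    exact subset_adjoin K _ (treeOver_trans f (treeOver_hom f (σ : Ω →ₐ[K] Ω) hx) ⟨n, hσ⟩)
  exact h2 h1

lemma coe_endoTreeField : (endoTreeField g y : Set Ω) = (treeField f Ω : Set Ω) := by
  refine Set.Subset.antisymm ?_ ?_
  · have h1 : (endoTreeField g y).toSubfield ≤ (treeField f Ω).toSubfield := by
      rw [endoTreeField, adjoin_toSubfield, Subfield.closure_le]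
      rintro a (⟨b, rfl⟩ | ha)
      · exact ptField_subset_treeField hy h hL (n := 0) rfl b.2
      · simp only [Set.mem_iUnion] at ha
        obtain ⟨n, z, hz, ha⟩ := ha
        exact ptField_subset_treeField hy h hL hz ha
    exact h1
  · have h1 : (treeField f Ω).toSubfield ≤ (endoTreeField g y).toSubfield := by
      rw [treeField, adjoin_toSubfield, Subfield.closure_le]
      rintro a (⟨b, rfl⟩ | ha)
      · exact (endoTreeField g y).algebraMap_mem ⟨_, ratFunc_mem_ptField hy b⟩
      · obtain ⟨n, hn⟩ := Set.mem_iUnion.1 ha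
        obtain ⟨z, hz, hza⟩ := (h.bijOn_endoFiber hy n).surjOn ⟨a, hn, rfl⟩
        have hza' : z ≫ π = P1.pt K Ω a := hza
        refine subset_adjoin _ _ (Set.mem_iUnion.2 ⟨n, Set.mem_iUnion₂.2 ⟨z, hz, ?_⟩⟩)
        exact ptField_comp_le z π (hza' ▸ mem_ptField_pt a)
    exact h1

/-- The residue field of a preimage `y₁` of the base point is generated by the fields `L` and
`K(tᵢ)`: an automorphism that fixes both of these fixes the images of `y₁` in the curve and in the
line, so it fixes `y₁`. -/
lemma ptField_le_sup (Λ : PathData f Ω) (i : Fin (degree f)) {y₁ : Spec (.of Ω) ⟶ Y}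
    (h1 : y₁ ≫ g = y) (h2 : y₁ ≫ π = P1.pt K Ω (Λ.label i : Ω)) {a : Ω} (ha : a ∈ ptField y₁) :
    a ∈ toK (L ⊔ Λ.rootField i) := by
  have hy₁ : y₁ ∈ endoFiber g y 1 := h1
  let a' : treeField f Ω := ⟨a, ptField_subset_treeField hy h hL hy₁ ha⟩
  suffices ha' : a' ∈ L ⊔ Λ.rootField i from mem_toK.2 ⟨a', ha', rfl⟩
  rw [← InfiniteGalois.fixedField_fixingSubgroup (L ⊔ Λ.rootField i)]
  rintro ⟨τ, hτ⟩
  obtain ⟨e, he⟩ := SelfSimilarIMG.exists_lift τ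
  rw [IntermediateField.mem_fixingSubgroup_iff] at hτ
  have hfix : ∀ b ∈ toK (L ⊔ Λ.rootField i), (e.restrictScalars K : Ω ≃ₐ[K] Ω) b = b := by
    rintro b hb
    obtain ⟨c, hc, rfl⟩ := mem_toK.1 hb
    exact (he c).trans (congrArg Subtype.val (hτ c hc))
  have h3 : galPt (e.restrictScalars K) y₁ = y₁ := by
    have h5 : galPt (e.restrictScalars K) y₁ ≫ π = y₁ ≫ π := by
      rw [galPt, Category.assoc, h2]
      refine (galPt_pt _ _).trans ?_
      rw [hfix _ (mem_toK.2 ⟨Λ.root i, le_sup_right (a := L) (Λ.root_mem_rootField i),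
        Λ.coe_root i⟩)]
    refine h.ext (transcendental_of_iterate (Λ.label i).2) (h5.trans h2) ?_ h5
    rw [galPt, Category.assoc, h1]
    refine galPt_eq_self_iff.2 fun b hb => hfix b ?_
    exact toK_le_iff.2 le_sup_left ((Set.ext_iff.1 hL b).2 hb)
  have h4 := galPt_eq_self_iff.1 h3 a ha
  exact Subtype.ext ((he a').symm.trans h4)

/-- The path `λᵢ` takes the residue field of `yᵢ`, which lies in `L(tᵢ)`, onto `L`; this is the
field criterion for self-similarity. -/
lemma isSelfSimilar_of_liftsTo (Λ : PathData f Ω) (hΛ : Λ.LiftsTo π g y) :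
    Λ.IsSelfSimilar L.fixingSubgroup := by
  obtain ⟨Λg, hΛg⟩ := hΛ
  refine Λ.isSelfSimilar_fixingSubgroup L fun i a ha => ?_
  have h1 := Λg.path_label i
  rw [(hΛg i).1] at h1
  have h2 : a ∈ ptField (galPt (Λ.path i) (Λg.label i : Spec (.of Ω) ⟶ Y)) := by
    rw [galPt, h1]
    exact (Set.ext_iff.1 hL a).1 ha
  obtain ⟨b, hb, rfl⟩ := mem_ptField_galPt.1 h2
  exact ⟨b, ptField_le_sup hy h hL Λ i (Λg.label i).2 (hΛg i).2 hb, rfl⟩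

end IsPullbackEndo

/-! ### The iterated monodromy group of a pullback endomorphism -/

section Krull

/-- A homomorphism to a Galois group is continuous if each element of the field has an open
stabilizer. -/
lemma continuous_of_isOpen_fixes {k E G : Type*} [Field k] [Field E] [Algebra k E] [Group G]
    [TopologicalSpace G] [IsTopologicalGroup G] (φ : G →* (E ≃ₐ[k] E))
    (h : ∀ x, IsOpen {g | φ g x = x}) : Continuous φ := by
  refine continuous_of_continuousAt_one φ ?_
  rw [ContinuousAt, map_one]
  intro U hU
  obtain ⟨E', hE', hU'⟩ := (krullTopology_mem_nhds_one_iff k E U).1 hU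
  let b := Module.finBasis k E'
  have h1 : IsOpen (⋂ i, {g | φ g (b i) = b i}) := isOpen_iInter_of_finite fun i => h _
  rw [Filter.mem_map]
  refine Filter.mem_of_superset (h1.mem_nhds (Set.mem_iInter.2 fun i => by
    change φ 1 (b i) = b i
    rw [map_one, AlgEquiv.one_apply])) fun g hg => ?_
  refine hU' ((IntermediateField.mem_fixingSubgroup_iff _ _).2 fun x hx => ?_)
  have h2 : (φ g).toLinearMap ∘ₗ E'.val.toLinearMap = E'.val.toLinearMap :=
    b.ext fun i => Set.mem_iInter.1 hg i
  exact congrArg (fun ψ => ψ ⟨x, hx⟩) h2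

/-- Galois groups of the same field extension, presented in two ways: over a subfield `S` of `Ω`,
and as the stabilizer of an intermediate field `L` of a larger extension. -/
lemma exists_continuousMulEquiv_fixingSubgroup {k Ω : Type*} [Field k] [Field Ω] [Algebra k Ω]
    (E : IntermediateField k Ω) [Algebra.IsAlgebraic k E] (L : IntermediateField k E)
    (S : Subfield Ω) (hS : ∀ a : Ω, a ∈ S ↔ ∃ b ∈ L, (b : Ω) = a) (T : IntermediateField S Ω)
    (hT : (T : Set Ω) = E) :
    ∃ Φ : (T ≃ₐ[S] T) ≃ₜ* L.fixingSubgroup, ∀ (σ : T ≃ₐ[S] T) (a : T) (b : E), (a : Ω) = (b : Ω) →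
      (σ a : Ω) = ((Φ σ : E ≃ₐ[k] E) b : Ω) := by
  have hT' : ∀ a, a ∈ T ↔ a ∈ E := fun a => Set.ext_iff.1 hT a
  let e : T ≃+* E :=
    { toFun := fun a => ⟨a, (hT' a).1 a.2⟩
      invFun := fun a => ⟨a, (hT' a).2 a.2⟩
      left_inv := fun _ => rfl
      right_inv := fun _ => rfl
      map_mul' := fun _ _ => rfl
      map_add' := fun _ _ => rfl }
  have hL : ∀ b ∈ L, (b : Ω) ∈ S := fun b hb => (hS b).2 ⟨b, hb, rfl⟩
  have he : ∀ (b : E) (hb : b ∈ L), e.symm b = algebraMap S T ⟨b, hL b hb⟩ := fun _ _ => rfl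
  let Φ₀ : (T ≃ₐ[S] T) →* (E ≃ₐ[k] E) :=
    { toFun := fun σ => AlgEquiv.ofRingEquiv (f := (e.symm.trans σ.toRingEquiv).trans e)
        fun r => by
          change e (σ (e.symm (algebraMap k E r))) = _
          rw [he _ (L.algebraMap_mem r), σ.commutes]
          rfl
      map_one' := rfl
      map_mul' := fun _ _ => rfl }
  have hΦ₀ : ∀ σ, Φ₀ σ ∈ L.fixingSubgroup := fun σ => by
    rw [IntermediateField.mem_fixingSubgroup_iff]
    intro b hb
    change e (σ (e.symm b)) = b
    rw [he b hb, σ.commutes]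
    rfl
  let Ψ : L.fixingSubgroup →* (T ≃ₐ[S] T) :=
    { toFun := fun τ => AlgEquiv.ofRingEquiv (f := (e.trans (τ : E ≃ₐ[k] E).toRingEquiv).trans e.symm)
        fun r => by
          obtain ⟨b, hb, hbr⟩ := (hS r).1 r.2
          have h1 : e (algebraMap S T r) = b := Subtype.ext hbr.symm
          change e.symm ((τ : E ≃ₐ[k] E) (e (algebraMap S T r))) = _
          rw [h1, (IntermediateField.mem_fixingSubgroup_iff _ _).1 τ.2 b hb, ← h1]
          rfl
      map_one' := rfl
      map_mul' := fun _ _ => rfl }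
  let ι : k →+* S := (algebraMap k Ω).codRestrict S fun r => hL _ (L.algebraMap_mem r)
  have : Algebra.IsIntegral S T := ⟨fun a => by
    obtain ⟨p, hp, hpa⟩ := Algebra.IsIntegral.isIntegral (R := k) (e a)
    refine ⟨p.map ι, hp.map ι, ?_⟩
    have h1 := congrArg e.symm hpa
    rw [← RingEquiv.coe_toRingHom, Polynomial.hom_eval₂, map_zero] at h1
    rw [Polynomial.eval₂_map]
    exact h1⟩
  have hc1 : Continuous Φ₀ := continuous_of_isOpen_fixes Φ₀ fun x => by
    have h1 : {σ | Φ₀ σ x = x} = MulAction.stabilizer (T ≃ₐ[S] T) (e.symm x) :=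
      Set.ext fun σ => e.symm.injective.eq_iff.symm
    rw [h1]
    exact stabilizer_isOpen_of_isIntegral _
  have hc2 : Continuous Ψ := continuous_of_isOpen_fixes Ψ fun x => by
    have h1 : {τ | Ψ τ x = x} = Subtype.val ⁻¹'
        (MulAction.stabilizer (E ≃ₐ[k] E) (e x) : Set (E ≃ₐ[k] E)) :=
      Set.ext fun τ => e.symm_apply_eq
    rw [h1]
    exact (stabilizer_isOpen_of_isIntegral _).preimage continuous_subtype_val
  refine ⟨{ toFun := fun σ => ⟨Φ₀ σ, hΦ₀ σ⟩, invFun := Ψ, left_inv := fun _ => rfl,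
            right_inv := fun _ => rfl, map_mul' := fun _ _ => rfl,
            continuous_toFun := hc1.subtype_mk _, continuous_invFun := hc2 }, ?_⟩
  intro σ a b hab
  obtain rfl : b = e a := Subtype.ext hab.symm
  rfl

end Krull

namespace IsPullbackEndo

variable {K : Type u} [Field K] {f : RatFunc K} {F : P1 K ⟶ P1 K} {Ω : Type u} [Field Ω]
  [Algebra K Ω] [Algebra (RatFunc K) Ω] [IsScalarTower K (RatFunc K) Ω]
  [IsSepClosure (RatFunc K) Ω]
  {Y : Scheme.{u}} [AlgebraicGeometry.IsIntegral Y] {π : Y ⟶ P1 K} {g : Y ⟶ Y}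

lemma isIdentifiedIMG (h : IsPullbackEndo f F π g) {y : Spec (.of Ω) ⟶ Y}
    (hy : y ≫ π = P1.pt K Ω (tElt K Ω)) {L : IntermediateField (RatFunc K) (treeField f Ω)}
    (hL : (toK L : Set Ω) = ptField y) : IsIdentifiedIMG π g y L.fixingSubgroup where
  tree := h.bijOn_endoFiber hy
  field := coe_endoTreeField hy h hL
  group := exists_continuousMulEquiv_fixingSubgroup (treeField f Ω) L (ptField y)
    (fun a => (Set.ext_iff.1 hL a).symm.trans mem_toK) (endoTreeField g y)
    (coe_endoTreeField hy h hL)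

end IsPullbackEndo

section GeometricBasePoint

variable {K : Type u} [Field K] {f : RatFunc K} {Ω : Type u} [Field Ω]
  [Algebra K Ω] [Algebra (RatFunc K) Ω] [IsScalarTower K (RatFunc K) Ω]

lemma geomPt_comp {Y Z : Scheme.{u}} {L : IntermediateField (RatFunc K) (treeField f Ω)}
    (y : Spec (.of L) ⟶ Y) (π : Y ⟶ Z) : geomPt f Ω y ≫ π = geomPt f Ω (y ≫ π) := by
  simp only [geomPt, Category.assoc]

lemma geomPt_basePt (L : IntermediateField (RatFunc K) (treeField f Ω)) :
    geomPt f Ω (basePt f Ω L) = P1.pt K Ω (tElt K Ω) := by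
  have h1 := specMap_pt (K := K) (L.val.restrictScalars K) (tElt K L)
  have h2 := specMap_pt (K := K) ((treeField f Ω).val.restrictScalars K)
    (tElt K (treeField f Ω))
  exact (congrArg (specIncl (treeField f Ω) Ω ≫ ·) h1).trans h2

lemma mem_ptField_geomPt {Y : Scheme.{u}} {L : IntermediateField (RatFunc K) (treeField f Ω)}
    {y : Spec (.of L) ⟶ Y} {a : Ω} :
    a ∈ ptField (geomPt f Ω y) ↔ ∃ b ∈ ptField y, ((b : treeField f Ω) : Ω) = a := by
  rw [geomPt, specIncl, ptField_map, specIncl, ptField_map]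
  constructor
  · rintro ⟨_, ⟨b, hb, rfl⟩, rfl⟩
    exact ⟨b, hb, rfl⟩
  · rintro ⟨b, hb, rfl⟩
    exact ⟨_, ⟨b, hb, rfl⟩, rfl⟩

/-- The residue field of a geometric point over `t` that is defined over `L'` is an intermediate
field of `L' / K(t)`. -/
lemma exists_toK_eq_ptField {Y : Scheme.{u}} [AlgebraicGeometry.IsIntegral Y] {π : Y ⟶ P1 K}
    {L' : IntermediateField (RatFunc K) (treeField f Ω)} (y : Spec (.of L') ⟶ Y)
    (hy : geomPt f Ω y ≫ π = P1.pt K Ω (tElt K Ω)) :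
    ∃ L ≤ L', (toK L : Set Ω) = ptField (geomPt f Ω y) := by
  have h1 : ∀ r, algebraMap (RatFunc K) Ω r ∈ ptField (geomPt f Ω y) :=
    IsPullbackEndo.ratFunc_mem_ptField hy
  have h2 : ∀ a ∈ ptField (geomPt f Ω y), ∃ b ∈ L', (b : Ω) = a := fun a ha => by
    obtain ⟨b, -, rfl⟩ := mem_ptField_geomPt.1 ha
    exact ⟨b, b.2, rfl⟩
  generalize ptField (geomPt f Ω y) = S at h1 h2
  let L : IntermediateField (RatFunc K) (treeField f Ω) :=
    (S.comap (algebraMap (treeField f Ω) Ω)).toIntermediateField h1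
  refine ⟨L, fun a ha => ?_, Set.ext fun a => mem_toK.trans ⟨?_, fun ha => ?_⟩⟩
  · obtain ⟨b, hb, hba⟩ := h2 a ha
    rwa [← show b = a from Subtype.ext hba]
  · rintro ⟨b, hb, rfl⟩
    exact hb
  · obtain ⟨b, hb, rfl⟩ := h2 a ha
    exact ⟨b, ha, rfl⟩

end GeometricBasePoint

section Converse

variable {K : Type u} [Field K] {f : RatFunc K} {Ω : Type u} [Field Ω]
  [Algebra K Ω] [Algebra (RatFunc K) Ω] [IsScalarTower K (RatFunc K) Ω]
  [IsSepClosure (RatFunc K) Ω]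

/-- The iterated monodromy group of an endomorphism of a curve that is a pullback of `f` and is
covered by a curve `X₍ₙ₎` is self-similar. -/
theorem PathData.isSelfSimilar_of_isNormalizedPullback (Λ : PathData f Ω) {F : P1 K ⟶ P1 K}
    (hF : IsMorphismOf f F) {Y : Scheme.{u}} [AlgebraicGeometry.IsIntegral Y]
    {s : Y ⟶ Spec (.of K)} {π : Y ⟶ P1 K} {g : Y ⟶ Y} {n : ℕ} (η : levelCurve f Ω n ⟶ Y)
    (hs : SmoothOfRelativeDimension 1 s) (hπ : π ≫ P1.struct K = s)
    (hN : IsNormalizedPullback g π π F) (hη : η ≫ π = levelCurveMap f Ω n) :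
    ∃ L : IntermediateField (RatFunc K) (treeField f Ω),
      (fun a : treeField f Ω => (a : Ω)) '' L =
        (ptField (geomPt f Ω (levelCurvePt f Ω n ≫ η)) : Set Ω) ∧
      IsIdentifiedIMG π g (geomPt f Ω (levelCurvePt f Ω n ≫ η)) L.fixingSubgroup ∧
      IsOpen (L.fixingSubgroup : Set (IMG f Ω)) ∧
      (∃ Λ' : PathData f Ω, Λ'.label = Λ.label ∧
        Λ'.LiftsTo π g (geomPt f Ω (levelCurvePt f Ω n ≫ η))) ∧
      ∀ Λ' : PathData f Ω, Λ'.LiftsTo π g (geomPt f Ω (levelCurvePt f Ω n ≫ η)) →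
        Λ'.IsSelfSimilar L.fixingSubgroup := by
  subst hπ
  have h : IsPullbackEndo f F π g := ⟨hF, hs, hN⟩
  have hy : geomPt f Ω (levelCurvePt f Ω n ≫ η) ≫ π = P1.pt K Ω (tElt K Ω) := by
    rw [geomPt_comp, Category.assoc, hη, levelCurvePt, levelCurveMap,
      Scheme.Hom.toNormalization_fromNormalization, geomPt_basePt]
  obtain ⟨L, hLn, hL⟩ := exists_toK_eq_ptField _ hy
  have := Λ.finiteDimensional_levelField n
  have : FiniteDimensional (RatFunc K) L :=
    .of_injective (inclusion hLn).toLinearMap (inclusion hLn).injective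
  exact ⟨L, (coe_toK L).symm.trans hL, h.isIdentifiedIMG hy hL, L.fixingSubgroup_isOpen,
    IsPullbackEndo.exists_pathData_liftsTo hy h Λ,
    fun Λ' => IsPullbackEndo.isSelfSimilar_of_liftsTo hy h hL Λ'⟩

end Converse

/-! ### Charts of normalizations -/

section NormalizationChart

/-- Integral closures are compatible with isomorphisms of pairs of rings. -/
lemma exists_integralClosure_ringEquiv {A B R L : Type*} [CommRing A] [CommRing B] [CommRing R]
    [CommRing L] [Algebra A B] [Algebra R L] (φ : A ≃+* R) (θ : B ≃+* L)
    (h : ∀ a, θ (algebraMap A B a) = algebraMap R L (φ a)) :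
    ∃ e : integralClosure A B ≃+* integralClosure R L,
      (∀ b, (e b : L) = θ b) ∧ ∀ a, e (algebraMap A _ a) = algebraMap R _ (φ a) := by
  have h1 : ∀ b : B, _root_.IsIntegral A b ↔ _root_.IsIntegral R (θ b) := fun b => by
    constructor
    · rintro ⟨p, hp, hb⟩
      refine ⟨p.map φ.toRingHom, hp.map _, ?_⟩
      rw [Polynomial.eval₂_map,
        show (algebraMap R L).comp φ.toRingHom = θ.toRingHom.comp (algebraMap A B) from
          RingHom.ext fun a => (h a).symm]
      exact (Polynomial.hom_eval₂ p (algebraMap A B) θ.toRingHom b).symm.trans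
        ((congrArg θ hb).trans (map_zero θ))
    · rintro ⟨p, hp, hb⟩
      refine ⟨p.map φ.symm.toRingHom, hp.map _, θ.injective ?_⟩
      rw [Polynomial.eval₂_map, map_zero]
      refine (Polynomial.hom_eval₂ p _ θ.toRingHom b).trans ?_
      rwa [show θ.toRingHom.comp ((algebraMap A B).comp φ.symm.toRingHom) = algebraMap R L from
          RingHom.ext fun a => (h _).trans (congrArg _ (φ.apply_symm_apply a))]
  refine ⟨{ toFun b := ⟨θ b, (h1 b).1 b.2⟩
            invFun b := ⟨θ.symm b, (h1 _).2 (by rw [θ.apply_symm_apply]; exact b.2)⟩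
            left_inv b := Subtype.ext (θ.symm_apply_apply _)
            right_inv b := Subtype.ext (θ.apply_symm_apply _)
            map_mul' a b := Subtype.ext (map_mul θ _ _)
            map_add' a b := Subtype.ext (map_add θ _ _) }, fun b => rfl, fun a => ?_⟩
  exact Subtype.ext (h a)

/-- The part of a normalization over an affine open is the spectrum of an integral closure. -/
lemma exists_affine_normalization_chart {X P : Scheme.{u}} (f : X ⟶ P) [QuasiCompact f]
    [QuasiSeparated f] {U : P.Opens} (hU : IsAffineOpen U) :
    letI := (f.app U).hom.toAlgebra
    ∃ (b : Spec (.of (integralClosure Γ(P, U) Γ(X, f ⁻¹ᵁ U))) ⟶ f.normalization)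
      (_ : IsOpenImmersion b), b.opensRange = f.fromNormalization ⁻¹ᵁ U ∧
      b ≫ f.fromNormalization = Spec.map (CommRingCat.ofHom
        (algebraMap Γ(P, U) (integralClosure Γ(P, U) Γ(X, f ⁻¹ᵁ U)))) ≫ hU.fromSpec ∧
      (f ⁻¹ᵁ U).ι ≫ f.toNormalization = (f ⁻¹ᵁ U).toSpecΓ ≫ Spec.map (CommRingCat.ofHom
        (algebraMap (integralClosure Γ(P, U) Γ(X, f ⁻¹ᵁ U)) Γ(X, f ⁻¹ᵁ U))) ≫ b :=
  ⟨f.normalizationOpenCover.f ⟨U, hU⟩, f.normalizationOpenCover.map_prop ⟨U, hU⟩,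
    (f.fromNormalization_preimage ⟨U, hU⟩).symm, f.ι_fromNormalization ⟨U, hU⟩,
    f.ι_toNormalization ⟨U, hU⟩⟩

/-- If `f : Spec L ⟶ P` factors through an affine open `c : Spec R ⟶ P`, then the part of the
normalization of `P` in `L` that lies over this open is the spectrum of the integral closure of `R`
in `L`. -/
lemma exists_normalization_chart {P : Scheme.{u}} {R L : Type u} [CommRing R] [CommRing L]
    [Algebra R L] (c : Spec (.of R) ⟶ P) [IsOpenImmersion c] (f : Spec (.of L) ⟶ P)
    [QuasiCompact f] [QuasiSeparated f]
    (hf : Spec.map (CommRingCat.ofHom (algebraMap R L)) ≫ c = f) :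
    ∃ (b : Spec (.of (integralClosure R L)) ⟶ f.normalization) (_ : IsOpenImmersion b),
      b.opensRange = f.fromNormalization ⁻¹ᵁ c.opensRange ∧
      b ≫ f.fromNormalization =
        Spec.map (CommRingCat.ofHom (algebraMap R (integralClosure R L))) ≫ c ∧
      Spec.map (CommRingCat.ofHom (algebraMap (integralClosure R L) L)) ≫ b =
        f.toNormalization := by
  have hU := isAffineOpen_opensRange c
  have hcU : (⊤ : (Spec (.of R)).Opens) ≤ c ⁻¹ᵁ c.opensRange := by simp
  have hfU : f ⁻¹ᵁ c.opensRange = ⊤ := by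
    rw [← hf, Scheme.Hom.comp_preimage, top_le_iff.1 hcU, Scheme.Hom.preimage_top]
  have hc : IsIso (c.appLE c.opensRange ⊤ hcU) := by
    rw [Scheme.Hom.appLE]
    have := Scheme.Hom.isIso_app c c.opensRange le_rfl
    have : IsIso (homOfLE hcU) := ⟨homOfLE le_top, Subsingleton.elim _ _, Subsingleton.elim _ _⟩
    infer_instance
  generalize c.opensRange = U at *
  let : Algebra Γ(P, U) Γ(Spec (.of L), f ⁻¹ᵁ U) := (f.app U).hom.toAlgebra
  let φ : Γ(P, U) ⟶ .of R := c.appLE U ⊤ hcU ≫ (Scheme.ΓSpecIso (.of R)).hom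
  let θ : Γ(Spec (.of L), f ⁻¹ᵁ U) ⟶ .of L :=
    (Spec (.of L)).presheaf.map (homOfLE hfU.ge).op ≫ (Scheme.ΓSpecIso (.of L)).hom
  have : IsIso (homOfLE hfU.ge) := ⟨homOfLE hfU.le, Subsingleton.elim _ _, Subsingleton.elim _ _⟩
  have hφ : IsIso φ := inferInstance
  have hθ : IsIso θ := inferInstance
  have hsq : f.app U ≫ θ = φ ≫ CommRingCat.ofHom (algebraMap R L) := by
    simp only [φ, θ, Category.assoc]
    rw [← Scheme.ΓSpecIso_naturality, Scheme.Hom.app_eq_appLE, Scheme.Hom.appLE_map_assoc]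
    subst hf
    rw [← Scheme.Hom.appLE_comp_appLE _ _ _ _ _ hcU (by simp)]
    simp [Scheme.Hom.app_eq_appLE]
  have hφc : Spec.map φ ≫ hU.fromSpec = c := by
    simp only [φ]
    rw [Spec.map_comp_assoc, IsAffineOpen.SpecMap_appLE_fromSpec _ _ (isAffineOpen_top (Spec _)),
      IsAffineOpen.fromSpec_top, Scheme.isoSpec_Spec_inv, ← Spec.map_comp_assoc]
    simp
  have h2 : (f ⁻¹ᵁ U).ι ≫ Spec.map θ = (f ⁻¹ᵁ U).toSpecΓ := by
    simp only [θ]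
    rw [Spec.map_comp, SpecMap_ΓSpecIso_hom, ← Scheme.Opens.toSpecΓ_SpecMap_presheaf_map_top_assoc,
      ← Spec.map_comp, ← Functor.map_comp, ← op_comp, Subsingleton.elim (homOfLE _ ≫ _) (𝟙 _),
      op_id, CategoryTheory.Functor.map_id, Spec.map_id, Category.comp_id]
  obtain ⟨e, he, he'⟩ := exists_integralClosure_ringEquiv
    (asIso φ).commRingCatIsoToRingEquiv (asIso θ).commRingCatIsoToRingEquiv
    (fun a => congrArg (fun ψ => ψ.hom a) hsq)
  obtain ⟨b, hb, h3, h4, h5⟩ := exists_affine_normalization_chart f hU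
  clear_value φ θ
  let ε : CommRingCat.of (integralClosure Γ(P, U) Γ(Spec (.of L), f ⁻¹ᵁ U)) ⟶
    .of (integralClosure R L) := e.toCommRingCatIso.hom
  have hε : IsIso (Spec.map ε) := inferInstance
  refine ⟨Spec.map ε ≫ b, inferInstance, ?_, ?_, ?_⟩
  · rw [← h3]
    exact Scheme.Hom.opensRange_comp_of_isIso _ _
  · have : CommRingCat.ofHom (algebraMap Γ(P, U)
        (integralClosure Γ(P, U) Γ(Spec (.of L), f ⁻¹ᵁ U))) ≫ ε =
        φ ≫ CommRingCat.ofHom (algebraMap R (integralClosure R L)) :=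
      CommRingCat.hom_ext (RingHom.ext he')
    rw [Category.assoc, h4, ← Spec.map_comp_assoc, this, Spec.map_comp_assoc, hφc]
  · have hi : IsIso (f ⁻¹ᵁ U).ι := by
      rw [hfU]; exact inferInstanceAs (IsIso (Scheme.topIso _).hom)
    have h1 : ε ≫ CommRingCat.ofHom (algebraMap (integralClosure R L) L) =
        CommRingCat.ofHom (algebraMap (integralClosure Γ(P, U) Γ(Spec (.of L), f ⁻¹ᵁ U))
          Γ(Spec (.of L), f ⁻¹ᵁ U)) ≫ θ :=
      CommRingCat.hom_ext (RingHom.ext he)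
    rw [← cancel_epi (f ⁻¹ᵁ U).ι, h5, ← Spec.map_comp_assoc, h1, Spec.map_comp_assoc,
      reassoc_of% h2]

end NormalizationChart

/-! ### The normalization of the projective line in a field -/

lemma isIntegrallyClosed_stalk_spec (B : Type u) [CommRing B] [IsDomain B] [IsIntegrallyClosed B]
    (p : PrimeSpectrum B) : IsIntegrallyClosed ((Spec (.of B)).presheaf.stalk p) := by
  let := StructureSheaf.stalkAlgebra B p
  have := StructureSheaf.IsLocalization.to_stalk B p
  exact isIntegrallyClosed_of_isLocalization ((Spec.structureSheaf B).presheaf.stalk p)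
    p.asIdeal.primeCompl p.asIdeal.primeCompl_le_nonZeroDivisors

section CurveOver

open IsLocalRing

variable (K L : Type u) [Field K] [Field L] [Algebra K L] [Algebra (RatFunc K) L]

/-- The generic point of the projective line with coordinate `t`, defined over an extension `L` of
`K(t)`. -/
abbrev fieldPt : Spec (.of L) ⟶ P1 K := P1.pt K L (tElt K L)

instance : QuasiCompact (fieldPt K L) := inferInstance

instance : QuasiSeparated (fieldPt K L) := inferInstance

/-- The normalization of the projective line in an extension `L` of its function field. -/
abbrev curveOver : Scheme.{u} := (fieldPt K L).normalization

/-- The covering map of the normalization of the projective line in `L`. -/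
abbrev curveMap : curveOver K L ⟶ P1 K := (fieldPt K L).fromNormalization

/-- The generic point of the normalization of the projective line in `L`. -/
abbrev curvePt : Spec (.of L) ⟶ curveOver K L := (fieldPt K L).toNormalization

/-- A standard chart of the projective line, as the spectrum of a subring of the function field. -/
def ratChart (K : Type u) [Field K] (j : Fin 2) : Spec (.of (ChartRing K j)) ⟶ P1 K :=
  Spec.map (CommRingCat.ofHom ((chartRingEquiv K j : Polynomial K →ₐ[K] ChartRing K j) :
    Polynomial K →+* ChartRing K j)) ≫ chart K j

instance (j : Fin 2) : IsIso (Spec.map (CommRingCat.ofHom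
    ((chartRingEquiv K j : Polynomial K →ₐ[K] ChartRing K j) : Polynomial K →+* ChartRing K j))) :=
  inferInstanceAs (IsIso (Spec.map (chartRingEquiv K j).toRingEquiv.toCommRingCatIso.hom))

instance (j : Fin 2) : IsOpenImmersion (ratChart K j) := inferInstanceAs (IsOpenImmersion (_ ≫ _))

lemma opensRange_ratChart (j : Fin 2) : (ratChart K j).opensRange = (chart K j).opensRange :=
  Scheme.Hom.opensRange_comp_of_isIso _ _

lemma ratChart_struct (j : Fin 2) : ratChart K j ≫ P1.struct K =
    Spec.map (CommRingCat.ofHom (algebraMap K (ChartRing K j))) := by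
  rw [ratChart, Category.assoc, chart_eq, chartPt_isOver, ← Spec.map_comp, ← CommRingCat.ofHom_comp]
  congr 2

lemma specMap_ratChart (j : Fin 2) :
    Spec.map (CommRingCat.ofHom (algebraMap (ChartRing K j) (RatFunc K))) ≫ ratChart K j =
      P1.pt K (RatFunc K) RatFunc.X := by
  rw [ratChart, ← Spec.map_comp_assoc, ← chartPt_ratCoord j, chartPt]
  rfl

variable [IsScalarTower K (RatFunc K) L]

lemma fieldPt_eq : specIncl (RatFunc K) L ≫ P1.pt K (RatFunc K) RatFunc.X = fieldPt K L :=
  specMap_pt (IsScalarTower.toAlgHom K (RatFunc K) L) RatFunc.X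

variable [∀ j, Algebra (ChartRing K j) L] [∀ j, IsScalarTower (ChartRing K j) (RatFunc K) L]

lemma specMap_ratChart_eq_fieldPt (j : Fin 2) :
    Spec.map (CommRingCat.ofHom (algebraMap (ChartRing K j) L)) ≫ ratChart K j =
      fieldPt K L := by
  rw [← fieldPt_eq, ← specMap_ratChart K j, ← Spec.map_comp_assoc, ← CommRingCat.ofHom_comp,
    ← IsScalarTower.algebraMap_eq]

/-- A chart of the normalization of the projective line: the spectrum of the integral closure of a
polynomial ring. -/
def curveChart (j : Fin 2) : Spec (.of (integralClosure (ChartRing K j) L)) ⟶ curveOver K L :=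
  (exists_normalization_chart _ _ (specMap_ratChart_eq_fieldPt K L j)).choose

instance (j : Fin 2) : IsOpenImmersion (curveChart K L j) :=
  (exists_normalization_chart _ _ (specMap_ratChart_eq_fieldPt K L j)).choose_spec.choose

lemma opensRange_curveChart (j : Fin 2) :
    (curveChart K L j).opensRange = curveMap K L ⁻¹ᵁ (ratChart K j).opensRange :=
  (exists_normalization_chart _ _ (specMap_ratChart_eq_fieldPt K L j)).choose_spec.choose_spec.1

lemma curveChart_curveMap (j : Fin 2) : curveChart K L j ≫ curveMap K L =
    Spec.map (CommRingCat.ofHom (algebraMap (ChartRing K j) (integralClosure (ChartRing K j) L))) ≫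
      ratChart K j :=
  (exists_normalization_chart _ _ (specMap_ratChart_eq_fieldPt K L j)).choose_spec.choose_spec.2.1

lemma specMap_curveChart (j : Fin 2) :
    Spec.map (CommRingCat.ofHom (algebraMap (integralClosure (ChartRing K j) L) L)) ≫
      curveChart K L j = curvePt K L :=
  (exists_normalization_chart _ _ (specMap_ratChart_eq_fieldPt K L j)).choose_spec.choose_spec.2.2

variable {K L} in
lemma exists_curveChart_eq (x : curveOver K L) : ∃ j y, curveChart K L j y = x := by
  obtain ⟨j, hj⟩ := exists_mem_range_chart (curveMap K L x)
  rw [← opensRange_ratChart] at hj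
  obtain ⟨y, hy⟩ := (opensRange_curveChart K L j).ge hj
  exact ⟨j, y, hy⟩

variable {K L} in
/-- A property of morphisms out of the normalization of the projective line in `L` that is local at
the source may be checked on charts. -/
lemma of_curveChart {P : MorphismProperty Scheme.{u}} (hP : IsZariskiLocalAtSource P)
    {Z : Scheme.{u}} (q : curveOver K L ⟶ Z) (h : ∀ j, P (curveChart K L j ≫ q)) : P q :=
  (IsZariskiLocalAtSource.iff_of_openCover (P := P) (Scheme.Cover.mkOfCovers (Fin 2) _
    (curveChart K L) exists_curveChart_eq inferInstance)).2 h

instance (j : Fin 2) : IsScalarTower K (ChartRing K j) L := .of_algebraMap_eq fun a => by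
  rw [IsScalarTower.algebraMap_apply (ChartRing K j) (RatFunc K) L,
    ← IsScalarTower.algebraMap_apply K (ChartRing K j) (RatFunc K),
    ← IsScalarTower.algebraMap_apply K (RatFunc K) L]

lemma curveChart_struct (j : Fin 2) : curveChart K L j ≫ curveMap K L ≫ P1.struct K =
    Spec.map (CommRingCat.ofHom (algebraMap K (integralClosure (ChartRing K j) L))) := by
  rw [← Category.assoc, curveChart_curveMap, Category.assoc, ratChart_struct, ← Spec.map_comp,
    ← CommRingCat.ofHom_comp, ← IsScalarTower.algebraMap_eq]

variable [FiniteDimensional (RatFunc K) L]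

instance (j : Fin 2) : IsFractionRing (integralClosure (ChartRing K j) L) L :=
  integralClosure.isFractionRing_of_finite_extension (RatFunc K) L

lemma surjectiveOnStalks_curvePt : SurjectiveOnStalks (curvePt K L) := by
  rw [← specMap_curveChart K L 0]
  have : SurjectiveOnStalks (Spec.map (CommRingCat.ofHom
      (algebraMap (integralClosure (ChartRing K 0) L) L))) :=
    SurjectiveOnStalks.Spec_iff.2
      (RingHom.surjectiveOnStalks_of_isLocalization (nonZeroDivisors _) L)
  infer_instance

lemma isIntegrallyClosed_stalk_curveOver (x : curveOver K L) :
    IsIntegrallyClosed ((curveOver K L).presheaf.stalk x) := by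
  obtain ⟨j, p, rfl⟩ := exists_curveChart_eq x
  have : IsIntegrallyClosed (integralClosure (ChartRing K j) L) :=
    integralClosure.isIntegrallyClosedOfFiniteExtension (RatFunc K)
  have := isIntegrallyClosed_stalk_spec (integralClosure (ChartRing K j) L) p
  exact .of_equiv (asIso ((curveChart K L j).stalkMap p)).symm.commRingCatIsoToRingEquiv

instance : Flat (curveMap K L) := by
  refine of_curveChart (P := @Flat)
    (HasRingHomProperty.instIsZariskiLocalAtSource (Q := RingHom.Flat)) _ fun j => ?_
  rw [curveChart_curveMap]
  have : Flat (Spec.map (CommRingCat.ofHom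
      (algebraMap (ChartRing K j) (integralClosure (ChartRing K j) L)))) := by
    rw [Flat.SpecMap_iff]
    have := faithfulSMul_integralClosure K (ChartRing K j) L
    have h : Module.Flat (ChartRing K j) (integralClosure (ChartRing K j) L) := inferInstance
    exact RingHom.flat_algebraMap_iff.2 h
  infer_instance

lemma isFinite_curveMap [Algebra.IsSeparable (RatFunc K) L] : IsFinite (curveMap K L) := by
  rw [IsFinite.iff_isIntegralHom_and_locallyOfFiniteType]
  refine ⟨inferInstance, of_curveChart (P := @LocallyOfFiniteType)
    (HasRingHomProperty.instIsZariskiLocalAtSource (Q := RingHom.FiniteType)) _ fun j => ?_⟩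
  suffices LocallyOfFiniteType ((curveChart K L j ≫ curveMap K L) ≫ P1.struct K) from
    locallyOfFiniteType_of_comp _ (P1.struct K)
  rw [Category.assoc, curveChart_struct, HasRingHomProperty.Spec_iff (P := @LocallyOfFiniteType)]
  have := finiteType_integralClosure (ChartRing K j) (chartRingEquiv K j) L
  exact RingHom.finiteType_algebraMap.2 this

lemma smooth_curveOver (h : ∀ j (q : Ideal (integralClosure (ChartRing K j) L)) [q.IsPrime],
      ∃ b ∉ q, Algebra.IsStandardSmoothOfRelativeDimension 1 K (Localization.Away b)) :
    SmoothOfRelativeDimension 1 (curveMap K L ≫ P1.struct K) := by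
  refine of_curveChart (P := @SmoothOfRelativeDimension 1)
    (HasRingHomProperty.instIsZariskiLocalAtSource
      (Q := RingHom.Locally (RingHom.IsStandardSmoothOfRelativeDimension 1))) _ fun j => ?_
  rw [curveChart_struct, HasRingHomProperty.Spec_iff (P := @SmoothOfRelativeDimension.{u} 1)]
  let B := integralClosure (ChartRing K j) L
  rw [RingHom.locally_iff_span_eq_top]
  by_contra hne
  obtain ⟨q, hq, hle⟩ := Ideal.exists_le_maximal _ hne
  obtain ⟨b, hb, hb'⟩ := h j q
  refine hb (hle (Ideal.subset_span ?_))
  change RingHom.IsStandardSmoothOfRelativeDimension 1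
    ((algebraMap B (Localization.Away b)).comp (algebraMap K B))
  rw [← IsScalarTower.algebraMap_eq]
  exact (RingHom.isStandardSmoothOfRelativeDimension_algebraMap 1).2 hb'

end CurveOver

/-! ### Endomorphisms of normalizations -/

section CurvePoints

open IsLocalRing

variable {K L : Type u} [Field K] [Field L] [Algebra K L] [Algebra (RatFunc K) L]
  [IsScalarTower K (RatFunc K) L] [∀ j, Algebra (ChartRing K j) L]
  [∀ j, IsScalarTower (ChartRing K j) (RatFunc K) L] [FiniteDimensional (RatFunc K) L]

/-- A point of the normalization of the projective line in `L` that has transcendental coordinate is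
given by a homomorphism on `L`. -/
lemma exists_specMap_curvePt_eq {M : Type u} [Field M] [Algebra K M]
    {z : Spec (.of M) ⟶ curveOver K L} {x : M} (hx : Transcendental K x)
    (hz : z ≫ curveMap K L = P1.pt K M x) :
    ∃ α : L →ₐ[K] M, Spec.map (CommRingCat.ofHom (α : L →+* M)) ≫ curvePt K L = z ∧
      α (tElt K L) = x := by
  obtain ⟨j, p, hp⟩ := exists_curveChart_eq (z (closedPoint M))
  obtain ⟨φ, rfl⟩ := exists_specMap_comp_eq (curveChart K L j) z ⟨p, hp⟩
  let B := integralClosure (ChartRing K j) L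
  let φ' : B →+* M := φ.hom
  have h1 : Spec.map (CommRingCat.ofHom (φ'.comp (algebraMap (ChartRing K j) B))) ≫
      ratChart K j = P1.pt K M x := by
    rw [← hz, Category.assoc, curveChart_curveMap, ← Spec.map_comp_assoc]
    rfl
  have hR : Function.Injective (φ'.comp (algebraMap (ChartRing K j) B)) := by
    have h2 : ratChart K j (Spec.map (CommRingCat.ofHom (φ'.comp (algebraMap (ChartRing K j) B)))
        (closedPoint M)) = ratChart K j (genericPoint (Spec (.of (ChartRing K j)))) :=
      (congrArg (fun z : Spec (.of M) ⟶ P1 K => z (closedPoint M)) h1).trans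
        ((pt_closedPoint hx).trans (genericPoint_eq_of_isOpenImmersion (ratChart K j)).symm)
    have h3 := (ratChart K j).isOpenEmbedding.injective h2
    rw [genericPoint_eq_bot_of_affine] at h3
    have h4 : (maximalIdeal M).comap (φ'.comp (algebraMap (ChartRing K j) B)) = ⊥ :=
      congrArg PrimeSpectrum.asIdeal h3
    rw [maximalIdeal_eq_bot] at h4
    exact (RingHom.injective_iff_ker_eq_bot _).2 h4
  have hB : Function.Injective φ' := by
    rw [RingHom.injective_iff_ker_eq_bot]
    refine Ideal.eq_bot_of_comap_eq_bot (R := ChartRing K j) ?_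
    exact (RingHom.injective_iff_ker_eq_bot _).1 hR
  have hK : φ'.comp (algebraMap K B) = algebraMap K M := by
    have h2 := congrArg (· ≫ P1.struct K) hz
    simp only [Category.assoc, curveChart_struct, isOver_pt] at h2
    rw [← Spec.map_comp, Spec.map_inj] at h2
    exact congrArg CommRingCat.Hom.hom h2
  let α : L →+* M := IsFractionRing.lift hB
  have hα : ∀ b : B, α (algebraMap B L b) = φ' b := IsFractionRing.lift_algebraMap hB
  let αK : L →ₐ[K] M :=
    { α with
      commutes' := fun a => by
        change α (algebraMap K L a) = _
        rw [IsScalarTower.algebraMap_apply K B L, hα]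
        exact congrArg (fun φ => φ a) hK }
  have h5 : Spec.map (CommRingCat.ofHom (αK : L →+* M)) ≫ curvePt K L =
      Spec.map φ ≫ curveChart K L j := by
    rw [← specMap_curveChart K L j, ← Spec.map_comp_assoc]
    congr 2
    ext b
    exact hα b
  refine ⟨αK, h5, ?_⟩
  refine pt_injective (K := K) ?_
  rw [← specMap_pt, ← hz, ← h5, Category.assoc, Scheme.Hom.toNormalization_fromNormalization]

end CurvePoints

section PushoutEndo

open IsLocalRing

variable {K L : Type u} [Field K] [Field L] [Algebra K L] [Algebra (RatFunc K) L]

/-- The endomorphism `ψ` of the extension `L` of `K(t)` extends `t ↦ f(t)`, and this square of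
fields is cocartesian: `L` is the compositum of `ψ(L)` and `K(t)`, and these are linearly disjoint over
`K(f(t))`, which is stated as a universal property. -/
structure IsFieldPushout (f : RatFunc K) (ψ : L →ₐ[K] L) : Prop where
  map_t : ψ (tElt K L) = evalMap f L (tElt K L)
  exists_desc : ∀ (M : Type u) [Field M] [Algebra K M] (α : L →ₐ[K] M) (x : M),
    Transcendental K x → α (tElt K L) = evalMap f M x →
      ∃ γ : L →ₐ[K] M, γ.comp ψ = α ∧ γ (tElt K L) = x
  eq_top : ∀ S : IntermediateField K L, tElt K L ∈ S → (∀ a, ψ a ∈ S) → S = ⊤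

variable [IsScalarTower K (RatFunc K) L] [∀ j, Algebra (ChartRing K j) L]
  [∀ j, IsScalarTower (ChartRing K j) (RatFunc K) L] [FiniteDimensional (RatFunc K) L]

/-- An endomorphism `ψ` of `L` that extends `t ↦ f(t)` induces an endomorphism of the normalization
of the projective line in `L`. -/
lemma exists_curve_endo {f : RatFunc K} {F : P1 K ⟶ P1 K} (hF : IsMorphismOf f F) {ψ : L →ₐ[K] L}
    (hψ : ψ (tElt K L) = evalMap f L (tElt K L)) :
    ∃ (g : curveOver K L ⟶ curveOver K L) (w : g ≫ curveMap K L = curveMap K L ≫ F),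
      curvePt K L ≫ g = Spec.map (CommRingCat.ofHom (ψ : L →+* L)) ≫ curvePt K L ∧
      IsIntegralHom (pullback.lift g (curveMap K L) w) := by
  have h1 : (Spec.map (CommRingCat.ofHom (ψ : L →+* L)) ≫ curvePt K L) ≫ curveMap K L =
      fieldPt K L ≫ F := by
    rw [Category.assoc, Scheme.Hom.toNormalization_fromNormalization, specMap_pt, hψ,
      hF.pt_comp transcendental_tElt]
  have h2 : fieldPt K L = pullback.lift _ _ h1 ≫ pullback.snd (curveMap K L) F :=
    (pullback.lift_snd _ _ _).symm
  let θ := (fieldPt K L).normalizationDesc (pullback.lift _ _ h1) (pullback.snd _ _) h2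
  have h3 : θ ≫ pullback.snd (curveMap K L) F = curveMap K L :=
    Scheme.Hom.normalizationDesc_comp _ _ _ h2
  have h4 : curvePt K L ≫ θ = pullback.lift _ _ h1 :=
    Scheme.Hom.toNormalization_normalizationDesc _ _ _ h2
  have w : (θ ≫ pullback.fst (curveMap K L) F) ≫ curveMap K L = curveMap K L ≫ F := by
    rw [Category.assoc, pullback.condition, reassoc_of% h3]
  refine ⟨θ ≫ pullback.fst _ _, w, ?_, ?_⟩
  · rw [reassoc_of% h4, pullback.lift_fst]
  · have : pullback.lift (θ ≫ pullback.fst (curveMap K L) F) (curveMap K L) w = θ := by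
      apply pullback.hom_ext
      · rw [pullback.lift_fst]
      · rw [pullback.lift_snd, h3]
    rw [this]
    infer_instance

lemma curvePt_closedPoint : curvePt K L (closedPoint L) = genericPoint (curveOver K L) := by
  rw [← specMap_curveChart K L 0]
  refine (congrArg (curveChart K L 0) (specMap_closedPoint _ ?_)).trans
    (genericPoint_eq_of_isOpenImmersion _)
  exact Subtype.val_injective

/-- If `t ↦ f(t)` extends to an endomorphism of `L` then `f` preserves transcendence. -/
lemma IsFieldPushout.transcendental_evalMap {f : RatFunc K} {ψ : L →ₐ[K] L}
    (hψ : IsFieldPushout f ψ) {M : Type u} [Field M] [Algebra K M] {x : M}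
    (hx : Transcendental K x) : Transcendental K (evalMap f M x) := by
  obtain ⟨β, rfl⟩ := exists_algHom_ratFunc hx
  have h1 : IsScalarTower.toAlgHom K (RatFunc K) L f = evalMap f L (tElt K L) := by
    conv_lhs => rw [← evalMap_X f, evalMap_hom]
    rfl
  have h2 : Transcendental K (evalMap f L (tElt K L)) := by
    rw [← hψ.map_t]
    exact mt (isAlgebraic_algHom_iff ψ ψ.injective).1 transcendental_tElt
  rw [← evalMap_hom, evalMap_X]
  rw [← h1] at h2
  exact mt (isAlgebraic_algHom_iff β β.injective).1
    (mt (isAlgebraic_algHom_iff _ (RingHom.injective _)).2 h2)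

lemma surjective_residueFieldMap_of_ptField_eq_top {Y P : Scheme.{u}} {M : Type u} [Field M]
    (z : Spec (.of M) ⟶ Y) (h : Y ⟶ P) (hz : ptField (z ≫ h) = ⊤) :
    Function.Surjective (h.residueFieldMap (z (closedPoint M))).hom := by
  obtain ⟨χ, hχ⟩ := exists_fac_residueField z
  generalize z (closedPoint M) = p at χ hχ
  subst hχ
  rw [comp_fromSpecResidueField, ptField_eq_fieldRange] at hz
  intro a
  obtain ⟨b, hb⟩ := hz.ge (Subfield.mem_top (χ.hom a))
  exact ⟨b, χ.hom.injective hb⟩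

/-- The square formed by the endomorphism of the normalization that is induced by `ψ` and the
endomorphism of the line is a pullback of curves if the corresponding square of function fields is
cocartesian. -/
lemma isNormalizedPullback_curve {f : RatFunc K} {F : P1 K ⟶ P1 K} (hF : IsMorphismOf f F)
    {ψ : L →ₐ[K] L} (hψ : IsFieldPushout f ψ) {g : curveOver K L ⟶ curveOver K L}
    (w : g ≫ curveMap K L = curveMap K L ≫ F)
    (hg : curvePt K L ≫ g = Spec.map (CommRingCat.ofHom (ψ : L →+* L)) ≫ curvePt K L)
    (hi : IsIntegralHom (pullback.lift g (curveMap K L) w)) :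
    IsNormalizedPullback g (curveMap K L) (curveMap K L) F := by
  refine ⟨w, isIntegrallyClosed_stalk_curveOver K L, hi, ?_, ?_⟩
  · -- the range is closed, and by flatness every point of the fibre product is a specialization of
    -- a point over the generic point of the line; such points are described by homomorphisms on `L`
    have hc := (pullback.lift g (curveMap K L) w).isClosedMap.isClosed_range
    suffices h : Function.Surjective (pullback.lift g (curveMap K L) w) from ⟨h.denseRange⟩
    intro p
    have hgen : GeneralizingMap (pullback.snd (curveMap K L) F) := Flat.generalizingMap _
    obtain ⟨q, hqp, hq⟩ := hgen (genericPoint_specializes (pullback.snd (curveMap K L) F p))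
    refine hqp.mem_closed hc ?_
    let M := (pullback (curveMap K L) F).residueField q
    let ξ : Spec (.of M) ⟶ pullback (curveMap K L) F := Scheme.fromSpecResidueField _ q
    have hξ : ξ (closedPoint M) = q := Scheme.fromSpecResidueField_apply _ _
    obtain ⟨ρ, hρ⟩ := Spec.map_surjective (ξ ≫ pullback.snd _ _ ≫ P1.struct K)
    let : Algebra K M := ρ.hom.toAlgebra
    obtain ⟨j, s, hs⟩ := exists_eq_chartPt (w := ξ ≫ pullback.snd _ _)
      (by rw [Category.assoc, ← hρ]; rfl)
    have hs' : Transcendental K s := transcendental_of_closedPoint (j := j) (by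
      rw [← hs]
      exact (congrArg (pullback.snd (curveMap K L) F) hξ).trans hq)
    obtain ⟨x, hx, hx'⟩ := exists_eq_pt (w := ξ ≫ pullback.snd _ _)
      (by rw [Category.assoc, ← hρ]; rfl) (hs ▸ mem_ptField_chartPt j s) hs'
    have h1 : (ξ ≫ pullback.fst _ _) ≫ curveMap K L = P1.pt K M (evalMap f M x) := by
      rw [Category.assoc, pullback.condition, ← Category.assoc, hx', hF.pt_comp hx]
    obtain ⟨α, hα, hαt⟩ := exists_specMap_curvePt_eq (hψ.transcendental_evalMap hx) h1
    obtain ⟨γ, rfl, rfl⟩ := hψ.exists_desc M α x hx hαt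
    have h2 : (Spec.map (CommRingCat.ofHom (γ : L →+* M)) ≫ curvePt K L) ≫
        pullback.lift g (curveMap K L) w = ξ := by
      apply pullback.hom_ext
      · rw [← hα, Category.assoc, Category.assoc, pullback.lift_fst, hg, ← Spec.map_comp_assoc]
        rfl
      · rw [hx', Category.assoc, Category.assoc, pullback.lift_snd,
          Scheme.Hom.toNormalization_fromNormalization, specMap_pt]
    rw [← hξ, ← h2]
    exact ⟨_, rfl⟩
  · have h1 := curvePt_closedPoint (K := K) (L := L)
    rw [← h1]
    apply surjective_residueFieldMap_of_ptField_eq_top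
    have := surjectiveOnStalks_curvePt K L
    have h2 : ptField (Spec.map (CommRingCat.ofHom (ψ : L →+* L)) ≫ curvePt K L) ≤
        ptField (curvePt K L ≫ pullback.lift g (curveMap K L) w) := by
      have := ptField_comp_le (curvePt K L ≫ pullback.lift g (curveMap K L) w) (pullback.fst _ _)
      rwa [Category.assoc, pullback.lift_fst, hg] at this
    have h3 : ptField (fieldPt K L) ≤
        ptField (curvePt K L ≫ pullback.lift g (curveMap K L) w) := by
      have := ptField_comp_le (curvePt K L ≫ pullback.lift g (curveMap K L) w) (pullback.snd _ _)
      rwa [Category.assoc, pullback.lift_snd, Scheme.Hom.toNormalization_fromNormalization] at this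
    rw [ptField_map, ptField_eq_top] at h2
    generalize ptField (curvePt K L ≫ pullback.lift g (curveMap K L) w) = S at h2 h3
    have h4 : ∀ a, ψ a ∈ S := fun a => h2 ⟨a, Subfield.mem_top a, rfl⟩
    have h5 := hψ.eq_top (S.toIntermediateField fun a => ψ.commutes a ▸ h4 _)
      (h3 (mem_ptField_pt _)) h4
    exact eq_top_iff.2 fun a _ => h5.ge (IntermediateField.mem_top (x := a))

end PushoutEndo

/-! ### The field pushout attached to a self-similar subgroup -/

section FieldPushout

/-- A homomorphism on `A` extends to the compositum of `A` and `F(x)` if the minimal polynomial of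
`x` over `A` acquires a root in the target. -/
lemma exists_ringHom_sup_adjoin {F E M : Type*} [Field F] [Field E] [Field M] [Algebra F E]
    {A : IntermediateField F E} {x : E} (hint : _root_.IsIntegral A x) (α : A →+* M) {y : M}
    (h : (minpoly A x).eval₂ α y = 0) :
    ∃ γ : (A ⊔ F⟮x⟯ : IntermediateField F E) →+* M,
      (∀ a (ha : a ∈ A), γ ⟨a, (le_sup_left : A ≤ A ⊔ F⟮x⟯) ha⟩ = α ⟨a, ha⟩) ∧
      γ ⟨x, (le_sup_right : F⟮x⟯ ≤ A ⊔ F⟮x⟯) (mem_adjoin_simple_self F x)⟩ = y := by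
  let : Algebra A M := α.toAlgebra
  have htf : Module.IsTorsionFree A M := inferInstance
  let γ₀ : adjoin A {x} →ₐ[A] M := (algHomAdjoinIntegralEquiv A hint).symm
    ⟨y, (Polynomial.mem_aroots).2 ⟨minpoly.ne_zero hint, h⟩⟩
  have hγ₀ : γ₀ (AdjoinSimple.gen A x) = y := algHomAdjoinIntegralEquiv_symm_apply_gen A hint _
  have h3 : A ⊔ F⟮x⟯ = (adjoin A {x}).restrictScalars F :=
    (restrictScalars_adjoin_eq_sup _ _ _).symm
  let κ : (A ⊔ F⟮x⟯ : IntermediateField F E) →+* adjoin A {x} :=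
    (inclusion h3.le).toRingHom
  exact ⟨(γ₀ : _ →+* M).comp κ, fun a ha => γ₀.commutes ⟨a, ha⟩, hγ₀⟩

variable {K : Type u} [Field K] {f : RatFunc K} {Ω : Type u} [Field Ω] [Algebra K Ω]
  [Algebra (RatFunc K) Ω] [IsScalarTower K (RatFunc K) Ω] [IsSepClosure (RatFunc K) Ω]

lemma exists_algEquiv_of_map_toK_eq {A B : IntermediateField (RatFunc K) (treeField f Ω)}
    {e : Ω ≃ₐ[K] Ω} (h : (toK A).map (e : Ω →ₐ[K] Ω) = toK B) :
    ∃ ψ : A ≃ₐ[K] B, ∀ a, ((ψ a : treeField f Ω) : Ω) = e ((a : treeField f Ω) : Ω) := by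
  have h1 : ∀ a : A, ∃ b : B, ((b : treeField f Ω) : Ω) = e ((a : treeField f Ω) : Ω) := fun a => by
    have : e ((a : treeField f Ω) : Ω) ∈ toK B := h ▸ ⟨_, coe_mem_toK.2 a.2, rfl⟩
    obtain ⟨b, hb, hba⟩ := mem_toK.1 this
    exact ⟨⟨b, hb⟩, hba⟩
  choose ψ hψ using h1
  have hinj : ∀ a b : B, ((a : treeField f Ω) : Ω) = ((b : treeField f Ω) : Ω) → a = b :=
    fun a b hab => Subtype.ext (Subtype.ext hab)
  let Ψ : A →ₐ[K] B :=
    { toFun := ψ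
      map_one' := hinj _ _ ((hψ 1).trans (map_one e))
      map_zero' := hinj _ _ ((hψ 0).trans (map_zero e))
      map_add' a b := hinj _ _ ((hψ (a + b)).trans
        ((map_add e _ _).trans (congrArg₂ (· + ·) (hψ a) (hψ b)).symm))
      map_mul' a b := hinj _ _ ((hψ (a * b)).trans
        ((map_mul e _ _).trans (congrArg₂ (· * ·) (hψ a) (hψ b)).symm))
      commutes' c := hinj _ _ ((hψ _).trans (e.commutes c)) }
  refine ⟨AlgEquiv.ofBijective Ψ ⟨Ψ.injective, fun b => ?_⟩, hψ⟩
  have h2 : ((b : treeField f Ω) : Ω) ∈ (toK A).map (e : Ω →ₐ[K] Ω) := h ▸ coe_mem_toK.2 b.2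
  obtain ⟨x, hx, hxb⟩ := h2
  obtain ⟨a, ha, rfl⟩ := mem_toK.1 hx
  exact ⟨⟨a, ha⟩, hinj _ _ ((hψ _).trans hxb)⟩

namespace PathData

variable (Λ : PathData f Ω) {L : IntermediateField (RatFunc K) (treeField f Ω)}
  [FiniteDimensional (RatFunc K) L] {i : Fin (degree f)}

/-- A point with the coordinate `x` and a point of the curve that lies over `f(x)` have the same
minimal equation: `x` is a root of the image of the minimal polynomial of `tᵢ` over `L`. -/
lemma eval₂_minpoly_root (hL : L.LinearDisjoint (Λ.rootField i)) {M : Type u} [Field M]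
    [Algebra K M] (α : L →ₐ[K] M) {x : M} (hx : Transcendental K x)
    (hα : α (tElt K L) = evalMap f M x) :
    (minpoly L (Λ.root i)).eval₂ (α : L →+* M) x = 0 := by
  have hint : _root_.IsIntegral (RatFunc K) (Λ.root i) := isIntegral_treeField _
  have hroot : evalMap f (treeField f Ω) (Λ.root i) = tElt K (treeField f Ω) :=
    Subtype.ext ((evalMap_hom f ((treeField f Ω).val.restrictScalars K) _).trans (Λ.evalMap_root i))
  have hrt : Transcendental K (Λ.root i) :=
    transcendental_of_iterate (f := f) (m := 1) hroot
  obtain ⟨β, hβ⟩ := exists_algHom_ratFunc hx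
  obtain ⟨j, hj⟩ := exists_algHom_ratFunc hrt
  have hjf : j f = tElt K (treeField f Ω) := by
    rw [← hroot, ← hj, ← evalMap_hom, evalMap_X]
  have hf : Transcendental K f := fun h => transcendental_tElt (K := K) (E := treeField f Ω)
    (hjf ▸ (isAlgebraic_algHom_iff j j.injective).2 h)
  obtain ⟨ε, hε⟩ := exists_algHom_ratFunc hf
  have h1 : (j : RatFunc K →+* treeField f Ω).comp (ε : RatFunc K →+* RatFunc K) =
      algebraMap (RatFunc K) (treeField f Ω) := by
    refine ratFunc_ringHom_ext (fun a => ?_) ((congrArg j hε).trans hjf)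
    exact ((j.comp ε).commutes a).trans (IsScalarTower.algebraMap_apply K (RatFunc K) _ a)
  have h2 : (β : RatFunc K →+* M).comp (ε : RatFunc K →+* RatFunc K) =
      (α : L →+* M).comp (algebraMap (RatFunc K) L) := by
    refine ratFunc_ringHom_ext (fun a => ((β.comp ε).commutes a).trans ?_) ?_
    · exact (α.commutes a).symm.trans
        (congrArg α (IsScalarTower.algebraMap_apply K (RatFunc K) L a))
    · refine (congrArg β hε).trans (Eq.trans ?_ hα.symm)
      rw [← hβ, ← evalMap_hom, evalMap_X]
  have h3 : (minpoly (RatFunc K) (Λ.root i)).eval₂ (ε : RatFunc K →+* RatFunc K) RatFunc.X = 0 := by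
    refine j.injective ?_
    rw [map_zero]
    refine (Polynomial.hom_eval₂ _ _ (j : RatFunc K →+* treeField f Ω) _).trans ?_
    rw [h1]
    change (minpoly (RatFunc K) (Λ.root i)).eval₂ _ (j RatFunc.X) = 0
    rw [hj]
    exact minpoly.aeval _ _
  rw [← IntermediateField.LinearDisjoint.map_minpoly hint hL, Polynomial.eval₂_map, ← h2, ← hβ]
  exact (Polynomial.hom_eval₂ _ _ (β : RatFunc K →+* M) _).symm.trans
    ((congrArg β h3).trans (map_zero β))

/-- The path `λᵢ` turns the linearly disjoint extensions `L` and `K(tᵢ)` of `K(t)` into a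
cocartesian square of fields. -/
lemma exists_isFieldPushout (hL : L.LinearDisjoint (Λ.rootField i)) (e : Ω ≃ₐ[K] Ω)
    (het : e (Λ.root i) = tElt K Ω)
    (heL : (toK (L ⊔ Λ.rootField i)).map (e : Ω →ₐ[K] Ω) = toK L) :
    ∃ ψ : L →ₐ[K] L, (∀ a, ((ψ a : treeField f Ω) : Ω) = e ((a : treeField f Ω) : Ω)) ∧
      IsFieldPushout f ψ := by
  obtain ⟨Ψ, hΨ⟩ := exists_algEquiv_of_map_toK_eq heL
  have hinj : ∀ a b : L, ((a : treeField f Ω) : Ω) = ((b : treeField f Ω) : Ω) → a = b :=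
    fun a b hab => Subtype.ext (Subtype.ext hab)
  let ι : L →ₐ[K] (L ⊔ Λ.rootField i : IntermediateField (RatFunc K) (treeField f Ω)) :=
    (inclusion (le_sup_left : L ≤ L ⊔ Λ.rootField i)).restrictScalars K
  have hroot : Λ.root i ∈ L ⊔ Λ.rootField i :=
    (le_sup_right : Λ.rootField i ≤ _) (Λ.root_mem_rootField i)
  have hΨr : Ψ ⟨Λ.root i, hroot⟩ = tElt K L := hinj _ _ ((hΨ _).trans het)
  refine ⟨(Ψ : _ →ₐ[K] L).comp ι, fun a => hΨ (ι a), ?_, ?_, ?_⟩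
  · refine hinj _ _ ((hΨ _).trans ?_)
    have h1 := evalMap_hom f (e : Ω →ₐ[K] Ω) (Λ.root i : Ω)
    rw [Λ.evalMap_root] at h1
    refine h1.trans ?_
    have h2 := evalMap_hom f
      (((treeField f Ω).val.restrictScalars K).comp (L.val.restrictScalars K)) (tElt K L)
    exact (congrArg (evalMap f Ω) het).trans h2.symm
  · intro M _ _ α x hx hα
    obtain ⟨γ, hγ, hγr⟩ := exists_ringHom_sup_adjoin (F := RatFunc K) (A := L)
      (isIntegral_treeField (Λ.root i)).tower_top (α : L →+* M) (Λ.eval₂_minpoly_root hL α hx hα)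
    let γ₁ : (L ⊔ Λ.rootField i : IntermediateField (RatFunc K) (treeField f Ω)) →ₐ[K] M :=
      { γ with
        commutes' := fun c => (hγ _ (algebraMap K L c).2).trans (α.commutes c) }
    refine ⟨γ₁.comp (Ψ.symm : L →ₐ[K] _), AlgHom.ext fun a => ?_, ?_⟩
    · exact (congrArg γ₁ (Ψ.symm_apply_apply _)).trans (hγ _ a.2)
    · rw [← hΨr]
      exact (congrArg γ₁ (Ψ.symm_apply_apply _)).trans hγr
  · intro S ht hS
    let W : IntermediateField (RatFunc K) (treeField f Ω) :=
      ((S.toSubfield.comap (Ψ : _ →+* L)).map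
        ((L ⊔ Λ.rootField i).val : _ →+* treeField f Ω)).toIntermediateField
        fun r => ⟨ι (algebraMap (RatFunc K) L r), hS _, rfl⟩
    have hW : L ⊔ Λ.rootField i ≤ W := by
      refine sup_le (fun a ha => ⟨ι ⟨a, ha⟩, hS _, rfl⟩) (adjoin_le_iff.2 ?_)
      rintro _ rfl
      exact ⟨⟨Λ.root i, hroot⟩, (congrArg (· ∈ S) hΨr).mpr ht, rfl⟩
    refine eq_top_iff.2 fun a _ => ?_
    obtain ⟨b, hb, hba⟩ := hW (Ψ.symm a).2
    have : b = Ψ.symm a := Subtype.ext hba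
    have h1 : Ψ b ∈ S := hb
    rwa [this, AlgEquiv.apply_symm_apply] at h1

end PathData
end FieldPushout

/-! ### Curves attached to open self-similar subgroups -/

section SelfSimilarCurve

open IsLocalRing

variable {K : Type u} [Field K] {f : RatFunc K} {Ω : Type u} [Field Ω] [Algebra K Ω]
  [Algebra (RatFunc K) Ω] [IsScalarTower K (RatFunc K) Ω]

/-- The coordinate rings of the charts of the projective line act on extensions of `K(t)`. -/
abbrev chartAlgebra (K L : Type u) [Field K] [Field L] [Algebra (RatFunc K) L] (j : Fin 2) :
    Algebra (ChartRing K j) L :=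
  ((algebraMap (RatFunc K) L).comp (algebraMap (ChartRing K j) (RatFunc K))).toAlgebra

variable [IsSepClosure (RatFunc K) Ω]

lemma algebraMap_mem_adjoin_verticesUpTo {L : IntermediateField (RatFunc K) (treeField f Ω)} {n : ℕ}
    (hL : L ≤ levelField f Ω n) {a : treeField f Ω} (ha : a ∈ L) :
    (a : Ω) ∈ adjoin (RatFunc K) (verticesUpTo f Ω n) := by
  have h : levelField f Ω n ≤
      (adjoin (RatFunc K) (verticesUpTo f Ω n)).comap (treeField f Ω).val := by
    refine adjoin_le_iff.2 fun x hx => subset_adjoin _ _ ⟨n, le_rfl, PathData.coe_mem_fiber.2 hx⟩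
  exact h (hL ha)

/-- The normalization of the projective line in a field generated by vertices of the tree is a
smooth proper curve. -/
lemma IsTame.isSmoothCurve_normalization (hf : IsTame f) (Λ : PathData f Ω)
    {L : IntermediateField (RatFunc K) (treeField f Ω)} [FiniteDimensional (RatFunc K) L] {n : ℕ}
    (hL : L ≤ levelField f Ω n) :
    IsSmoothCurve (curveMap K L ≫ P1.struct K) ∧ IsProper (curveMap K L ≫ P1.struct K) ∧
      IsFunctionFieldPoint (curvePt K L) := by
  let := chartAlgebra K L
  have : ∀ j, IsScalarTower (ChartRing K j) (RatFunc K) L := fun j => .of_algebraMap_eq fun _ => rfl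
  have hsep : Algebra.IsSeparable (RatFunc K) Ω := IsSepClosure.separable
  have : Algebra.IsSeparable (RatFunc K) (treeField f Ω) :=
    Algebra.isSeparable_tower_bot_of_isSeparable _ _ Ω
  have : Algebra.IsSeparable (RatFunc K) L :=
    Algebra.isSeparable_tower_bot_of_isSeparable _ _ (treeField f Ω)
  have : IsScalarTower (RatFunc K) L Ω := .of_algebraMap_eq fun _ => rfl
  have : IsScalarTower K L Ω := .of_algebraMap_eq fun _ => rfl
  have := isFinite_curveMap K L
  have hproper : IsProper (curveMap K L ≫ P1.struct K) := inferInstance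
  refine ⟨⟨inferInstance, ?_, inferInstance, inferInstance⟩, hproper, ⟨inferInstance,
    surjectiveOnStalks_curvePt K L⟩⟩
  refine smooth_curveOver K L fun j q _ => ?_
  refine hf.exists_isStandardSmooth_of_isPrime (ChartRing K j) (chartRingEquiv K j) ?_ L
    Λ.finite_fiber (fun a => algebraMap_mem_adjoin_verticesUpTo hL a.2) q
  rw [algebraMap_chartRing, Polynomial.aeval_X, ratCoord]
  split_ifs
  exacts [.inl rfl, .inr rfl]

lemma ptField_geomPt_curvePt {L : IntermediateField (RatFunc K) (treeField f Ω)}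
    [FiniteDimensional (RatFunc K) L] :
    (toK L : Set Ω) = ptField (geomPt f Ω (curvePt K L)) := by
  let := chartAlgebra K L
  have : ∀ j, IsScalarTower (ChartRing K j) (RatFunc K) L := fun j => .of_algebraMap_eq fun _ => rfl
  have := surjectiveOnStalks_curvePt K L
  ext a
  rw [SetLike.mem_coe, SetLike.mem_coe, mem_toK, mem_ptField_geomPt, ptField_eq_top]
  exact ⟨fun ⟨b, hb, hba⟩ => ⟨⟨b, hb⟩, Subfield.mem_top _, hba⟩, fun ⟨b, _, hba⟩ => ⟨b, b.2, hba⟩⟩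

lemma geomPt_curvePt_comp {L : IntermediateField (RatFunc K) (treeField f Ω)} :
    geomPt f Ω (curvePt K L) ≫ curveMap K L = P1.pt K Ω (tElt K Ω) := by
  rw [geomPt_comp, Scheme.Hom.toNormalization_fromNormalization]
  exact geomPt_basePt L

lemma geomPt_specMap {Y : Scheme.{u}} {L : IntermediateField (RatFunc K) (treeField f Ω)}
    (y : Spec (.of L) ⟶ Y) (σ : Ω ≃ₐ[K] Ω) (ψ : L →ₐ[K] L)
    (h : ∀ a, ((ψ a : treeField f Ω) : Ω) = σ ((a : treeField f Ω) : Ω)) :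
    geomPt f Ω (Spec.map (CommRingCat.ofHom (ψ : L →+* L)) ≫ y) = galPt σ (geomPt f Ω y) := by
  simp only [geomPt, galPt, specIncl]
  simp only [← Spec.map_comp_assoc, ← CommRingCat.ofHom_comp]
  congr 3
  ext a
  exact h a

/-- For `L ≤ L'` the normalization of the line in `L'` maps to the one in `L`. -/
lemma exists_levelCurve_hom {L : IntermediateField (RatFunc K) (treeField f Ω)} {n : ℕ}
    (hL : L ≤ levelField f Ω n) : ∃ η : levelCurve f Ω n ⟶ curveOver K L,
      η ≫ curveMap K L = levelCurveMap f Ω n ∧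
      geomPt f Ω (levelCurvePt f Ω n ≫ η) = geomPt f Ω (curvePt K L) := by
  let ι : L →ₐ[K] levelField f Ω n := (inclusion hL).restrictScalars K
  have h : basePt f Ω (levelField f Ω n) =
      (Spec.map (CommRingCat.ofHom (ι : L →+* levelField f Ω n)) ≫ curvePt K L) ≫
        curveMap K L := by
    rw [Category.assoc, Scheme.Hom.toNormalization_fromNormalization]
    exact (specMap_pt ι (tElt K L)).symm
  refine ⟨Scheme.Hom.normalizationDesc _ _ _ h, Scheme.Hom.normalizationDesc_comp _ _ _ h, ?_⟩
  rw [levelCurvePt, Scheme.Hom.toNormalization_normalizationDesc]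
  simp only [geomPt, specIncl]
  simp only [← Spec.map_comp_assoc, ← CommRingCat.ofHom_comp]
  rfl

/-- An open self-similar subgroup is the iterated monodromy group of an endomorphism of a smooth
proper curve, namely of the normalization of the line in its fixed field. -/
theorem PathData.exists_endo_of_isSelfSimilar (Λ : PathData f Ω) (hf : IsTame f)
    {F : P1 K ⟶ P1 K} (hF : IsMorphismOf f F)
    {L : IntermediateField (RatFunc K) (treeField f Ω)} [FiniteDimensional (RatFunc K) L] {n : ℕ}
    (hLn : L ≤ levelField f Ω n) (hH : Λ.IsSelfSimilar L.fixingSubgroup) (i : Fin (degree f)) :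
    ∃ g : curveOver K L ⟶ curveOver K L,
      g ≫ curveMap K L ≫ P1.struct K = curveMap K L ≫ P1.struct K ∧
      IsNormalizedPullback g (curveMap K L) (curveMap K L) F ∧
      geomPt f Ω (curvePt K L) ≫ g = galPt (Λ.path i) (geomPt f Ω (curvePt K L)) ∧
      IsIdentifiedIMG (curveMap K L) g (geomPt f Ω (curvePt K L)) L.fixingSubgroup ∧
      ∃ Λ' : PathData f Ω, Λ'.label = Λ.label ∧ Λ'.path i = Λ.path i ∧
        Λ'.LiftsTo (curveMap K L) g (geomPt f Ω (curvePt K L)) ∧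
        Λ'.IsSelfSimilar L.fixingSubgroup := by
  let := chartAlgebra K L
  have : ∀ j, IsScalarTower (ChartRing K j) (RatFunc K) L := fun j => .of_algebraMap_eq fun _ => rfl
  obtain ⟨h1, hdisj⟩ := Λ.toK_sup_rootField_eq_and_linearDisjoint hH i
  have heL : (toK (L ⊔ Λ.rootField i)).map (Λ.path i : Ω →ₐ[K] Ω) = toK L := by
    rw [h1]
    exact map_map_symm _ _
  obtain ⟨ψ, hψ, hpush⟩ := Λ.exists_isFieldPushout hdisj (Λ.path i) (Λ.path_root i) heL
  obtain ⟨g, w, hg, hi⟩ := exists_curve_endo hF hpush.map_t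
  have hN := isNormalizedPullback_curve hF hpush w hg hi
  have hsm := (hf.isSmoothCurve_normalization Λ hLn).1.smooth
  have h : IsPullbackEndo f F (curveMap K L) g := ⟨hF, hsm, hN⟩
  have hy : geomPt f Ω (curvePt K L) ≫ g = galPt (Λ.path i) (geomPt f Ω (curvePt K L)) := by
    rw [geomPt_comp, hg, geomPt_specMap _ _ _ hψ]
  have hL := ptField_geomPt_curvePt (L := L)
  refine ⟨g, ?_, hN, hy, h.isIdentifiedIMG geomPt_curvePt_comp hL, ?_⟩
  · rw [reassoc_of% w, hF.isOver]
  obtain ⟨Λ', hlab, hpath, -, hΛ'⟩ :=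
    Λ.exists_pathData_of_algEquiv hdisj (Λ.path i) (Λ.path_root i) heL
  have hlift : Λ'.LiftsTo (curveMap K L) g (geomPt f Ω (curvePt K L)) := by
    refine IsPullbackEndo.liftsTo_of_forall geomPt_curvePt_comp h Λ' fun j =>
      ⟨galPt (Λ'.path j).symm (geomPt f Ω (curvePt K L)), ?_, ?_, ?_⟩
    · rw [galPt, Category.assoc, hy]
      refine (galPt_galPt _ _ _).trans (galPt_eq_self_iff.2 fun a ha => ?_)
      obtain ⟨b, hb, rfl⟩ := mem_toK.1 (show a ∈ toK L from hL.ge ha)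
      rw [AlgEquiv.trans_apply, ← hΛ' j b hb, AlgEquiv.symm_apply_apply]
    · rw [galPt, Category.assoc, geomPt_curvePt_comp]
      refine (galPt_pt _ _).trans ?_
      rw [Λ'.path_symm_t, Λ'.coe_root]
    · refine (galPt_galPt _ _ _).trans (galPt_eq_self_iff.2 fun a _ => ?_)
      rw [AlgEquiv.trans_apply, AlgEquiv.apply_symm_apply]
  exact ⟨Λ', hlab, hpath, hlift,
    IsPullbackEndo.isSelfSimilar_of_liftsTo geomPt_curvePt_comp h hL Λ' hlift⟩

/-- The curves attached to an open self-similar subgroup, and the endomorphism that each coordinate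
induces on them. -/
theorem PathData.exists_curve_of_isSelfSimilar (Λ : PathData f Ω) (hf : IsTame f)
    {F : P1 K ⟶ P1 K} (hF : IsMorphismOf f F) {H : Subgroup (IMG f Ω)}
    (hHo : IsOpen (H : Set (IMG f Ω))) (hH : Λ.IsSelfSimilar H) :
    ∃ (Y : Scheme.{u}) (_ : AlgebraicGeometry.IsIntegral Y) (s : Y ⟶ Spec (.of K))
      (π : Y ⟶ P1 K) (y : Spec (.of (fixedField H)) ⟶ Y),
      IsSmoothCurve s ∧ IsProper s ∧ π ≫ P1.struct K = s ∧
      IsFunctionFieldPoint y ∧ y ≫ π = basePt f Ω (fixedField H) ∧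
      (∃ N : ℕ, ∀ n ≥ N, ∃ η : levelCurve f Ω n ⟶ Y,
        η ≫ π = levelCurveMap f Ω n ∧
        geomPt f Ω (levelCurvePt f Ω n ≫ η) = geomPt f Ω y) ∧
      ∀ i : Fin (degree f), ∃ g : Y ⟶ Y,
        g ≫ s = s ∧ IsNormalizedPullback g π π F ∧
        geomPt f Ω y ≫ g = galPt (Λ.path i) (geomPt f Ω y) ∧
        IsIdentifiedIMG π g (geomPt f Ω y) H ∧
        ∃ Λ' : PathData f Ω, Λ'.label = Λ.label ∧ Λ'.path i = Λ.path i ∧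
          Λ'.LiftsTo π g (geomPt f Ω y) ∧ Λ'.IsSelfSimilar H := by
  have := finiteDimensional_fixedField_of_isOpen hHo
  have hfix := fixingSubgroup_fixedField_of_isOpen hHo
  obtain ⟨N, hN⟩ := Λ.exists_le_levelField hf.1 (fixedField H)
  obtain ⟨h1, h2, h3⟩ := hf.isSmoothCurve_normalization Λ (hN N le_rfl)
  refine ⟨curveOver K (fixedField H), h1.integral, curveMap K _ ≫ P1.struct K, curveMap K _,
    curvePt K _, h1, h2, rfl, h3, Scheme.Hom.toNormalization_fromNormalization _,
    ⟨N, fun n hn => exists_levelCurve_hom (hN n hn)⟩, fun i => ?_⟩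
  have := Λ.exists_endo_of_isSelfSimilar hf hF (hN N le_rfl) (hfix.symm ▸ hH) i
  rwa [hfix] at this

end SelfSimilarCurve

end SelfSimilarIMG

end

theorem mainTheorem6 {K : Type u} [Field K] (f : RatFunc K) (hf : IsTame f)
    {Ω : Type u} [Field Ω] [Algebra K Ω] [Algebra (RatFunc K) Ω]
    [IsScalarTower K (RatFunc K) Ω] [IsSepClosure (RatFunc K) Ω] (Λ : PathData f Ω) :
    -- open self-similar subgroups: fields
    (∀ H : Subgroup (IMG f Ω), IsOpen (H : Set (IMG f Ω)) → Λ.IsSelfSimilar H →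
      Λ.IsFractal H ∧
      (∃ N : ℕ, ∀ n ≥ N, fixedField H ≤ levelField f Ω n) ∧
      ∀ i : Fin (degree f),
        fixedField H ≤ fixedField (Λ.stab H i) ∧
        fixedField (Λ.stab H i) ≤ Λ.treeFieldOver i ∧
        (fun a : treeField f Ω => Λ.path i (a : Ω)) '' (fixedField (Λ.stab H i)) =
          (fun a : treeField f Ω => (a : Ω)) '' (fixedField H) ∧
        (fun a : treeField f Ω => Λ.path i (a : Ω)) '' (Λ.rootField i) =
          Set.range (algebraMap (RatFunc K) Ω) ∧
        fixedField (Λ.stab H i) = fixedField H ⊔ Λ.rootField i ∧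
        fixedField (Λ.stab H i) =
          (adjoin (fixedField H) {Λ.root i}).restrictScalars (RatFunc K) ∧
        (fixedField H).LinearDisjoint (Λ.rootField i)) ∧
    -- converse: fields
    (∀ (L : IntermediateField (RatFunc K) (treeField f Ω)) (n : ℕ) (i : Fin (degree f)),
      L ≤ levelField f Ω n → L.LinearDisjoint (Λ.rootField i) →
      ∀ ψ : (L ⊔ Λ.rootField i : IntermediateField (RatFunc K) (treeField f Ω)) ≃ₐ[K] L,
        (∀ a : (L ⊔ Λ.rootField i : IntermediateField (RatFunc K) (treeField f Ω)),
          (a : treeField f Ω) = Λ.root i → ψ a = tElt K L) →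
        (∃ Λ' : PathData f Ω, Λ'.label = Λ.label ∧
          (∀ a : (L ⊔ Λ.rootField i : IntermediateField (RatFunc K) (treeField f Ω)),
            Λ'.path i ((a : treeField f Ω) : Ω) = ((ψ a : treeField f Ω) : Ω)) ∧
          Λ'.IsSelfSimilar L.fixingSubgroup) ∧
        ((∀ j, (fun a : treeField f Ω => Λ.path j (a : Ω)) ''
            (L ⊔ Λ.rootField j : IntermediateField (RatFunc K) (treeField f Ω)) =
              (fun a : treeField f Ω => (a : Ω)) '' L) →
          Λ.IsSelfSimilar L.fixingSubgroup) ∧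
        (IsGalois (RatFunc K) L → Λ.IsSelfSimilar L.fixingSubgroup)) ∧
    ∃ F : P1 K ⟶ P1 K, IsMorphismOf f F ∧
    -- open self-similar subgroups: geometry
    (∀ H : Subgroup (IMG f Ω), IsOpen (H : Set (IMG f Ω)) → Λ.IsSelfSimilar H →
      ∃ (Y : Scheme.{u}) (_ : AlgebraicGeometry.IsIntegral Y) (s : Y ⟶ Spec (.of K))
        (π : Y ⟶ P1 K) (y : Spec (.of (fixedField H)) ⟶ Y),
        IsSmoothCurve s ∧ IsProper s ∧ π ≫ P1.struct K = s ∧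
        IsFunctionFieldPoint y ∧ y ≫ π = basePt f Ω (fixedField H) ∧
        (∃ N : ℕ, ∀ n ≥ N, ∃ η : levelCurve f Ω n ⟶ Y,
          η ≫ π = levelCurveMap f Ω n ∧
          geomPt f Ω (levelCurvePt f Ω n ≫ η) = geomPt f Ω y) ∧
        ∀ i : Fin (degree f), ∃ g : Y ⟶ Y,
          g ≫ s = s ∧ IsNormalizedPullback g π π F ∧
          geomPt f Ω y ≫ g =
            Spec.map (CommRingCat.ofHom ((Λ.path i : Ω →ₐ[K] Ω) : Ω →+* Ω)) ≫ geomPt f Ω y ∧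
          IsIdentifiedIMG π g (geomPt f Ω y) H ∧
          ∃ Λ' : PathData f Ω, Λ'.label = Λ.label ∧ Λ'.path i = Λ.path i ∧
            Λ'.LiftsTo π g (geomPt f Ω y) ∧ Λ'.IsSelfSimilar H) ∧
    -- converse: geometry
    (∀ (Y : Scheme.{u}) [AlgebraicGeometry.IsIntegral Y] (s : Y ⟶ Spec (.of K))
      (π : Y ⟶ P1 K) (g : Y ⟶ Y) (n : ℕ) (η : levelCurve f Ω n ⟶ Y),
      IsSmoothCurve s → π ≫ P1.struct K = s → g ≫ s = s → IsNormalizedPullback g π π F →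
      η ≫ π = levelCurveMap f Ω n →
      ∃ L : IntermediateField (RatFunc K) (treeField f Ω),
        (fun a : treeField f Ω => (a : Ω)) '' L =
          (ptField (geomPt f Ω (levelCurvePt f Ω n ≫ η)) : Set Ω) ∧
        IsIdentifiedIMG π g (geomPt f Ω (levelCurvePt f Ω n ≫ η)) L.fixingSubgroup ∧
        IsOpen (L.fixingSubgroup : Set (IMG f Ω)) ∧
        (∃ Λ' : PathData f Ω, Λ'.label = Λ.label ∧
          Λ'.LiftsTo π g (geomPt f Ω (levelCurvePt f Ω n ≫ η))) ∧
        ∀ Λ' : PathData f Ω, Λ'.LiftsTo π g (geomPt f Ω (levelCurvePt f Ω n ≫ η)) →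
          Λ'.IsSelfSimilar L.fixingSubgroup) := by
  have hf0 : f ≠ 0 := by
    rintro rfl
    simpa [degree] using hf.1
  obtain ⟨F, hF⟩ := exists_isMorphismOf hf0
  exact ⟨fun H hH hself => Λ.field_properties_of_isSelfSimilar hf.1 hH hself,
    fun L n i hLn hL ψ hψ => Λ.isSelfSimilar_converse L n i hLn hL ψ hψ, F, hF,
    fun H hH hself => Λ.exists_curve_of_isSelfSimilar hf hF hH hself,
    fun Y _ s π g n η hs hπ _ hN hη =>
      Λ.isSelfSimilar_of_isNormalizedPullback hF η hs.smooth hπ hN hη⟩
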